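/- Let $0<r<R<\infty$, $0<r_*<R_*<\infty$, $\mathbb A=\{x\in\mathbb C: r<|x|<R\}$ and $\mathbb A^*=\{y\in\mathbb C: r_*<|y|<R_*\}$. Let $\mathscr H^{1,2}(\mathbb A,\mathbb A^*)$ be the class of all homeomorphisms $h$ of $\mathbb A$ onto $\mathbb A^*$ that belong to the Sobolev space $W^{1,2}(\mathbb A,\mathbb C)$ (no boundary values are prescribed), and let $\mathscr H^{1,2}_+(\mathbb A,\mathbb A^*)$ be the subclass of those that preserve the orientation and the order of the boundary components, i.e. $|h(x)|\to r_*$ as $|x|\to r$ and $|h(x)|\to R_*$ as $|x|\to R$. The Dirichlet energy is $\mathscr E[h]=\int_{\mathbb A}|Dh(x)|^2\,dx$, with $|Dh|$ the Hilbert–Schmidt norm of the weak differential. A deformation is a weak $W^{1,2}(\mathbb A,\mathbb C)$-limit of a sequence in $\mathscr H^{1,2}(\mathbb A,\mathbb A^*)$. Theorem. There are a nondecreasing $C^1$ map $H$ of $[r,R]$ onto $[r_*,R_*]$ and a constant $c\in\mathbb R$ such that $$H(t)^2-t^2\dot H(t)^2=c\qquad\text{for all } t\in[r,R].$$ For every such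 $H$ (and $c$), the radial map $h_\circ(x)=H(|x|)\,\frac{x}{|x|}$ has the following properties. 1. If $\frac12\left(\frac Rr+\frac rR\right)\le\frac{R_*}{r_*}$ (the Nitsche range), then $H(t)=at+\frac bt$ on $[r,R]$ with $a=\frac{RR_*-rr_*}{R^2-r^2}$ and $b=\frac{R^2rr_*-r^2RR_*}{R^2-r^2}$, and $h_\circ\in\mathscr H^{1,2}_+(\mathbb A,\mathbb A^*)$. 2. If $\frac12\left(\frac Rr+\frac rR\right)>\frac{R_*}{r_*}$ (beyond the Nitsche bound), then $h_\circ$ is the squeezing map: there is $\rho\in(r,R)$ with $\frac12\left(\frac R\rho+\frac\rho R\right)=\frac{R_*}{r_*}$ such that $H(t)=r_*$ for $t\in[r,\rho]$ and $H(t)=\frac{r_*}{2}\left(\frac t\rho+\frac\rho t\right)$ for $t\in[\rho,R]$. 3. $\mathscr E[h_\circ]=\inf\{\mathscr E[h]:h\in\mathscr H^{1,2}(\mathbb A,\mathbb A^*)\}=\inf\{\mathscr E[h]:h\in\mathscr H^{1,2}_+(\mathbb A,\mathbb A^*)\}$. Moreover $h_\circ$ is a weak $W^{1,2}$-limit of a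 sequence in $\mathscr H^{1,2}_+(\mathbb A,\mathbb A^*)$, and $\mathscr E[h_\circ]\le\mathscr E[h]$ for every deformation $h$; so the minimum of the energy among deformations is assumed at $h_\circ$. 4. The minimiser is unique up to rotation: if $h$ is a weak $W^{1,2}$-limit of a sequence in $\mathscr H^{1,2}_+(\mathbb A,\mathbb A^*)$ (in particular, if $h\in\mathscr H^{1,2}_+(\mathbb A,\mathbb A^*)$), then $\mathscr E[h]=\mathscr E[h_\circ]$ if and only if there is $\alpha\in\mathbb R$ with $h(x)=e^{i\alpha}h_\circ(x)$ for almost every $x\in\mathbb A$. -/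

import Mathlib

open MeasureTheory Filter Topology Set
open scoped ContDiff ENNReal

noncomputable section

/-- The open round annulus `{z : r < |z| < R}` in the complex plane. -/
def annulus (r R : ℝ) : Set ℂ := {z | r < ‖z‖ ∧ ‖z‖ < R}

/-- `G` is a weak (distributional) differential of `h` on the open set `Ω`: both are locally
integrable on `Ω`, and integration by parts holds against every smooth real test function with
compact support in `Ω`, in every direction `v`. -/
def HasWeakDeriv (Ω : Set ℂ) (h : ℂ → ℂ) (G : ℂ → ℂ →L[ℝ] ℂ) : Prop :=
  LocallyIntegrableOn h Ω ∧ LocallyIntegrableOn G Ω ∧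
    ∀ φ : ℂ → ℝ, ContDiff ℝ ∞ φ → HasCompactSupport φ → tsupport φ ⊆ Ω →
      ∀ v : ℂ, ∫ x in Ω, (fderiv ℝ φ x v) • h x = -∫ x in Ω, φ x • G x v

/-- The Sobolev class `W^{1,2}(Ω, ℂ)`. -/
def MemW12 (Ω : Set ℂ) (h : ℂ → ℂ) : Prop :=
  MemLp h 2 (volume.restrict Ω) ∧
    ∃ G : ℂ → ℂ →L[ℝ] ℂ, HasWeakDeriv Ω h G ∧ MemLp G 2 (volume.restrict Ω)

open Classical in
/-- The weak differential `Dh` on `Ω` (determined almost everywhere on `Ω`); it is only used for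
maps that have one. -/
def weakDeriv (Ω : Set ℂ) (h : ℂ → ℂ) : ℂ → ℂ →L[ℝ] ℂ :=
  if hG : ∃ G : ℂ → ℂ →L[ℝ] ℂ, HasWeakDeriv Ω h G then hG.choose else 0

/-- The Dirichlet energy `∫_Ω |Dh|²`, with the Hilbert–Schmidt norm
`|Dh|² = |∂h/∂x₁|² + |∂h/∂x₂|²`. -/
def dirichletEnergy (Ω : Set ℂ) (h : ℂ → ℂ) : ℝ≥0∞ :=
  ∫⁻ x in Ω, ENNReal.ofReal (‖weakDeriv Ω h x 1‖ ^ 2 + ‖weakDeriv Ω h x Complex.I‖ ^ 2)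

/-- The homeomorphisms of the annulus `r < |x| < R` onto the annulus `r' < |y| < R'` that are of
class `W^{1,2}`. Only the values of `h` on the first annulus matter. -/
def sobolevHomeos (r R r' R' : ℝ) : Set (ℂ → ℂ) :=
  {h | (∃ e : annulus r R ≃ₜ annulus r' R', ∀ x, (e x : ℂ) = h x) ∧ MemW12 (annulus r R) h}

/-- `h` is orientation preserving on the open set `Ω`: at every point `a` of `Ω` it has local degree
`+1`, i.e. for all small `s > 0` the curve `t ↦ h (a + s e^{it})`, `0 ≤ t ≤ 2π`, winds exactly once
counterclockwise around `h a` (`θ` is a continuous choice of the argument along the curve). -/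
def OrientationPreservingOn (h : ℂ → ℂ) (Ω : Set ℂ) : Prop :=
  ∀ a ∈ Ω, ∀ᶠ s : ℝ in 𝓝[>] 0, ∃ θ : ℝ → ℝ, Continuous θ ∧
    (∀ t : ℝ, h (a + s * Complex.exp (t * Complex.I)) ≠ h a ∧
      h (a + s * Complex.exp (t * Complex.I)) - h a =
        ‖h (a + s * Complex.exp (t * Complex.I)) - h a‖ * Complex.exp (θ t * Complex.I)) ∧
    θ (2 * Real.pi) = θ 0 + 2 * Real.pi

/-- `h` preserves the order of the boundary components of the annuli: `|h|` extends continuously to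
the closed annulus, with `|h| = r'` on `|x| = r` and `|h| = R'` on `|x| = R`. -/
def PreservesBoundaryOrder (r R r' R' : ℝ) (h : ℂ → ℂ) : Prop :=
  Tendsto (fun x => ‖h x‖) (comap norm (𝓝 r) ⊓ 𝓟 (annulus r R)) (𝓝 r') ∧
    Tendsto (fun x => ‖h x‖) (comap norm (𝓝 R) ⊓ 𝓟 (annulus r R)) (𝓝 R')

/-- The `W^{1,2}` homeomorphisms between the annuli that preserve the orientation and the order of
the boundary components. -/
def orientedSobolevHomeos (r R r' R' : ℝ) : Set (ℂ → ℂ) :=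
  {h | h ∈ sobolevHomeos r R r' R' ∧ OrientationPreservingOn h (annulus r R) ∧
    PreservesBoundaryOrder r R r' R' h}

/-- Weak convergence `u n ⇀ h` in `W^{1,2}(Ω, ℂ)`: weak convergence in `L²(Ω)` of the maps and of
their first order weak partial derivatives. -/
def WeaklyTendstoW12 (Ω : Set ℂ) (u : ℕ → ℂ → ℂ) (h : ℂ → ℂ) : Prop :=
  (∀ n, MemW12 Ω (u n)) ∧ MemW12 Ω h ∧
    ∀ g : ℂ → ℂ, MemLp g 2 (volume.restrict Ω) →
      Tendsto (fun n => ∫ x in Ω, g x * u n x) atTop (𝓝 (∫ x in Ω, g x * h x)) ∧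
      ∀ v : ℂ, Tendsto (fun n => ∫ x in Ω, g x * weakDeriv Ω (u n) x v) atTop
        (𝓝 (∫ x in Ω, g x * weakDeriv Ω h x v))

/-- The deformations of `Ω` generated by a class `S` of maps: the weak `W^{1,2}` limits of sequences
in `S`. Constant sequences show that it contains the `W^{1,2}` members of `S`. -/
def weakLimits (Ω : Set ℂ) (S : Set (ℂ → ℂ)) : Set (ℂ → ℂ) :=
  {h | ∃ u : ℕ → ℂ → ℂ, (∀ n, u n ∈ S) ∧ WeaklyTendstoW12 Ω u h}

/-- The radial map `x ↦ H(|x|) x / |x|`. -/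
def radialMap (H : ℝ → ℝ) (x : ℂ) : ℂ := (H ‖x‖ : ℂ) * (x / (‖x‖ : ℂ))

/-- `H` is a nondecreasing `C¹` map of `[r, R]` onto `[r', R']` that solves the characteristic
equation `H² - t² Ḣ² ≡ c`. -/
def IsCharacteristicSolution (r R r' R' : ℝ) (H : ℝ → ℝ) (c : ℝ) : Prop :=
  ContDiffOn ℝ 1 H (Icc r R) ∧ MonotoneOn H (Icc r R) ∧ H '' Icc r R = Icc r' R' ∧
    ∀ t ∈ Icc r R, H t ^ 2 - t ^ 2 * derivWithin H (Icc r R) t ^ 2 = c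

end

/-! The proof is a calibration by free Lagrangians: integrands built from `h` and `Dh` whose
integral depends only on the two annuli, the degree `k = ±1` of `h` on circles and the order of the
boundary components. Write `G` for `Dh`, and take derivatives along `x` (radial) and along `I * x`
(angular), so that `|Dh|² = (|G x x|² + |G x (I x)|²) / |x|²`.

Two families of identities, both linear in `Dh`, are collected in `IsAnnularMap`. The normal one is
the divergence theorem for `ζ(|x|) Φ(|h|²)`, with the boundary values of `|h|`. The tangential one
says that the argument of `h` grows by `2πk` along each circle. For homeomorphisms they follow by
mollification on compact annuli and exhaustion (`isAnnularMap_of_mem_sobolevHomeos`). Topology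
enters through the lift `L` of `h` to logarithmic coordinates: it is injective with `L(z + 2πi) =
L(z) + 2πik` and `k = ±1`, and `degree_eq_one` deduces `k = 1` for oriented maps by comparing the
winding of a small loop with that of a large ellipse. Being linear in `Dh`, the identities survive
weak limits: Rellich's theorem provides almost everywhere convergence of the coefficients along a
subsequence (`IsAnnularMap.of_weaklyTendsto`). Homeomorphisms and deformations are therefore treated
alike.

The change of variables formula `∫ σ(|h|²) det Dh = kπ ∫ σ` is quadratic in `Dh` and is not passed
to weak limits. `IsAnnularMap.integral_jacobian` recovers it for every annular map: the Jacobian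
with a radial density is a divergence, so a cut-off turns its integral into fluxes through thin
collars, and a Hardy type estimate for `|h|²` at the boundary identifies the limits of the fluxes
with tangential integrals.

Let `H` solve `H² - t²Ḣ² = c` and put `σ(q) = √(1 - c/q)`; this is real on the range of `|h|²`, as
the equation at the inner radius gives `c ≤ H(r)²`. The radial map satisfies `G x x = σ(|h|²) h` and
`G x (I x) = I h` (`IsExtremal`). For `c ≥ 0` the energy density minus `2σ` times the Jacobian minus
`c` times an angular free Lagrangian, with suitable signs, is a sum of squares plus a semidefinite
form (`defect_identity`); for `c < 0` the same works with `1/σ` and a radial free Lagrangian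
(`defect_identity'`). Integration bounds the energy below by a constant, and among oriented maps
equality holds exactly for extremal maps. When `c = 0` the defect only sees conformality, and
`IsAnnularMap.isExtremal_of_conformal` uses the integral identities once more.

For uniqueness, an extremal oriented map satisfies `|x| ∂|h| = √(|h|² - c)` radially, the equation
that `H` solves; monotonicity of the right side and the common boundary values force `|h| = H(|x|)`
(`IsAnnularMap.norm_eq_of_isExtremal`). The quotient of `h` by the radial map then has zero weak
derivative and modulus one.

The radial map need not be injective, so to see that its energy is an infimum over homeomorphisms,
`H` is mixed with a little of the affine profile. The mixtures are strictly increasing, hence give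
oriented homeomorphisms, and the energy is convex. The shape of `H` comes from the fact that `H` is
a combination of `t` and `1/t` wherever it is increasing, and that it can be stationary only where
`H² = c`, which forces `H` to equal its minimum (`IsSmoothProfile.exists_structure`). -/

theorem isOpen_annulus (r R : ℝ) : IsOpen (annulus r R) :=
  (isOpen_lt continuous_const continuous_norm).inter (isOpen_lt continuous_norm continuous_const)

theorem measurableSet_annulus (r R : ℝ) : MeasurableSet (annulus r R) :=
  (isOpen_annulus r R).measurableSet

theorem volume_annulus_lt_top (r R : ℝ) : volume (annulus r R) < ⊤ :=
  (measure_mono (fun x hx => by simpa using hx.2.le : annulus r R ⊆ Metric.closedBall 0 R)).trans_lt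
    (isCompact_closedBall 0 R).measure_lt_top

instance isFiniteMeasure_annulus (r R : ℝ) :
    IsFiniteMeasure (volume.restrict (annulus r R)) :=
  ⟨by simpa using volume_annulus_lt_top r R⟩

/-! ### Uniqueness and elementary calculus of weak derivatives. -/

section WeakDeriv

variable {Ω : Set ℂ} {h h' : ℂ → ℂ} {G G' : ℂ → ℂ →L[ℝ] ℂ}

/-- Local integrability becomes integrability on the compact support of the test function, and the
product vanishes elsewhere. -/
theorem integrable_smul_of_locallyIntegrableOn {E : Type*} [NormedAddCommGroup E] [NormedSpace ℝ E]
    {f : ℂ → E} (hf : LocallyIntegrableOn f Ω) {φ : ℂ → ℝ} (hφ : Continuous φ)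
    (hc : HasCompactSupport φ) (hs : tsupport φ ⊆ Ω) :
    IntegrableOn (fun x => φ x • f x) Ω := by
  have hK : IntegrableOn f (tsupport φ) := hf.integrableOn_compact_subset hs hc
  have : IntegrableOn (fun x => φ x • f x) (tsupport φ) :=
    hK.continuousOn_smul hφ.continuousOn hc
  have h2 : Integrable (fun x => φ x • f x) := by
    rw [← integrableOn_iff_integrable_of_support_subset (s := tsupport φ)]
    · exact this
    · intro x hx
      apply subset_tsupport
      intro h0
      simp [h0] at hx
  exact h2.integrableOn

/-- The fundamental lemma of the calculus of variations, applied in the directions `1` and `I` only: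
they determine a real-linear map, so two null sets suffice. -/
theorem HasWeakDeriv.ae_eq (hΩ : IsOpen Ω) (h1 : HasWeakDeriv Ω h G)
    (h2 : HasWeakDeriv Ω h G') : G =ᵐ[volume.restrict Ω] G' := by
  have key : ∀ v : ℂ, ∀ᵐ x ∂(volume : Measure ℂ), x ∈ Ω → G x v - G' x v = 0 := by
    intro v
    have l1 : LocallyIntegrableOn (fun x => G x v) Ω := fun x hx => by
      obtain ⟨t, ht, hi⟩ := h1.2.1 x hx
      exact ⟨t, ht, hi.apply_continuousLinearMap v⟩
    have l2 : LocallyIntegrableOn (fun x => G' x v) Ω := fun x hx => by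
      obtain ⟨t, ht, hi⟩ := h2.2.1 x hx
      exact ⟨t, ht, hi.apply_continuousLinearMap v⟩
    apply hΩ.ae_eq_zero_of_integral_contDiff_smul_eq_zero (l1.sub l2)
    intro g hg hc hs
    have e1 := h1.2.2 g hg hc hs v
    have e2 := h2.2.2 g hg hc hs v
    have i1 := integrable_smul_of_locallyIntegrableOn l1 hg.continuous hc hs
    have i2 := integrable_smul_of_locallyIntegrableOn l2 hg.continuous hc hs
    have e3 : ∫ x in Ω, g x • (G x v - G' x v) = 0 := by
      simp_rw [smul_sub]
      rw [integral_sub i1 i2, sub_eq_zero]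
      have := e1.symm.trans e2
      exact neg_injective this
    rw [← e3]
    symm
    apply setIntegral_eq_integral_of_forall_compl_eq_zero
    intro x hx
    have : g x = 0 := by
      by_contra h0
      exact hx (hs (subset_tsupport g h0))
    simp [this]
  rw [Filter.EventuallyEq, ae_restrict_iff' hΩ.measurableSet]
  filter_upwards [key 1, key Complex.I] with x k1 k2 hx
  have := k1 hx
  have := k2 hx
  ext1 z
  rw [show z = z.re • (1 : ℂ) + z.im • Complex.I by simp [Complex.re_add_im]]
  simp only [map_add, map_smul]
  rw [sub_eq_zero.mp (k1 hx), sub_eq_zero.mp (k2 hx)]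

theorem HasWeakDeriv.hasWeakDeriv_weakDeriv (h1 : HasWeakDeriv Ω h G) : HasWeakDeriv Ω h (weakDeriv Ω h) := by
  have hG : ∃ G : ℂ → ℂ →L[ℝ] ℂ, HasWeakDeriv Ω h G := ⟨G, h1⟩
  rw [_root_.weakDeriv, dif_pos hG]
  exact hG.choose_spec

theorem HasWeakDeriv.weakDeriv_ae_eq (hΩ : IsOpen Ω) (h1 : HasWeakDeriv Ω h G) :
    weakDeriv Ω h =ᵐ[volume.restrict Ω] G :=
  h1.hasWeakDeriv_weakDeriv.ae_eq hΩ h1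

/-- The energy is defined through a chosen weak differential; uniqueness allows it to be computed
from any other. -/
theorem HasWeakDeriv.dirichletEnergy_eq (hΩ : IsOpen Ω) (h1 : HasWeakDeriv Ω h G) :
    dirichletEnergy Ω h =
      ∫⁻ x in Ω, ENNReal.ofReal (‖G x 1‖ ^ 2 + ‖G x Complex.I‖ ^ 2) := by
  apply lintegral_congr_ae
  filter_upwards [h1.weakDeriv_ae_eq hΩ] with x hx
  rw [hx]

theorem MemW12.hasWeakDeriv (hh : MemW12 Ω h) : HasWeakDeriv Ω h (weakDeriv Ω h) := by
  obtain ⟨-, G, hG, -⟩ := hh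
  exact hG.hasWeakDeriv_weakDeriv

theorem MemW12.memLp_weakDeriv (hΩ : IsOpen Ω) (hh : MemW12 Ω h) :
    MemLp (weakDeriv Ω h) 2 (volume.restrict Ω) := by
  obtain ⟨-, G, hG, hL⟩ := hh
  exact (memLp_congr_ae (hG.weakDeriv_ae_eq hΩ)).mpr hL

theorem LocallyIntegrableOn.congr_ae_restrict {E : Type*} [NormedAddCommGroup E] {f g : ℂ → E}
    (hf : LocallyIntegrableOn f Ω) (hfg : f =ᵐ[volume.restrict Ω] g) :
    LocallyIntegrableOn g Ω := by
  intro x hx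
  obtain ⟨t, ht, hi⟩ := hf x hx
  refine ⟨t ∩ Ω, inter_mem ht self_mem_nhdsWithin, ?_⟩
  exact (hi.mono_set inter_subset_left).congr (ae_restrict_of_ae_restrict_of_subset
    inter_subset_right hfg)

theorem HasWeakDeriv.congr_ae (h1 : HasWeakDeriv Ω h G)
    (hh : h =ᵐ[volume.restrict Ω] h') : HasWeakDeriv Ω h' G := by
  refine ⟨LocallyIntegrableOn.congr_ae_restrict h1.1 hh, h1.2.1, fun φ hφ hc hs v => ?_⟩
  rw [← h1.2.2 φ hφ hc hs v]
  apply integral_congr_ae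
  filter_upwards [hh] with x hx
  rw [hx]

theorem HasWeakDeriv.congr_deriv (h1 : HasWeakDeriv Ω h G)
    (hG : G =ᵐ[volume.restrict Ω] G') : HasWeakDeriv Ω h G' := by
  refine ⟨h1.1, LocallyIntegrableOn.congr_ae_restrict h1.2.1 hG, fun φ hφ hc hs v => ?_⟩
  rw [h1.2.2 φ hφ hc hs v]
  congr 1
  apply integral_congr_ae
  filter_upwards [hG] with x hx
  rw [hx]

theorem HasWeakDeriv.const_mul (h1 : HasWeakDeriv Ω h G) (c : ℂ) :
    HasWeakDeriv Ω (fun x => c * h x) (fun x => c • G x) := by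
  refine ⟨fun x hx => ?_, fun x hx => ?_, fun φ hφ hc hs v => ?_⟩
  · obtain ⟨t, ht, hi⟩ := h1.1 x hx
    exact ⟨t, ht, Integrable.const_mul hi c⟩
  · obtain ⟨t, ht, hi⟩ := h1.2.1 x hx
    exact ⟨t, ht, Integrable.smul c hi⟩
  · have := h1.2.2 φ hφ hc hs v
    calc ∫ x in Ω, (fderiv ℝ φ x v) • (c * h x) = ∫ x in Ω, c * ((fderiv ℝ φ x v) • h x) := by
          congr 1; ext x; simp only [Complex.real_smul]; ring
      _ = c * ∫ x in Ω, (fderiv ℝ φ x v) • h x := integral_const_mul _ _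
      _ = -(c * ∫ x in Ω, φ x • G x v) := by rw [this]; ring
      _ = -∫ x in Ω, φ x • (c • G x) v := by
          rw [← integral_const_mul]
          congr 2; ext x; simp only [Complex.real_smul, smul_apply, smul_eq_mul]
          ring

theorem dirichletEnergy_const_mul (hΩ : IsOpen Ω) (hh : MemW12 Ω h) {c : ℂ} (hc : ‖c‖ = 1) :
    dirichletEnergy Ω (fun x => c * h x) = dirichletEnergy Ω h := by
  rw [(hh.hasWeakDeriv.const_mul c).dirichletEnergy_eq hΩ, dirichletEnergy]
  simp [hc]

theorem dirichletEnergy_congr_ae (hΩ : IsOpen Ω) (hh : MemW12 Ω h)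
    (e : h =ᵐ[volume.restrict Ω] h') : dirichletEnergy Ω h' = dirichletEnergy Ω h := by
  rw [(hh.hasWeakDeriv.congr_ae e).dirichletEnergy_eq hΩ, dirichletEnergy]

/-- Nothing is known about `h` off `Ω`. Integration by parts is nevertheless done on the whole
plane, because both integrands vanish off `Ω` and differentiability of `h` is needed only on the
support of the test function. -/
theorem ContDiffOn.hasWeakDeriv (hΩ : IsOpen Ω) (hh : ContDiffOn ℝ 1 h Ω) :
    HasWeakDeriv Ω h (fderiv ℝ h) := by
  have hD : ContinuousOn (fderiv ℝ h) Ω := hh.continuousOn_fderiv_of_isOpen hΩ le_rfl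
  have l1 : LocallyIntegrableOn h Ω := hh.continuousOn.locallyIntegrableOn hΩ.measurableSet
  have l2 : LocallyIntegrableOn (fderiv ℝ h) Ω := hD.locallyIntegrableOn hΩ.measurableSet
  refine ⟨l1, l2, fun φ hφ hc hs v => ?_⟩
  have l3 : LocallyIntegrableOn (fun x => fderiv ℝ h x v) Ω := fun x hx => by
      obtain ⟨t, ht, hi⟩ := l2 x hx
      exact ⟨t, ht, hi.apply_continuousLinearMap v⟩
  have z1 : ∀ x, x ∉ Ω → φ x = 0 := fun x hx => by
    by_contra h0
    exact hx (hs (subset_tsupport φ h0))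
  have z2 : ∀ x, x ∉ Ω → fderiv ℝ φ x v = 0 := fun x hx => by
    by_contra h0
    exact hx (hs (tsupport_fderiv_apply_subset ℝ v (subset_tsupport _ h0)))
  have c2 : Continuous (fun x => fderiv ℝ φ x v) :=
    (hφ.continuous_fderiv (by simp)).clm_apply continuous_const
  have hc2 : HasCompactSupport (fun x => fderiv ℝ φ x v) :=
    hc.mono' (fun x hx => tsupport_fderiv_apply_subset ℝ v (subset_tsupport _ hx))
  have i1 := integrable_smul_of_locallyIntegrableOn l3 hφ.continuous hc hs
  have i2 := integrable_smul_of_locallyIntegrableOn l1 c2 hc2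
    ((tsupport_fderiv_apply_subset ℝ v).trans hs)
  have i3 := integrable_smul_of_locallyIntegrableOn l1 hφ.continuous hc hs
  have I1 : Integrable (fun x => φ x • fderiv ℝ h x v) :=
    (integrableOn_iff_integrable_of_support_subset
      (fun x hx => by by_contra h0; simp [z1 x h0] at hx)).mp i1
  have I2 : Integrable (fun x => fderiv ℝ φ x v • h x) :=
    (integrableOn_iff_integrable_of_support_subset
      (fun x hx => by by_contra h0; simp [z2 x h0] at hx)).mp i2
  have I3 : Integrable (fun x => φ x • h x) :=
    (integrableOn_iff_integrable_of_support_subset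
      (fun x hx => by by_contra h0; simp [z1 x h0] at hx)).mp i3
  rw [setIntegral_eq_integral_of_forall_compl_eq_zero (fun x hx => by simp [z2 x hx]),
    setIntegral_eq_integral_of_forall_compl_eq_zero (fun x hx => by simp [z1 x hx])]
  have := integral_smul_fderiv_eq_neg_fderiv_smul_of_integrable (μ := volume) (f := φ) (g := h)
    (v := v) I2 I1 I3 (fun x _ => (hφ.differentiable (by simp)) x)
    (fun x hx => (hh.contDiffAt (hΩ.mem_nhds (hs hx))).differentiableAt (by simp))
  rw [this, neg_neg]

end WeakDeriv

/-! ### Strong and weak convergence in `L²`. -/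

section SquareIntegrable

variable {α : Type*} [MeasurableSpace α] {μ : Measure α} {E : Type*} [NormedAddCommGroup E]

theorem eLpNorm_two_sq (f : α → E) : eLpNorm f 2 μ ^ 2 = ∫⁻ x, ‖f x‖ₑ ^ 2 ∂μ := by
  have := eLpNorm_nnreal_pow_eq_lintegral (μ := μ) (f := f) (p := 2) (by norm_num)
  simpa using this

theorem eLpNorm_two_tendsto_zero_iff {f : ℕ → α → E} :
    Tendsto (fun n => eLpNorm (f n) 2 μ) atTop (𝓝 0) ↔
      Tendsto (fun n => ∫⁻ x, ‖f n x‖ₑ ^ 2 ∂μ) atTop (𝓝 0) := by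
  simp_rw [← eLpNorm_two_sq]
  constructor
  · intro h
    simpa using ENNReal.Tendsto.pow (n := 2) h
  · intro h
    have h2 := h.ennrpow_const (1 / 2 : ℝ)
    simp only [one_div, ← ENNReal.rpow_natCast, ← ENNReal.rpow_mul] at h2
    simpa using h2

/-- If `f n → f` almost everywhere and `‖f n‖₂ ≤ ‖f‖₂ < ∞` then `f n → f` in `L²`. -/
theorem tendsto_eLpNorm_two_sub_of_ae_of_le {f : ℕ → α → E} {f₀ : α → E}
    (hf : ∀ n, MemLp (f n) 2 μ) (hf₀ : MemLp f₀ 2 μ)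
    (hae : ∀ᵐ x ∂μ, Tendsto (fun n => f n x) atTop (𝓝 (f₀ x)))
    (hle : ∀ n, eLpNorm (f n) 2 μ ≤ eLpNorm f₀ 2 μ) :
    Tendsto (fun n => eLpNorm (f n - f₀) 2 μ) atTop (𝓝 0) := by
  rw [eLpNorm_two_tendsto_zero_iff]
  set I : ℝ≥0∞ := ∫⁻ x, ‖f₀ x‖ₑ ^ 2 ∂μ with hI
  have hIt : I ≠ ⊤ := by
    rw [hI, ← eLpNorm_two_sq]
    exact ENNReal.pow_ne_top hf₀.eLpNorm_ne_top
  have hle' : ∀ n, ∫⁻ x, ‖f n x‖ₑ ^ 2 ∂μ ≤ I := fun n => by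
    rw [hI, ← eLpNorm_two_sq, ← eLpNorm_two_sq]
    gcongr
    exact hle n
  -- Fatou's lemma is applied to `2|fₙ|² + 2|f₀|² - |fₙ - f₀|²`, which is nonnegative and tends to
  -- `4|f₀|²`. Since the first two terms integrate to at most `4I`, no mass is left for the third.
  let F : ℕ → α → ℝ≥0∞ := fun n x => (2 * ‖f n x‖ₑ ^ 2 + 2 * ‖f₀ x‖ₑ ^ 2) - ‖(f n - f₀) x‖ₑ ^ 2
  have hpt : ∀ n x, ‖(f n - f₀) x‖ₑ ^ 2 ≤ 2 * ‖f n x‖ₑ ^ 2 + 2 * ‖f₀ x‖ₑ ^ 2 := fun n x => by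
    have h1 : ‖(f n - f₀) x‖ ^ 2 ≤ 2 * ‖f n x‖ ^ 2 + 2 * ‖f₀ x‖ ^ 2 := by
      have := norm_sub_le (f n x) (f₀ x)
      simp only [Pi.sub_apply]
      nlinarith [norm_nonneg (f n x - f₀ x), sq_nonneg (‖f n x‖ - ‖f₀ x‖)]
    have h2 := ENNReal.ofReal_le_ofReal h1
    rw [ENNReal.ofReal_add (by positivity) (by positivity), ENNReal.ofReal_mul (by norm_num),
      ENNReal.ofReal_mul (by norm_num), ENNReal.ofReal_pow (norm_nonneg _),
      ENNReal.ofReal_pow (norm_nonneg _), ENNReal.ofReal_pow (norm_nonneg _)] at h2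
    simpa using h2
  have m1 : ∀ n, AEMeasurable (fun x => ‖f n x‖ₑ ^ 2) μ := fun n =>
    (hf n).1.enorm.pow_const 2
  have m0 : AEMeasurable (fun x => ‖f₀ x‖ₑ ^ 2) μ := hf₀.1.enorm.pow_const 2
  have m2 : ∀ n, AEMeasurable (fun x => ‖(f n - f₀) x‖ₑ ^ 2) μ := fun n =>
    ((hf n).1.sub hf₀.1).enorm.pow_const 2
  have mF : ∀ n, AEMeasurable (F n) μ := fun n =>
    (((m1 n).const_mul 2).add (m0.const_mul 2)).sub (m2 n)
  have hsum : ∀ n, ∫⁻ x, F n x ∂μ + ∫⁻ x, ‖(f n - f₀) x‖ₑ ^ 2 ∂μ ≤ 4 * I := fun n => by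
    rw [← lintegral_add_left' (mF n)]
    calc ∫⁻ x, (F n x + ‖(f n - f₀) x‖ₑ ^ 2) ∂μ
        = ∫⁻ x, (2 * ‖f n x‖ₑ ^ 2 + 2 * ‖f₀ x‖ₑ ^ 2) ∂μ := by
          congr 1; ext x; exact tsub_add_cancel_of_le (hpt n x)
      _ = 2 * ∫⁻ x, ‖f n x‖ₑ ^ 2 ∂μ + 2 * I := by
          rw [lintegral_add_left' ((m1 n).const_mul 2), lintegral_const_mul'' _ (m1 n),
            lintegral_const_mul'' _ m0]
      _ ≤ 2 * I + 2 * I := by gcongr; exact hle' n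
      _ = 4 * I := by ring
  have hlim : ∀ᵐ x ∂μ, liminf (fun n => F n x) atTop = 4 * ‖f₀ x‖ₑ ^ 2 := by
    filter_upwards [hae] with x hx
    apply Tendsto.liminf_eq
    have t1 : Tendsto (fun n => ‖f n x‖ₑ ^ 2) atTop (𝓝 (‖f₀ x‖ₑ ^ 2)) :=
      ENNReal.Tendsto.pow hx.enorm
    have t2 : Tendsto (fun n => ‖(f n - f₀) x‖ₑ ^ 2) atTop (𝓝 0) := by
      have : Tendsto (fun n => f n x - f₀ x) atTop (𝓝 0) := by
        simpa using hx.sub_const (f₀ x)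
      simpa using ENNReal.Tendsto.pow (n := 2) this.enorm
    have t3 := ENNReal.Tendsto.sub
      ((ENNReal.Tendsto.const_mul (a := 2) t1 (Or.inr (by simp))).add_const (2 * ‖f₀ x‖ₑ ^ 2)) t2
      (Or.inr (by simp))
    convert t3 using 2
    rw [tsub_zero]
    ring
  have hfatou : 4 * I ≤ liminf (fun n => ∫⁻ x, F n x ∂μ) atTop := by
    calc 4 * I = ∫⁻ x, 4 * ‖f₀ x‖ₑ ^ 2 ∂μ := (lintegral_const_mul'' _ m0).symm
      _ = ∫⁻ x, liminf (fun n => F n x) atTop ∂μ := (lintegral_congr_ae hlim).symm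
      _ ≤ _ := lintegral_liminf_le' mF
  have h4 : 4 * I ≠ ⊤ := ENNReal.mul_ne_top (by simp) hIt
  rw [ENNReal.tendsto_nhds_zero]
  intro ε hε
  by_cases hI0 : 4 * I ≤ ε
  · exact Eventually.of_forall fun n => (le_add_self.trans (hsum n)).trans hI0
  push Not at hI0
  have hεt : ε ≠ ⊤ := (hI0.trans_le le_top).ne
  have hlt : 4 * I - ε < liminf (fun n => ∫⁻ x, F n x ∂μ) atTop :=
    (ENNReal.sub_lt_self h4 (hε.trans hI0).ne' hε.ne').trans_le hfatou
  filter_upwards [eventually_lt_of_lt_liminf hlt] with n hn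
  by_contra! hc
  have : 4 * I < 4 * I := by
    calc 4 * I = (4 * I - ε) + ε := (tsub_add_cancel_of_le hI0.le).symm
      _ < ∫⁻ x, F n x ∂μ + ∫⁻ x, ‖(f n - f₀) x‖ₑ ^ 2 ∂μ := ENNReal.add_lt_add hn hc
      _ ≤ 4 * I := hsum n
  exact lt_irrefl _ this

theorem norm_integral_mul_le_eLpNorm {f g : α → ℂ} (hf : MemLp f 2 μ) (hg : MemLp g 2 μ) :
    ‖∫ x, f x * g x ∂μ‖ ≤ (eLpNorm f 2 μ * eLpNorm g 2 μ).toReal := by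
  have h1 := eLpNorm_smul_le_mul_eLpNorm (p := 2) (q := 2) (r := 1) hg.1 hf.1
  have h2 : ‖∫ x, f x * g x ∂μ‖ₑ ≤ eLpNorm f 2 μ * eLpNorm g 2 μ := by
    refine (enorm_integral_le_lintegral_enorm _).trans ?_
    rw [← eLpNorm_one_eq_lintegral_enorm]
    exact h1
  have := ENNReal.toReal_mono (ENNReal.mul_ne_top hf.eLpNorm_ne_top hg.eLpNorm_ne_top) h2
  simpa using this

theorem MemLp.integrable_mul_two {f g : α → ℂ} (hf : MemLp f 2 μ) (hg : MemLp g 2 μ) :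
    Integrable (fun x => f x * g x) μ := hf.integrable_mul hg

/-- Split `gₙVₙ = (gₙ - g₀)Vₙ + g₀Vₙ`. The first part tends to zero by Cauchy–Schwarz and the
uniform bound on `Vₙ`; the second is weak convergence tested against the single function `g₀`. -/
theorem tendsto_integral_mul_of_strong_weak {g V : ℕ → α → ℂ} {g₀ V₀ : α → ℂ} {C : ℝ≥0∞}
    (hC : C ≠ ⊤) (hg : ∀ n, MemLp (g n) 2 μ) (hg₀ : MemLp g₀ 2 μ)
    (hs : Tendsto (fun n => eLpNorm (g n - g₀) 2 μ) atTop (𝓝 0))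
    (hV : ∀ n, MemLp (V n) 2 μ) (hVC : ∀ n, eLpNorm (V n) 2 μ ≤ C)
    (hw : Tendsto (fun n => ∫ x, g₀ x * V n x ∂μ) atTop (𝓝 (∫ x, g₀ x * V₀ x ∂μ))) :
    Tendsto (fun n => ∫ x, g n x * V n x ∂μ) atTop (𝓝 (∫ x, g₀ x * V₀ x ∂μ)) := by
  have e : ∀ n, ∫ x, g n x * V n x ∂μ =
      ∫ x, (g n - g₀) x * V n x ∂μ + ∫ x, g₀ x * V n x ∂μ := fun n => by
    rw [← integral_add (MemLp.integrable_mul_two ((hg n).sub hg₀) (hV n))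
      (MemLp.integrable_mul_two hg₀ (hV n))]
    congr 1; ext x; simp only [Pi.sub_apply]; ring
  simp_rw [e]
  have h0 : Tendsto (fun n => ∫ x, (g n - g₀) x * V n x ∂μ) atTop (𝓝 0) := by
    have hb : Tendsto (fun n => (eLpNorm (g n - g₀) 2 μ * C).toReal) atTop (𝓝 0) := by
      have := ENNReal.Tendsto.mul_const (b := C) hs (Or.inr hC)
      rw [zero_mul] at this
      exact (ENNReal.tendsto_toReal ENNReal.zero_ne_top).comp this
    apply squeeze_zero_norm (fun n => ?_) hb
    refine (norm_integral_mul_le_eLpNorm ((hg n).sub hg₀) (hV n)).trans ?_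
    apply ENNReal.toReal_mono (ENNReal.mul_ne_top ((hg n).sub hg₀).eLpNorm_ne_top hC)
    gcongr
    exact hVC n
  simpa using h0.add hw

theorem tendsto_integral_mul_of_strong {V : ℕ → α → ℂ} {g₀ V₀ : α → ℂ}
    (hg₀ : MemLp g₀ 2 μ) (hV : ∀ n, MemLp (V n) 2 μ) (hV₀ : MemLp V₀ 2 μ)
    (hs : Tendsto (fun n => eLpNorm (V n - V₀) 2 μ) atTop (𝓝 0)) :
    Tendsto (fun n => ∫ x, g₀ x * V n x ∂μ) atTop (𝓝 (∫ x, g₀ x * V₀ x ∂μ)) := by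
  have := tendsto_integral_mul_of_strong_weak (V := fun _ => g₀) (V₀ := g₀)
    hg₀.eLpNorm_ne_top hV hV₀ hs (fun _ => hg₀) (fun _ => le_rfl) tendsto_const_nhds
  simpa only [mul_comm] using this

/-- Split into `Aₙ(pₙ - p₀)`, bounded by `C` times a null sequence, and `(Aₙ - A₀)p₀`, handled by
dominated convergence with majorant `(2C|p₀|)²`. Bounded coefficients converging almost everywhere
are thus harmless for strong convergence. -/
theorem tendsto_eLpNorm_mul_sub {A p : ℕ → α → ℂ} {A₀ p₀ : α → ℂ} {C : ℝ}
    (hA : ∀ n, AEStronglyMeasurable (A n) μ) (hAC : ∀ n, ∀ᵐ x ∂μ, ‖A n x‖ ≤ C)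
    (hAt : ∀ᵐ x ∂μ, Tendsto (fun n => A n x) atTop (𝓝 (A₀ x)))
    (hp : ∀ n, MemLp (p n) 2 μ) (hp₀ : MemLp p₀ 2 μ)
    (hs : Tendsto (fun n => eLpNorm (p n - p₀) 2 μ) atTop (𝓝 0)) :
    (∀ n, MemLp (fun x => A n x * p n x) 2 μ) ∧ MemLp (fun x => A₀ x * p₀ x) 2 μ ∧
    Tendsto (fun n => eLpNorm ((fun x => A n x * p n x) - fun x => A₀ x * p₀ x) 2 μ)
      atTop (𝓝 0) := by
  have hA₀ : AEStronglyMeasurable A₀ μ := aestronglyMeasurable_of_tendsto_ae atTop hA hAt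
  have hA₀C : ∀ᵐ x ∂μ, ‖A₀ x‖ ≤ C := by
    filter_upwards [hAt, ae_all_iff.mpr hAC] with x hx hb
    exact le_of_tendsto hx.norm (Eventually.of_forall hb)
  have mul : ∀ {B q : α → ℂ}, AEStronglyMeasurable B μ → (∀ᵐ x ∂μ, ‖B x‖ ≤ C) → MemLp q 2 μ →
      MemLp (fun x => B x * q x) 2 μ := fun {B q} h1 h2 hq => by
    refine hq.of_le_mul (c := C) (h1.mul hq.1) ?_
    filter_upwards [h2] with x hx
    rw [norm_mul]
    gcongr
  refine ⟨fun n => mul (hA n) (hAC n) (hp n), mul hA₀ hA₀C hp₀, ?_⟩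
  have h1 : Tendsto (fun n => eLpNorm (fun x => A n x * (p n - p₀) x) 2 μ) atTop (𝓝 0) := by
    have hb := ENNReal.Tendsto.const_mul (a := ENNReal.ofReal C) hs (Or.inr ENNReal.ofReal_ne_top)
    rw [mul_zero] at hb
    refine tendsto_of_tendsto_of_tendsto_of_le_of_le tendsto_const_nhds hb (fun _ => zero_le)
      (fun n => ?_)
    apply eLpNorm_le_mul_eLpNorm_of_ae_le_mul
    filter_upwards [hAC n] with x hx
    rw [norm_mul]
    gcongr
  have h2 : Tendsto (fun n => eLpNorm (fun x => (A n x - A₀ x) * p₀ x) 2 μ) atTop (𝓝 0) := by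
    rw [eLpNorm_two_tendsto_zero_iff]
    have hb : ∫⁻ x, (ENNReal.ofReal (2 * C) * ‖p₀ x‖ₑ) ^ 2 ∂μ ≠ ⊤ := by
      simp_rw [mul_pow]
      rw [lintegral_const_mul'' _ (hp₀.1.enorm.pow_const 2), ← eLpNorm_two_sq]
      exact ENNReal.mul_ne_top (ENNReal.pow_ne_top ENNReal.ofReal_ne_top)
        (ENNReal.pow_ne_top hp₀.eLpNorm_ne_top)
    have := tendsto_lintegral_of_dominated_convergence' (μ := μ)
      (F := fun n x => ‖(A n x - A₀ x) * p₀ x‖ₑ ^ 2) (f := fun _ => 0) _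
      (fun n => (((hA n).sub hA₀).mul hp₀.1).enorm.pow_const 2) (fun n => ?_) hb ?_
    · simpa using this
    · filter_upwards [hAC n, hA₀C] with x hx hx0
      gcongr
      rw [enorm_mul]
      gcongr
      rw [← ofReal_norm]
      apply ENNReal.ofReal_le_ofReal
      linarith [norm_sub_le (A n x) (A₀ x)]
    · filter_upwards [hAt] with x hx
      have : Tendsto (fun n => (A n x - A₀ x) * p₀ x) atTop (𝓝 0) := by
        simpa using (hx.sub_const (A₀ x)).mul_const (p₀ x)
      simpa using ENNReal.Tendsto.pow (n := 2) this.enorm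
  refine tendsto_of_tendsto_of_tendsto_of_le_of_le tendsto_const_nhds
    (by simpa using h1.add h2) (fun _ => zero_le) (fun n => ?_)
  have e : ((fun x => A n x * p n x) - fun x => A₀ x * p₀ x) =
      (fun x => A n x * (p n - p₀) x) + fun x => (A n x - A₀ x) * p₀ x := by
    ext x; simp only [Pi.sub_apply, Pi.add_apply]; ring
  rw [e]
  exact eLpNorm_add_le ((hA n).mul ((hp n).sub hp₀).1) (((hA n).sub hA₀).mul hp₀.1) (by norm_num)

/-- The uniform boundedness principle. Pairing with `Vₙ` is the inner product with its conjugate, so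
the norm of the functional is the `L²` norm of `Vₙ`. -/
theorem exists_eLpNorm_le_of_weak {V : ℕ → α → ℂ} {V₀ : α → ℂ} (hV : ∀ n, MemLp (V n) 2 μ)
    (hw : ∀ g : α → ℂ, MemLp g 2 μ →
      Tendsto (fun n => ∫ x, g x * V n x ∂μ) atTop (𝓝 (∫ x, g x * V₀ x ∂μ))) :
    ∃ C : ℝ≥0∞, C ≠ ⊤ ∧ ∀ n, eLpNorm (V n) 2 μ ≤ C := by
  let T : ℕ → Lp ℂ 2 μ →L[ℂ] ℂ := fun n => innerSL ℂ ((hV n).star.toLp _)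
  have hT : ∀ n (g : Lp ℂ 2 μ), T n g = ∫ x, g x * V n x ∂μ := fun n g => by
    simp only [T, innerSL_apply_apply, L2.inner_def]
    apply integral_congr_ae
    filter_upwards [(hV n).star.coeFn_toLp] with x hx
    rw [hx]
    simp [mul_comm]
  have hb : ∀ g : Lp ℂ 2 μ, ∃ C, ∀ n, ‖T n g‖ ≤ C := fun g => by
    have := (hw g (Lp.memLp g)).norm.bddAbove_range
    obtain ⟨C, hC⟩ := this
    refine ⟨C, fun n => ?_⟩
    rw [hT]
    exact hC ⟨n, rfl⟩
  obtain ⟨C, hC⟩ := banach_steinhaus hb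
  refine ⟨ENNReal.ofReal C, ENNReal.ofReal_ne_top, fun n => ?_⟩
  have h1 := hC n
  simp only [T, innerSL_apply_norm] at h1
  rw [Lp.norm_toLp] at h1
  have h2 := ENNReal.ofReal_le_ofReal h1
  rw [ENNReal.ofReal_toReal (hV n).star.eLpNorm_ne_top] at h2
  have e : eLpNorm (star (V n)) 2 μ = eLpNorm (V n) 2 μ := by
    apply eLpNorm_congr_norm_ae
    filter_upwards with x
    simp
  rwa [e] at h2

end SquareIntegrable

/-! ### Mollification: contraction, convergence and commutation with weak derivatives. -/

section Mollification

open scoped Convolution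
open ContinuousLinearMap (lsmul)

/-- A sequence of smooth bump functions on `ℂ` shrinking to the origin. -/
noncomputable def bumpSeq (n : ℕ) : ContDiffBump (0 : ℂ) where
  rIn := 1 / (2 * (n + 1))
  rOut := 1 / (n + 1)
  rIn_pos := by positivity
  rIn_lt_rOut := by
    apply one_div_lt_one_div_of_lt <;> nlinarith [Nat.cast_nonneg (α := ℝ) n]

variable {E : Type*} [NormedAddCommGroup E] [NormedSpace ℝ E]

/-- The normalised bump function used as a mollifying kernel. -/
noncomputable def mollKernel (n : ℕ) : ℂ → ℝ := (bumpSeq n).normed volume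

/-- Mollification at scale `1 / (n + 1)`. -/
noncomputable def mollify (n : ℕ) (g : ℂ → E) : ℂ → E :=
  mollKernel n ⋆[lsmul ℝ ℝ, volume] g

theorem mollify_apply (n : ℕ) (g : ℂ → E) (x : ℂ) :
    mollify n g x = ∫ y, mollKernel n y • g (x - y) := rfl

theorem mollKernel_nonneg (n : ℕ) (x : ℂ) : 0 ≤ mollKernel n x := (bumpSeq n).nonneg_normed x

theorem contDiff_mollKernel (n : ℕ) : ContDiff ℝ ∞ (mollKernel n) := (bumpSeq n).contDiff_normed

theorem hasCompactSupport_mollKernel (n : ℕ) : HasCompactSupport (mollKernel n) :=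
  (bumpSeq n).hasCompactSupport_normed

theorem integral_mollKernel (n : ℕ) : ∫ x, mollKernel n x = 1 := (bumpSeq n).integral_normed

theorem integrable_mollKernel (n : ℕ) : Integrable (mollKernel n) :=
  (contDiff_mollKernel n).continuous.integrable_of_hasCompactSupport
    (hasCompactSupport_mollKernel n)

theorem tsupport_mollKernel (n : ℕ) :
    tsupport (mollKernel n) = Metric.closedBall 0 (1 / (n + 1)) := (bumpSeq n).tsupport_normed_eq

theorem mollKernel_eq_zero {n : ℕ} {x : ℂ} (hx : 1 / (n + 1 : ℝ) < ‖x‖) : mollKernel n x = 0 := by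
  by_contra h
  have : x ∈ tsupport (mollKernel n) := subset_tsupport _ h
  rw [tsupport_mollKernel] at this
  simp only [mem_closedBall_zero_iff] at this
  linarith

theorem lintegral_mollKernel (n : ℕ) : ∫⁻ x, ENNReal.ofReal (mollKernel n x) = 1 := by
  rw [← ofReal_integral_eq_lintegral_ofReal (integrable_mollKernel n)
    (Eventually.of_forall (mollKernel_nonneg n)), integral_mollKernel, ENNReal.ofReal_one]

theorem tendsto_bumpSeq_rOut : Tendsto (fun n => (bumpSeq n).rOut) atTop (𝓝 0) :=
  tendsto_one_div_add_atTop_nhds_zero_nat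

/-- Jensen's inequality for the square and a probability density. -/
theorem enorm_integral_smul_sq_le {α : Type*} [MeasurableSpace α] {μ : Measure α} {φ : α → ℝ}
    (hφ : AEMeasurable φ μ) (h0 : ∀ x, 0 ≤ φ x) (h1 : ∫⁻ x, ENNReal.ofReal (φ x) ∂μ = 1) {F : α → E}
    (hF : AEStronglyMeasurable F μ) :
    ‖∫ x, φ x • F x ∂μ‖ₑ ^ 2 ≤ ∫⁻ x, ENNReal.ofReal (φ x) * ‖F x‖ₑ ^ 2 ∂μ := by
  have hm : AEMeasurable (fun x => ENNReal.ofReal (φ x)) μ := hφ.ennreal_ofReal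
  have hpr : IsProbabilityMeasure (μ.withDensity fun x => ENNReal.ofReal (φ x)) :=
    ⟨by rw [withDensity_apply _ MeasurableSet.univ]; simpa using h1⟩
  have hF' : AEStronglyMeasurable F (μ.withDensity fun x => ENNReal.ofReal (φ x)) :=
    hF.mono_ac (withDensity_absolutelyContinuous _ _)
  have h2 := eLpNorm_le_eLpNorm_of_exponent_le (p := 1) (q := 2) (by norm_num) hF'
  have h3 : ∀ k : ℕ, ∫⁻ x, ‖F x‖ₑ ^ k ∂(μ.withDensity fun x => ENNReal.ofReal (φ x)) =
      ∫⁻ x, ENNReal.ofReal (φ x) * ‖F x‖ₑ ^ k ∂μ := fun k => by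
    rw [lintegral_withDensity_eq_lintegral_mul₀ hm (hF.enorm.pow_const k)]
    rfl
  have h4 := pow_le_pow_left' h2 2
  rw [eLpNorm_two_sq, eLpNorm_one_eq_lintegral_enorm, h3] at h4
  refine le_trans ?_ h4
  gcongr
  have h5 := h3 1
  simp only [pow_one] at h5
  rw [h5]
  refine (enorm_integral_le_lintegral_enorm _).trans (lintegral_mono fun x => ?_)
  rw [enorm_smul, Real.enorm_eq_ofReal (h0 x)]

theorem norm_mollify_le {n : ℕ} {g : ℂ → E} {M : ℝ} (hM : ∀ᵐ x, ‖g x‖ ≤ M) (x : ℂ) :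
    ‖mollify n g x‖ ≤ M := by
  rw [mollify_apply]
  have hM' : ∀ᵐ y, ‖g (x - y)‖ ≤ M :=
    (Measure.measurePreserving_sub_left volume x).quasiMeasurePreserving.ae hM
  calc ‖∫ y, mollKernel n y • g (x - y)‖ ≤ ∫ y, mollKernel n y * M := by
        apply norm_integral_le_of_norm_le ((integrable_mollKernel n).mul_const M)
        filter_upwards [hM'] with y hy
        rw [norm_smul, Real.norm_of_nonneg (mollKernel_nonneg n y)]
        exact mul_le_mul_of_nonneg_left hy (mollKernel_nonneg n y)
    _ = M := by rw [integral_mul_const, integral_mollKernel, one_mul]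

theorem contDiff_mollify (n : ℕ) {g : ℂ → E} (hg : LocallyIntegrable g) :
    ContDiff ℝ ∞ (mollify n g) :=
  (hasCompactSupport_mollKernel n).contDiff_convolution_left _ (contDiff_mollKernel n) hg

/-- Jensen's inequality for the kernel as a probability density, then Tonelli and translation
invariance. -/
theorem lintegral_enorm_mollify_sq_le (n : ℕ) {g : ℂ → E} (hg : AEStronglyMeasurable g) :
    ∫⁻ x, ‖mollify n g x‖ₑ ^ 2 ≤ ∫⁻ x, ‖g x‖ₑ ^ 2 := by
  have hk : AEMeasurable (mollKernel n) := (contDiff_mollKernel n).continuous.aemeasurable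
  have hm : AEMeasurable (fun p : ℂ × ℂ => ENNReal.ofReal (mollKernel n p.2) * ‖g (p.1 - p.2)‖ₑ ^ 2)
      (volume.prod volume) := by
    have m1 : AEMeasurable (fun p : ℂ × ℂ => ENNReal.ofReal (mollKernel n p.2))
        (volume.prod volume) :=
      ((contDiff_mollKernel n).continuous.comp continuous_snd).aemeasurable.ennreal_ofReal
    have m2 : AEStronglyMeasurable (fun p : ℂ × ℂ => g (p.1 - p.2)) (volume.prod volume) :=
      hg.comp_quasiMeasurePreserving (quasiMeasurePreserving_sub volume volume)
    exact m1.mul (m2.enorm.pow_const 2)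
  calc ∫⁻ x, ‖mollify n g x‖ₑ ^ 2
      ≤ ∫⁻ x, ∫⁻ y, ENNReal.ofReal (mollKernel n y) * ‖g (x - y)‖ₑ ^ 2 := by
        apply lintegral_mono fun x => ?_
        exact enorm_integral_smul_sq_le hk (mollKernel_nonneg n) (lintegral_mollKernel n)
          (hg.comp_quasiMeasurePreserving (quasiMeasurePreserving_sub_left volume x))
    _ = ∫⁻ y, ∫⁻ x, ENNReal.ofReal (mollKernel n y) * ‖g (x - y)‖ₑ ^ 2 :=
        lintegral_lintegral_swap hm
    _ = ∫⁻ y, ENNReal.ofReal (mollKernel n y) * ∫⁻ x, ‖g x‖ₑ ^ 2 := by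
        congr 1; ext y
        rw [lintegral_const_mul' _ _ ENNReal.ofReal_ne_top,
          lintegral_sub_right_eq_self (fun x => ‖g x‖ₑ ^ 2) y]
    _ = ∫⁻ x, ‖g x‖ₑ ^ 2 := by
        rw [lintegral_mul_const'' _ hk.ennreal_ofReal, lintegral_mollKernel, one_mul]

theorem eLpNorm_mollify_le (n : ℕ) {g : ℂ → E} (hg : AEStronglyMeasurable g) :
    eLpNorm (mollify n g) 2 volume ≤ eLpNorm g 2 volume := by
  have := lintegral_enorm_mollify_sq_le n hg
  rw [← eLpNorm_two_sq, ← eLpNorm_two_sq] at this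
  exact (ENNReal.pow_le_pow_left_iff two_ne_zero).mp this

theorem memLp_mollify (n : ℕ) {g : ℂ → E} (hg : MemLp g 2 volume) :
    MemLp (mollify n g) 2 volume :=
  ⟨(contDiff_mollify n (hg.locallyIntegrable (by norm_num))).continuous.aestronglyMeasurable,
    (eLpNorm_mollify_le n hg.1).trans_lt hg.2⟩

variable [CompleteSpace E]

theorem mollify_ae_tendsto {g : ℂ → E} (hg : LocallyIntegrable g) :
    ∀ᵐ x, Tendsto (fun n => mollify n g x) atTop (𝓝 (g x)) := by
  -- Lebesgue differentiation needs inner and outer radii of the bumps to be comparable; here their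
  -- ratio is exactly `2`.
  refine ContDiffBump.ae_convolution_tendsto_right_of_locallyIntegrable (K := 2)
    tendsto_bumpSeq_rOut (Eventually.of_forall fun n => ?_) hg
  have : (0 : ℝ) < n + 1 := by positivity
  change 1 / ((n : ℝ) + 1) ≤ 2 * (1 / (2 * (n + 1)))
  apply le_of_eq
  field_simp

/-- Almost everywhere convergence together with the contraction of norms already implies strong
convergence. -/
theorem tendsto_mollify_eLpNorm {g : ℂ → E} (hg : MemLp g 2 volume) :
    Tendsto (fun n => eLpNorm (mollify n g - g) 2 volume) atTop (𝓝 0) :=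
  tendsto_eLpNorm_two_sub_of_ae_of_le (fun n => memLp_mollify n hg) hg
    (mollify_ae_tendsto (hg.locallyIntegrable (by norm_num))) (fun n => eLpNorm_mollify_le n hg.1)

theorem dist_mollify_le {n : ℕ} {g : ℂ → E} (hg : AEStronglyMeasurable g) {x : ℂ} {ε : ℝ}
    (h : ∀ y, dist y x < 1 / (n + 1) → dist (g y) (g x) ≤ ε) : dist (mollify n g x) (g x) ≤ ε :=
  ContDiffBump.dist_normed_convolution_le hg (fun y hy => h y hy)

theorem convolution_precompL_lsmul_apply {f : ℂ → ℂ →L[ℝ] ℝ} (hcf : HasCompactSupport f)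
    (hf : Continuous f) {g : ℂ → ℂ} (hg : LocallyIntegrable g) (x v : ℂ) :
    (f ⋆[(lsmul ℝ ℝ : ℝ →L[ℝ] ℂ →L[ℝ] ℂ).precompL ℂ, volume] g) x v =
      ∫ y, f y v • g (x - y) := by
  have := hcf.convolutionExists_left
    ((lsmul ℝ ℝ : ℝ →L[ℝ] ℂ →L[ℝ] ℂ).precompL ℂ) hf hg x
  simp_rw [convolution_def, ContinuousLinearMap.integral_apply this]
  rfl

/-- The derivative falls on the kernel, and `y ↦ mollKernel n (x - y)` is an admissible test
function because the closed ball around `x` lies in `Ω`. The sign from differentiating in `y`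
cancels the sign of integration by parts. -/
theorem fderiv_mollify_indicator {Ω : Set ℂ} (hΩ : IsOpen Ω) {h : ℂ → ℂ} {G : ℂ → ℂ →L[ℝ] ℂ}
    (hw : HasWeakDeriv Ω h G) (hh : LocallyIntegrable (Ω.indicator h))
    (hG : LocallyIntegrable (Ω.indicator G))
    {n : ℕ} {x : ℂ} (hx : Metric.closedBall x (1 / (n + 1)) ⊆ Ω) :
    fderiv ℝ (mollify n (Ω.indicator h)) x = mollify n (Ω.indicator G) x := by
  have hd := ((hasCompactSupport_mollKernel n).hasFDerivAt_convolution_left (lsmul ℝ ℝ)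
    ((contDiff_mollKernel n).of_le (by simp)) hh x).fderiv
  rw [mollify, hd]
  have hk1 : Continuous (fderiv ℝ (mollKernel n)) :=
    (contDiff_mollKernel n).continuous_fderiv (by simp)
  have hφ : ContDiff ℝ ∞ (fun y => mollKernel n (x - y)) :=
    (contDiff_mollKernel n).comp (contDiff_const.sub contDiff_id)
  have hts : tsupport (fun y => mollKernel n (x - y)) ⊆ Metric.closedBall x (1 / (n + 1)) := by
    apply closure_minimal _ Metric.isClosed_closedBall
    intro y hy
    by_contra hn
    apply hy
    apply mollKernel_eq_zero
    simpa [dist_eq_norm, norm_sub_rev] using hn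
  have hcs : HasCompactSupport (fun y => mollKernel n (x - y)) :=
    (isCompact_closedBall x _).of_isClosed_subset (isClosed_tsupport _) hts
  ext1 v
  have e2 : (mollify n (Ω.indicator G) x) v =
      ∫ y in Ω, mollKernel n (x - y) • G y v := by
    have i1 : Integrable fun y => mollKernel n y • (Ω.indicator G) (x - y) :=
      (hasCompactSupport_mollKernel n).convolutionExists_left (lsmul ℝ ℝ)
        (contDiff_mollKernel n).continuous hG x
    rw [mollify_apply, ContinuousLinearMap.integral_apply i1,
      ← integral_sub_left_eq_self (fun y => (mollKernel n y • (Ω.indicator G) (x - y)) v) _ x,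
      ← integral_indicator hΩ.measurableSet]
    congr 1; ext y
    by_cases hy : y ∈ Ω <;> simp [hy]
  have e1 : ((fderiv ℝ (mollKernel n) ⋆[(lsmul ℝ ℝ).precompL ℂ, volume] Ω.indicator h) x) v =
      -∫ y in Ω, fderiv ℝ (fun y => mollKernel n (x - y)) y v • h y := by
    rw [convolution_precompL_lsmul_apply ((hasCompactSupport_mollKernel n).fderiv ℝ) hk1 hh,
      ← integral_sub_left_eq_self
        (fun y => (fderiv ℝ (mollKernel n) y) v • (Ω.indicator h) (x - y)) _ x,
      ← integral_neg, ← integral_indicator hΩ.measurableSet]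
    congr 1; ext y
    have hf : fderiv ℝ (fun y => mollKernel n (x - y)) y v = -fderiv ℝ (mollKernel n) (x - y) v := by
      have h1 : HasFDerivAt (mollKernel n) (fderiv ℝ (mollKernel n) (x - y)) (x - y) :=
        ((contDiff_mollKernel n).differentiable (by simp) _).hasFDerivAt
      have h2 := h1.comp y ((hasFDerivAt_id y).const_sub x)
      have h3 : HasFDerivAt (fun y => mollKernel n (x - y)) _ y := h2
      rw [h3.fderiv]
      simp
    by_cases hy : y ∈ Ω <;> simp [hy, hf]
  rw [e2, e1, hw.2.2 _ hφ hcs (hts.trans hx) v, neg_neg]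

end Mollification

/-! ### Compact sub-annuli. -/

/-- The closed annulus `{z : a ≤ |z| ≤ b}`. -/
def closedAnnulus (a b : ℝ) : Set ℂ := {z | a ≤ ‖z‖ ∧ ‖z‖ ≤ b}

theorem isClosed_closedAnnulus (a b : ℝ) : IsClosed (closedAnnulus a b) :=
  (isClosed_le continuous_const continuous_norm).inter (isClosed_le continuous_norm continuous_const)

theorem isCompact_closedAnnulus (a b : ℝ) : IsCompact (closedAnnulus a b) :=
  (isCompact_closedBall (0 : ℂ) b).of_isClosed_subset (isClosed_closedAnnulus a b)
    (fun x hx => by simpa using hx.2)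

theorem measurableSet_closedAnnulus (a b : ℝ) : MeasurableSet (closedAnnulus a b) :=
  (isClosed_closedAnnulus a b).measurableSet

theorem closedAnnulus_subset {r R a b : ℝ} (ha : r < a) (hb : b < R) :
    closedAnnulus a b ⊆ annulus r R := fun _ hx => ⟨ha.trans_le hx.1, hx.2.trans_lt hb⟩

theorem closedAnnulus_mono {a b a' b' : ℝ} (ha : a' ≤ a) (hb : b ≤ b') :
    closedAnnulus a b ⊆ closedAnnulus a' b' := fun _ hx => ⟨ha.trans hx.1, hx.2.trans hb⟩

theorem mem_closedAnnulus_of_dist {a b ε : ℝ} {x y : ℂ} (hx : x ∈ closedAnnulus a b)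
    (h : ‖x - y‖ ≤ ε) : y ∈ closedAnnulus (a - ε) (b + ε) := by
  have h1 := norm_sub_norm_le x y
  have h2 := norm_sub_norm_le y x
  rw [norm_sub_rev] at h2
  exact ⟨by linarith [hx.1], by linarith [hx.2]⟩

instance isFiniteMeasure_closedAnnulus (a b : ℝ) :
    IsFiniteMeasure (volume.restrict (closedAnnulus a b)) :=
  ⟨by simpa using (isCompact_closedAnnulus a b).measure_lt_top⟩

/-! ### Smooth approximation of Sobolev maps, and a Poincaré estimate. -/

section Approximation

variable {r R : ℝ} {h : ℂ → ℂ} {G : ℂ → ℂ →L[ℝ] ℂ}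

theorem memLp_indicator_annulus {E : Type*} [NormedAddCommGroup E] {f : ℂ → E}
    (hf : MemLp f 2 (volume.restrict (annulus r R))) :
    MemLp ((annulus r R).indicator f) 2 volume :=
  (memLp_indicator_iff_restrict (measurableSet_annulus r R)).mpr hf

theorem locallyIntegrable_indicator_annulus {E : Type*} [NormedAddCommGroup E] {f : ℂ → E}
    (hf : MemLp f 2 (volume.restrict (annulus r R))) :
    LocallyIntegrable ((annulus r R).indicator f) :=
  (memLp_indicator_annulus hf).locallyIntegrable (by norm_num)

/-- The mollification of the extension of `h` by zero. -/
noncomputable def smoothApprox (r R : ℝ) (h : ℂ → ℂ) (n : ℕ) : ℂ → ℂ :=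
  mollify n ((annulus r R).indicator h)

theorem contDiff_smoothApprox (hh : MemLp h 2 (volume.restrict (annulus r R))) (n : ℕ) :
    ContDiff ℝ ∞ (smoothApprox r R h n) :=
  contDiff_mollify n (locallyIntegrable_indicator_annulus hh)

theorem norm_smoothApprox_le {M : ℝ} (hM0 : 0 ≤ M)
    (hM : ∀ᵐ x ∂volume.restrict (annulus r R), ‖h x‖ ≤ M) (n : ℕ) (x : ℂ) :
    ‖smoothApprox r R h n x‖ ≤ M := by
  apply norm_mollify_le
  filter_upwards [(ae_restrict_iff' (measurableSet_annulus r R)).mp hM] with x hx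
  by_cases hxA : x ∈ annulus r R
  · simpa [hxA] using hx hxA
  · simpa [hxA] using hM0

theorem smoothApprox_ae_tendsto (hh : MemLp h 2 (volume.restrict (annulus r R))) :
    ∀ᵐ x ∂volume.restrict (annulus r R),
      Tendsto (fun n => smoothApprox r R h n x) atTop (𝓝 (h x)) := by
  rw [ae_restrict_iff' (measurableSet_annulus r R)]
  filter_upwards [mollify_ae_tendsto (locallyIntegrable_indicator_annulus hh)] with x hx hxA
  simpa [smoothApprox, hxA] using hx

/-- The extension of `h` by zero may have no weak derivative across the boundary circles, so
differentiation commutes with mollification only once the scale is smaller than the distance from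
the compact sub-annulus to the boundary. -/
theorem eventually_fderiv_smoothApprox (hw : HasWeakDeriv (annulus r R) h G)
    (hh : MemLp h 2 (volume.restrict (annulus r R)))
    (hG : MemLp G 2 (volume.restrict (annulus r R))) {a b : ℝ} (ha : r < a) (hb : b < R) :
    ∀ᶠ n : ℕ in atTop, ∀ x ∈ closedAnnulus a b,
      fderiv ℝ (smoothApprox r R h n) x = mollify n ((annulus r R).indicator G) x := by
  obtain ⟨ε, hε, hε1⟩ : ∃ ε > 0, ε < min (a - r) (R - b) :=
    exists_between (lt_min (by linarith) (by linarith))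
  have h1 : ε < a - r := hε1.trans_le (min_le_left _ _)
  have h2 : ε < R - b := hε1.trans_le (min_le_right _ _)
  have ev : ∀ᶠ n : ℕ in atTop, 1 / ((n : ℝ) + 1) < ε :=
    (tendsto_order.mp tendsto_one_div_add_atTop_nhds_zero_nat).2 ε hε
  filter_upwards [ev] with n hn x hx
  apply fderiv_mollify_indicator (isOpen_annulus r R) hw (locallyIntegrable_indicator_annulus hh)
    (locallyIntegrable_indicator_annulus hG)
  intro y hy
  apply closedAnnulus_subset (a := a - ε) (b := b + ε) (by linarith) (by linarith)
  apply mem_closedAnnulus_of_dist hx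
  rw [← dist_eq_norm, dist_comm]
  exact (Metric.mem_closedBall.mp hy).trans hn.le

theorem tendsto_eLpNorm_fderiv_smoothApprox (hw : HasWeakDeriv (annulus r R) h G)
    (hh : MemLp h 2 (volume.restrict (annulus r R)))
    (hG : MemLp G 2 (volume.restrict (annulus r R))) {a b : ℝ} (ha : r < a) (hb : b < R) :
    Tendsto (fun n => eLpNorm (fderiv ℝ (smoothApprox r R h n) - G) 2
      (volume.restrict (closedAnnulus a b))) atTop (𝓝 0) := by
  have h1 := tendsto_mollify_eLpNorm (memLp_indicator_annulus hG)
  refine tendsto_of_tendsto_of_tendsto_of_le_of_le' tendsto_const_nhds h1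
    (Eventually.of_forall fun _ => zero_le) ?_
  filter_upwards [eventually_fderiv_smoothApprox hw hh hG ha hb] with n hn
  refine le_trans (le_of_eq ?_) (eLpNorm_restrict_le _ _ _ (closedAnnulus a b))
  apply eLpNorm_congr_ae
  filter_upwards [ae_restrict_mem (measurableSet_closedAnnulus a b)] with x hx
  simp only [Pi.sub_apply]
  rw [hn x hx, indicator_of_mem (closedAnnulus_subset ha hb hx)]

theorem tendsto_eLpNorm_smoothApprox (hh : MemLp h 2 (volume.restrict (annulus r R))) :
    Tendsto (fun n => eLpNorm (smoothApprox r R h n - h) 2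
      (volume.restrict (annulus r R))) atTop (𝓝 0) := by
  have h1 := tendsto_mollify_eLpNorm (memLp_indicator_annulus hh)
  refine tendsto_of_tendsto_of_tendsto_of_le_of_le tendsto_const_nhds h1 (fun _ => zero_le)
    fun n => ?_
  refine le_trans (le_of_eq ?_) (eLpNorm_restrict_le _ _ _ (annulus r R))
  apply eLpNorm_congr_ae
  filter_upwards [ae_restrict_mem (measurableSet_annulus r R)] with x hx
  simp [smoothApprox, hx]

theorem tendstoUniformlyOn_smoothApprox (hc : ContinuousOn h (annulus r R)) {a b : ℝ} (ha : r < a)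
    (hb : b < R) :
    TendstoUniformlyOn (smoothApprox r R h) h atTop (closedAnnulus a b) := by
  obtain ⟨ε, hε, hε1⟩ : ∃ ε > 0, ε < min (a - r) (R - b) :=
    exists_between (lt_min (by linarith) (by linarith))
  have h1 : ε < a - r := hε1.trans_le (min_le_left _ _)
  have h2 : ε < R - b := hε1.trans_le (min_le_right _ _)
  have hsub : closedAnnulus (a - ε) (b + ε) ⊆ annulus r R :=
    closedAnnulus_subset (by linarith) (by linarith)
  have huc := (isCompact_closedAnnulus (a - ε) (b + ε)).uniformContinuousOn_of_continuous
    (hc.mono hsub)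
  rw [Metric.uniformContinuousOn_iff_le] at huc
  have hm : AEStronglyMeasurable ((annulus r R).indicator h) :=
    (aestronglyMeasurable_indicator_iff (measurableSet_annulus r R)).mpr
      (hc.aestronglyMeasurable (measurableSet_annulus r R))
  rw [Metric.tendstoUniformlyOn_iff]
  intro δ hδ
  obtain ⟨η, hη, hu⟩ := huc (δ / 2) (by positivity)
  have ev : ∀ᶠ n : ℕ in atTop, 1 / ((n : ℝ) + 1) < min ε η :=
    (tendsto_order.mp tendsto_one_div_add_atTop_nhds_zero_nat).2 _ (lt_min hε hη)
  filter_upwards [ev] with n hn x hx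
  have hxA : x ∈ closedAnnulus (a - ε) (b + ε) :=
    closedAnnulus_mono (by linarith) (by linarith) hx
  have hd : dist (smoothApprox r R h n x) ((annulus r R).indicator h x) ≤ δ / 2 := by
    apply dist_mollify_le hm
    intro y hy
    have hyn : dist y x < min ε η := hy.trans hn
    have hyA : y ∈ closedAnnulus (a - ε) (b + ε) := by
      apply mem_closedAnnulus_of_dist hx
      rw [← dist_eq_norm, dist_comm]
      exact (hyn.trans_le (min_le_left _ _)).le
    rw [indicator_of_mem (hsub hyA), indicator_of_mem (hsub hxA)]
    exact hu y hyA x hxA (hyn.trans_le (min_le_right _ _)).le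
  rw [indicator_of_mem (hsub hxA)] at hd
  rw [dist_comm]
  linarith

/-- Two exchanges of integrals reduce an average over kernel shifts and segments to a single shift
and a single point of the segment, where a translation finishes the estimate. -/
theorem lintegral_kernel_le {k : ℂ → ℝ≥0∞} (hk : AEMeasurable k) (hk1 : ∫⁻ y, k y = 1)
    {W : ℂ → ℂ → ℝ → ℝ≥0∞} (hW : Measurable fun p : ℂ × ℂ × ℝ => W p.1 p.2.1 p.2.2) {K : Set ℂ}
    {B : ℝ≥0∞} (hB : ∀ y, k y ≠ 0 → ∀ s ∈ Icc (0 : ℝ) 1, ∫⁻ x in K, W x y s ≤ B) :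
    ∫⁻ x in K, ∫⁻ y, k y * ∫⁻ s in Icc (0 : ℝ) 1, W x y s ≤ B := by
  have m2 : Measurable fun p : ℂ × ℂ => ∫⁻ s in Icc (0 : ℝ) 1, W p.1 p.2 s :=
    Measurable.lintegral_prod_right' (f := fun q : (ℂ × ℂ) × ℝ => W q.1.1 q.1.2 q.2)
      (hW.comp (measurable_fst.fst.prodMk (measurable_fst.snd.prodMk measurable_snd)))
  calc ∫⁻ x in K, ∫⁻ y, k y * ∫⁻ s in Icc (0 : ℝ) 1, W x y s
      = ∫⁻ y, ∫⁻ x in K, k y * ∫⁻ s in Icc (0 : ℝ) 1, W x y s :=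
        lintegral_lintegral_swap (hk.comp_snd.mul m2.aemeasurable)
    _ ≤ ∫⁻ y, k y * B := by
        apply lintegral_mono fun y => ?_
        have m3 : Measurable fun x => ∫⁻ s in Icc (0 : ℝ) 1, W x y s :=
          m2.comp (measurable_id.prodMk measurable_const)
        rw [lintegral_const_mul _ m3]
        by_cases hy : k y = 0
        · simp [hy]
        gcongr
        calc ∫⁻ x in K, ∫⁻ s in Icc (0 : ℝ) 1, W x y s
            = ∫⁻ s in Icc (0 : ℝ) 1, ∫⁻ x in K, W x y s :=
              lintegral_lintegral_swap (hW.comp (measurable_fst.prodMk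
                (measurable_const.prodMk measurable_snd))).aemeasurable
          _ ≤ ∫⁻ s in Icc (0 : ℝ) 1, B := setLIntegral_mono' measurableSet_Icc (hB y hy)
          _ = B := by simp
    _ = B := by rw [lintegral_mul_const'' _ hk, hk1, one_mul]

/-- A Poincaré type estimate for mollifications of smooth functions. -/
theorem lintegral_sub_mollify_sq_le {f : ℂ → ℂ} (hf : ContDiff ℝ 1 f) {K K' : Set ℂ}
    (hK : MeasurableSet K) (hK' : MeasurableSet K') {n : ℕ}
    (hKK : ∀ x ∈ K, ∀ y : ℂ, ‖y‖ ≤ 1 / (n + 1) → x - y ∈ K') :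
    ∫⁻ x in K, ‖f x - mollify n f x‖ₑ ^ 2 ≤
      ENNReal.ofReal (1 / (n + 1)) ^ 2 * ∫⁻ x in K', ‖fderiv ℝ f x‖ₑ ^ 2 := by
  set ε : ℝ := 1 / (n + 1) with hε
  have hcD : Continuous (fderiv ℝ f) := hf.continuous_fderiv (by simp)
  have hk : AEMeasurable (mollKernel n) := (contDiff_mollKernel n).continuous.aemeasurable
  have e1 : ∀ x, f x - mollify n f x = ∫ y, mollKernel n y • (f x - f (x - y)) := fun x => by
    simp_rw [smul_sub]
    rw [integral_sub ((integrable_mollKernel n).smul_const _), integral_smul_const,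
      integral_mollKernel, one_smul, mollify_apply]
    exact (hasCompactSupport_mollKernel n).convolutionExists_left (ContinuousLinearMap.lsmul ℝ ℝ)
      (contDiff_mollKernel n).continuous hf.continuous.locallyIntegrable x
  -- The fundamental theorem of calculus along the segment from `x` to `x - y`, then Jensen on the
  -- unit interval.
  have e2 : ∀ x y : ℂ, ‖f x - f (x - y)‖ₑ ^ 2 ≤
      ∫⁻ s in Icc (0 : ℝ) 1, (‖fderiv ℝ f (x - s • y)‖ₑ * ‖y‖ₑ) ^ 2 := fun x y => by
    have hd : ∀ s : ℝ, HasDerivAt (fun s : ℝ => f (x - s • y))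
        (-(fderiv ℝ f (x - s • y) y)) s := fun s => by
      have h1 : HasFDerivAt f (fderiv ℝ f (x - s • y)) (x - s • y) :=
        (hf.differentiable (by simp) _).hasFDerivAt
      have h2 : HasDerivAt (fun s : ℝ => x - s • y) (-y) s := by
        simpa using ((hasDerivAt_id s).smul_const y).const_sub x
      have := h1.comp_hasDerivAt s h2
      simpa [Function.comp_def] using this
    have hcont : Continuous (fun s : ℝ => -(fderiv ℝ f (x - s • y) y)) := by fun_prop
    have h3 := intervalIntegral.integral_eq_sub_of_hasDerivAt (a := 0) (b := 1)
      (fun s _ => hd s) (hcont.intervalIntegrable _ _)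
    simp only [one_smul, zero_smul, sub_zero] at h3
    have h4 : f x - f (x - y) = ∫ s in Icc (0 : ℝ) 1, (1 : ℝ) • (fderiv ℝ f (x - s • y) y) := by
      rw [← neg_sub, ← h3, intervalIntegral.integral_neg, neg_neg,
        intervalIntegral.integral_of_le zero_le_one, integral_Icc_eq_integral_Ioc]
      simp
    rw [h4]
    have hc2 : Continuous (fun s : ℝ => fderiv ℝ f (x - s • y) y) := by fun_prop
    have h5 := enorm_integral_smul_sq_le (μ := volume.restrict (Icc (0 : ℝ) 1)) (φ := fun _ => 1)
      (F := fun s : ℝ => fderiv ℝ f (x - s • y) y) aemeasurable_const (fun _ => zero_le_one)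
      (by simp) hc2.aestronglyMeasurable
    refine h5.trans (lintegral_mono fun s => ?_)
    simp only [ENNReal.ofReal_one, one_mul]
    gcongr
    exact ContinuousLinearMap.le_opENorm _ _
  have e3 : ∀ x, ‖f x - mollify n f x‖ₑ ^ 2 ≤ ∫⁻ y, ENNReal.ofReal (mollKernel n y) *
      ∫⁻ s in Icc (0 : ℝ) 1, (‖fderiv ℝ f (x - s • y)‖ₑ * ‖y‖ₑ) ^ 2 := fun x => by
    rw [e1]
    refine (enorm_integral_smul_sq_le hk (mollKernel_nonneg n) (lintegral_mollKernel n)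
      (by have := hf.continuous; fun_prop)).trans (lintegral_mono fun y => ?_)
    gcongr
    exact e2 x y
  have mm : Measurable fun p : ℂ × ℂ × ℝ =>
      (‖fderiv ℝ f (p.1 - p.2.2 • p.2.1)‖ₑ * ‖p.2.1‖ₑ) ^ 2 := by
    apply Continuous.measurable
    have h1 : Continuous fun p : ℂ × ℂ × ℝ => ‖fderiv ℝ f (p.1 - p.2.2 • p.2.1)‖ₑ := by fun_prop
    have h2 : Continuous fun p : ℂ × ℂ × ℝ => (‖fderiv ℝ f (p.1 - p.2.2 • p.2.1)‖ * ‖p.2.1‖) ^ 2 := by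
      fun_prop
    have h3 := ENNReal.continuous_ofReal.comp h2
    convert h3 using 2 with p
    simp only [Function.comp]
    rw [ENNReal.ofReal_pow (by positivity), ENNReal.ofReal_mul (norm_nonneg _), ofReal_norm,
      ofReal_norm]
  refine (lintegral_mono fun x => e3 x).trans ?_
  refine lintegral_kernel_le hk.ennreal_ofReal (lintegral_mollKernel n) mm fun y hy s hs => ?_
  have hy : ‖y‖ ≤ ε := by
    by_contra hc
    push Not at hc
    exact hy (by rw [mollKernel_eq_zero hc, ENNReal.ofReal_zero])
  rw [← lintegral_const_mul' _ _ (ENNReal.pow_ne_top ENNReal.ofReal_ne_top)]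
  -- Translation by `s • y` carries `K` into `K'`, and Lebesgue measure does not notice it.
  rw [← lintegral_indicator hK, ← lintegral_indicator hK',
    ← lintegral_sub_right_eq_self (K'.indicator _) (s • y)]
  apply lintegral_mono fun x => ?_
  by_cases hx : x ∈ K
  · have hx' : x - s • y ∈ K' := by
      apply hKK x hx
      rw [norm_smul, Real.norm_of_nonneg hs.1]
      exact (mul_le_of_le_one_left (norm_nonneg _) hs.2).trans hy
    rw [indicator_of_mem hx, indicator_of_mem hx', mul_pow, mul_comm]
    gcongr
    rw [← ofReal_norm]
    exact ENNReal.ofReal_le_ofReal hy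
  · rw [indicator_of_notMem hx]
    exact zero_le

end Approximation

/-! ### Exhaustion of an open annulus by compact annuli. -/

section Exhaustion

/-- Inner radii of an exhaustion of an annulus by closed annuli. -/
noncomputable def innerRadius (r R : ℝ) (j : ℕ) : ℝ := r + (R - r) * (1 / (j + 1) / 3)

/-- Outer radii of an exhaustion of an annulus by closed annuli. -/
noncomputable def outerRadius (r R : ℝ) (j : ℕ) : ℝ := R - (R - r) * (1 / (j + 1) / 3)

variable {r R : ℝ}

theorem lt_innerRadius (hrR : r < R) (j : ℕ) : r < innerRadius r R j := by
  have : 0 < (R - r) * (1 / ((j : ℝ) + 1) / 3) := mul_pos (by linarith) (by positivity)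
  unfold innerRadius; linarith

theorem outerRadius_lt (hrR : r < R) (j : ℕ) : outerRadius r R j < R := by
  have : 0 < (R - r) * (1 / ((j : ℝ) + 1) / 3) := mul_pos (by linarith) (by positivity)
  unfold outerRadius; linarith

theorem innerRadius_lt_outerRadius (hrR : r < R) (j : ℕ) :
    innerRadius r R j < outerRadius r R j := by
  -- Each radius moves inwards by at most a third of the width, so the annuli are nondegenerate
  -- already for `j = 0`.
  have h1 : 1 / ((j : ℝ) + 1) ≤ 1 := by
    rw [div_le_one (by positivity)]; linarith [Nat.cast_nonneg (α := ℝ) j]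
  unfold innerRadius outerRadius
  nlinarith

theorem tendsto_innerRadius (r R : ℝ) : Tendsto (innerRadius r R) atTop (𝓝 r) := by
  have := ((tendsto_one_div_add_atTop_nhds_zero_nat (𝕜 := ℝ)).div_const 3).const_mul (R - r)
  have h2 := this.const_add r
  simp only [zero_div, mul_zero, add_zero] at h2
  exact h2

theorem tendsto_outerRadius (r R : ℝ) : Tendsto (outerRadius r R) atTop (𝓝 R) := by
  have := ((tendsto_one_div_add_atTop_nhds_zero_nat (𝕜 := ℝ)).div_const 3).const_mul (R - r)
  have h2 := this.const_sub R
  simp only [zero_div, mul_zero, sub_zero] at h2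
  exact h2

/-- An exhaustion of an annulus by closed annuli. -/
noncomputable def exhaustion (r R : ℝ) (j : ℕ) : Set ℂ :=
  closedAnnulus (innerRadius r R j) (outerRadius r R j)

theorem exhaustion_subset (hrR : r < R) (j : ℕ) : exhaustion r R j ⊆ annulus r R :=
  closedAnnulus_subset (lt_innerRadius hrR j) (outerRadius_lt hrR j)

theorem eventually_mem_exhaustion {x : ℂ} (hx : x ∈ annulus r R) :
    ∀ᶠ j in atTop, x ∈ exhaustion r R j := by
  filter_upwards [(tendsto_order.mp (tendsto_innerRadius r R)).2 _ hx.1,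
    (tendsto_order.mp (tendsto_outerRadius r R)).1 _ hx.2] with j h1 h2
  exact ⟨h1.le, h2.le⟩

theorem tendsto_setLIntegral_diff_exhaustion {F : ℂ → ℝ≥0∞}
    (hF : AEMeasurable F (volume.restrict (annulus r R))) (hfin : ∫⁻ x in annulus r R, F x ≠ ⊤) :
    Tendsto (fun j => ∫⁻ x in annulus r R, (exhaustion r R j)ᶜ.indicator F x) atTop (𝓝 0) := by
  have := tendsto_lintegral_of_dominated_convergence' (μ := volume.restrict (annulus r R))
    (F := fun j x => (exhaustion r R j)ᶜ.indicator F x) (f := fun _ => 0) F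
    (fun j => hF.indicator (measurableSet_closedAnnulus _ _).compl)
    (fun j => Eventually.of_forall fun x => indicator_le_self _ _ x) hfin ?_
  · simpa using this
  · filter_upwards [ae_restrict_mem (measurableSet_annulus r R)] with x hx
    apply tendsto_const_nhds.congr'
    filter_upwards [eventually_mem_exhaustion hx] with j hj
    simp [hj]

theorem tendsto_setIntegral_exhaustion {E : Type*} [NormedAddCommGroup E] [NormedSpace ℝ E]
    (hrR : r < R) {F : ℂ → E} (hF : IntegrableOn F (annulus r R)) :
    Tendsto (fun j => ∫ x in exhaustion r R j, F x) atTop (𝓝 (∫ x in annulus r R, F x)) := by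
  have e : ∀ j, ∫ x in exhaustion r R j, F x =
      ∫ x in annulus r R, (exhaustion r R j).indicator F x := fun j => by
    rw [setIntegral_indicator (show MeasurableSet (exhaustion r R j) from
      measurableSet_closedAnnulus _ _), inter_eq_self_of_subset_right (exhaustion_subset hrR j)]
  simp_rw [e]
  refine tendsto_integral_of_dominated_convergence (fun x => ‖F x‖)
    (fun j => hF.1.indicator (measurableSet_closedAnnulus _ _)) hF.norm
    (fun j => Eventually.of_forall fun x => norm_indicator_le_norm_self _ _) ?_
  filter_upwards [ae_restrict_mem (measurableSet_annulus r R)] with x hx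
  apply tendsto_const_nhds.congr'
  filter_upwards [eventually_mem_exhaustion hx] with j hj
  simp [hj]

end Exhaustion

/-! ### Rellich's theorem. -/

section Compactness

variable {r R : ℝ}

theorem mollify_sub {n : ℕ} {f g : ℂ → ℂ} (hf : LocallyIntegrable f) (hg : LocallyIntegrable g) :
    mollify n (f - g) = mollify n f - mollify n g := by
  have i : ∀ {f : ℂ → ℂ}, LocallyIntegrable f → ∀ x,
      Integrable fun y => mollKernel n y • f (x - y) := fun hf x =>
    (hasCompactSupport_mollKernel n).convolutionExists_left (ContinuousLinearMap.lsmul ℝ ℝ)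
      (contDiff_mollKernel n).continuous hf x
  ext x
  simp only [Pi.sub_apply, mollify_apply, smul_sub]
  exact integral_sub (i hf x) (i hg x)

/-- The smooth Poincaré estimate is applied to `fₘ - mollify n fₘ` for a second mollification `fₘ`
of `f`, and then `m → ∞`. The bound depends on `f` only through its gradient norm, hence is uniform
along bounded sequences. -/
theorem eLpNorm_sub_smoothApprox_le {f : ℂ → ℂ} {G : ℂ → ℂ →L[ℝ] ℂ}
    (hw : HasWeakDeriv (annulus r R) f G) (hf : MemLp f 2 (volume.restrict (annulus r R)))
    (hG : MemLp G 2 (volume.restrict (annulus r R))) {a b : ℝ} {n : ℕ}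
    (ha : r < a - 1 / (n + 1)) (hb : b + 1 / (n + 1) < R) :
    eLpNorm (f - smoothApprox r R f n) 2 (volume.restrict (closedAnnulus a b)) ≤
      ENNReal.ofReal (1 / (n + 1)) * eLpNorm G 2 (volume.restrict (annulus r R)) := by
  set A := annulus r R
  set ε : ℝ := 1 / (n + 1) with hε
  have hε0 : 0 < ε := by positivity
  have hKA : closedAnnulus a b ⊆ A := closedAnnulus_subset (by linarith) (by linarith)
  have hKA' : closedAnnulus (a - ε) (b + ε) ⊆ A := closedAnnulus_subset ha hb
  set ν := volume.restrict (closedAnnulus a b)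
  have hI : MemLp (A.indicator f) 2 volume := memLp_indicator_annulus hf
  set fm : ℕ → ℂ → ℂ := smoothApprox r R f with hfm
  have hfmL : ∀ m, MemLp (fm m) 2 volume := fun m => memLp_mollify m hI
  have key : ∀ m, eLpNorm (f - fm n) 2 ν ≤
      eLpNorm (fm m - A.indicator f) 2 volume +
      (ENNReal.ofReal ε * (eLpNorm (fderiv ℝ (fm m) - G) 2
          (volume.restrict (closedAnnulus (a - ε) (b + ε))) + eLpNorm G 2 (volume.restrict A)) +
      eLpNorm (fm m - A.indicator f) 2 volume) := fun m => by
    have e : f - fm n =ᵐ[ν] (A.indicator f - fm m) + ((fm m - mollify n (fm m)) +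
        mollify n (fm m - A.indicator f)) := by
      filter_upwards [ae_restrict_mem (measurableSet_closedAnnulus a b)] with x hx
      rw [mollify_sub ((hfmL m).locallyIntegrable (by norm_num))
        (hI.locallyIntegrable (by norm_num))]
      simp only [Pi.sub_apply, Pi.add_apply, indicator_of_mem (hKA hx)]
      simp only [hfm, smoothApprox]
      ring
    have s1 : AEStronglyMeasurable (A.indicator f - fm m) ν := (hI.1.sub (hfmL m).1).restrict
    have s2 : AEStronglyMeasurable (fm m - mollify n (fm m)) ν :=
      ((hfmL m).1.sub (memLp_mollify n (hfmL m)).1).restrict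
    have s3 : AEStronglyMeasurable (mollify n (fm m - A.indicator f)) ν :=
      (memLp_mollify n ((hfmL m).sub hI)).1.restrict
    rw [eLpNorm_congr_ae e]
    refine (eLpNorm_add_le s1 (s2.add s3) (by norm_num)).trans ?_
    gcongr
    · rw [eLpNorm_sub_comm]
      exact eLpNorm_restrict_le _ _ _ _
    refine (eLpNorm_add_le s2 s3 (by norm_num)).trans ?_
    gcongr
    · have h1 := lintegral_sub_mollify_sq_le (n := n)
        ((contDiff_smoothApprox hf m).of_le (by simp)) (measurableSet_closedAnnulus a b)
        (measurableSet_closedAnnulus (a - ε) (b + ε))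
        (fun x hx y hy => mem_closedAnnulus_of_dist hx (by simpa only [sub_sub_cancel] using hy))
      have h2 : eLpNorm (fm m - mollify n (fm m)) 2 ν ≤ ENNReal.ofReal ε *
          eLpNorm (fderiv ℝ (fm m)) 2 (volume.restrict (closedAnnulus (a - ε) (b + ε))) := by
        rw [← ENNReal.pow_le_pow_left_iff two_ne_zero, mul_pow, eLpNorm_two_sq, eLpNorm_two_sq]
        exact h1
      refine h2.trans ?_
      gcongr
      have hcd : Continuous (fderiv ℝ (fm m)) :=
        (contDiff_smoothApprox hf m).continuous_fderiv (by simp)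
      have h3 : fderiv ℝ (fm m) = (fderiv ℝ (fm m) - G) + G := by simp
      conv_lhs => rw [h3]
      refine (eLpNorm_add_le (hcd.aestronglyMeasurable.sub (hG.1.mono_set hKA'))
        (hG.1.mono_set hKA') (by norm_num)).trans ?_
      gcongr
    · exact (eLpNorm_restrict_le _ _ _ _).trans (eLpNorm_mollify_le n ((hfmL m).1.sub hI.1))
  have t1 : Tendsto (fun m => eLpNorm (fm m - A.indicator f) 2 volume) atTop (𝓝 0) :=
    tendsto_mollify_eLpNorm hI
  have t2 := tendsto_eLpNorm_fderiv_smoothApprox hw hf hG ha hb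
  have t3 := t1.add ((ENNReal.Tendsto.const_mul (a := ENNReal.ofReal ε)
    (t2.add_const (eLpNorm G 2 (volume.restrict A))) (Or.inr ENNReal.ofReal_ne_top)).add t1)
  have := ge_of_tendsto' t3 key
  simpa using this

/-- At a fixed scale and a fixed point, mollification is pairing with one `L²` function, so weak
convergence becomes pointwise convergence. -/
theorem tendsto_smoothApprox_of_weak {u : ℕ → ℂ → ℂ} {h : ℂ → ℂ}
    (hw : ∀ g : ℂ → ℂ, MemLp g 2 (volume.restrict (annulus r R)) →
      Tendsto (fun n => ∫ x in annulus r R, g x * u n x) atTop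
        (𝓝 (∫ x in annulus r R, g x * h x))) (n : ℕ) (x : ℂ) :
    Tendsto (fun k => smoothApprox r R (u k) n x) atTop (𝓝 (smoothApprox r R h n x)) := by
  have hk : Continuous fun y : ℂ => (mollKernel n (x - y) : ℂ) :=
    Complex.continuous_ofReal.comp
      ((contDiff_mollKernel n).continuous.comp (continuous_const.sub continuous_id))
  obtain ⟨C, hC⟩ : ∃ C, ∀ y, ‖mollKernel n y‖ ≤ C :=
    (hasCompactSupport_mollKernel n).exists_bound_of_continuous (contDiff_mollKernel n).continuous
  have hL : MemLp (fun y : ℂ => (mollKernel n (x - y) : ℂ)) 2 (volume.restrict (annulus r R)) :=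
    MemLp.of_bound hk.aestronglyMeasurable C
      (Eventually.of_forall fun y => by simpa using hC (x - y))
  have e : ∀ f : ℂ → ℂ, smoothApprox r R f n x =
      ∫ y in annulus r R, (mollKernel n (x - y) : ℂ) * f y := fun f => by
    rw [smoothApprox, mollify_apply, ← integral_sub_left_eq_self _ _ x,
      ← integral_indicator (measurableSet_annulus r R)]
    congr 1; ext y
    by_cases hy : y ∈ annulus r R <;> simp [hy]
  simp_rw [e]
  exact hw _ hL

/-- Rellich's theorem for bounded sequences: weak convergence in `W^{1,2}` implies strong
convergence in `L²`. -/
theorem WeaklyTendstoW12.tendsto_eLpNorm (hrR : r < R) {u : ℕ → ℂ → ℂ} {h : ℂ → ℂ} {M : ℝ}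
    (hM0 : 0 ≤ M) (hM : ∀ k, ∀ x ∈ annulus r R, ‖u k x‖ ≤ M) (hu : WeaklyTendstoW12 (annulus r R) u h) :
    Tendsto (fun k => eLpNorm (u k - h) 2 (volume.restrict (annulus r R))) atTop (𝓝 0) := by
  obtain ⟨hum, hhm, hconv⟩ := hu
  set A := annulus r R with hA
  have hΩ : IsOpen A := isOpen_annulus r R
  have hGk := fun k => (hum k).memLp_weakDeriv hΩ
  have hbd : ∀ v : ℂ, ∃ C : ℝ≥0∞, C ≠ ⊤ ∧
      ∀ k, eLpNorm (fun x => weakDeriv A (u k) x v) 2 (volume.restrict A) ≤ C := fun v =>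
    exists_eLpNorm_le_of_weak (V₀ := fun x => weakDeriv A h x v)
      (fun k => (hGk k).continuousLinearMap_comp (ContinuousLinearMap.apply ℝ ℂ v))
      (fun g hg => (hconv g hg).2 v)
  obtain ⟨C1, hC1, hb1⟩ := hbd 1
  obtain ⟨C2, hC2, hb2⟩ := hbd Complex.I
  have hGb : ∀ k, eLpNorm (weakDeriv A (u k)) 2 (volume.restrict A) ≤ C1 + C2 := fun k => by
    have m1 := (hGk k).continuousLinearMap_comp (ContinuousLinearMap.apply ℝ ℂ (1 : ℂ))
    have m2 := (hGk k).continuousLinearMap_comp (ContinuousLinearMap.apply ℝ ℂ Complex.I)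
    calc eLpNorm (weakDeriv A (u k)) 2 (volume.restrict A)
        ≤ eLpNorm ((fun x => ‖weakDeriv A (u k) x 1‖) + fun x => ‖weakDeriv A (u k) x Complex.I‖) 2
          (volume.restrict A) := by
          apply eLpNorm_mono_real
          intro x
          apply ContinuousLinearMap.opNorm_le_bound _ (by simp only [Pi.add_apply]; positivity)
          intro z
          have hz : z = z.re • (1 : ℂ) + z.im • Complex.I := by simp [Complex.re_add_im]
          conv_lhs => rw [hz]
          rw [map_add, map_smul, map_smul]
          refine (norm_add_le _ _).trans ?_
          rw [norm_smul, norm_smul, Pi.add_apply, add_mul, mul_comm, mul_comm ‖z.im‖]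
          gcongr
          · exact Complex.abs_re_le_norm z
          · exact Complex.abs_im_le_norm z
      _ ≤ _ := eLpNorm_add_le m1.1.norm m2.1.norm (by norm_num)
      _ ≤ C1 + C2 := by
          rw [eLpNorm_norm, eLpNorm_norm]
          exact add_le_add (hb1 k) (hb2 k)
  have hMk : ∀ k, ∀ᵐ x ∂volume.restrict A, ‖u k x‖ ≤ M := fun k => by
    filter_upwards [ae_restrict_mem hΩ.measurableSet] with x hx using hM k x hx
  set T := eLpNorm (weakDeriv A h) 2 (volume.restrict A) with hT
  have hTt : T ≠ ⊤ := (hhm.memLp_weakDeriv hΩ).eLpNorm_ne_top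
  -- On a compact sub-annulus the scale `n` is fixed first, so that the mollification errors of all
  -- `u k` and of `h` are small at once; the mollifications themselves converge by dominated
  -- convergence.
  have hK : ∀ j, Tendsto (fun k => eLpNorm (u k - h) 2 (volume.restrict (exhaustion r R j)))
      atTop (𝓝 0) := fun j => by
    have hKA := exhaustion_subset hrR j
    rw [ENNReal.tendsto_nhds_zero]
    intro δ hδ
    have ev1 : ∀ᶠ n : ℕ in atTop, ENNReal.ofReal (1 / (n + 1)) * (C1 + C2 + T) ≤ δ / 2 := by
      have t1 : Tendsto (fun n : ℕ => ENNReal.ofReal (1 / ((n : ℝ) + 1))) atTop (𝓝 0) := by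
        simpa using ENNReal.tendsto_ofReal (tendsto_one_div_add_atTop_nhds_zero_nat (𝕜 := ℝ))
      have t2 := ENNReal.Tendsto.mul_const (b := C1 + C2 + T) t1
        (Or.inr (ENNReal.add_ne_top.mpr ⟨ENNReal.add_ne_top.mpr ⟨hC1, hC2⟩, hTt⟩))
      rw [zero_mul] at t2
      exact (ENNReal.tendsto_nhds_zero.mp t2) _ (ENNReal.half_pos hδ.ne')
    have ev2 : ∀ᶠ n : ℕ in atTop, 1 / ((n : ℝ) + 1) <
        min (innerRadius r R j - r) (R - outerRadius r R j) :=
      (tendsto_order.mp tendsto_one_div_add_atTop_nhds_zero_nat).2 _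
        (lt_min (by linarith [lt_innerRadius hrR j]) (by linarith [outerRadius_lt hrR j]))
    obtain ⟨n, hn1, hn2⟩ := (ev1.and ev2).exists
    have ha : r < innerRadius r R j - 1 / (n + 1) := by
      linarith [hn2.trans_le (min_le_left _ _)]
    have hb : outerRadius r R j + 1 / (n + 1) < R := by
      linarith [hn2.trans_le (min_le_right _ _)]
    have hmid : Tendsto (fun k => eLpNorm (fun x => smoothApprox r R (u k) n x -
        smoothApprox r R h n x) 2 (volume.restrict (exhaustion r R j))) atTop (𝓝 0) := by
      rw [eLpNorm_two_tendsto_zero_iff]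
      have hp := tendsto_smoothApprox_of_weak (fun g hg => (hconv g hg).1) n
      have hb : ∀ x, ‖smoothApprox r R h n x‖ ≤ M := fun x =>
        le_of_tendsto (hp x).norm
          (Eventually.of_forall fun k => norm_smoothApprox_le hM0 (hMk k) n x)
      have := tendsto_lintegral_of_dominated_convergence'
        (μ := volume.restrict (exhaustion r R j))
        (F := fun k x => ‖smoothApprox r R (u k) n x - smoothApprox r R h n x‖ₑ ^ 2)
        (f := fun _ => 0) (fun _ => ENNReal.ofReal (M + M) ^ 2) (fun k => ?_)
        (fun k => Eventually.of_forall fun x => ?_) ?_ (Eventually.of_forall fun x => ?_)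
      · simpa using this
      · have c3 : Continuous fun x => smoothApprox r R (u k) n x - smoothApprox r R h n x :=
          (contDiff_smoothApprox (hum k).1 n).continuous.sub
            (contDiff_smoothApprox hhm.1 n).continuous
        exact (c3.enorm.measurable.pow_const 2).aemeasurable
      · dsimp only
        gcongr
        rw [← ofReal_norm]
        apply ENNReal.ofReal_le_ofReal
        exact (norm_sub_le _ _).trans (add_le_add (norm_smoothApprox_le hM0 (hMk k) n x) (hb x))
      · rw [lintegral_const]
        apply ENNReal.mul_ne_top (ENNReal.pow_ne_top ENNReal.ofReal_ne_top)
        rw [Measure.restrict_apply_univ]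
        exact (isCompact_closedAnnulus _ _).measure_lt_top.ne
      · have : Tendsto (fun k => smoothApprox r R (u k) n x - smoothApprox r R h n x)
            atTop (𝓝 0) := by
          simpa using (hp x).sub_const (smoothApprox r R h n x)
        simpa using ENNReal.Tendsto.pow (n := 2) this.enorm
    filter_upwards [(ENNReal.tendsto_nhds_zero.mp hmid) _ (ENNReal.half_pos hδ.ne')] with k hk
    have e : u k - h = (u k - smoothApprox r R (u k) n) + ((fun x => smoothApprox r R (u k) n x -
        smoothApprox r R h n x) - (h - smoothApprox r R h n)) := by
      ext x; simp only [Pi.sub_apply, Pi.add_apply]; ring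
    have q1 := eLpNorm_sub_smoothApprox_le (hum k).hasWeakDeriv (hum k).1 (hGk k) ha hb
    have q2 := eLpNorm_sub_smoothApprox_le hhm.hasWeakDeriv hhm.1 (hhm.memLp_weakDeriv hΩ) ha hb
    have c1 := (contDiff_smoothApprox (hum k).1 n).continuous
    have c2 := (contDiff_smoothApprox hhm.1 n).continuous
    have s1 : AEStronglyMeasurable (u k - smoothApprox r R (u k) n)
        (volume.restrict (exhaustion r R j)) :=
      ((hum k).1.1.mono_set hKA).sub c1.aestronglyMeasurable
    have s3 : AEStronglyMeasurable (h - smoothApprox r R h n)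
        (volume.restrict (exhaustion r R j)) :=
      (hhm.1.1.mono_set hKA).sub c2.aestronglyMeasurable
    have s2 : AEStronglyMeasurable (fun x => smoothApprox r R (u k) n x - smoothApprox r R h n x)
        (volume.restrict (exhaustion r R j)) := (c1.sub c2).aestronglyMeasurable
    rw [e]
    calc _ ≤ ENNReal.ofReal (1 / (n + 1)) * (C1 + C2) +
          (δ / 2 + ENNReal.ofReal (1 / (n + 1)) * T) := by
          refine (eLpNorm_add_le s1 (s2.sub s3) (by norm_num)).trans ?_
          refine add_le_add (q1.trans (by gcongr; exact hGb k)) ?_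
          exact (eLpNorm_sub_le s2 s3 (by norm_num)).trans (add_le_add hk q2)
      _ = ENNReal.ofReal (1 / (n + 1)) * (C1 + C2 + T) + δ / 2 := by ring
      _ ≤ δ / 2 + δ / 2 := by gcongr
      _ = δ := ENNReal.add_halves δ
  rw [eLpNorm_two_tendsto_zero_iff]
  -- In the remaining boundary layer the uniform bound `|u k| ≤ M` supplies an integrable majorant,
  -- so no regularity of the boundary is needed.
  let F : ℂ → ℝ≥0∞ := fun x => 2 * ENNReal.ofReal M ^ 2 + 2 * ‖h x‖ₑ ^ 2
  have hFm : AEMeasurable F (volume.restrict A) :=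
    ((hhm.1.1.enorm.pow_const 2).const_mul 2).const_add _
  have hFt : ∫⁻ x in A, F x ≠ ⊤ := by
    simp only [F]
    rw [lintegral_add_left' aemeasurable_const, lintegral_const_mul'' _
      (hhm.1.1.enorm.pow_const 2), ← eLpNorm_two_sq, lintegral_const]
    apply ENNReal.add_ne_top.mpr
    constructor
    · exact ENNReal.mul_ne_top (ENNReal.mul_ne_top (by simp)
        (ENNReal.pow_ne_top ENNReal.ofReal_ne_top)) (measure_ne_top _ _)
    · exact ENNReal.mul_ne_top (by simp) (ENNReal.pow_ne_top hhm.1.eLpNorm_ne_top)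
  have hFb : ∀ k, ∀ x ∈ A, ‖(u k - h) x‖ₑ ^ 2 ≤ F x := fun k x hx => by
    have h1 : ‖(u k - h) x‖ ^ 2 ≤ 2 * M ^ 2 + 2 * ‖h x‖ ^ 2 := by
      have := norm_sub_le (u k x) (h x)
      have := hM k x hx
      simp only [Pi.sub_apply]
      nlinarith [norm_nonneg (u k x - h x), sq_nonneg (M - ‖h x‖), norm_nonneg (h x)]
    have h2 := ENNReal.ofReal_le_ofReal h1
    rw [ENNReal.ofReal_add (by positivity) (by positivity), ENNReal.ofReal_mul (by norm_num),
      ENNReal.ofReal_mul (by norm_num), ENNReal.ofReal_pow (norm_nonneg _),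
      ENNReal.ofReal_pow hM0, ENNReal.ofReal_pow (norm_nonneg _)] at h2
    simpa [F] using h2
  rw [ENNReal.tendsto_nhds_zero]
  intro δ hδ
  obtain ⟨j, hj⟩ := ((ENNReal.tendsto_nhds_zero.mp
    (tendsto_setLIntegral_diff_exhaustion hFm hFt)) _ (ENNReal.half_pos hδ.ne')).exists
  filter_upwards [(ENNReal.tendsto_nhds_zero.mp (eLpNorm_two_tendsto_zero_iff.mp (hK j))) _
    (ENNReal.half_pos hδ.ne')] with k hk
  have hmE : MeasurableSet (exhaustion r R j) := measurableSet_closedAnnulus _ _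
  calc ∫⁻ x in A, ‖(u k - h) x‖ₑ ^ 2
      ≤ ∫⁻ x in A, ((exhaustion r R j).indicator (fun x => ‖(u k - h) x‖ₑ ^ 2) x +
          (exhaustion r R j)ᶜ.indicator F x) := by
        apply setLIntegral_mono' hΩ.measurableSet fun x hx => ?_
        by_cases hxj : x ∈ exhaustion r R j
        · simp [hxj]
        · simpa [hxj] using hFb k x hx
    _ = (∫⁻ x in A, (exhaustion r R j).indicator (fun x => ‖(u k - h) x‖ₑ ^ 2) x) +
          ∫⁻ x in A, (exhaustion r R j)ᶜ.indicator F x :=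
        lintegral_add_right' _ (hFm.indicator hmE.compl)
    _ ≤ δ / 2 + δ / 2 := by
        gcongr
        rw [lintegral_indicator hmE, Measure.restrict_restrict hmE,
          inter_eq_self_of_subset_left (exhaustion_subset hrR j)]
        exact hk
    _ = δ := ENNReal.add_halves δ

end Compactness

/-! ### Polar coordinates and the argument principle. -/

section Polar

open scoped ComplexConjugate

theorem norm_mul_exp_mul_I {t : ℝ} (ht : 0 ≤ t) (θ : ℝ) :
    ‖(t : ℂ) * Complex.exp (θ * Complex.I)‖ = t := by
  rw [norm_mul, Complex.norm_exp_ofReal_mul_I, mul_one, Complex.norm_real, Real.norm_of_nonneg ht]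

theorem polar_mem_closedAnnulus {a b t : ℝ} (ha : 0 < a) (ht : t ∈ Icc a b) (θ : ℝ) :
    (t : ℂ) * Complex.exp (θ * Complex.I) ∈ closedAnnulus a b := by
  have h := norm_mul_exp_mul_I (ha.le.trans ht.1) θ
  refine ⟨?_, ?_⟩ <;> rw [h]
  exacts [ht.1, ht.2]

theorem norm_sq_ne_zero_of_mem_closedAnnulus {a b : ℝ} (ha : 0 < a) {x : ℂ}
    (hx : x ∈ closedAnnulus a b) : ‖x‖ ^ 2 ≠ 0 := by
  have : 0 < ‖x‖ := ha.trans_le hx.1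
  positivity

theorem continuousOn_polar {a b : ℝ} (ha : 0 < a) {f : ℂ → ℝ}
    (hf : ContinuousOn f (closedAnnulus a b)) :
    ContinuousOn (fun p : ℝ × ℝ => p.1 * f (p.1 * Complex.exp (p.2 * Complex.I)))
      (Icc a b ×ˢ Icc (-Real.pi) Real.pi) := by
  apply continuousOn_fst.mul
  apply hf.comp (by fun_prop)
  rintro ⟨t, θ⟩ ⟨ht, -⟩
  exact polar_mem_closedAnnulus ha ht θ

theorem setIntegral_closedAnnulus_polar {a b : ℝ} (ha : 0 < a) (f : ℂ → ℝ) :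
    ∫ x in closedAnnulus a b, f x = ∫ p in Icc a b ×ˢ Icc (-Real.pi) Real.pi,
      p.1 * f (p.1 * Complex.exp (p.2 * Complex.I)) := by
  rw [← integral_indicator (measurableSet_closedAnnulus a b),
    ← Complex.integral_comp_polarCoord_symm]
  have hprod : (Icc a b ×ˢ Ioo (-Real.pi) Real.pi : Set (ℝ × ℝ)) =ᵐ[volume]
      (Icc a b ×ˢ Icc (-Real.pi) Real.pi : Set (ℝ × ℝ)) :=
    Measure.set_prod_ae_eq (μ := volume) (ν := volume) (ae_eq_refl _) Ioo_ae_eq_Icc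
  rw [← setIntegral_congr_set hprod, ← integral_indicator (measurableSet_Icc.prod measurableSet_Ioo),
    ← integral_indicator polarCoord.open_target.measurableSet]
  congr 1
  ext ⟨t, θ⟩
  have e : (t : ℂ) * (Real.cos θ + Real.sin θ * Complex.I) = t * Complex.exp (θ * Complex.I) := by
    rw [Complex.exp_mul_I, Complex.ofReal_cos, Complex.ofReal_sin]
  by_cases ht : 0 < t
  · by_cases hθ : θ ∈ Ioo (-Real.pi) Real.pi
    · have h1 : (t, θ) ∈ polarCoord.target := ⟨ht, hθ⟩
      rw [indicator_of_mem h1, Complex.polarCoord_symm_apply, e]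
      have hn := norm_mul_exp_mul_I ht.le θ
      by_cases htab : t ∈ Icc a b
      · have h2 : (t, θ) ∈ Icc a b ×ˢ Ioo (-Real.pi) Real.pi := ⟨htab, hθ⟩
        rw [indicator_of_mem h2, indicator_of_mem (polar_mem_closedAnnulus ha htab θ), smul_eq_mul]
      · have h2 : (t, θ) ∉ Icc a b ×ˢ Ioo (-Real.pi) Real.pi := fun h => htab h.1
        rw [indicator_of_notMem h2, indicator_of_notMem, smul_zero]
        rintro ⟨h3, h4⟩
        rw [hn] at h3 h4
        exact htab ⟨h3, h4⟩
    · rw [indicator_of_notMem (fun h => hθ h.2), indicator_of_notMem (fun h => hθ h.2)]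
  · rw [indicator_of_notMem (fun h => ht h.1), indicator_of_notMem (fun h => ht (ha.trans_le h.1.1))]

theorem setIntegral_closedAnnulus_eq {a b : ℝ} (ha : 0 < a) (hab : a ≤ b) {f : ℂ → ℝ}
    (hf : ContinuousOn f (closedAnnulus a b)) :
    ∫ x in closedAnnulus a b, f x = ∫ t in a..b, ∫ θ in (-Real.pi)..Real.pi,
      t * f (t * Complex.exp (θ * Complex.I)) := by
  have hi := (continuousOn_polar ha hf).integrableOn_compact (μ := volume)
    (isCompact_Icc.prod isCompact_Icc)
  have hp : -Real.pi ≤ Real.pi := by linarith [Real.pi_pos]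
  rw [setIntegral_closedAnnulus_polar ha, Measure.volume_eq_prod, setIntegral_prod _ hi,
    intervalIntegral.integral_of_le hab, integral_Icc_eq_integral_Ioc]
  simp_rw [intervalIntegral.integral_of_le hp, integral_Icc_eq_integral_Ioc]

theorem setIntegral_closedAnnulus_eq' {a b : ℝ} (ha : 0 < a) (hab : a ≤ b) {f : ℂ → ℝ}
    (hf : ContinuousOn f (closedAnnulus a b)) :
    ∫ x in closedAnnulus a b, f x = ∫ θ in (-Real.pi)..Real.pi, ∫ t in a..b,
      t * f (t * Complex.exp (θ * Complex.I)) := by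
  have hi := (continuousOn_polar ha hf).integrableOn_compact (μ := volume)
    (isCompact_Icc.prod isCompact_Icc)
  have hp : -Real.pi ≤ Real.pi := by linarith [Real.pi_pos]
  rw [setIntegral_closedAnnulus_polar ha, Measure.volume_eq_prod,
    ← setIntegral_prod_swap, setIntegral_prod _ (by
      exact hi.swap),
    intervalIntegral.integral_of_le hp, integral_Icc_eq_integral_Ioc]
  simp_rw [intervalIntegral.integral_of_le hab, integral_Icc_eq_integral_Ioc]
  rfl

/-- Divergence theorem on an annulus for radial derivatives. -/
theorem setIntegral_radial_deriv {a b : ℝ} (ha : 0 < a) (hab : a ≤ b) {w g : ℂ → ℝ}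
    (hg : ContinuousOn g (closedAnnulus a b))
    (hw : ∀ x ∈ closedAnnulus a b, HasDerivAt (fun s : ℝ => w (s * x)) (g x) 1) :
    ∫ x in closedAnnulus a b, g x / ‖x‖ ^ 2 = ∫ θ in (-Real.pi)..Real.pi,
      (w (b * Complex.exp (θ * Complex.I)) - w (a * Complex.exp (θ * Complex.I))) := by
  have hne : ∀ x ∈ closedAnnulus a b, ‖x‖ ^ 2 ≠ 0 :=
    fun x hx => norm_sq_ne_zero_of_mem_closedAnnulus ha hx
  rw [setIntegral_closedAnnulus_eq' ha hab (f := fun x => g x / ‖x‖ ^ 2)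
    (hg.div (by fun_prop) hne)]
  congr 1; ext θ
  set e := Complex.exp (θ * Complex.I)
  have hmem : ∀ t ∈ Icc a b, (t : ℂ) * e ∈ closedAnnulus a b := fun t ht =>
    polar_mem_closedAnnulus ha ht θ
  have hd : ∀ t ∈ uIcc a b, HasDerivAt (fun t : ℝ => w (t * e))
      (t * (g (t * e) / ‖(t : ℂ) * e‖ ^ 2)) t := fun t ht => by
    rw [uIcc_of_le hab] at ht
    have htpos : 0 < t := ha.trans_le ht.1
    have h1 := hw _ (hmem t ht)
    have h2 : HasDerivAt (fun s : ℝ => s / t) (1 / t) t := (hasDerivAt_id t).div_const t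
    have h1' : HasDerivAt (fun s : ℝ => w (s * (t * e))) (g (t * e)) (t / t) := by
      rwa [div_self htpos.ne']
    have h3 := HasDerivAt.comp (h := fun s : ℝ => s / t) t h1' h2
    have e1 : ((fun s : ℝ => w (s * (t * e))) ∘ fun s : ℝ => s / t) = fun s : ℝ => w (s * e) := by
      ext s
      simp only [Function.comp]
      congr 1
      push_cast
      have : (t : ℂ) ≠ 0 := by exact_mod_cast htpos.ne'
      field_simp
    rw [e1] at h3
    refine h3.congr_deriv ?_
    rw [norm_mul_exp_mul_I htpos.le]
    field_simp
  apply intervalIntegral.integral_eq_sub_of_hasDerivAt hd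
  apply ContinuousOn.intervalIntegrable
  rw [uIcc_of_le hab]
  apply continuousOn_id.mul
  exact (hg.div (by fun_prop) hne).comp (by fun_prop) hmem

theorem hasDerivAt_angular {w g : ℂ → ℝ} {t θ : ℝ}
    (hw : HasDerivAt (fun s : ℝ => w (Complex.exp (s * Complex.I) * (t * Complex.exp (θ * Complex.I))))
      (g (t * Complex.exp (θ * Complex.I))) 0) :
    HasDerivAt (fun θ : ℝ => w (t * Complex.exp (θ * Complex.I)))
      (g (t * Complex.exp (θ * Complex.I))) θ := by
  have h1 : HasDerivAt (fun s : ℝ => w (Complex.exp (s * Complex.I) *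
      (t * Complex.exp (θ * Complex.I)))) (g (t * Complex.exp (θ * Complex.I))) (θ - θ) := by
    rwa [sub_self]
  have h3 := h1.comp_sub_const θ θ
  have e : (fun s : ℝ => w (t * Complex.exp (s * Complex.I))) = fun s : ℝ =>
      w (Complex.exp ((s - θ : ℝ) * Complex.I) * (t * Complex.exp (θ * Complex.I))) := by
    ext s
    push_cast
    rw [mul_left_comm, ← Complex.exp_add]
    congr 3
    ring
  rw [e]
  exact h3

/-- On every circle the integrand is a constant multiple of the derivative of a `2π`-periodic
function. -/
theorem setIntegral_angular_deriv {a b : ℝ} (ha : 0 < a) (hab : a ≤ b) {w g : ℂ → ℝ}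
    (hg : ContinuousOn g (closedAnnulus a b))
    (hw : ∀ x ∈ closedAnnulus a b,
      HasDerivAt (fun s : ℝ => w (Complex.exp (s * Complex.I) * x)) (g x) 0) :
    ∫ x in closedAnnulus a b, g x / ‖x‖ ^ 2 = 0 := by
  have hne : ∀ x ∈ closedAnnulus a b, ‖x‖ ^ 2 ≠ 0 :=
    fun x hx => norm_sq_ne_zero_of_mem_closedAnnulus ha hx
  rw [setIntegral_closedAnnulus_eq ha hab (f := fun x => g x / ‖x‖ ^ 2)
    (hg.div (by fun_prop) hne)]
  rw [← intervalIntegral.integral_zero (a := a) (b := b) (μ := volume)]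
  apply intervalIntegral.integral_congr
  intro t ht
  rw [uIcc_of_le hab] at ht
  have htpos : 0 < t := ha.trans_le ht.1
  have hmem : ∀ θ : ℝ, (t : ℂ) * Complex.exp (θ * Complex.I) ∈ closedAnnulus a b := fun θ =>
    polar_mem_closedAnnulus ha ht θ
  have e1 : ∀ θ : ℝ, t * (g (t * Complex.exp (θ * Complex.I)) /
      ‖(t : ℂ) * Complex.exp (θ * Complex.I)‖ ^ 2) =
      t⁻¹ * g (t * Complex.exp (θ * Complex.I)) := fun θ => by
    rw [norm_mul_exp_mul_I htpos.le]; field_simp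
  simp_rw [e1]
  rw [intervalIntegral.integral_const_mul,
    intervalIntegral.integral_eq_sub_of_hasDerivAt (fun θ _ => hasDerivAt_angular (hw _ (hmem θ)))]
  · push_cast
    rw [neg_mul, Complex.exp_neg, Complex.exp_pi_mul_I]
    norm_num
  · apply Continuous.intervalIntegrable
    exact hg.comp_continuous (by fun_prop) hmem

/-- The derivative of a continuous logarithm along a differentiable curve. -/
theorem hasDerivAt_of_exp_eq {γ L : ℝ → ℂ} {γ' : ℂ} {θ : ℝ} (hL : ContinuousAt L θ)
    (he : ∀ s, Complex.exp (L s) = γ s) (hγ : HasDerivAt γ γ' θ) :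
    HasDerivAt L (γ' / γ θ) θ := by
  have hne : γ θ ≠ 0 := by rw [← he]; exact Complex.exp_ne_zero _
  have h1 : HasDerivAt (fun s => γ s / γ θ) (γ' / γ θ) θ := hγ.div_const _
  -- Near `θ` the values of `L` stay within distance `1 < π` of `L θ`, so `L` is the principal
  -- logarithm of `γ s / γ θ` shifted by `L θ`.
  have h2 : HasDerivAt (fun s => Complex.log (γ s / γ θ) + L θ) (γ' / γ θ) θ := by
    have := (h1.clog_real (by rw [div_self hne]; exact Complex.one_mem_slitPlane)).add_const (L θ)
    simpa [div_self hne] using this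
  apply h2.congr_of_eventuallyEq
  have h3 : Tendsto (fun s => L s - L θ) (𝓝 θ) (𝓝 0) := by
    simpa using hL.tendsto.sub_const (L θ)
  have h4 : ∀ᶠ s in 𝓝 θ, ‖L s - L θ‖ < 1 := by
    have := h3.norm
    rw [norm_zero] at this
    exact (tendsto_order.mp this).2 1 one_pos
  filter_upwards [h4] with s hs
  have him := (Complex.abs_im_le_norm (L s - L θ)).trans_lt hs
  rw [abs_lt] at him
  rw [← he s, ← he θ, ← Complex.exp_sub, Complex.log_exp (by linarith [Real.pi_gt_three])
    (by linarith [Real.pi_gt_three])]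
  ring

theorem hasDerivAt_comp_rotation {f : ℂ → ℂ} {x : ℂ} (hf : DifferentiableAt ℝ f x) :
    HasDerivAt (fun s : ℝ => f (Complex.exp (s * Complex.I) * x)) (fderiv ℝ f x (Complex.I * x)) 0 := by
  have h1 : HasDerivAt (fun s : ℝ => Complex.exp (s * Complex.I) * x) (Complex.I * x) 0 := by
    have h2 : HasDerivAt (fun s : ℝ => (s : ℂ) * Complex.I) Complex.I 0 := by
      simpa using (Complex.ofRealCLM.hasDerivAt (x := (0 : ℝ))).mul_const Complex.I
    simpa using (h2.cexp).mul_const x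
  have h3 : HasFDerivAt f (fderiv ℝ f x) (Complex.exp ((0 : ℝ) * Complex.I) * x) := by
    simpa using hf.hasFDerivAt
  exact h3.comp_hasDerivAt 0 h1

theorem hasDerivAt_comp_dilation {E : Type*} [NormedAddCommGroup E] [NormedSpace ℝ E] {f : ℂ → E}
    {x : ℂ} (hf : DifferentiableAt ℝ f x) :
    HasDerivAt (fun s : ℝ => f (s * x)) (fderiv ℝ f x x) 1 := by
  have h1 : HasDerivAt (fun s : ℝ => (s : ℂ) * x) x 1 := by
    simpa using (Complex.ofRealCLM.hasDerivAt (x := (1 : ℝ))).mul_const x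
  have h3 : HasFDerivAt f (fderiv ℝ f x) (((1 : ℝ) : ℂ) * x) := by
    simpa using hf.hasFDerivAt
  exact h3.comp_hasDerivAt 1 h1

/-- The argument principle for smooth maps: the weighted integral of the angular derivative of the
argument. -/
theorem setIntegral_angular_arg {a b : ℝ} (ha : 0 < a) (hab : a ≤ b) {f : ℂ → ℂ}
    (hf : ContDiff ℝ 1 f) {k : ℤ} {ζ : ℝ → ℝ} (hζ : Continuous ζ)
    (hL : ∀ t ∈ Icc a b, ∃ L : ℝ → ℂ, Continuous L ∧
      (∀ θ : ℝ, Complex.exp (L θ) = f (t * Complex.exp (θ * Complex.I))) ∧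
      L Real.pi - L (-Real.pi) = 2 * Real.pi * Complex.I * k) :
    ∫ x in closedAnnulus a b, ζ ‖x‖ *
      ((conj (f x) * fderiv ℝ f x (Complex.I * x)).im / ‖f x‖ ^ 2) / ‖x‖ ^ 2 =
      2 * Real.pi * k * ∫ t in a..b, ζ t / t := by
  have hfd : Continuous (fderiv ℝ f) := hf.continuous_fderiv (by simp)
  have hfc := hf.continuous
  have hne : ∀ x ∈ closedAnnulus a b, ‖x‖ ^ 2 ≠ 0 :=
    fun x hx => norm_sq_ne_zero_of_mem_closedAnnulus ha hx
  have hfne : ∀ x ∈ closedAnnulus a b, ‖f x‖ ^ 2 ≠ 0 := fun x hx => by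
    obtain ⟨L, -, h2, -⟩ := hL ‖x‖ hx
    have := h2 x.arg
    rw [Complex.norm_mul_exp_arg_mul_I] at this
    rw [← this]
    simp [Complex.exp_ne_zero]
  have hcont : ContinuousOn (fun x => (conj (f x) * fderiv ℝ f x (Complex.I * x)).im / ‖f x‖ ^ 2)
      (closedAnnulus a b) := by
    apply ContinuousOn.div _ _ hfne
    · apply Continuous.continuousOn
      have : Continuous fun x => conj (f x) := Complex.continuous_conj.comp hfc
      fun_prop
    · fun_prop
  have hcont2 : ContinuousOn (fun x => ζ ‖x‖ *
      ((conj (f x) * fderiv ℝ f x (Complex.I * x)).im / ‖f x‖ ^ 2) / ‖x‖ ^ 2)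
      (closedAnnulus a b) :=
    ((by fun_prop : Continuous fun x : ℂ => ζ ‖x‖).continuousOn.mul hcont).div (by fun_prop) hne
  rw [setIntegral_closedAnnulus_eq ha hab hcont2, ← intervalIntegral.integral_const_mul]
  apply intervalIntegral.integral_congr
  intro t ht
  rw [uIcc_of_le hab] at ht
  have htpos : 0 < t := ha.trans_le ht.1
  have hmem : ∀ θ : ℝ, (t : ℂ) * Complex.exp (θ * Complex.I) ∈ closedAnnulus a b := fun θ =>
    polar_mem_closedAnnulus ha ht θ
  obtain ⟨L, h1, h2, h3⟩ := hL t ht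
  -- The imaginary part of the logarithm is a continuous argument of `f` along the circle, and its
  -- total increment is `2πk`.
  have hd : ∀ θ : ℝ, HasDerivAt (fun θ => (L θ).im)
      ((conj (f (t * Complex.exp (θ * Complex.I))) * fderiv ℝ f (t * Complex.exp (θ * Complex.I))
        (Complex.I * (t * Complex.exp (θ * Complex.I)))).im /
        ‖f (t * Complex.exp (θ * Complex.I))‖ ^ 2) θ := fun θ => by
    have hγ : HasDerivAt (fun θ : ℝ => f (t * Complex.exp (θ * Complex.I)))
        (fderiv ℝ f (t * Complex.exp (θ * Complex.I))
          (Complex.I * (t * Complex.exp (θ * Complex.I)))) θ := by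
      have h4 : HasDerivAt (fun θ : ℝ => (t : ℂ) * Complex.exp (θ * Complex.I))
          (Complex.I * (t * Complex.exp (θ * Complex.I))) θ := by
        have h2 : HasDerivAt (fun s : ℝ => (s : ℂ) * Complex.I) Complex.I θ := by
          simpa using (Complex.ofRealCLM.hasDerivAt (x := θ)).mul_const Complex.I
        have h6 := (h2.cexp).const_mul (t : ℂ)
        rwa [show (t : ℂ) * (Complex.exp (θ * Complex.I) * Complex.I) =
          Complex.I * (t * Complex.exp (θ * Complex.I)) by ring] at h6
      exact (hf.differentiable (by simp) _).hasFDerivAt.comp_hasDerivAt θ h4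
    have h5 := Complex.imCLM.hasFDerivAt.comp_hasDerivAt θ
      (hasDerivAt_of_exp_eq h1.continuousAt h2 hγ)
    refine HasDerivAt.congr_deriv h5 ?_
    rw [Complex.imCLM_apply, Complex.div_im, Complex.mul_im, Complex.conj_re, Complex.conj_im, Complex.normSq_eq_norm_sq]
    ring
  have e1 : ∀ θ : ℝ, t * (ζ ‖(t : ℂ) * Complex.exp (θ * Complex.I)‖ *
      ((conj (f (t * Complex.exp (θ * Complex.I))) * fderiv ℝ f (t * Complex.exp (θ * Complex.I))
        (Complex.I * (t * Complex.exp (θ * Complex.I)))).im /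
        ‖f (t * Complex.exp (θ * Complex.I))‖ ^ 2) / ‖(t : ℂ) * Complex.exp (θ * Complex.I)‖ ^ 2) =
      ζ t / t * ((conj (f (t * Complex.exp (θ * Complex.I))) *
        fderiv ℝ f (t * Complex.exp (θ * Complex.I))
        (Complex.I * (t * Complex.exp (θ * Complex.I)))).im /
        ‖f (t * Complex.exp (θ * Complex.I))‖ ^ 2) := fun θ => by
    rw [norm_mul_exp_mul_I htpos.le]; field_simp
  simp_rw [e1]
  rw [intervalIntegral.integral_const_mul,
    intervalIntegral.integral_eq_sub_of_hasDerivAt (fun θ _ => hd θ), ← Complex.sub_im, h3]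
  · simp only [Complex.mul_im, Complex.mul_re, Complex.re_ofNat, Complex.im_ofNat,
      Complex.ofReal_re, Complex.ofReal_im, Complex.I_re, Complex.I_im, Complex.intCast_re,
      Complex.intCast_im]
    ring
  · apply Continuous.intervalIntegrable
    exact hcont.comp_continuous (by fun_prop) hmem

end Polar

/-! ### Integral identities for smooth maps. -/

section SmoothIdentities

open scoped ComplexConjugate

theorem HasDerivAt.conj_mul {F B : ℝ → ℂ} {F' B' : ℂ} {s : ℝ} (hF : HasDerivAt F F' s)
    (hB : HasDerivAt B B' s) :
    HasDerivAt (fun s => conj (F s) * B s) (conj F' * B s + conj (F s) * B') s :=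
  HasDerivAt.mul (Complex.conjCLE.hasFDerivAt.comp_hasDerivAt s hF) hB

theorem HasDerivAt.norm_sq_complex {F : ℝ → ℂ} {F' : ℂ} {s : ℝ} (hF : HasDerivAt F F' s) :
    HasDerivAt (fun s => ‖F s‖ ^ 2) (2 * (conj (F s) * F').re) s := by
  have h := hF.norm_sq
  rwa [Complex.inner, mul_comm F'] at h

theorem HasDerivAt.im_complex {F : ℝ → ℂ} {F' : ℂ} {s : ℝ} (hF : HasDerivAt F F' s) :
    HasDerivAt (fun s => (F s).im) F'.im s :=
  Complex.imCLM.hasFDerivAt.comp_hasDerivAt s hF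

theorem hasDerivAt_comp_norm_dilation {ζ : ℝ → ℝ} (hζ : Differentiable ℝ ζ) (x : ℂ) :
    HasDerivAt (fun s : ℝ => ζ ‖(s : ℂ) * x‖) (‖x‖ * deriv ζ ‖x‖) 1 := by
  have h1 : HasDerivAt (fun s : ℝ => s * ‖x‖) ‖x‖ 1 := by
    simpa using (hasDerivAt_id (1 : ℝ)).mul_const ‖x‖
  have h2 : HasDerivAt ζ (deriv ζ ‖x‖) (1 * ‖x‖) := by
    rw [one_mul]; exact (hζ _).hasDerivAt
  have h3 := HasDerivAt.comp (h := fun s : ℝ => s * ‖x‖) (1 : ℝ) h2 h1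
  have h4 : HasDerivAt (fun s : ℝ => ζ ‖(s : ℂ) * x‖) (deriv ζ ‖x‖ * ‖x‖) 1 := by
    apply h3.congr_of_eventuallyEq
    filter_upwards [lt_mem_nhds one_pos] with s hs
    simp [abs_of_pos hs]
  rwa [mul_comm] at h4

/-- The radial divergence theorem for `ζ(|x|) Φ(|f|²)`; the integrand is its derivative under
dilation, written out by the product rule. -/
theorem setIntegral_normal_smooth {a b : ℝ} (ha : 0 < a) (hab : a ≤ b) {f : ℂ → ℂ}
    (hf : ContDiff ℝ 1 f) {ζ Φ : ℝ → ℝ} (hζ : ContDiff ℝ 1 ζ) (hΦ : ContDiff ℝ 1 Φ) :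
    ∫ x in closedAnnulus a b, (ζ ‖x‖ * deriv Φ (‖f x‖ ^ 2) * (2 * (conj (f x) * fderiv ℝ f x x).re) +
      ‖x‖ * deriv ζ ‖x‖ * Φ (‖f x‖ ^ 2)) / ‖x‖ ^ 2 =
    ∫ θ in (-Real.pi)..Real.pi, (ζ b * Φ (‖f (b * Complex.exp (θ * Complex.I))‖ ^ 2) -
      ζ a * Φ (‖f (a * Complex.exp (θ * Complex.I))‖ ^ 2)) := by
  have hfd : Continuous (fderiv ℝ f) := hf.continuous_fderiv (by simp)
  have hfc := hf.continuous
  have hζd : Continuous (deriv ζ) := hζ.continuous_deriv (by simp)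
  have hΦd : Continuous (deriv Φ) := hΦ.continuous_deriv (by simp)
  have hζc := hζ.continuous
  have hΦc := hΦ.continuous
  rw [setIntegral_radial_deriv ha hab (w := fun x => ζ ‖x‖ * Φ (‖f x‖ ^ 2))]
  · congr 1; ext θ
    rw [norm_mul_exp_mul_I (ha.le.trans hab), norm_mul_exp_mul_I ha.le]
  · apply Continuous.continuousOn
    have : Continuous fun x => conj (f x) := Complex.continuous_conj.comp hfc
    fun_prop
  · intro x hx
    have h1 := hasDerivAt_comp_norm_dilation (hζ.differentiable (by simp)) x
    have h2 := (hasDerivAt_comp_dilation (hf.differentiable (by simp) x)).norm_sq_complex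
    have h3 : HasDerivAt Φ (deriv Φ (‖f x‖ ^ 2)) (‖f (((1 : ℝ) : ℂ) * x)‖ ^ 2) := by
      simpa using (hΦ.differentiable (by simp) (‖f x‖ ^ 2)).hasDerivAt
    have h4 := HasDerivAt.comp (h := fun s : ℝ => ‖f (s * x)‖ ^ 2) (1 : ℝ) h3 h2
    refine (h1.mul h4).congr_deriv ?_
    simp only [Complex.ofReal_one, one_mul, Function.comp]
    ring

/-- Stokes' theorem for the one-form `P(|f|²) Im(f̄ df)`. Subtracting the angular derivative of its
radial component from the radial derivative of its angular component, the second derivatives cancel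
by symmetry. The remaining quadratic terms combine to `2(P + qP')`, `q = |f|²`, times the Jacobian.
The cut-off `η` removes the boundary terms. -/
theorem setIntegral_null_lagrangian_smooth {a b : ℝ} (ha : 0 < a) (hab : a ≤ b) {f : ℂ → ℂ}
    (hf : ContDiff ℝ ∞ f) {η P : ℝ → ℝ} (hη : ContDiff ℝ 1 η) (hP : ContDiff ℝ 1 P)
    (hηa : η a = 0) (hηb : η b = 0) :
    ∫ x in closedAnnulus a b, (η ‖x‖ * (2 * (P (‖f x‖ ^ 2) + ‖f x‖ ^ 2 * deriv P (‖f x‖ ^ 2))) *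
      (conj (fderiv ℝ f x x) * fderiv ℝ f x (Complex.I * x)).im +
      ‖x‖ * deriv η ‖x‖ * (P (‖f x‖ ^ 2) * (conj (f x) * fderiv ℝ f x (Complex.I * x)).im)) /
      ‖x‖ ^ 2 = 0 := by
  have hfd : ContDiff ℝ ∞ (fderiv ℝ f) := hf.fderiv_right (by simp)
  have hfdc := hfd.continuous
  have hfdd : Continuous (fderiv ℝ (fderiv ℝ f)) := hfd.continuous_fderiv (by simp)
  have hfc := hf.continuous
  have hcc : Continuous fun x => conj (f x) := Complex.continuous_conj.comp hfc
  have hcd : ∀ v : ℂ → ℂ, Continuous v → Continuous fun x => conj (fderiv ℝ f x (v x)) :=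
    fun v hv => Complex.continuous_conj.comp (by fun_prop)
  have hηd : Continuous (deriv η) := hη.continuous_deriv (by simp)
  have hPd : Continuous (deriv P) := hP.continuous_deriv (by simp)
  have hηc := hη.continuous
  have hPc := hP.continuous
  have hfD := hf.differentiable (by simp)
  have hfdD := hfd.differentiable (by simp)
  have hPD := hP.differentiable (by simp)
  have hηD := hη.differentiable (by simp)
  -- the radial part
  let D2 : ℂ → ℂ → ℂ → ℂ := fun x u v => fderiv ℝ (fderiv ℝ f) x u v
  let gr : ℂ → ℝ := fun x => ‖x‖ * deriv η ‖x‖ * (P (‖f x‖ ^ 2) *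
      (conj (f x) * fderiv ℝ f x (Complex.I * x)).im) + η ‖x‖ * (deriv P (‖f x‖ ^ 2) *
      (2 * (conj (f x) * fderiv ℝ f x x).re) * (conj (f x) * fderiv ℝ f x (Complex.I * x)).im +
      P (‖f x‖ ^ 2) * (conj (fderiv ℝ f x x) * fderiv ℝ f x (Complex.I * x) +
        conj (f x) * (D2 x x (Complex.I * x) + fderiv ℝ f x (Complex.I * x))).im)
  let ga : ℂ → ℝ := fun x => η ‖x‖ * (deriv P (‖f x‖ ^ 2) *
      (2 * (conj (f x) * fderiv ℝ f x (Complex.I * x)).re) * (conj (f x) * fderiv ℝ f x x).im +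
      P (‖f x‖ ^ 2) * (conj (fderiv ℝ f x (Complex.I * x)) * fderiv ℝ f x x +
        conj (f x) * (D2 x (Complex.I * x) x + fderiv ℝ f x (Complex.I * x))).im)
  have c1 := hcd (fun x => x) continuous_id
  have c2 := hcd (fun x => Complex.I * x) (by fun_prop)
  have hgr : Continuous gr := by simp only [gr, D2]; fun_prop
  have hga : Continuous ga := by simp only [ga, D2]; fun_prop
  have hP1 : ∀ x, HasDerivAt (fun s : ℝ => P (‖f (s * x)‖ ^ 2))
      (deriv P (‖f x‖ ^ 2) * (2 * (conj (f x) * fderiv ℝ f x x).re)) 1 := fun x => by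
    have h2 := (hasDerivAt_comp_dilation (hfD x)).norm_sq_complex
    have h3 : HasDerivAt P (deriv P (‖f x‖ ^ 2)) (‖f (((1 : ℝ) : ℂ) * x)‖ ^ 2) := by
      simpa using (hPD (‖f x‖ ^ 2)).hasDerivAt
    have h4 := HasDerivAt.comp (h := fun s : ℝ => ‖f (s * x)‖ ^ 2) (1 : ℝ) h3 h2
    simp only [Complex.ofReal_one, one_mul] at h4
    exact h4
  have hP2 : ∀ x, HasDerivAt (fun s : ℝ => P (‖f (Complex.exp (s * Complex.I) * x)‖ ^ 2))
      (deriv P (‖f x‖ ^ 2) * (2 * (conj (f x) * fderiv ℝ f x (Complex.I * x)).re)) 0 := fun x => by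
    have h2 := (hasDerivAt_comp_rotation (hfD x)).norm_sq_complex
    have h3 : HasDerivAt P (deriv P (‖f x‖ ^ 2))
        (‖f (Complex.exp ((0 : ℝ) * Complex.I) * x)‖ ^ 2) := by
      simpa using (hPD (‖f x‖ ^ 2)).hasDerivAt
    have h4 := HasDerivAt.comp (h := fun s : ℝ => ‖f (Complex.exp (s * Complex.I) * x)‖ ^ 2)
      (0 : ℝ) h3 h2
    simp only [Complex.ofReal_zero, zero_mul, Complex.exp_zero, one_mul] at h4
    exact h4
  have hB1 : ∀ x, HasDerivAt (fun s : ℝ => fderiv ℝ f (s * x) (Complex.I * (s * x)))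
      (D2 x x (Complex.I * x) + fderiv ℝ f x (Complex.I * x)) 1 := fun x => by
    have h1 := hasDerivAt_comp_dilation (hfdD x)
    have h2 : HasDerivAt (fun s : ℝ => Complex.I * (s * x)) (Complex.I * x) 1 := by
      have := ((Complex.ofRealCLM.hasDerivAt (x := (1 : ℝ))).mul_const x).const_mul Complex.I
      simpa using this
    have h3 := h1.clm_apply h2
    simp only [Complex.ofReal_one, one_mul] at h3
    exact h3
  have hB2 : ∀ x, HasDerivAt (fun s : ℝ => fderiv ℝ f (Complex.exp (s * Complex.I) * x)
      (Complex.exp (s * Complex.I) * x))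
      (D2 x (Complex.I * x) x + fderiv ℝ f x (Complex.I * x)) 0 := fun x => by
    have h0 : HasDerivAt (fun s : ℝ => Complex.exp (s * Complex.I) * x) (Complex.I * x) 0 := by
      have := hasDerivAt_comp_rotation (f := id) (x := x) differentiableAt_id
      simpa using this
    have h1 : HasDerivAt (fun s : ℝ => fderiv ℝ f (Complex.exp (s * Complex.I) * x))
        (fderiv ℝ (fderiv ℝ f) x (Complex.I * x)) 0 := by
      have h3 : HasFDerivAt (fderiv ℝ f) (fderiv ℝ (fderiv ℝ f) x)
          (Complex.exp ((0 : ℝ) * Complex.I) * x) := by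
        simpa using (hfdD x).hasFDerivAt
      exact h3.comp_hasDerivAt 0 h0
    have h3 := h1.clm_apply h0
    simp only [Complex.ofReal_zero, zero_mul, Complex.exp_zero, one_mul] at h3
    exact h3
  have hr := setIntegral_radial_deriv ha hab (w := fun x => η ‖x‖ * (P (‖f x‖ ^ 2) *
    (conj (f x) * fderiv ℝ f x (Complex.I * x)).im)) (g := gr) hgr.continuousOn (fun x hx => by
      have h1 := hasDerivAt_comp_norm_dilation hηD x
      have h2 := ((hasDerivAt_comp_dilation (hfD x)).conj_mul (hB1 x)).im_complex
      refine (h1.mul ((hP1 x).mul h2)).congr_deriv ?_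
      simp only [Complex.ofReal_one, one_mul, gr, Pi.mul_apply])
  have hang := setIntegral_angular_deriv ha hab (w := fun x => η ‖x‖ * (P (‖f x‖ ^ 2) *
    (conj (f x) * fderiv ℝ f x x).im)) (g := ga) hga.continuousOn (fun x hx => by
      have h2 := ((hasDerivAt_comp_rotation (hfD x)).conj_mul (hB2 x)).im_complex
      have h3 := ((hP2 x).mul h2).const_mul (η ‖x‖)
      have e : (fun s : ℝ => η ‖Complex.exp (s * Complex.I) * x‖ *
        (P (‖f (Complex.exp (s * Complex.I) * x)‖ ^ 2) * (conj (f (Complex.exp (s * Complex.I) * x)) *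
        fderiv ℝ f (Complex.exp (s * Complex.I) * x) (Complex.exp (s * Complex.I) * x)).im)) =
        fun s : ℝ => η ‖x‖ * (P (‖f (Complex.exp (s * Complex.I) * x)‖ ^ 2) *
        (conj (f (Complex.exp (s * Complex.I) * x)) *
        fderiv ℝ f (Complex.exp (s * Complex.I) * x) (Complex.exp (s * Complex.I) * x)).im) := by
        ext s
        rw [norm_mul, Complex.norm_exp_ofReal_mul_I, one_mul]
      rw [e]
      refine h3.congr_deriv ?_
      simp only [Complex.ofReal_zero, zero_mul, Complex.exp_zero, one_mul, ga])
  have hne : ∀ x ∈ closedAnnulus a b, ‖x‖ ^ 2 ≠ 0 :=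
    fun x hx => norm_sq_ne_zero_of_mem_closedAnnulus ha hx
  have i1 : IntegrableOn (fun x => gr x / ‖x‖ ^ 2) (closedAnnulus a b) :=
    (hgr.continuousOn.div (by fun_prop) hne).integrableOn_compact (isCompact_closedAnnulus a b)
  have i2 : IntegrableOn (fun x => ga x / ‖x‖ ^ 2) (closedAnnulus a b) :=
    (hga.continuousOn.div (by fun_prop) hne).integrableOn_compact (isCompact_closedAnnulus a b)
  have hsub := integral_sub i1 i2
  rw [hr, hang] at hsub
  simp only [norm_mul_exp_mul_I (ha.le.trans hab), norm_mul_exp_mul_I ha.le, hηa, hηb, zero_mul,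
    sub_zero, intervalIntegral.integral_zero] at hsub
  rw [← hsub]
  congr 1; ext x
  have hsymm : D2 x x (Complex.I * x) = D2 x (Complex.I * x) x :=
    (hf.contDiffAt.isSymmSndFDerivAt (by simp; exact WithTop.coe_le_coe.mpr le_top)) x (Complex.I * x)
  simp only [gr, ga, hsymm]
  rw [← sub_div]
  congr 1
  simp only [Complex.add_im, Complex.mul_im, Complex.mul_re, Complex.conj_re, Complex.conj_im,
    Complex.add_re, ← Complex.normSq_eq_norm_sq, Complex.normSq_apply]
  ring

end SmoothIdentities

/-! ### Passage to the limit in integrals with variable coefficients. -/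

section Limits

open scoped ComplexConjugate

variable {μ : Measure ℂ} {S T : Set ℂ} {h : ℕ → ℂ → ℂ} {h₀ : ℂ → ℂ}

/-- Compactness of `S × T` bounds the coefficient, and closedness of `T` keeps the limit map in the
region where the coefficient is continuous. -/
theorem coeff_aux {B : ℂ × ℂ → ℂ} (hBm : Measurable B) (hBc : ContinuousOn B (S ×ˢ T))
    (hS : IsCompact S) (hT : IsCompact T) (hμS : ∀ᵐ x ∂μ, x ∈ S)
    (hm : ∀ n, AEStronglyMeasurable (h n) μ) (hhT : ∀ n, ∀ᵐ x ∂μ, h n x ∈ T)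
    (hae : ∀ᵐ x ∂μ, Tendsto (fun n => h n x) atTop (𝓝 (h₀ x))) :
    ∃ C : ℝ, (∀ n, AEStronglyMeasurable (fun x => B (x, h n x)) μ) ∧
      (∀ n, ∀ᵐ x ∂μ, ‖B (x, h n x)‖ ≤ C) ∧
      ∀ᵐ x ∂μ, Tendsto (fun n => B (x, h n x)) atTop (𝓝 (B (x, h₀ x))) := by
  obtain ⟨C, hC⟩ := (hS.prod hT).exists_bound_of_continuousOn hBc
  refine ⟨C, fun n => ?_, fun n => ?_, ?_⟩
  · exact (hBm.comp_aemeasurable (aemeasurable_id.prodMk (hm n).aemeasurable)).aestronglyMeasurable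
  · filter_upwards [hμS, hhT n] with x hx hx2 using hC (x, h n x) ⟨hx, hx2⟩
  · filter_upwards [hμS, ae_all_iff.mpr hhT, hae] with x hx hx2 hx3
    have hx0 : h₀ x ∈ T := hT.isClosed.mem_of_tendsto hx3 (Eventually.of_forall hx2)
    have h1 := hBc (x, h₀ x) ⟨hx, hx0⟩
    apply h1.tendsto.comp
    apply tendsto_nhdsWithin_of_tendsto_nhds_of_eventually_within
    · exact tendsto_const_nhds.prodMk_nhds hx3
    · exact Eventually.of_forall fun n => ⟨hx, hx2 n⟩

theorem clm_apply_eq (L : ℂ →L[ℝ] ℂ) (z : ℂ) : L z = z.re * L 1 + z.im * L Complex.I := by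
  conv_lhs => rw [show z = z.re • (1 : ℂ) + z.im • Complex.I by simp [Complex.re_add_im]]
  rw [map_add, map_smul, map_smul, Complex.real_smul, Complex.real_smul]

theorem MemLp.clm_apply_const {G : ℂ → ℂ →L[ℝ] ℂ} (hG : MemLp G 2 μ) (v : ℂ) :
    MemLp (fun x => G x v) 2 μ :=
  hG.continuousLinearMap_comp (ContinuousLinearMap.apply ℝ ℂ v)

theorem MemLp.clm_apply_bounded {G : ℂ → ℂ →L[ℝ] ℂ} (hG : MemLp G 2 μ) {d : ℂ → ℂ}
    (hd : Continuous d) (hS : IsCompact S) (hμS : ∀ᵐ x ∂μ, x ∈ S) :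
    MemLp (fun x => G x (d x)) 2 μ := by
  obtain ⟨C, hC⟩ := hS.exists_bound_of_continuousOn hd.continuousOn
  have e : ∀ x, G x (d x) = (d x).re * G x 1 + (d x).im * G x Complex.I := fun x => clm_apply_eq _ _
  simp_rw [e]
  have h1 := MemLp.clm_apply_const hG 1
  have h2 := MemLp.clm_apply_const hG Complex.I
  have c1 : Continuous fun x => ((d x).re : ℂ) := by fun_prop
  have c2 : Continuous fun x => ((d x).im : ℂ) := by fun_prop
  apply MemLp.add
  · refine h1.of_le_mul (c := C) (c1.aestronglyMeasurable.mul h1.1) ?_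
    filter_upwards [hμS] with x hx
    rw [norm_mul]
    gcongr
    simpa using (Complex.abs_re_le_norm (d x)).trans (hC x hx)
  · refine h2.of_le_mul (c := C) (c2.aestronglyMeasurable.mul h2.1) ?_
    filter_upwards [hμS] with x hx
    rw [norm_mul]
    gcongr
    simpa using (Complex.abs_im_le_norm (d x)).trans (hC x hx)

theorem memLp_coeff [IsFiniteMeasure μ] {a : ℂ → ℂ} {C : ℝ} (ha : AEStronglyMeasurable a μ)
    (hC : ∀ᵐ x ∂μ, ‖a x‖ ≤ C) : MemLp a 2 μ := MemLp.of_bound ha C hC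

variable {G : ℕ → ℂ → ℂ →L[ℝ] ℂ} {G₀ : ℂ → ℂ →L[ℝ] ℂ}

/-- The integrand is linear in `G`, so weak convergence suffices: the coefficients converge strongly
in `L²`. Since weak convergence is given for constant directions only, the variable direction `d x`
is resolved along `1` and `I`. -/
theorem tendsto_integral_coeff_mul [IsFiniteMeasure μ] {B : ℂ × ℂ → ℂ} (hBm : Measurable B)
    (hBc : ContinuousOn B (S ×ˢ T)) (hS : IsCompact S) (hT : IsCompact T) (hμS : ∀ᵐ x ∂μ, x ∈ S)
    (hm : ∀ n, AEStronglyMeasurable (h n) μ) (hhT : ∀ n, ∀ᵐ x ∂μ, h n x ∈ T)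
    (hae : ∀ᵐ x ∂μ, Tendsto (fun n => h n x) atTop (𝓝 (h₀ x)))
    (hG : ∀ n, MemLp (G n) 2 μ) (hG₀ : MemLp G₀ 2 μ)
    (hw : ∀ g : ℂ → ℂ, MemLp g 2 μ → ∀ v : ℂ,
      Tendsto (fun n => ∫ x, g x * G n x v ∂μ) atTop (𝓝 (∫ x, g x * G₀ x v ∂μ)))
    {d : ℂ → ℂ} (hd : Continuous d) :
    Tendsto (fun n => ∫ x, (B (x, h n x) * G n x (d x)).re ∂μ) atTop
      (𝓝 (∫ x, (B (x, h₀ x) * G₀ x (d x)).re ∂μ)) := by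
  obtain ⟨C, b1, b2, b3⟩ := coeff_aux hBm hBc hS hT hμS hm hhT hae
  have hB0 : AEStronglyMeasurable (fun x => B (x, h₀ x)) μ :=
    aestronglyMeasurable_of_tendsto_ae atTop b1 b3
  have hB0C : ∀ᵐ x ∂μ, ‖B (x, h₀ x)‖ ≤ C := by
    filter_upwards [b3, ae_all_iff.mpr b2] with x hx hb
    exact le_of_tendsto hx.norm (Eventually.of_forall hb)
  obtain ⟨D, hD⟩ := hS.exists_bound_of_continuousOn hd.continuousOn
  have piece : ∀ (c : ℂ → ℝ), Continuous c → (∀ x ∈ S, |c x| ≤ D) → ∀ v : ℂ,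
      Tendsto (fun n => ∫ x, B (x, h n x) * c x * G n x v ∂μ) atTop
        (𝓝 (∫ x, B (x, h₀ x) * c x * G₀ x v ∂μ)) := fun c hc hcD v => by
    have hcL : MemLp (fun x => (c x : ℂ)) 2 μ :=
      memLp_coeff (by fun_prop) (C := D) (by filter_upwards [hμS] with x hx; simpa using hcD x hx)
    obtain ⟨s1, s2, s3⟩ := tendsto_eLpNorm_mul_sub (p := fun _ x => (c x : ℂ))
      (p₀ := fun x => (c x : ℂ)) b1 b2 b3 (fun _ => hcL) hcL (by simp)
    obtain ⟨C', hC', hb'⟩ := exists_eLpNorm_le_of_weak (V := fun n x => G n x v)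
      (V₀ := fun x => G₀ x v) (fun n => MemLp.clm_apply_const (hG n) v) (fun g hg => hw g hg v)
    exact tendsto_integral_mul_of_strong_weak (V := fun n x => G n x v) (V₀ := fun x => G₀ x v)
      hC' s1 s2 s3 (fun n => MemLp.clm_apply_const (hG n) v) hb' (hw _ s2 v)
  have t1 := piece (fun x => (d x).re) (by fun_prop)
    (fun x hx => (Complex.abs_re_le_norm _).trans (hD x hx)) 1
  have t2 := piece (fun x => (d x).im) (by fun_prop)
    (fun x hx => (Complex.abs_im_le_norm _).trans (hD x hx)) Complex.I
  have key : ∀ (a : ℂ → ℂ) (L : ℂ → ℂ →L[ℝ] ℂ), MemLp a 2 μ → (∀ᵐ x ∂μ, ‖a x‖ ≤ C) →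
      MemLp L 2 μ → ∫ x, (a x * L x (d x)).re ∂μ =
      (∫ x, a x * (d x).re * L x 1 ∂μ + ∫ x, a x * (d x).im * L x Complex.I ∂μ).re := by
    intro a L ha haC hL
    have bdd : ∀ (c : ℂ → ℝ), Continuous c → (∀ x ∈ S, |c x| ≤ D) →
        MemLp (fun x => a x * (c x : ℂ)) 2 μ := fun c hc hcD => by
      have hc' : Continuous fun x => (c x : ℂ) := by fun_prop
      refine ha.of_le_mul (c := D) (ha.1.mul hc'.aestronglyMeasurable) ?_
      filter_upwards [hμS] with x hx
      rw [norm_mul, mul_comm]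
      gcongr
      simpa using hcD x hx
    have i1 := MemLp.integrable_mul_two (bdd (fun x => (d x).re) (by fun_prop)
      (fun x hx => (Complex.abs_re_le_norm _).trans (hD x hx))) (MemLp.clm_apply_const hL 1)
    have i2 := MemLp.integrable_mul_two (bdd (fun x => (d x).im) (by fun_prop)
      (fun x hx => (Complex.abs_im_le_norm _).trans (hD x hx)))
      (MemLp.clm_apply_const hL Complex.I)
    rw [← integral_add i1 i2]
    have := integral_re (𝕜 := ℂ) (i1.add i2)
    simp only [RCLike.re_eq_complex_re] at this
    refine Eq.trans ?_ this
    congr 1; ext x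
    rw [clm_apply_eq]
    simp only [Pi.add_apply]
    congr 1
    ring
  have e1 := fun n => key (fun x => B (x, h n x)) (G n) (memLp_coeff (b1 n) (b2 n)) (b2 n) (hG n)
  have e2 := key (fun x => B (x, h₀ x)) G₀ (memLp_coeff hB0 hB0C) hB0C hG₀
  simp only [e1, e2]
  exact (Complex.continuous_re.tendsto _).comp (t1.add t2)

theorem tendsto_integral_coeff [IsFiniteMeasure μ] {B : ℂ × ℂ → ℝ} (hBm : Measurable B)
    (hBc : ContinuousOn B (S ×ˢ T)) (hS : IsCompact S) (hT : IsCompact T) (hμS : ∀ᵐ x ∂μ, x ∈ S)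
    (hm : ∀ n, AEStronglyMeasurable (h n) μ) (hhT : ∀ n, ∀ᵐ x ∂μ, h n x ∈ T)
    (hae : ∀ᵐ x ∂μ, Tendsto (fun n => h n x) atTop (𝓝 (h₀ x))) :
    Tendsto (fun n => ∫ x, B (x, h n x) ∂μ) atTop (𝓝 (∫ x, B (x, h₀ x) ∂μ)) := by
  obtain ⟨C, b1, b2, b3⟩ := coeff_aux (B := fun p => (B p : ℂ)) (Complex.measurable_ofReal.comp hBm)
    (Complex.continuous_ofReal.comp_continuousOn hBc) hS hT hμS hm hhT hae
  refine tendsto_integral_of_dominated_convergence (fun _ => C) (fun n => ?_)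
    (integrable_const C) (fun n => ?_) ?_
  · have := Complex.continuous_re.comp_aestronglyMeasurable (b1 n)
    simpa using this
  · filter_upwards [b2 n] with x hx
    simpa using hx
  · filter_upwards [b3] with x hx
    have := (Complex.continuous_re.tendsto _).comp hx
    simpa [Function.comp_def] using this

theorem tendsto_eLpNorm_clm_apply
    (hs : Tendsto (fun n => eLpNorm (G n - G₀) 2 μ) atTop (𝓝 0)) {d : ℂ → ℂ}
    (hd : Continuous d) (hS : IsCompact S) (hμS : ∀ᵐ x ∂μ, x ∈ S) :
    Tendsto (fun n => eLpNorm ((fun x => G n x (d x)) - fun x => G₀ x (d x)) 2 μ)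
      atTop (𝓝 0) := by
  obtain ⟨C, hC⟩ := hS.exists_bound_of_continuousOn hd.continuousOn
  have hb := ENNReal.Tendsto.const_mul (a := ENNReal.ofReal C) hs (Or.inr ENNReal.ofReal_ne_top)
  rw [mul_zero] at hb
  refine tendsto_of_tendsto_of_tendsto_of_le_of_le tendsto_const_nhds hb (fun _ => zero_le)
    (fun n => ?_)
  apply eLpNorm_le_mul_eLpNorm_of_ae_le_mul
  filter_upwards [hμS] with x hx
  have := (G n x - G₀ x).le_opNorm (d x)
  simp only [Pi.sub_apply]
  rw [← sub_apply, mul_comm]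
  exact this.trans (by gcongr; exact hC x hx)

theorem weak_of_strong (hG : ∀ n, MemLp (G n) 2 μ) (hG₀ : MemLp G₀ 2 μ)
    (hs : Tendsto (fun n => eLpNorm (G n - G₀) 2 μ) atTop (𝓝 0)) (g : ℂ → ℂ) (hg : MemLp g 2 μ)
    (v : ℂ) :
    Tendsto (fun n => ∫ x, g x * G n x v ∂μ) atTop (𝓝 (∫ x, g x * G₀ x v ∂μ)) := by
  apply tendsto_integral_mul_of_strong hg (fun n => MemLp.clm_apply_const (hG n) v)
    (MemLp.clm_apply_const hG₀ v)
  have hb := ENNReal.Tendsto.const_mul (a := ENNReal.ofReal ‖v‖) hs (Or.inr ENNReal.ofReal_ne_top)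
  rw [mul_zero] at hb
  refine tendsto_of_tendsto_of_tendsto_of_le_of_le tendsto_const_nhds hb (fun _ => zero_le)
    (fun n => ?_)
  apply eLpNorm_le_mul_eLpNorm_of_ae_le_mul
  refine Eventually.of_forall fun x => ?_
  have := (G n x - G₀ x).le_opNorm v
  simp only [Pi.sub_apply]
  rw [← sub_apply, mul_comm]
  exact this

/-- The integrand is quadratic in `G`, and here strong convergence of the derivatives is used. This
is available for mollifications on compact annuli, though not along arbitrary deformations. -/
theorem tendsto_integral_coeff_mul_mul [IsFiniteMeasure μ] {B : ℂ × ℂ → ℂ} (hBm : Measurable B)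
    (hBc : ContinuousOn B (S ×ˢ T)) (hS : IsCompact S) (hT : IsCompact T) (hμS : ∀ᵐ x ∂μ, x ∈ S)
    (hm : ∀ n, AEStronglyMeasurable (h n) μ) (hhT : ∀ n, ∀ᵐ x ∂μ, h n x ∈ T)
    (hae : ∀ᵐ x ∂μ, Tendsto (fun n => h n x) atTop (𝓝 (h₀ x)))
    (hG : ∀ n, MemLp (G n) 2 μ) (hG₀ : MemLp G₀ 2 μ)
    (hs : Tendsto (fun n => eLpNorm (G n - G₀) 2 μ) atTop (𝓝 0))
    {d d' : ℂ → ℂ} (hd : Continuous d) (hd' : Continuous d') :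
    Tendsto (fun n => ∫ x, (B (x, h n x) * conj (G n x (d x)) * G n x (d' x)).re ∂μ) atTop
      (𝓝 (∫ x, (B (x, h₀ x) * conj (G₀ x (d x)) * G₀ x (d' x)).re ∂μ)) := by
  obtain ⟨C, b1, b2, b3⟩ := coeff_aux hBm hBc hS hT hμS hm hhT hae
  have l1 := fun n => MemLp.clm_apply_bounded (hG n) hd hS hμS
  have l1' := fun n => MemLp.clm_apply_bounded (hG n) hd' hS hμS
  have l2 := MemLp.clm_apply_bounded hG₀ hd hS hμS
  have l2' := MemLp.clm_apply_bounded hG₀ hd' hS hμS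
  have t1 := tendsto_eLpNorm_clm_apply hs hd hS hμS
  have t1' := tendsto_eLpNorm_clm_apply hs hd' hS hμS
  have hcj : Tendsto (fun n => eLpNorm ((fun x => conj (G n x (d x))) - fun x => conj (G₀ x (d x)))
      2 μ) atTop (𝓝 0) := by
    refine t1.congr fun n => ?_
    apply eLpNorm_congr_norm_ae
    refine Eventually.of_forall fun x => ?_
    simp only [Pi.sub_apply]
    rw [← map_sub, RCLike.norm_conj]
  obtain ⟨s1, s2, s3⟩ := tendsto_eLpNorm_mul_sub b1 b2 b3 (fun n => (l1 n).star) l2.star hcj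
  have w := tendsto_integral_mul_of_strong s2 l1' l2' t1'
  obtain ⟨C', hC', hb'⟩ := exists_eLpNorm_le_of_weak (V := fun n x => G n x (d' x))
      (V₀ := fun x => G₀ x (d' x)) l1' (fun g hg => tendsto_integral_mul_of_strong hg l1' l2' t1')
  have t := tendsto_integral_mul_of_strong_weak (V := fun n x => G n x (d' x))
    (V₀ := fun x => G₀ x (d' x)) hC' s1 s2 s3 l1' hb' w
  have e1 := fun n => integral_re (𝕜 := ℂ) (MemLp.integrable_mul_two (s1 n) (l1' n))
  have e2 := integral_re (𝕜 := ℂ) (MemLp.integrable_mul_two s2 l2')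
  have t2 := (Complex.continuous_re.tendsto _).comp t
  refine (t2.congr fun n => (e1 n).symm).trans (le_of_eq ?_)
  congr 1
  exact e2.symm

end Limits

/-! ### Annular maps and their stability under weak convergence. -/

section Deformations

open scoped ComplexConjugate

/-- The integral identities satisfied by `W^{1,2}` homeomorphisms of the annulus `r < |x| < R` into
the annulus `m < |y| < M` and by their weak limits: `k` is the degree on circles, and `p`, `P` are
the values of `|h|²` on the circles `|x| = r` and `|x| = R`. -/
structure IsAnnularMap (r R m M p P : ℝ) (k : ℤ) (h : ℂ → ℂ) (G : ℂ → ℂ →L[ℝ] ℂ) : Prop where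
  hasWeakDeriv : HasWeakDeriv (annulus r R) h G
  memLp : MemLp h 2 (volume.restrict (annulus r R))
  memLp_deriv : MemLp G 2 (volume.restrict (annulus r R))
  bound : ∀ᵐ x ∂volume.restrict (annulus r R), m ≤ ‖h x‖ ∧ ‖h x‖ ≤ M
  normal : ∀ ζ Φ : ℝ → ℝ, ContDiff ℝ 1 ζ → ContDiff ℝ 1 Φ →
    (∫ x in annulus r R, (((ζ ‖x‖ * deriv Φ (‖h x‖ ^ 2) * 2 / ‖x‖ ^ 2 : ℝ) : ℂ) * conj (h x) *
      G x x).re) + ∫ x in annulus r R, deriv ζ ‖x‖ * Φ (‖h x‖ ^ 2) / ‖x‖ =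
      2 * Real.pi * (ζ R * Φ P - ζ r * Φ p)
  tangential : ∀ ζ : ℝ → ℝ, Continuous ζ →
    ∫ x in annulus r R, (((ζ ‖x‖ / ‖h x‖ ^ 2 / ‖x‖ ^ 2 : ℝ) : ℂ) * (-Complex.I * conj (h x)) *
      G x (Complex.I * x)).re = 2 * Real.pi * k * ∫ t in r..R, ζ t / t

theorem isCompact_norm_Icc (m M : ℝ) : IsCompact {y : ℂ | m ≤ ‖y‖ ∧ ‖y‖ ≤ M} :=
  isCompact_closedAnnulus m M

theorem annulus_subset_closedAnnulus (r R : ℝ) : annulus r R ⊆ closedAnnulus r R :=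
  fun _ hx => ⟨hx.1.le, hx.2.le⟩

section Coefficients

variable {S T : Set ℂ} {ζ Φ : ℝ → ℝ}

theorem measurable_normalCoeff (hζ : Continuous ζ) (hΦ : Continuous Φ) :
    Measurable fun p : ℂ × ℂ => ((ζ ‖p.1‖ * Φ (‖p.2‖ ^ 2) * 2 / ‖p.1‖ ^ 2 : ℝ) : ℂ) * conj p.2 := by
  have h1 : Measurable fun p : ℂ × ℂ => ζ ‖p.1‖ * Φ (‖p.2‖ ^ 2) * 2 :=
    Continuous.measurable (by fun_prop)
  have h2 : Measurable fun p : ℂ × ℂ => ‖p.1‖ ^ 2 := Continuous.measurable (by fun_prop)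
  have h3 : Measurable fun p : ℂ × ℂ => conj p.2 :=
    (Complex.continuous_conj.comp continuous_snd).measurable
  exact (Complex.measurable_ofReal.comp (h1.div h2)).mul h3

theorem continuousOn_normalCoeff (hζ : Continuous ζ) (hΦ : Continuous Φ)
    (hS : ∀ x ∈ S, x ≠ 0) :
    ContinuousOn (fun p : ℂ × ℂ => ((ζ ‖p.1‖ * Φ (‖p.2‖ ^ 2) * 2 / ‖p.1‖ ^ 2 : ℝ) : ℂ) * conj p.2)
      (S ×ˢ T) := by
  apply ContinuousOn.mul
  · apply Complex.continuous_ofReal.comp_continuousOn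
    apply ContinuousOn.div (by fun_prop) (by fun_prop)
    rintro ⟨x, y⟩ ⟨hx, -⟩
    have := hS x hx
    simpa using this
  · exact (Complex.continuous_conj.comp continuous_snd).continuousOn

theorem measurable_normalCoeff' (hζ : Continuous ζ) (hΦ : Continuous Φ) :
    Measurable fun p : ℂ × ℂ => ζ ‖p.1‖ * Φ (‖p.2‖ ^ 2) / ‖p.1‖ := by
  have h1 : Measurable fun p : ℂ × ℂ => ζ ‖p.1‖ * Φ (‖p.2‖ ^ 2) :=
    Continuous.measurable (by fun_prop)
  have h2 : Measurable fun p : ℂ × ℂ => ‖p.1‖ := Continuous.measurable (by fun_prop)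
  exact h1.div h2

theorem continuousOn_normalCoeff' (hζ : Continuous ζ) (hΦ : Continuous Φ) (hS : ∀ x ∈ S, x ≠ 0) :
    ContinuousOn (fun p : ℂ × ℂ => ζ ‖p.1‖ * Φ (‖p.2‖ ^ 2) / ‖p.1‖) (S ×ˢ T) := by
  apply ContinuousOn.div (by fun_prop) (by fun_prop)
  rintro ⟨x, y⟩ ⟨hx, -⟩
  have := hS x hx
  simpa using this

theorem measurable_tangentialCoeff (hζ : Continuous ζ) :
    Measurable fun p : ℂ × ℂ =>
      ((ζ ‖p.1‖ / ‖p.2‖ ^ 2 / ‖p.1‖ ^ 2 : ℝ) : ℂ) * (-Complex.I * conj p.2) := by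
  have h1 : Measurable fun p : ℂ × ℂ => ζ ‖p.1‖ := Continuous.measurable (by fun_prop)
  have h2 : Measurable fun p : ℂ × ℂ => ‖p.1‖ ^ 2 := Continuous.measurable (by fun_prop)
  have h4 : Measurable fun p : ℂ × ℂ => ‖p.2‖ ^ 2 := Continuous.measurable (by fun_prop)
  have h3 : Measurable fun p : ℂ × ℂ => -Complex.I * conj p.2 :=
    (continuous_const.mul (Complex.continuous_conj.comp continuous_snd)).measurable
  exact (Complex.measurable_ofReal.comp ((h1.div h4).div h2)).mul h3

theorem continuousOn_tangentialCoeff (hζ : Continuous ζ) (hS : ∀ x ∈ S, x ≠ 0)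
    (hT : ∀ y ∈ T, y ≠ 0) :
    ContinuousOn (fun p : ℂ × ℂ =>
      ((ζ ‖p.1‖ / ‖p.2‖ ^ 2 / ‖p.1‖ ^ 2 : ℝ) : ℂ) * (-Complex.I * conj p.2)) (S ×ˢ T) := by
  apply ContinuousOn.mul
  · apply Complex.continuous_ofReal.comp_continuousOn
    refine ContinuousOn.div (ContinuousOn.div (by fun_prop) (by fun_prop) ?_) (by fun_prop) ?_
    · rintro ⟨x, y⟩ ⟨-, hy⟩
      have := hT y hy
      simpa using this
    · rintro ⟨x, y⟩ ⟨hx, -⟩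
      have := hS x hx
      simpa using this
  · exact (continuous_const.mul (Complex.continuous_conj.comp continuous_snd)).continuousOn

end Coefficients

variable {r R m M p P : ℝ} {k : ℤ}

/-- The integral identities are stable under weak convergence in `W^{1,2}`. -/
theorem IsAnnularMap.of_weaklyTendsto (hr : 0 < r) (hrR : r < R) (hm : 0 < m) (hmM : m ≤ M)
    {u : ℕ → ℂ → ℂ} {h : ℂ → ℂ}
    (hu : ∀ n, IsAnnularMap r R m M p P k (u n) (weakDeriv (annulus r R) (u n)))
    (hb : ∀ n, ∀ x ∈ annulus r R, m ≤ ‖u n x‖ ∧ ‖u n x‖ ≤ M)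
    (hw : WeaklyTendstoW12 (annulus r R) u h) :
    IsAnnularMap r R m M p P k h (weakDeriv (annulus r R) h) := by
  have hA := measurableSet_annulus r R
  have hΩ := isOpen_annulus r R
  -- The coefficients of the identities depend nonlinearly on the map. Rellich's theorem gives a
  -- subsequence converging almost everywhere, which is enough because the derivatives enter
  -- linearly.
  have hstrong := hw.tendsto_eLpNorm hrR (hm.le.trans hmM) (fun k x hx => (hb k x hx).2)
  obtain ⟨hum, hhm, hconv⟩ := hw
  have hmeas := tendstoInMeasure_of_tendsto_eLpNorm (two_ne_zero) (fun n => (hum n).1.1) hhm.1.1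
    hstrong
  obtain ⟨φ, hφ, hae⟩ := hmeas.exists_seq_tendsto_ae
  set S := closedAnnulus r R
  set T := {y : ℂ | m ≤ ‖y‖ ∧ ‖y‖ ≤ M}
  have hS : IsCompact S := isCompact_closedAnnulus r R
  have hT : IsCompact T := isCompact_norm_Icc m M
  have hS0 : ∀ x ∈ S, x ≠ 0 := fun x hx h0 => by
    have := hx.1; rw [h0, norm_zero] at this; linarith
  have hT0 : ∀ x ∈ T, x ≠ 0 := fun x hx h0 => by
    have := hx.1; rw [h0, norm_zero] at this; linarith
  have hμS : ∀ᵐ x ∂volume.restrict (annulus r R), x ∈ S := by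
    filter_upwards [ae_restrict_mem hA] with x hx using annulus_subset_closedAnnulus r R hx
  have hhT : ∀ n, ∀ᵐ x ∂volume.restrict (annulus r R), u (φ n) x ∈ T := fun n => by
    filter_upwards [ae_restrict_mem hA] with x hx using hb _ x hx
  have hm' : ∀ n, AEStronglyMeasurable (u (φ n)) (volume.restrict (annulus r R)) :=
    fun n => (hum _).1.1
  have hG := fun n => (hum (φ n)).memLp_weakDeriv hΩ
  have hG0 := hhm.memLp_weakDeriv hΩ
  have hwk : ∀ g : ℂ → ℂ, MemLp g 2 (volume.restrict (annulus r R)) → ∀ v : ℂ,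
      Tendsto (fun n => ∫ x in annulus r R, g x * weakDeriv (annulus r R) (u (φ n)) x v) atTop
        (𝓝 (∫ x in annulus r R, g x * weakDeriv (annulus r R) h x v)) := fun g hg v =>
    ((hconv g hg).2 v).comp hφ.tendsto_atTop
  refine ⟨hhm.hasWeakDeriv, hhm.1, hG0, ?_, fun ζ Φ hζ hΦ => ?_, fun ζ hζ => ?_⟩
  · filter_upwards [hae, ae_all_iff.mpr hhT] with x hx h2
    exact hT.isClosed.mem_of_tendsto hx (Eventually.of_forall h2)
  · have hΦd : Continuous (deriv Φ) := hΦ.continuous_deriv (by simp)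
    have hζd : Continuous (deriv ζ) := hζ.continuous_deriv (by simp)
    have t1 := tendsto_integral_coeff_mul (measurable_normalCoeff hζ.continuous hΦd)
      (continuousOn_normalCoeff hζ.continuous hΦd hS0) hS hT hμS hm' hhT hae hG hG0 hwk
      continuous_id
    have t2 := tendsto_integral_coeff (measurable_normalCoeff' hζd hΦ.continuous)
      (continuousOn_normalCoeff' hζd hΦ.continuous hS0) hS hT hμS hm' hhT hae
    refine tendsto_nhds_unique (t1.add t2) ?_
    apply tendsto_const_nhds.congr fun n => ?_
    exact ((hu (φ n)).normal ζ Φ hζ hΦ).symm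
  · have t1 := tendsto_integral_coeff_mul (measurable_tangentialCoeff hζ)
      (continuousOn_tangentialCoeff hζ hS0 hT0) hS hT hμS hm' hhT hae hG hG0 hwk
      (d := fun x => Complex.I * x) (by fun_prop)
    refine tendsto_nhds_unique t1 ?_
    apply tendsto_const_nhds.congr fun n => ?_
    exact ((hu (φ n)).tangential ζ hζ).symm

end Deformations

/-! ### Logarithmic coordinates and the degree on circles. -/

section LogLift

/-- The vertical strip that the exponential maps onto the annulus `r < |x| < R`. -/
def logStrip (r R : ℝ) : Set ℂ := {z | Real.log r < z.re ∧ z.re < Real.log R}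

variable {r R r' R' : ℝ}

theorem isOpen_logStrip (r R : ℝ) : IsOpen (logStrip r R) :=
  (isOpen_lt continuous_const Complex.continuous_re).inter
    (isOpen_lt Complex.continuous_re continuous_const)

theorem convex_logStrip (r R : ℝ) : Convex ℝ (logStrip r R) :=
  (convex_halfSpace_re_gt _).inter (convex_halfSpace_re_lt _)

theorem exp_mem_annulus_iff (hr : 0 < r) (hR : 0 < R) {z : ℂ} :
    Complex.exp z ∈ annulus r R ↔ z ∈ logStrip r R := by
  simp only [annulus, logStrip, mem_ofPred_eq, Complex.norm_exp, Real.log_lt_iff_lt_exp hr,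
    Real.lt_log_iff_exp_lt hR]

theorem add_I_mul_mem_logStrip {z : ℂ} (hz : z ∈ logStrip r R) (s : ℝ) :
    z + s * Complex.I ∈ logStrip r R := by
  simpa [logStrip] using hz

/-- The annulus is the exponential image of a vertical strip, which is convex. -/
theorem isPreconnected_annulus (hr : 0 < r) (R : ℝ) : IsPreconnected (annulus r R) := by
  rcases le_or_gt R 0 with hR | hR
  · have : annulus r R = ∅ := by
      ext x
      simp only [annulus, mem_ofPred_eq, mem_empty_iff_false, iff_false, not_and, not_lt]
      intro _
      exact hR.trans (norm_nonneg x)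
    rw [this]; exact isPreconnected_empty
  have : annulus r R = Complex.exp '' logStrip r R := by
    ext x
    constructor
    · intro hx
      have hx0 : x ≠ 0 := fun h0 => by
        have := hx.1; rw [h0, norm_zero] at this; linarith
      exact ⟨Complex.log x, (exp_mem_annulus_iff hr hR).mp (by rwa [Complex.exp_log hx0]),
        Complex.exp_log hx0⟩
    · rintro ⟨z, hz, rfl⟩
      exact (exp_mem_annulus_iff hr hR).mpr hz
  rw [this]
  exact (convex_logStrip r R).isPreconnected.image _ Complex.continuous_exp.continuousOn

/-- A continuous logarithm of `1` on a preconnected set is constant. -/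
theorem exists_int_of_exp_eq_one {X : Type*} [TopologicalSpace X] {S : Set X}
    (hS : IsPreconnected S) {f : X → ℂ} (hf : ContinuousOn f S)
    (h1 : ∀ z ∈ S, Complex.exp (f z) = 1) :
    ∃ n : ℤ, ∀ z ∈ S, f z = n * (2 * Real.pi * Complex.I) := by
  rcases S.eq_empty_or_nonempty with rfl | ⟨z₀, hz₀⟩
  · exact ⟨0, by simp⟩
  have hint : ∀ z ∈ S, ∃ n : ℤ, f z = n * (2 * Real.pi * Complex.I) := fun z hz =>
    Complex.exp_eq_one_iff.mp (h1 z hz)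
  have hpi : (0 : ℝ) < 2 * Real.pi := by positivity
  have him : ∀ z (n : ℤ), f z = n * (2 * Real.pi * Complex.I) → (f z).im / (2 * Real.pi) = n := by
    intro z n hn
    rw [hn]
    simp
  have hcont : ContinuousOn (fun z => (f z).im / (2 * Real.pi)) S :=
    (Complex.continuous_im.comp_continuousOn hf).div_const _
  have hconst : ∀ z ∈ S, ∀ w ∈ S, ∀ n m : ℤ, f z = n * (2 * Real.pi * Complex.I) →
      f w = m * (2 * Real.pi * Complex.I) → ¬ n < m := by
    intro z hz w hw n m hn hm hnm
    have h := hS.intermediate_value hz hw hcont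
    -- Two different integer values would force, by the intermediate value theorem, a half-integer
    -- value in between.
    have hmem : (n : ℝ) + 1 / 2 ∈ Icc ((f z).im / (2 * Real.pi)) ((f w).im / (2 * Real.pi)) := by
      rw [him z n hn, him w m hm]
      have : (n : ℝ) + 1 ≤ m := by exact_mod_cast hnm
      constructor <;> linarith
    obtain ⟨y, hy, hyn⟩ := h hmem
    obtain ⟨l, hl⟩ := hint y hy
    have h2 : (l : ℝ) = n + 1 / 2 := by rw [← him y l hl]; exact hyn
    have h3 : ((2 * l : ℤ) : ℝ) = ((2 * n + 1 : ℤ) : ℝ) := by push_cast; linarith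
    have h4 : 2 * l = 2 * n + 1 := by exact_mod_cast h3
    omega
  obtain ⟨n, hn⟩ := hint z₀ hz₀
  refine ⟨n, fun z hz => ?_⟩
  obtain ⟨m, hm⟩ := hint z hz
  have : n = m := by
    rcases lt_trichotomy n m with h | h | h
    · exact absurd h (hconst z₀ hz₀ z hz n m hn hm)
    · exact h
    · exact absurd h (hconst z hz z₀ hz₀ m n hm hn)
  rw [hm, this]

theorem exists_continuousOn_log {X : Type*} [NormedAddCommGroup X] [NormedSpace ℝ X] {S : Set X}
    (hS : Convex ℝ S) (hne : S.Nonempty) (hSo : IsOpen S) {g : X → ℂ} (hg : ContinuousOn g S)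
    (h0 : ∀ z ∈ S, g z ≠ 0) :
    ∃ L : X → ℂ, ContinuousOn L S ∧ ∀ z ∈ S, Complex.exp (L z) = g z := by
  have hsc : IsSimplyConnected S := by
    have := hS.contractibleSpace hne
    exact (inferInstance : SimplyConnectedSpace S)
  obtain ⟨L, hL, hLe⟩ := Complex.exists_continuousOn_eqOn_exp_comp hsc hSo hg
    (by rintro ⟨z, hz, h⟩; exact h0 z hz h)
  exact ⟨L, hL, fun z hz => hLe hz⟩

/-- The logarithm of a nonvanishing map of an annulus in logarithmic coordinates. -/
theorem exists_log_lift (hr : 0 < r) (hrR : r < R) {h : ℂ → ℂ} (hc : ContinuousOn h (annulus r R))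
    (h0 : ∀ x ∈ annulus r R, h x ≠ 0) :
    ∃ (L : ℂ → ℂ) (k : ℤ), ContinuousOn L (logStrip r R) ∧
      (∀ z ∈ logStrip r R, Complex.exp (L z) = h (Complex.exp z)) ∧
      ∀ z ∈ logStrip r R, L (z + (2 * Real.pi : ℝ) * Complex.I) =
        L z + k * (2 * Real.pi * Complex.I) := by
  have hR := hr.trans hrR
  have hne : (logStrip r R).Nonempty := by
    obtain ⟨x, hx⟩ := exists_between (Real.log_lt_log hr hrR)
    exact ⟨(x : ℂ), by simpa [logStrip] using hx⟩
  have hmaps : MapsTo Complex.exp (logStrip r R) (annulus r R) := fun z hz =>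
    (exp_mem_annulus_iff hr hR).mpr hz
  obtain ⟨L, hL, hLe⟩ := exists_continuousOn_log (convex_logStrip r R) hne (isOpen_logStrip r R)
    (hc.comp Complex.continuous_exp.continuousOn hmaps) (fun z hz => h0 _ (hmaps hz))
  have hsh : MapsTo (fun z : ℂ => z + (2 * Real.pi : ℝ) * Complex.I) (logStrip r R)
      (logStrip r R) := fun z hz => add_I_mul_mem_logStrip hz _
  have hper : ∀ z : ℂ, Complex.exp (z + (2 * Real.pi : ℝ) * Complex.I) = Complex.exp z := by
    intro z
    push_cast
    exact Complex.exp_periodic z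
  -- The increment of `L` over one period is a continuous logarithm of `1` on a connected strip,
  -- hence one fixed multiple of `2πi`.
  obtain ⟨k, hk⟩ := exists_int_of_exp_eq_one (convex_logStrip r R).isPreconnected
    (f := fun z => L (z + (2 * Real.pi : ℝ) * Complex.I) - L z)
    ((hL.comp (by fun_prop) hsh).sub hL) (fun z hz => by
      rw [Complex.exp_sub, hLe _ (hsh hz), hLe z hz]
      simp only [Function.comp_apply, hper]
      exact div_self (h0 _ (hmaps hz)))
  exact ⟨L, k, hL, hLe, fun z hz => by rw [← hk z hz]; ring⟩

theorem lift_add_int {L : ℂ → ℂ} {k : ℤ} (hL : ∀ z ∈ logStrip r R,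
    L (z + (2 * Real.pi : ℝ) * Complex.I) = L z + k * (2 * Real.pi * Complex.I)) {z : ℂ}
    (hz : z ∈ logStrip r R) (n : ℤ) :
    L (z + n * (2 * Real.pi * Complex.I)) = L z + n * k * (2 * Real.pi * Complex.I) := by
  have hmem : ∀ m : ℤ, z + m * (2 * Real.pi * Complex.I) ∈ logStrip r R := fun m => by
    have := add_I_mul_mem_logStrip hz (m * (2 * Real.pi))
    push_cast at this
    convert this using 2; ring
  induction n using Int.induction_on with
  | zero => simp
  | succ n ih =>
    have := hL _ (hmem n)
    rw [ih] at this
    have e : z + n * (2 * Real.pi * Complex.I) + (2 * Real.pi : ℝ) * Complex.I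
      = z + ((n + 1 : ℤ) : ℂ) * (2 * Real.pi * Complex.I) := by push_cast; ring
    push_cast at e this ⊢
    rw [← e, this]; ring
  | pred n ih =>
    have := hL _ (hmem (-n - 1))
    have e : z + ((-(n : ℤ) - 1 : ℤ) : ℂ) * (2 * Real.pi * Complex.I) + (2 * Real.pi : ℝ) * Complex.I
      = z + ((-(n : ℤ) : ℤ) : ℂ) * (2 * Real.pi * Complex.I) := by push_cast; ring
    rw [e, ih] at this
    rw [eq_sub_of_add_eq this.symm]
    push_cast; ring

/-- The lift of a homeomorphism between annuli is injective and its degree on circles is `±1`. -/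
theorem exists_log_lift_of_homeo (hr : 0 < r) (hrR : r < R) (hr' : 0 < r') (hrR' : r' < R')
    {h : ℂ → ℂ} (e : annulus r R ≃ₜ annulus r' R') (he : ∀ x, (e x : ℂ) = h x) :
    ∃ (L : ℂ → ℂ) (k : ℤ), (k = 1 ∨ k = -1) ∧ ContinuousOn L (logStrip r R) ∧
      InjOn L (logStrip r R) ∧
      (∀ z ∈ logStrip r R, Complex.exp (L z) = h (Complex.exp z)) ∧
      ∀ z ∈ logStrip r R, L (z + (2 * Real.pi : ℝ) * Complex.I) =
        L z + k * (2 * Real.pi * Complex.I) := by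
  classical
  have hR := hr.trans hrR
  have hR' := hr'.trans hrR'
  have hc : ContinuousOn h (annulus r R) := by
    rw [continuousOn_iff_continuous_domRestrict]
    exact (continuous_subtype_val.comp e.continuous).congr fun x => he x
  have hmem : ∀ x ∈ annulus r R, h x ∈ annulus r' R' := fun x hx => by
    rw [← he ⟨x, hx⟩]; exact (e _).2
  have hne0 : ∀ y ∈ annulus r' R', y ≠ 0 := fun y hy h0 => by
    have := hy.1; rw [h0, norm_zero] at this; linarith
  have hne0' : ∀ y ∈ annulus r R, y ≠ 0 := fun y hy h0 => by
    have := hy.1; rw [h0, norm_zero] at this; linarith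
  set g : ℂ → ℂ := fun y => if hy : y ∈ annulus r' R' then e.symm ⟨y, hy⟩ else 1 with hgdef
  have hg : ∀ y : annulus r' R', (e.symm y : ℂ) = g y := fun y => by
    simp only [hgdef, dif_pos y.2]
  have hgc : ContinuousOn g (annulus r' R') := by
    rw [continuousOn_iff_continuous_domRestrict]
    exact (continuous_subtype_val.comp e.symm.continuous).congr fun x => hg x
  have hgmem : ∀ x ∈ annulus r' R', g x ∈ annulus r R := fun x hx => by
    rw [← hg ⟨x, hx⟩]; exact (e.symm _).2
  have hgh : ∀ x ∈ annulus r R, g (h x) = x := fun x hx => by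
    have h1 : h x = (e ⟨x, hx⟩ : ℂ) := (he ⟨x, hx⟩).symm
    rw [h1, ← hg, e.symm_apply_apply]
  obtain ⟨L, k, hL, hLe, hLk⟩ := exists_log_lift hr hrR hc fun x hx => hne0 _ (hmem x hx)
  obtain ⟨L', k', hL', hLe', hLk'⟩ := exists_log_lift hr' hrR' hgc fun x hx => hne0' _ (hgmem x hx)
  have hmapsL : MapsTo L (logStrip r R) (logStrip r' R') := fun z hz => by
    rw [← exp_mem_annulus_iff hr' hR', hLe z hz]
    exact hmem _ ((exp_mem_annulus_iff hr hR).mpr hz)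
  -- The lift of the inverse composed with the lift of `h` is a translation by a multiple of `2πi`.
  -- Injectivity of `L` follows at once, and comparing increments over a period gives `k k' = 1`.
  obtain ⟨n, hn⟩ := exists_int_of_exp_eq_one (convex_logStrip r R).isPreconnected
    (f := fun z => L' (L z) - z) ((hL'.comp hL hmapsL).sub continuousOn_id) (fun z hz => by
      rw [Complex.exp_sub, hLe' _ (hmapsL hz), hLe z hz,
        hgh _ ((exp_mem_annulus_iff hr hR).mpr hz)]
      exact div_self (Complex.exp_ne_zero z))
  refine ⟨L, k, ?_, hL, ?_, hLe, hLk⟩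
  · obtain ⟨x, hx⟩ := exists_between (Real.log_lt_log hr hrR)
    have hz : (x : ℂ) ∈ logStrip r R := by simpa [logStrip] using hx
    have h1 := hn _ hz
    have h2 := hn _ (add_I_mul_mem_logStrip hz (2 * Real.pi))
    rw [hLk _ hz, lift_add_int hLk' (hmapsL hz)] at h2
    have h3 : ((k * k' : ℤ) : ℂ) * (2 * Real.pi * Complex.I) =
        ((1 : ℤ) : ℂ) * (2 * Real.pi * Complex.I) := by
      have h5 := h2.trans h1.symm
      push_cast at h5 ⊢
      linear_combination h5
    have h4 := mul_right_cancel₀ Complex.two_pi_I_ne_zero h3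
    have h5 : k * k' = 1 := by exact_mod_cast h4
    exact Int.isUnit_iff.mp (IsUnit.of_mul_eq_one _ h5)
  · intro z hz w hw hzw
    have h1 := hn z hz
    have h2 := hn w hw
    simp only [hzw] at h1 h2
    linear_combination h2 - h1

end LogLift

/-! ### Winding numbers of loops. -/

section Winding

/-- The loop `γ`, parametrized by `[0, 2π]`, winds `n` times around the origin. -/
def HasWinding (γ : ℝ → ℂ) (n : ℤ) : Prop :=
  ∃ L : ℝ → ℂ, Continuous L ∧ (∀ t, Complex.exp (L t) = γ t) ∧
    L (2 * Real.pi) = L 0 + n * (2 * Real.pi * Complex.I)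

/-- A periodic factor with values in the slit plane has a periodic principal logarithm, and a
nonzero constant has a constant one; neither changes the increment. -/
theorem HasWinding.mul {γ γ' c : ℝ → ℂ} {n : ℤ} (h : HasWinding γ n) {a : ℂ} (ha : a ≠ 0)
    (hc : Continuous c) (hs : ∀ t, c t ∈ Complex.slitPlane) (hper : c (2 * Real.pi) = c 0)
    (hγ : ∀ t, γ' t = a * γ t * c t) : HasWinding γ' n := by
  obtain ⟨L, hL, hLe, hLn⟩ := h
  refine ⟨fun t => Complex.log a + L t + Complex.log (c t), ?_, fun t => ?_, ?_⟩
  · exact (continuous_const.add hL).add (hc.clog hs)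
  · rw [Complex.exp_add, Complex.exp_add, Complex.exp_log ha, hLe,
      Complex.exp_log (Complex.slitPlane_ne_zero (hs t)), hγ]
  · simp only [hLn, hper]; ring

/-- A logarithm of the whole homotopy has an increment over one period that varies continuously with
the parameter and lies in `2πiℤ`. -/
theorem HasWinding.eq_of_homotopy {F : ℝ → ℝ → ℂ} {n m : ℤ}
    (hF : ContinuousOn (fun p : ℝ × ℝ => F p.1 p.2) (Icc 0 1 ×ˢ univ))
    (h0 : ∀ s ∈ Icc (0 : ℝ) 1, ∀ t, F s t ≠ 0)
    (hper : ∀ s ∈ Icc (0 : ℝ) 1, F s (2 * Real.pi) = F s 0)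
    (hn : HasWinding (F 0) n) (hm : HasWinding (F 1) m) : n = m := by
  -- Clamping the parameter extends the homotopy to the whole plane, an open convex set on which
  -- logarithms exist.
  set σ : ℝ → ℝ := fun s => max 0 (min 1 s) with hσ
  have hσc : Continuous σ := by fun_prop
  have hσm : ∀ s, σ s ∈ Icc (0 : ℝ) 1 := fun s =>
    ⟨le_max_left _ _, max_le zero_le_one (min_le_left _ _)⟩
  have hc : Continuous fun p : ℝ × ℝ => F (σ p.1) p.2 := by
    have := hF.comp_continuous (f := fun p : ℝ × ℝ => (σ p.1, p.2)) (by fun_prop)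
      (fun p => ⟨hσm _, mem_univ _⟩)
    exact this
  obtain ⟨ℓ, hℓ, hℓe⟩ := exists_continuousOn_log (X := ℝ × ℝ) convex_univ univ_nonempty isOpen_univ
    hc.continuousOn (fun p _ => h0 _ (hσm _) _)
  rw [← continuousOn_univ.symm.eq] at hℓ
  obtain ⟨N, hN⟩ := exists_int_of_exp_eq_one (X := ℝ) isPreconnected_univ
    (f := fun s => ℓ (s, 2 * Real.pi) - ℓ (s, 0)) (Continuous.continuousOn (by fun_prop))
    (fun s _ => by
      rw [Complex.exp_sub, hℓe _ (mem_univ _), hℓe _ (mem_univ _)]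
      simp only [hper _ (hσm s)]
      exact div_self (h0 _ (hσm s) _))
  have key : ∀ (s : ℝ) (j : ℤ), σ s = s → HasWinding (F s) j → j = N := by
    intro s j hs hj
    obtain ⟨L, hL, hLe, hLj⟩ := hj
    obtain ⟨l, hl⟩ := exists_int_of_exp_eq_one (X := ℝ) isPreconnected_univ
      (f := fun t => L t - ℓ (s, t)) (Continuous.continuousOn (by fun_prop)) (fun t _ => by
        rw [Complex.exp_sub, hLe, hℓe _ (mem_univ _)]
        simp only [hs]
        exact div_self (hs ▸ h0 _ (hσm s) t))
    have h1 := hl (2 * Real.pi) (mem_univ _)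
    have h2 := hl 0 (mem_univ _)
    have h3 := hN s (mem_univ _)
    have h4 : (j : ℂ) * (2 * Real.pi * Complex.I) = N * (2 * Real.pi * Complex.I) := by
      linear_combination h1 - h2 + h3 - hLj
    exact_mod_cast mul_right_cancel₀ Complex.two_pi_I_ne_zero h4
  rw [key 0 n (by simp [hσ]) hn, key 1 m (by simp [hσ]) hm]

theorem hasWinding_cos_add_sin {k : ℤ} (hk : k = 1 ∨ k = -1) :
    HasWinding (fun t => (Real.cos t : ℂ) + k * Real.sin t * Complex.I) k := by
  refine ⟨fun t => k * t * Complex.I, by fun_prop, fun t => ?_, ?_⟩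
  · rcases hk with rfl | rfl
    · simp [Complex.exp_mul_I]
    · have := Complex.exp_mul_I (-(t : ℂ))
      simp only [Complex.cos_neg, Complex.sin_neg] at this
      simpa using this
  · push_cast; ring

end Winding

/-! ### Behaviour of the lift near the ends of the strip. -/

section Orientation

variable {r R r' R' : ℝ}

theorem re_lift {L h : ℂ → ℂ} (hLe : ∀ z ∈ logStrip r R, Complex.exp (L z) = h (Complex.exp z))
    {z : ℂ} (hz : z ∈ logStrip r R) : ‖h (Complex.exp z)‖ = Real.exp (L z).re := by
  rw [← hLe z hz, Complex.norm_exp]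

theorem eventually_comap_norm_iff {A : Set ℂ} {ρ : ℝ} {P : ℂ → Prop} :
    (∀ᶠ x in comap norm (𝓝 ρ) ⊓ 𝓟 A, P x) ↔ ∃ ε > 0, ∀ x ∈ A, |‖x‖ - ρ| < ε → P x := by
  rw [eventually_inf_principal, eventually_comap, Metric.eventually_nhds_iff]
  constructor
  · rintro ⟨ε, hε, h⟩
    exact ⟨ε, hε, fun x hx hxε => h (y := ‖x‖) hxε x rfl hx⟩
  · rintro ⟨ε, hε, h⟩
    refine ⟨ε, hε, fun y hy x hxy hx => h x hx ?_⟩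
    rw [hxy]; exact hy

/-- `Im L(z) - k Im z` is bounded on closed substrips. -/
theorem exists_bound_im_lift {L : ℂ → ℂ} {k : ℤ} (hL : ContinuousOn L (logStrip r R))
    (hLk : ∀ z ∈ logStrip r R,
      L (z + (2 * Real.pi : ℝ) * Complex.I) = L z + k * (2 * Real.pi * Complex.I))
    {u v : ℝ} (hu : Real.log r < u) (hv : v < Real.log R) :
    ∃ B, ∀ z : ℂ, u ≤ z.re → z.re ≤ v → |(L z).im - k * z.im| ≤ B := by
  have hK : IsCompact (Icc u v ×ℂ Icc 0 (2 * Real.pi)) := isCompact_Icc.reProdIm isCompact_Icc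
  have hsub : Icc u v ×ℂ Icc 0 (2 * Real.pi) ⊆ logStrip r R := fun z hz =>
    ⟨hu.trans_le hz.1.1, hz.1.2.trans_lt hv⟩
  obtain ⟨B, hB⟩ := hK.exists_bound_of_continuousOn (f := fun z => (L z).im - k * z.im)
    ((Complex.continuous_im.comp_continuousOn (hL.mono hsub)).sub
      (Continuous.continuousOn (by fun_prop)))
  refine ⟨B, fun z h1 h2 => ?_⟩
  have hpi : (0 : ℝ) < 2 * Real.pi := by positivity
  -- `Im L(z) - k Im z` is invariant under `z ↦ z + 2πi`, so its bound on one compact period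
  -- rectangle is global.
  set n : ℤ := ⌊z.im / (2 * Real.pi)⌋
  have hn1 : (n : ℝ) * (2 * Real.pi) ≤ z.im := by
    rw [← le_div_iff₀ hpi]; exact Int.floor_le _
  have hn2 : z.im < (n + 1) * (2 * Real.pi) := by
    rw [← div_lt_iff₀ hpi]; exact Int.lt_floor_add_one _
  have hw : z + ((-n : ℤ) : ℂ) * (2 * Real.pi * Complex.I) ∈ Icc u v ×ℂ Icc 0 (2 * Real.pi) := by
    refine ⟨?_, ?_⟩
    · simp [h1, h2]
    · simp only [mem_preimage]
      have : (z + ((-n : ℤ) : ℂ) * (2 * Real.pi * Complex.I)).im = z.im - n * (2 * Real.pi) := by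
        simp; ring
      rw [this]
      constructor <;> linarith
  have h3 := hB _ hw
  rw [lift_add_int hLk ⟨hu.trans_le h1, h2.trans_lt hv⟩] at h3
  convert h3 using 2
  simp
  ring_nf

/-- Near the inner circle `|h|` lies below its value at the base point, and near the outer circle
above it. In the strip this fixes the sign of `Re (L - L z₀)` to the left of one vertical line and
to the right of another. -/
theorem exists_radius_of_boundary (hr : 0 < r) (hrR : r < R) {h L : ℂ → ℂ}
    (hmem : ∀ x ∈ annulus r R, h x ∈ annulus r' R')
    (hLe : ∀ z ∈ logStrip r R, Complex.exp (L z) = h (Complex.exp z))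
    (ho : PreservesBoundaryOrder r R r' R' h) {z₀ : ℂ} (hz₀ : z₀ ∈ logStrip r R) :
    ∃ u v, Real.log r < u ∧ u < z₀.re ∧ z₀.re < v ∧ v < Real.log R ∧
      (∀ z ∈ logStrip r R, z.re ≤ u → (L z).re < (L z₀).re) ∧
      (∀ z ∈ logStrip r R, v ≤ z.re → (L z₀).re < (L z).re) := by
  have hR := hr.trans hrR
  have ha := (exp_mem_annulus_iff hr hR).mpr hz₀
  obtain ⟨ε₁, hε₁, h₁⟩ := eventually_comap_norm_iff.mp (ho.1.eventually_lt_const (hmem _ ha).1)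
  obtain ⟨ε₂, hε₂, h₂⟩ := eventually_comap_norm_iff.mp (ho.2.eventually_const_lt (hmem _ ha).2)
  obtain ⟨u, hu1, hu2⟩ := exists_between (a₁ := Real.log r) (a₂ := min z₀.re (Real.log (r + ε₁)))
    (lt_min hz₀.1 (Real.log_lt_log hr (by linarith)))
  obtain ⟨v, hv1, hv2⟩ := exists_between
    (a₁ := max z₀.re (Real.log (max r (R - ε₂)))) (a₂ := Real.log R)
    (max_lt hz₀.2 (Real.log_lt_log (lt_max_of_lt_left hr) (max_lt hrR (by linarith))))
  refine ⟨u, v, hu1, hu2.trans_le (min_le_left _ _), (le_max_left _ _).trans_lt hv1, hv2,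
    fun z hz hzu => ?_, fun z hz hzv => ?_⟩
  · have hx := (exp_mem_annulus_iff hr hR).mpr hz
    have h3 := h₁ _ hx (by
      rw [abs_of_pos (sub_pos.mpr hx.1), Complex.norm_exp]
      have : Real.exp z.re < r + ε₁ := by
        rw [← Real.lt_log_iff_exp_lt (by linarith)]
        exact (hzu.trans_lt hu2).trans_le (min_le_right _ _)
      linarith)
    rw [re_lift hLe hz, re_lift hLe hz₀] at h3
    exact Real.exp_lt_exp.mp h3
  · have hx := (exp_mem_annulus_iff hr hR).mpr hz
    have h3 := h₂ _ hx (by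
      rw [abs_sub_comm, abs_of_pos (sub_pos.mpr hx.2), Complex.norm_exp]
      have : max r (R - ε₂) < Real.exp z.re := by
        rw [← Real.log_lt_iff_lt_exp (lt_max_of_lt_left hr)]
        exact ((le_max_right _ _).trans_lt hv1).trans_le hzv
      have := (le_max_right r (R - ε₂)).trans_lt this
      linarith)
    rw [re_lift hLe hz, re_lift hLe hz₀] at h3
    exact Real.exp_lt_exp.mp h3

end Orientation

/-! ### Orientation and boundary order determine the degree. -/

section Degree

open scoped ComplexConjugate

variable {r R r' R' : ℝ}

theorem inv_mem_slitPlane {z : ℂ} (hz : z ∈ Complex.slitPlane) : z⁻¹ ∈ Complex.slitPlane := by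
  have h0 := Complex.normSq_pos.mpr (Complex.slitPlane_ne_zero hz)
  rw [Complex.mem_slitPlane_iff] at hz ⊢
  rw [Complex.inv_re, Complex.inv_im]
  refine hz.imp (fun h => div_pos h h0) (fun h => div_ne_zero (neg_ne_zero.mpr h) h0.ne')

/-- A round circle about `exp z₀` is the exponential image of a small loop about `z₀`; this carries
the winding condition on `h` over to its lift. -/
theorem circle_eq_exp {z₀ : ℂ} {s t : ℝ} {u : ℂ}
    (hu : u = (s : ℂ) * Complex.exp (-z₀) * Complex.exp (t * Complex.I)) (h1 : ‖u‖ < 1) :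
    Complex.exp z₀ + s * Complex.exp (t * Complex.I) = Complex.exp (z₀ + Complex.log (1 + u)) := by
  have hne : 1 + u ≠ 0 := fun h => by
    have : u = -1 := by linear_combination h
    rw [this] at h1; simp at h1
  rw [Complex.exp_add, Complex.exp_log hne, hu, mul_add, mul_one]
  have : Complex.exp z₀ * ((s : ℂ) * Complex.exp (-z₀) * Complex.exp (t * Complex.I)) =
    s * Complex.exp (t * Complex.I) * (Complex.exp z₀ * Complex.exp (-z₀)) := by ring
  rw [this, ← Complex.exp_add, add_neg_cancel, Complex.exp_zero, mul_one]

/-- `log (1 + u) = u + O(|u|²)`, and for `|u| ≤ 1/2` the remainder contributes at most half of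
`|u|²`. The logarithm therefore never points away from `u`. -/
theorem re_log_one_add_mul_conj_pos {u : ℂ} (h0 : u ≠ 0) (h1 : ‖u‖ ≤ 1 / 2) :
    0 < (Complex.log (1 + u) * conj u).re := by
  have hb := Complex.norm_log_one_add_sub_self_le (z := u) (by linarith)
  have hu : 0 < ‖u‖ := norm_pos_iff.mpr h0
  have h2 : ‖Complex.log (1 + u) - u‖ ≤ ‖u‖ ^ 2 := by
    refine hb.trans ?_
    have : (1 - ‖u‖)⁻¹ ≤ 2 := by
      rw [inv_le_comm₀ (by linarith) (by norm_num)]; linarith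
    nlinarith [sq_nonneg ‖u‖]
  have h3 : Complex.log (1 + u) * conj u = (‖u‖ ^ 2 : ℝ) + (Complex.log (1 + u) - u) * conj u := by
    rw [sub_mul, Complex.mul_conj, Complex.normSq_eq_norm_sq]; ring
  rw [h3, Complex.add_re, Complex.ofReal_re]
  have h4 := Complex.abs_re_le_norm ((Complex.log (1 + u) - u) * conj u)
  rw [norm_mul, RCLike.norm_conj] at h4
  have h5 := (abs_le.mp h4).1
  nlinarith [mul_le_mul_of_nonneg_right h2 hu.le, pow_pos hu 2]

/-- The winding number of a small loop in logarithmic coordinates. -/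
theorem hasWinding_lift_of_orientation (hr : 0 < r) (hrR : r < R)
    {h L : ℂ → ℂ} (hc : ContinuousOn h (annulus r R)) (hL : ContinuousOn L (logStrip r R))
    (hinj : InjOn L (logStrip r R))
    (hLe : ∀ z ∈ logStrip r R, Complex.exp (L z) = h (Complex.exp z))
    (ho : OrientationPreservingOn h (annulus r R)) {x₀ : ℝ} (hx₀ : (x₀ : ℂ) ∈ logStrip r R) :
    ∃ ε : ℝ, 0 < ε ∧ ε ≤ 1 / 2 ∧
      (∀ t : ℝ, (x₀ : ℂ) + Complex.log (1 + ε * Complex.exp (t * Complex.I)) ∈ logStrip r R) ∧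
      HasWinding (fun t : ℝ => L (x₀ + Complex.log (1 + ε * Complex.exp (t * Complex.I))) - L x₀)
        1 := by
  have hR := hr.trans hrR
  set z₀ : ℂ := (x₀ : ℂ)
  set a : ℂ := Complex.exp z₀ with ha
  have haA : a ∈ annulus r R := (exp_mem_annulus_iff hr hR).mpr hx₀
  have hSo := (isOpen_logStrip r R)
  have h1 : ContinuousAt (fun u : ℂ => z₀ + Complex.log (1 + u)) 0 := by
    apply ContinuousAt.add continuousAt_const
    apply ContinuousAt.clog (by fun_prop)
    simp
  have h10 : (fun u : ℂ => z₀ + Complex.log (1 + u)) 0 = z₀ := by simp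
  have h2 : ∀ᶠ u : ℂ in 𝓝 0, z₀ + Complex.log (1 + u) ∈ logStrip r R ∧
      ‖L (z₀ + Complex.log (1 + u)) - L z₀‖ < 1 := by
    have hLz : ContinuousAt L z₀ := hL.continuousAt (hSo.mem_nhds hx₀)
    have e1 : ∀ᶠ z in 𝓝 z₀, z ∈ logStrip r R ∧ ‖L z - L z₀‖ < 1 := by
      refine Filter.Eventually.and (hSo.mem_nhds hx₀) ?_
      have := Metric.tendsto_nhds.mp hLz 1 one_pos
      simpa [dist_eq_norm] using this
    have h1' : Tendsto (fun u : ℂ => z₀ + Complex.log (1 + u)) (𝓝 0) (𝓝 z₀) := by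
      have := h1.tendsto; simp only [add_zero, Complex.log_one] at this; exact this
    exact h1'.eventually e1
  obtain ⟨δ, hδ, h3⟩ := Metric.eventually_nhds_iff.mp h2
  simp only [dist_zero_right] at h3
  have hpos : 0 < Real.exp x₀ := Real.exp_pos _
  have h4 : ∀ᶠ s : ℝ in 𝓝[>] 0, s < min δ (1 / 2) * Real.exp x₀ :=
    (eventually_lt_nhds (by positivity)).filter_mono nhdsWithin_le_nhds
  obtain ⟨s, ⟨hs1, hs2⟩, hs0⟩ := (((ho a haA).and h4).and self_mem_nhdsWithin).exists
  obtain ⟨θ, hθ, hθe, hθ2⟩ := hs1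
  have hs0 : 0 < s := hs0
  set ε : ℝ := s * Real.exp (-x₀) with hε
  have hε0 : 0 < ε := by positivity
  have hεlt : ε < min δ (1 / 2) := by
    rw [hε, Real.exp_neg, ← div_eq_mul_inv, div_lt_iff₀ hpos]; exact hs2
  set u : ℝ → ℂ := fun t => ε * Complex.exp (t * Complex.I) with hu
  have hun : ∀ t, ‖u t‖ = ε := fun t => norm_mul_exp_mul_I hε0.le t
  have huc : Continuous u := by fun_prop
  have hup : u (2 * Real.pi) = u 0 := by
    simp only [hu]
    push_cast
    rw [Complex.exp_two_pi_mul_I]; simp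
  have hstrip : ∀ t, z₀ + Complex.log (1 + u t) ∈ logStrip r R := fun t =>
    (h3 (by rw [hun]; exact hεlt.trans_le (min_le_left _ _))).1
  have hsmall : ∀ t, ‖L (z₀ + Complex.log (1 + u t)) - L z₀‖ < 1 := fun t =>
    (h3 (by rw [hun]; exact hεlt.trans_le (min_le_left _ _))).2
  have hhalf : ε ≤ 1 / 2 := (hεlt.trans_le (min_le_right _ _)).le
  have hu1 : ∀ t, ‖u t‖ < 1 := fun t => by rw [hun]; linarith
  have hcirc : ∀ t : ℝ, a + s * Complex.exp (t * Complex.I) =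
      Complex.exp (z₀ + Complex.log (1 + u t)) := fun t =>
    circle_eq_exp (by simp only [hu, hε]; push_cast; ring) (hu1 t)
  have hlogc : Continuous fun t => Complex.log (1 + u t) := by
    apply Continuous.clog (by fun_prop)
    intro t
    exact Complex.mem_slitPlane_of_norm_lt_one (hu1 t)
  have hwc : Continuous fun t => L (z₀ + Complex.log (1 + u t)) :=
    hL.comp_continuous (by fun_prop) hstrip
  have hne : ∀ t, L (z₀ + Complex.log (1 + u t)) - L z₀ ≠ 0 := by
    intro t h0
    have h5 := hinj (hstrip t) hx₀ (sub_eq_zero.mp h0)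
    have h6 : Complex.log (1 + u t) = 0 := by simpa using h5
    have h7 := re_log_one_add_mul_conj_pos (u := u t)
      (norm_pos_iff.mp (by rw [hun]; exact hε0)) (by rw [hun]; exact hhalf)
    rw [h6] at h7; simp at h7
  have hW : HasWinding (fun t : ℝ => h (a + s * Complex.exp (t * Complex.I)) - h a) 1 := by
    have hn0 : ∀ t : ℝ, h (a + s * Complex.exp (t * Complex.I)) - h a ≠ 0 := fun t =>
      sub_ne_zero.mpr (hθe t).1
    have hcc : Continuous fun t : ℝ => h (a + s * Complex.exp (t * Complex.I)) - h a := by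
      apply Continuous.sub _ continuous_const
      apply hc.comp_continuous (by fun_prop)
      intro t
      rw [hcirc]
      exact (exp_mem_annulus_iff hr hR).mpr (hstrip t)
    refine ⟨fun t => (Real.log ‖h (a + s * Complex.exp (t * Complex.I)) - h a‖ : ℂ) +
      θ t * Complex.I, ?_, fun t => ?_, ?_⟩
    · have := hcc.norm.log fun t => (norm_pos_iff.mpr (hn0 t)).ne'
      fun_prop
    · rw [Complex.exp_add, ← Complex.ofReal_exp, Real.exp_log (norm_pos_iff.mpr (hn0 t))]
      exact (hθe t).2.symm
    · have e0 : ((2 * Real.pi : ℝ) : ℂ) * Complex.I = 2 * Real.pi * Complex.I := by push_cast; ring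
      simp only [hθ2, e0, Complex.exp_two_pi_mul_I]
      push_cast
      simp
      ring
  refine ⟨ε, hε0, hhalf, hstrip, ?_⟩
  set w : ℝ → ℂ := fun t => L (z₀ + Complex.log (1 + u t)) - L z₀ with hw
  -- The increment of `h` is `exp (L z₀) (exp w - 1)`, where `w` is the increment of the lift. For
  -- `|w| < 1` the quotient `(exp w - 1) / w` is within distance `1` of `1`, so both increments wind
  -- equally often.
  have hcne : ∀ t, (Complex.exp (w t) - 1) / w t ∈ Complex.slitPlane := by
    intro t
    have h5 := Complex.norm_exp_sub_one_sub_id_le (hsmall t).le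
    have h6 : 0 < ‖w t‖ := norm_pos_iff.mpr (hne t)
    have h7 : (Complex.exp (w t) - 1) / w t = 1 + (Complex.exp (w t) - 1 - w t) / w t := by
      have : w t ≠ 0 := hne t
      field_simp
      ring
    rw [h7]
    apply Complex.mem_slitPlane_of_norm_lt_one
    rw [norm_div, div_lt_one h6]
    refine h5.trans_lt ?_
    have := hsmall t
    change ‖w t‖ ^ 2 < ‖w t‖
    change ‖w t‖ < 1 at this
    nlinarith
  have hwcont : Continuous w := hwc.sub continuous_const
  refine hW.mul (a := Complex.exp (-L z₀)) (c := fun t => ((Complex.exp (w t) - 1) / w t)⁻¹)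
    (Complex.exp_ne_zero _) ?_ ?_ ?_ ?_
  · apply Continuous.inv₀
    · exact ((Complex.continuous_exp.comp hwcont).sub continuous_const).div hwcont hne
    · exact fun t => Complex.slitPlane_ne_zero (hcne t)
  · intro t
    exact inv_mem_slitPlane (hcne t)
  · simp only [hw, hup]
  · intro t
    have e1 : h (a + s * Complex.exp (t * Complex.I)) - h a =
        Complex.exp (L z₀) * (Complex.exp (w t) - 1) := by
      rw [hcirc, ← hLe _ (hstrip t), ha, ← hLe _ hx₀, mul_sub, ← Complex.exp_add]
      simp [hw]
    rw [e1]
    have h8 := Complex.slitPlane_ne_zero (hcne t)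
    have h9 : Complex.exp (w t) - 1 ≠ 0 := fun h => h8 (by rw [h, zero_div])
    have h10 : Complex.exp (-L z₀) * Complex.exp (L z₀) = 1 := by
      rw [← Complex.exp_add]; simp
    have h11 := hne t
    change w t = _
    rw [inv_div, ← mul_assoc, h10, one_mul, mul_div_cancel₀ _ h9]

set_option maxHeartbeats 1000000 in
/-- Homeomorphisms that preserve the orientation and the order of the boundary components have
degree `1` on circles. -/
theorem degree_eq_one (hr : 0 < r) (hrR : r < R)
    {h L : ℂ → ℂ} {k : ℤ} (hk : k = 1 ∨ k = -1) (hc : ContinuousOn h (annulus r R))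
    (hmem : ∀ x ∈ annulus r R, h x ∈ annulus r' R')
    (hL : ContinuousOn L (logStrip r R)) (hinj : InjOn L (logStrip r R))
    (hLe : ∀ z ∈ logStrip r R, Complex.exp (L z) = h (Complex.exp z))
    (hLk : ∀ z ∈ logStrip r R,
      L (z + (2 * Real.pi : ℝ) * Complex.I) = L z + k * (2 * Real.pi * Complex.I))
    (ho : OrientationPreservingOn h (annulus r R)) (hb : PreservesBoundaryOrder r R r' R' h) :
    k = 1 := by
  have hlog := Real.log_lt_log hr hrR
  set x₀ : ℝ := (Real.log r + Real.log R) / 2 with hx₀d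
  have hx₀ : (x₀ : ℂ) ∈ logStrip r R := by
    simp only [logStrip, mem_ofPred_eq, Complex.ofReal_re]
    constructor <;> linarith
  obtain ⟨ε, hε0, hhalf, hstrip, hW⟩ := hasWinding_lift_of_orientation hr hrR hc hL hinj hLe ho hx₀
  obtain ⟨μ, ν, hμ1, hμ2, hν1, hν2, hμ, hν⟩ := exists_radius_of_boundary hr hrR hmem hLe hb hx₀
  simp only [Complex.ofReal_re] at hμ2 hν1
  set l₀ : ℝ := max (x₀ - μ) (ν - x₀) with hl₀
  set W : ℝ := (Real.log R - Real.log r) / 2 with hWd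
  have hl₀W : l₀ < W := max_lt (by linarith) (by linarith)
  have hl₀0 : 0 < l₀ := lt_max_of_lt_left (by linarith)
  -- The half-width of the ellipse: less than that of the strip, but large enough to reach beyond
  -- both vertical lines where the sign of `Re (L - L x₀)` is known.
  obtain ⟨l, hl1, hl2⟩ := exists_between hl₀W
  have hl0 : 0 < l := hl₀0.trans hl1
  obtain ⟨B, hB⟩ := exists_bound_im_lift hL hLk (u := x₀ - l) (v := x₀ + l)
    (by linarith) (by linarith)
  set σ : ℝ := Real.sqrt (1 - (l₀ / l) ^ 2) with hσd
  have hq : l₀ / l < 1 := (div_lt_one hl0).mpr hl1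
  have hq0 : 0 < l₀ / l := div_pos hl₀0 hl0
  have hσ0 : 0 < σ := Real.sqrt_pos.mpr (by nlinarith)
  have hB0 : 0 ≤ B := (abs_nonneg _).trans (hB x₀ (by simp [hl0.le]) (by simp [hl0.le]))
  -- Where the ellipse does not reach those lines, `|sin t| > σ`. This half-height makes `|k M sin
  -- t|` exceed `2B`, the total deviation of `Im L` from `k Im z` at the point and at the centre, so
  -- the sign of `Im (L - L x₀)` is that of `k sin t`.
  set M : ℝ := (2 * B + 1) / σ with hM
  have hM0 : 0 < M := by positivity
  set E : ℝ → ℂ := fun t => (l * Real.cos t : ℝ) + (M * Real.sin t : ℝ) * Complex.I with hE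
  have hEc : Continuous E := by fun_prop
  have hEre : ∀ t, ((x₀ : ℂ) + E t).re = x₀ + l * Real.cos t := fun t => by simp [hE, -Complex.ofReal_cos, -Complex.ofReal_sin]
  have hEim : ∀ t, ((x₀ : ℂ) + E t).im = M * Real.sin t := fun t => by simp [hE, -Complex.ofReal_cos, -Complex.ofReal_sin]
  have hcosle : ∀ t, |l * Real.cos t| ≤ l := fun t => by
    rw [abs_mul, abs_of_pos hl0]
    exact mul_le_of_le_one_right hl0.le (Real.abs_cos_le_one t)
  have hEs : ∀ t, (x₀ : ℂ) + E t ∈ logStrip r R := fun t => by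
    have := abs_le.mp (hcosle t)
    refine ⟨?_, ?_⟩ <;> rw [hEre] <;> linarith [this.1, this.2]
  have hEp : E (2 * Real.pi) = E 0 := by simp [hE]
  set u : ℝ → ℂ := fun t => ε * Complex.exp (t * Complex.I) with hu
  have hun : ∀ t, ‖u t‖ = ε := fun t => norm_mul_exp_mul_I hε0.le t
  have huc : Continuous u := by fun_prop
  have hup : u (2 * Real.pi) = u 0 := by
    simp only [hu]
    push_cast
    rw [Complex.exp_two_pi_mul_I]; simp
  have hlogc : Continuous fun t => Complex.log (1 + u t) := by
    apply Continuous.clog (by fun_prop)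
    intro t
    exact Complex.mem_slitPlane_of_norm_lt_one (by rw [hun]; linarith)
  have hseg : ∀ s ∈ Icc (0 : ℝ) 1, ∀ t, (x₀ : ℂ) + ((1 - s : ℝ) * Complex.log (1 + u t) + s * E t) ∈
      logStrip r R := fun s hs t => by
    have := (convex_logStrip r R) (hstrip t) (hEs t) (a := 1 - s) (b := s) (by linarith [hs.2])
      hs.1 (by ring)
    convert this using 1
    simp only [Complex.real_smul]
    push_cast
    ring
  -- sign conditions on the large ellipse
  have hsign : ∀ t, 0 < (L (x₀ + E t) - L x₀).re * Real.cos t ∨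
      0 < (L (x₀ + E t) - L x₀).im * (k * Real.sin t) := by
    intro t
    rcases le_or_gt l₀ (l * |Real.cos t|) with h1 | h1
    · left
      rw [Complex.sub_re]
      rcases le_total 0 (Real.cos t) with hcs | hcs
      · rw [abs_of_nonneg hcs] at h1
        have h2 := hν _ (hEs t) (by rw [hEre]; linarith [le_max_right (x₀ - μ) (ν - x₀)])
        have h3 : 0 < Real.cos t := by
          by_contra h
          have : Real.cos t = 0 := le_antisymm (not_lt.mp h) hcs
          rw [this] at h1; linarith
        exact mul_pos (by linarith) h3
      · rw [abs_of_nonpos hcs] at h1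
        have h2 := hμ _ (hEs t) (by rw [hEre]; linarith [le_max_left (x₀ - μ) (ν - x₀)])
        have h3 : Real.cos t < 0 := by
          by_contra h
          have : Real.cos t = 0 := le_antisymm hcs (not_lt.mp h)
          rw [this] at h1; linarith
        exact mul_pos_of_neg_of_neg (by linarith) h3
    · right
      have h2 : |Real.cos t| < l₀ / l := by rw [lt_div_iff₀ hl0]; linarith
      have h3 : σ < |Real.sin t| := by
        rw [hσd, ← Real.sqrt_sq_eq_abs]
        apply Real.sqrt_lt_sqrt (by nlinarith)
        rw [Real.sin_sq]
        have : Real.cos t ^ 2 < (l₀ / l) ^ 2 := by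
          rw [← sq_abs]; exact pow_lt_pow_left₀ h2 (abs_nonneg _) two_ne_zero
        linarith
      have h5 := abs_le.mp (hcosle t)
      have h6 := hB _ (by rw [hEre]; linarith [h5.1]) (by rw [hEre]; linarith [h5.2])
      have h7 := hB x₀ (by simp [hl0.le]) (by simp [hl0.le])
      rw [hEim] at h6
      simp only [Complex.ofReal_im, mul_zero, sub_zero] at h7
      rw [Complex.sub_im]
      have hMσ : 2 * B + 1 < M * |Real.sin t| := by
        have : M * σ = 2 * B + 1 := by rw [hM]; field_simp
        rw [← this]; exact mul_lt_mul_of_pos_left h3 hM0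
      set S := Real.sin t
      set X := (L (x₀ + E t)).im
      set Y := (L x₀).im
      have h8 := abs_le.mp h6
      have h9 := abs_le.mp h7
      rcases hk with rfl | rfl <;> rcases le_total 0 S with hS | hS <;>
        simp only [abs_of_nonneg, abs_of_nonpos, hS] at hMσ h3 <;> push_cast at h8 ⊢ <;>
        [skip; rw [← neg_mul_neg]; rw [← neg_mul_neg]; skip] <;> apply mul_pos <;> linarith
  -- the two homotopies
  have hEn : HasWinding (fun t => L (x₀ + E t) - L x₀) k := by
    have hγc : Continuous fun t => L (x₀ + E t) - L x₀ :=
      (hL.comp_continuous (by fun_prop) hEs).sub continuous_const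
    obtain ⟨ℓ, hℓ, hℓe⟩ := exists_continuousOn_log (X := ℝ) convex_univ univ_nonempty isOpen_univ
      hγc.continuousOn (fun t _ h0 => by have := hsign t; rw [h0] at this; simp at this)
    rw [continuousOn_univ] at hℓ
    have hn : ∃ n, HasWinding (fun t => L (x₀ + E t) - L x₀) n := by
      have h1 : Complex.exp (ℓ (2 * Real.pi) - ℓ 0) = 1 := by
        rw [Complex.exp_sub, hℓe _ (mem_univ _), hℓe _ (mem_univ _), hEp]
        refine div_self fun h0 => ?_
        have := hsign 0; rw [h0] at this; simp at this
      obtain ⟨n, hn⟩ := Complex.exp_eq_one_iff.mp h1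
      exact ⟨n, ℓ, hℓ, fun t => hℓe t (mem_univ t), by rw [← hn]; ring⟩
    obtain ⟨n, hn⟩ := hn
    have : n = k := by
      -- The straight-line homotopy to `cos t + i k sin t` avoids zero: by the sign conditions, at
      -- each `t` the real parts or the imaginary parts of the two loops have the same strict sign.
      refine HasWinding.eq_of_homotopy (F := fun s t => (1 - s : ℝ) * (L (x₀ + E t) - L x₀) +
        s * ((Real.cos t : ℂ) + k * Real.sin t * Complex.I)) ?_ ?_ ?_ (by simpa using hn)
        (by simpa using hasWinding_cos_add_sin hk)
      · apply Continuous.continuousOn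
        have : Continuous fun p : ℝ × ℝ => L (x₀ + E p.2) - L x₀ := hγc.comp continuous_snd
        fun_prop
      · intro s hs t h0
        have hre := congrArg Complex.re h0
        have him := congrArg Complex.im h0
        simp only [Complex.add_re, Complex.add_im, Complex.re_ofReal_mul, Complex.im_ofReal_mul,
          Complex.zero_re, Complex.zero_im, Complex.ofReal_re, Complex.ofReal_im] at hre him
        have e1 : ((k : ℂ) * Real.sin t * Complex.I).re = 0 := by simp [-Complex.ofReal_cos, -Complex.ofReal_sin]
        have e2 : ((k : ℂ) * Real.sin t * Complex.I).im = k * Real.sin t := by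
          simp [-Complex.ofReal_cos, -Complex.ofReal_sin]
        rw [e1] at hre
        rw [e2] at him
        have hs1 : 0 ≤ 1 - s := by linarith [hs.2]
        have hkk : ((k : ℝ) * Real.sin t) * (k * Real.sin t) = (k : ℝ) ^ 2 * Real.sin t ^ 2 := by
          ring
        rcases hsign t with h1 | h1
        · have h2 : (1 - s) * ((L (x₀ + E t) - L x₀).re * Real.cos t) + s * Real.cos t ^ 2 = 0 := by
            linear_combination Real.cos t * hre
          have h3 : Real.cos t ≠ 0 := fun h => by rw [h] at h1; simp at h1
          have h4 : 0 < Real.cos t ^ 2 := by positivity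
          rcases hs.1.eq_or_lt with h5 | h5
          · rw [← h5] at h2; linarith
          · have h6 := mul_nonneg hs1 h1.le
            have h7 := mul_pos h5 h4
            linarith
        · have h2 : (1 - s) * ((L (x₀ + E t) - L x₀).im * (k * Real.sin t)) +
              s * (k * Real.sin t) ^ 2 = 0 := by
            linear_combination (k * Real.sin t) * him
          have h3 : (k : ℝ) * Real.sin t ≠ 0 := fun h => by rw [h] at h1; simp at h1
          have h4 : 0 < ((k : ℝ) * Real.sin t) ^ 2 := by positivity
          rcases hs.1.eq_or_lt with h5 | h5
          · rw [← h5] at h2; linarith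
          · have h6 := mul_nonneg hs1 h1.le
            have h7 := mul_pos h5 h4
            linarith
      · intro s _
        simp [hEp]
    exact this ▸ hn
  symm
  -- The homotopy is made in the domain, between the small loop and the ellipse. By injectivity of
  -- `L` it suffices that the displacement from `x₀` never vanishes, and both displacements have
  -- positive real part after multiplication by the conjugate of `u t`.
  refine HasWinding.eq_of_homotopy (F := fun s t =>
    L (x₀ + ((1 - s : ℝ) * Complex.log (1 + u t) + s * E t)) - L x₀) ?_ ?_ ?_ (by simpa using hW)
    (by simpa using hEn)
  · apply ContinuousOn.sub _ continuousOn_const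
    apply hL.comp
    · apply Continuous.continuousOn
      have h1 : Continuous fun p : ℝ × ℝ => Complex.log (1 + u p.2) := hlogc.comp continuous_snd
      fun_prop
    · rintro ⟨s, t⟩ ⟨hs, -⟩
      exact hseg s hs t
  · intro s hs t h0
    have h5 := hinj (hseg s hs t) hx₀ (sub_eq_zero.mp h0)
    have h6 : ((1 - s : ℝ) * Complex.log (1 + u t) + s * E t) = 0 := by simpa using h5
    have h7 := re_log_one_add_mul_conj_pos (u := u t)
      (norm_pos_iff.mp (by rw [hun]; exact hε0)) (by rw [hun]; exact hhalf)
    have h8 : (E t * conj (u t)).re = ε * (l * Real.cos t ^ 2 + M * Real.sin t ^ 2) := by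
      have : conj (u t) = ε * (Real.cos t - Real.sin t * Complex.I) := by
        simp only [hu, Complex.exp_mul_I, ← Complex.ofReal_cos, ← Complex.ofReal_sin, map_mul,
          map_add, Complex.conj_ofReal, Complex.conj_I]
        ring
      rw [this]
      simp only [hE]
      simp [-Complex.ofReal_cos, -Complex.ofReal_sin]
      ring
    have h9 : 0 < (E t * conj (u t)).re := by
      rw [h8]
      apply mul_pos hε0
      have hcs := Real.cos_sq_add_sin_sq t
      rcases eq_or_ne (Real.cos t) 0 with h | h
      · rw [h] at hcs ⊢
        have : Real.sin t ^ 2 = 1 := by linarith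
        rw [this]; linarith
      · have : 0 < Real.cos t ^ 2 := by positivity
        nlinarith [mul_pos hl0 this, mul_nonneg hM0.le (sq_nonneg (Real.sin t))]
    have h10 := congrArg (fun z => (z * conj (u t)).re) h6
    simp only [add_mul, mul_assoc, Complex.add_re, Complex.re_ofReal_mul, zero_mul,
      Complex.zero_re] at h10
    have hs1 : 0 ≤ 1 - s := by linarith [hs.2]
    rcases hs.1.eq_or_lt with h11 | h11
    · rw [← h11] at h10; linarith
    · have h12 := mul_nonneg hs1 h7.le
      have h13 := mul_pos h11 h9
      linarith
  · intro s _
    simp [hup, hEp]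

end Degree

/-! ### Homeomorphisms preserve or exchange the boundary circles. -/

section BoundaryOrder

variable {r R r' R' : ℝ}

/-- On a small connected collar the function avoids a middle level, hence stays on one side of it;
since it leaves every compact subinterval, it can only tend to the endpoint on that side. -/
theorem tendsto_or_of_escape {l : Filter ℂ} {u : ℂ → ℝ} {A : Set ℂ} {a b : ℝ} (hab : a < b)
    (hconn : ∀ s ∈ l, ∃ t ∈ l, t ⊆ s ∧ IsPreconnected t) (hu : ContinuousOn u A) (hA : A ∈ l)
    (hr : ∀ x ∈ A, a < u x ∧ u x < b)
    (hesc : ∀ c d, a < c → d < b → ∀ᶠ x in l, u x < c ∨ d < u x) :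
    Tendsto u l (𝓝 a) ∨ Tendsto u l (𝓝 b) := by
  obtain ⟨μ, hμ1, hμ2⟩ := exists_between hab
  obtain ⟨t, htl, hts, htc⟩ := hconn _ (inter_mem hA (hesc μ μ hμ1 hμ2))
  have hut : ContinuousOn u t := hu.mono fun x hx => (hts hx).1
  have hside : (∀ x ∈ t, u x < μ) ∨ ∀ x ∈ t, μ < u x := by
    by_contra! hcon
    obtain ⟨⟨x, hx, hxμ⟩, y, hy, hyμ⟩ := hcon
    obtain ⟨z, hz, hzμ⟩ := htc.intermediate_value hy hx hut ⟨hyμ, hxμ⟩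
    rcases (hts hz).2 with h | h
    · exact h.ne hzμ
    · exact h.ne' hzμ
  rcases hside with h | h
  · left
    rw [tendsto_order]
    refine ⟨fun c hc => ?_, fun c hc => ?_⟩
    · filter_upwards [hA] with x hx using hc.trans (hr x hx).1
    · filter_upwards [htl, hesc c μ hc hμ2] with x hx h2
      exact h2.resolve_right (h x hx).not_gt
  · right
    rw [tendsto_order]
    refine ⟨fun c hc => ?_, fun c hc => ?_⟩
    · filter_upwards [htl, hesc μ c hμ1 hc] with x hx h2
      exact h2.resolve_left (h x hx).not_gt
    · filter_upwards [hA] with x hx using (hr x hx).2.trans hc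

theorem exists_preconnected_collar (hr : 0 < r) (R ρ : ℝ) :
    ∀ s ∈ comap norm (𝓝 ρ) ⊓ 𝓟 (annulus r R), ∃ t ∈ comap norm (𝓝 ρ) ⊓ 𝓟 (annulus r R),
      t ⊆ s ∧ IsPreconnected t := by
  intro s hs
  obtain ⟨ε, hε, h⟩ := eventually_comap_norm_iff.mp hs
  refine ⟨annulus (max r (ρ - ε)) (min R (ρ + ε)), ?_, ?_, ?_⟩
  · change ∀ᶠ x in _, x ∈ annulus (max r (ρ - ε)) (min R (ρ + ε))
    rw [eventually_comap_norm_iff]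
    refine ⟨ε, hε, fun x hx hxε => ?_⟩
    rw [abs_lt] at hxε
    exact ⟨max_lt hx.1 (by linarith [hxε.1]), lt_min hx.2 (by linarith [hxε.2])⟩
  · intro x hx
    refine h x ⟨(le_max_left _ _).trans_lt hx.1, hx.2.trans_le (min_le_left _ _)⟩ ?_
    rw [abs_lt]
    have h1 := (le_max_right _ _).trans_lt hx.1
    have h2 := hx.2.trans_le (min_le_right _ _)
    constructor <;> linarith
  · exact isPreconnected_annulus (lt_max_of_lt_left hr) _

/-- Properness of a homeomorphism: it is why `|h|` escapes every compact subinterval near each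
boundary circle. -/
theorem isCompact_preimage_closedAnnulus {h : ℂ → ℂ} (e : annulus r R ≃ₜ annulus r' R')
    (he : ∀ x, (e x : ℂ) = h x) {c d : ℝ} (hc : r' < c) (hd : d < R') :
    IsCompact {x | x ∈ annulus r R ∧ h x ∈ closedAnnulus c d} := by
  have h1 : IsCompact ((↑) ⁻¹' closedAnnulus c d : Set (annulus r' R')) := by
    rw [Subtype.isCompact_iff, Subtype.image_preimage_coe,
      inter_eq_right.mpr (closedAnnulus_subset hc hd)]
    exact isCompact_closedAnnulus c d
  have h2 := (e.isCompact_preimage).mpr h1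
  rw [Subtype.isCompact_iff] at h2
  convert h2 using 1
  ext x
  simp only [mem_ofPred_eq, mem_image, mem_preimage, he, Subtype.exists, exists_and_right,
    exists_eq_right]
  exact ⟨fun h => ⟨h.1, h.2⟩, fun ⟨h, h'⟩ => ⟨h, h'⟩⟩

/-- If `u` tends to `a` at both ends of the annulus then `u` attains its maximum unless `u ≤ a`. -/
theorem exists_forall_le_of_tendsto {u : ℂ → ℝ} (hu : ContinuousOn u (annulus r R))
    {a : ℝ} (h1 : Tendsto u (comap norm (𝓝 r) ⊓ 𝓟 (annulus r R)) (𝓝 a))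
    (h2 : Tendsto u (comap norm (𝓝 R) ⊓ 𝓟 (annulus r R)) (𝓝 a)) {x₁ : ℂ}
    (hx₁ : x₁ ∈ annulus r R) (ha : a < u x₁) :
    ∃ x₀ ∈ annulus r R, ∀ x ∈ annulus r R, u x ≤ u x₀ := by
  obtain ⟨ε₁, hε₁, h₁⟩ := eventually_comap_norm_iff.mp (h1.eventually_lt_const ha)
  obtain ⟨ε₂, hε₂, h₂⟩ := eventually_comap_norm_iff.mp (h2.eventually_lt_const ha)
  have hin : ∀ x ∈ annulus r R, u x₁ ≤ u x → x ∈ closedAnnulus (r + ε₁) (R - ε₂) := by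
    intro x hx hux
    constructor
    · by_contra hlt
      have := h₁ x hx (by rw [abs_of_pos (sub_pos.mpr hx.1)]; linarith)
      linarith
    · by_contra hlt
      have := h₂ x hx (by rw [abs_sub_comm, abs_of_pos (sub_pos.mpr hx.2)]; linarith)
      linarith
  have hK := isCompact_closedAnnulus (r + ε₁) (R - ε₂)
  have hKA : closedAnnulus (r + ε₁) (R - ε₂) ⊆ annulus r R :=
    closedAnnulus_subset (by linarith) (by linarith)
  obtain ⟨x₀, hx₀, hmax⟩ := hK.exists_isMaxOn ⟨x₁, hin x₁ hx₁ le_rfl⟩ (hu.mono hKA)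
  refine ⟨x₀, hKA hx₀, fun x hx => ?_⟩
  by_cases h : u x₁ ≤ u x
  · exact hmax (hin x hx h)
  · exact (not_le.mp h).le.trans (hmax (hin x₁ hx₁ le_rfl))

/-- A homeomorphism between annuli preserves or reverses the order of the boundary components. -/
theorem preservesBoundaryOrder_or (hr : 0 < r) (hrR : r < R) (hr' : 0 < r') (hrR' : r' < R')
    {h : ℂ → ℂ} (e : annulus r R ≃ₜ annulus r' R') (he : ∀ x, (e x : ℂ) = h x) :
    PreservesBoundaryOrder r R r' R' h ∨ PreservesBoundaryOrder r R R' r' h := by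
  have hc : ContinuousOn h (annulus r R) := by
    rw [continuousOn_iff_continuous_domRestrict]
    exact (continuous_subtype_val.comp e.continuous).congr fun x => he x
  have hmem : ∀ x ∈ annulus r R, h x ∈ annulus r' R' := fun x hx => by
    rw [← he ⟨x, hx⟩]; exact (e _).2
  have hsurj : ∀ y ∈ annulus r' R', ∃ x ∈ annulus r R, h x = y := fun y hy =>
    ⟨e.symm ⟨y, hy⟩, (e.symm _).2, by rw [← he, e.apply_symm_apply]⟩
  have hesc : ∀ ρ, ρ = r ∨ ρ = R → ∀ c d, r' < c → d < R' →
      ∀ᶠ x in comap norm (𝓝 ρ) ⊓ 𝓟 (annulus r R), ‖h x‖ < c ∨ d < ‖h x‖ := by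
    intro ρ hρ c d hc' hd'
    have hK := isCompact_preimage_closedAnnulus e he hc' hd'
    have hKn := (hK.image continuous_norm).isClosed
    have hρn : ρ ∉ norm '' {x | x ∈ annulus r R ∧ h x ∈ closedAnnulus c d} := by
      rintro ⟨x, ⟨hx, -⟩, hxρ⟩
      rcases hρ with rfl | rfl
      · exact hx.1.ne' hxρ
      · exact hx.2.ne hxρ
    rw [eventually_inf_principal]
    filter_upwards [preimage_mem_comap (hKn.isOpen_compl.mem_nhds hρn)] with x hx hxA
    by_contra! hcon
    exact hx ⟨x, ⟨hxA, hcon.1, hcon.2⟩, rfl⟩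
  have hAm : ∀ ρ, annulus r R ∈ comap norm (𝓝 ρ) ⊓ 𝓟 (annulus r R) := fun ρ =>
    mem_inf_of_right (mem_principal_self _)
  have key := fun ρ hρ => tendsto_or_of_escape hrR' (exists_preconnected_collar hr R ρ)
    hc.norm (hAm ρ) (fun x hx => hmem x hx) (hesc ρ hρ)
  have hx : ∀ s ∈ Ioo r' R', ∃ x ∈ annulus r R, ‖h x‖ = s := by
    intro s hs
    have h0 : ‖(s : ℂ)‖ = s := by
      rw [Complex.norm_real, Real.norm_of_nonneg (hr'.trans hs.1).le]
    obtain ⟨x, hx, hxs⟩ := hsurj (s : ℂ) ⟨by rw [h0]; exact hs.1, by rw [h0]; exact hs.2⟩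
    exact ⟨x, hx, by rw [hxs, h0]⟩
  obtain ⟨μ, hμ⟩ := exists_between hrR'
  obtain ⟨x₁, hx₁, hx₁'⟩ := hx μ hμ
  rcases key r (Or.inl rfl) with h1 | h1 <;> rcases key R (Or.inr rfl) with h2 | h2
  · exfalso
    -- If `|h|` had the same limit `r'` at both circles it would attain a maximum inside,
    -- contradicting that all moduli below `R'` are taken.
    obtain ⟨x₀, hx₀, hmax⟩ := exists_forall_le_of_tendsto hc.norm h1 h2 hx₁ (show r' < ‖h x₁‖ by rw [hx₁']; exact hμ.1)
    obtain ⟨s, hs1, hs2⟩ := exists_between (hmem x₀ hx₀).2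
    obtain ⟨x, hxA, hxs⟩ := hx s ⟨(hmem x₀ hx₀).1.trans hs1, hs2⟩
    have := hmax x hxA
    linarith
  · exact Or.inl ⟨h1, h2⟩
  · exact Or.inr ⟨h1, h2⟩
  · exfalso
    obtain ⟨x₀, hx₀, hmax⟩ := exists_forall_le_of_tendsto hc.norm.neg h1.neg h2.neg hx₁
      (neg_lt_neg (show ‖h x₁‖ < R' by rw [hx₁']; exact hμ.2))
    obtain ⟨s, hs1, hs2⟩ := exists_between (hmem x₀ hx₀).1
    obtain ⟨x, hxA, hxs⟩ := hx s ⟨hs1, hs2.trans (hmem x₀ hx₀).2⟩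
    have : -‖h x‖ ≤ -‖h x₀‖ := hmax x hxA
    linarith

end BoundaryOrder

/-! ### The normal identity for continuous Sobolev maps. -/

section Homeomorphisms

open scoped ComplexConjugate

theorem integrable_coeff_mul {μ : Measure ℂ} [IsFiniteMeasure μ] {S T : Set ℂ} {B : ℂ × ℂ → ℂ}
    (hBm : Measurable B) (hBc : ContinuousOn B (S ×ˢ T)) (hS : IsCompact S) (hT : IsCompact T)
    (hμS : ∀ᵐ x ∂μ, x ∈ S) {h : ℂ → ℂ} (hm : AEStronglyMeasurable h μ) (hhT : ∀ᵐ x ∂μ, h x ∈ T)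
    {G : ℂ → ℂ →L[ℝ] ℂ} (hG : MemLp G 2 μ) {d : ℂ → ℂ} (hd : Continuous d) :
    Integrable (fun x => (B (x, h x) * G x (d x)).re) μ := by
  obtain ⟨C, b1, b2, -⟩ := coeff_aux (h := fun _ => h) (h₀ := h) hBm hBc hS hT hμS (fun _ => hm)
    (fun _ => hhT) (Eventually.of_forall fun _ => tendsto_const_nhds)
  exact (MemLp.integrable_mul_two (memLp_coeff (b1 0) (b2 0))
    (MemLp.clm_apply_bounded hG hd hS hμS)).re

theorem integrable_coeff {μ : Measure ℂ} [IsFiniteMeasure μ] {S T : Set ℂ} {B : ℂ × ℂ → ℝ}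
    (hBm : Measurable B) (hBc : ContinuousOn B (S ×ˢ T)) (hS : IsCompact S) (hT : IsCompact T)
    (hμS : ∀ᵐ x ∂μ, x ∈ S) {h : ℂ → ℂ} (hm : AEStronglyMeasurable h μ) (hhT : ∀ᵐ x ∂μ, h x ∈ T) :
    Integrable (fun x => B (x, h x)) μ := by
  obtain ⟨C, b1, b2, -⟩ := coeff_aux (B := fun p => (B p : ℂ)) (h := fun _ => h) (h₀ := h)
    (Complex.measurable_ofReal.comp hBm) (Complex.continuous_ofReal.comp_continuousOn hBc) hS hT hμS
    (fun _ => hm) (fun _ => hhT) (Eventually.of_forall fun _ => tendsto_const_nhds)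
  simpa using ((memLp_coeff (b1 0) (b2 0)).integrable (by norm_num)).re

variable {r R m M a b : ℝ} {h : ℂ → ℂ} {G : ℂ → ℂ →L[ℝ] ℂ}

/-- Membership in `T` is required only eventually: for the tangential coefficient `T` must exclude
the origin, which mollifications avoid only at small scales. -/
theorem HasWeakDeriv.tendsto_integral_coeff_mul_smoothApprox
    (hc : ContinuousOn h (annulus r R)) (hw : HasWeakDeriv (annulus r R) h G)
    (hh : MemLp h 2 (volume.restrict (annulus r R)))
    (hG : MemLp G 2 (volume.restrict (annulus r R))) (ha : r < a) (hb : b < R) {T : Set ℂ}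
    (hT : IsCompact T) (hmem : ∀ᶠ n in atTop, ∀ x ∈ closedAnnulus a b, smoothApprox r R h n x ∈ T)
    {B : ℂ × ℂ → ℂ} (hBm : Measurable B) (hBc : ContinuousOn B (closedAnnulus a b ×ˢ T))
    {d : ℂ → ℂ} (hd : Continuous d) :
    Tendsto (fun n => ∫ x in closedAnnulus a b, (B (x, smoothApprox r R h n x) *
      fderiv ℝ (smoothApprox r R h n) x (d x)).re) atTop
      (𝓝 (∫ x in closedAnnulus a b, (B (x, h x) * G x (d x)).re)) := by
  have hKm := measurableSet_closedAnnulus a b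
  have hsub := closedAnnulus_subset (r := r) (R := R) ha hb
  obtain ⟨N, hN⟩ := eventually_atTop.mp hmem
  rw [← tendsto_add_atTop_iff_nat N]
  have hG0 : MemLp G 2 (volume.restrict (closedAnnulus a b)) :=
    hG.mono_measure (Measure.restrict_mono hsub le_rfl)
  have hGn : ∀ n, MemLp (fderiv ℝ (smoothApprox r R h n)) 2
      (volume.restrict (closedAnnulus a b)) := fun n => by
    have hcd : Continuous (fderiv ℝ (smoothApprox r R h n)) :=
      (contDiff_smoothApprox hh n).continuous_fderiv (by simp)
    obtain ⟨C, hC⟩ := (isCompact_closedAnnulus a b).exists_bound_of_continuousOn hcd.continuousOn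
    exact MemLp.of_bound hcd.aestronglyMeasurable C
      (by filter_upwards [ae_restrict_mem hKm] with x hx using hC x hx)
  have hs := tendsto_eLpNorm_fderiv_smoothApprox hw hh hG ha hb
  refine tendsto_integral_coeff_mul hBm hBc (isCompact_closedAnnulus a b) hT
    (ae_restrict_mem hKm) (fun n => ?_) (fun n => ?_) ?_ (fun n => hGn _) hG0 ?_ hd
  · exact (contDiff_smoothApprox hh _).continuous.aestronglyMeasurable
  · filter_upwards [ae_restrict_mem hKm] with x hx using hN _ (Nat.le_add_left N n) x hx
  · filter_upwards [ae_restrict_mem hKm] with x hx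
    exact ((tendstoUniformlyOn_smoothApprox hc ha hb).tendsto_at hx).comp
      (tendsto_add_atTop_nat N)
  · intro g hg v
    exact (weak_of_strong hGn hG0 hs g hg v).comp (tendsto_add_atTop_nat N)

theorem tendsto_integral_coeff_smoothApprox (hc : ContinuousOn h (annulus r R))
    (hh : MemLp h 2 (volume.restrict (annulus r R))) (ha : r < a) (hb : b < R) {T : Set ℂ}
    (hT : IsCompact T) (hmem : ∀ n, ∀ x ∈ closedAnnulus a b, smoothApprox r R h n x ∈ T)
    {B : ℂ × ℂ → ℝ} (hBm : Measurable B) (hBc : ContinuousOn B (closedAnnulus a b ×ˢ T)) :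
    Tendsto (fun n => ∫ x in closedAnnulus a b, B (x, smoothApprox r R h n x)) atTop
      (𝓝 (∫ x in closedAnnulus a b, B (x, h x))) := by
  have hKm := measurableSet_closedAnnulus a b
  refine tendsto_integral_coeff hBm hBc (isCompact_closedAnnulus a b) hT
    (ae_restrict_mem hKm) (fun n => ?_) (fun n => ?_) ?_
  · exact (contDiff_smoothApprox hh _).continuous.aestronglyMeasurable
  · filter_upwards [ae_restrict_mem hKm] with x hx using hmem n x hx
  · filter_upwards [ae_restrict_mem hKm] with x hx
    exact ((tendstoUniformlyOn_smoothApprox hc ha hb).tendsto_at hx)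

theorem tendsto_circle_integral {F : ℕ → ℝ → ℝ} {f : ℝ → ℝ} {Φ : ℝ → ℝ} (hΦ : Continuous Φ)
    (hF : ∀ n, Continuous (F n)) {C : ℝ} (hC : ∀ n θ, |F n θ| ≤ C)
    (hlim : ∀ θ, Tendsto (fun n => F n θ) atTop (𝓝 (f θ))) :
    Tendsto (fun n => ∫ θ in (-Real.pi)..Real.pi, Φ (F n θ)) atTop
      (𝓝 (∫ θ in (-Real.pi)..Real.pi, Φ (f θ))) := by
  obtain ⟨D, hD⟩ := (isCompact_Icc (a := -C) (b := C)).exists_bound_of_continuousOn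
    hΦ.continuousOn
  refine intervalIntegral.tendsto_integral_filter_of_dominated_convergence (fun _ => D)
    (Eventually.of_forall fun n => (hΦ.comp (hF n)).aestronglyMeasurable)
    (Eventually.of_forall fun n => Eventually.of_forall fun θ _ => hD _ (abs_le.mp (hC n θ)))
    intervalIntegrable_const (Eventually.of_forall fun θ _ => (hΦ.tendsto _).comp (hlim θ))

/-- The smooth identity is applied to mollifications. Continuity of `h` makes them converge
uniformly, which is what the integrals over the two boundary circles need. -/
theorem setIntegral_normal_closedAnnulus (hr : 0 < r) (hc : ContinuousOn h (annulus r R))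
    (hM0 : 0 ≤ M) (hM : ∀ x ∈ annulus r R, ‖h x‖ ≤ M)
    (hw : HasWeakDeriv (annulus r R) h G) (hh : MemLp h 2 (volume.restrict (annulus r R)))
    (hG : MemLp G 2 (volume.restrict (annulus r R))) (ha : r < a) (hab : a ≤ b) (hb : b < R)
    {ζ Φ : ℝ → ℝ} (hζ : ContDiff ℝ 1 ζ) (hΦ : ContDiff ℝ 1 Φ) :
    (∫ x in closedAnnulus a b, (((ζ ‖x‖ * deriv Φ (‖h x‖ ^ 2) * 2 / ‖x‖ ^ 2 : ℝ) : ℂ) *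
      conj (h x) * G x x).re) + ∫ x in closedAnnulus a b, deriv ζ ‖x‖ * Φ (‖h x‖ ^ 2) / ‖x‖ =
    ζ b * (∫ θ in (-Real.pi)..Real.pi, Φ (‖h (b * Complex.exp (θ * Complex.I))‖ ^ 2)) -
      ζ a * ∫ θ in (-Real.pi)..Real.pi, Φ (‖h (a * Complex.exp (θ * Complex.I))‖ ^ 2) := by
  have ha0 := hr.trans ha
  have hΦd : Continuous (deriv Φ) := hΦ.continuous_deriv (by simp)
  have hζd : Continuous (deriv ζ) := hζ.continuous_deriv (by simp)
  have hS0 : ∀ x ∈ closedAnnulus a b, x ≠ 0 := fun x hx h0 => by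
    have := hx.1; rw [h0, norm_zero] at this; linarith
  have hMae : ∀ᵐ x ∂volume.restrict (annulus r R), ‖h x‖ ≤ M := by
    filter_upwards [ae_restrict_mem (measurableSet_annulus r R)] with x hx using hM x hx
  have hT := isCompact_closedAnnulus 0 M
  have hmem : ∀ n x, smoothApprox r R h n x ∈ closedAnnulus 0 M := fun n x =>
    ⟨norm_nonneg _, norm_smoothApprox_le hM0 hMae n x⟩
  have t1 := hw.tendsto_integral_coeff_mul_smoothApprox hc hh hG ha hb hT
    (Eventually.of_forall fun n x _ => hmem n x) (measurable_normalCoeff hζ.continuous hΦd)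
    (continuousOn_normalCoeff hζ.continuous hΦd hS0) continuous_id
  have t2 := tendsto_integral_coeff_smoothApprox hc hh ha hb hT
    (fun n x _ => hmem n x) (measurable_normalCoeff' hζd hΦ.continuous)
    (continuousOn_normalCoeff' hζd hΦ.continuous hS0)
  have t3 : ∀ t ∈ Icc a b, Tendsto (fun n => ∫ θ in (-Real.pi)..Real.pi,
      Φ (‖smoothApprox r R h n (t * Complex.exp (θ * Complex.I))‖ ^ 2)) atTop
      (𝓝 (∫ θ in (-Real.pi)..Real.pi, Φ (‖h (t * Complex.exp (θ * Complex.I))‖ ^ 2))) := by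
    intro t ht
    refine tendsto_circle_integral (F := fun n θ =>
      ‖smoothApprox r R h n (t * Complex.exp (θ * Complex.I))‖ ^ 2) hΦ.continuous (fun n => ?_)
      (C := M ^ 2) (fun n θ => ?_) (fun θ => ?_)
    · have := (contDiff_smoothApprox hh n).continuous
      fun_prop
    · rw [abs_of_nonneg (by positivity)]
      exact pow_le_pow_left₀ (norm_nonneg _) (hmem n _).2 2
    · exact (((tendstoUniformlyOn_smoothApprox hc ha hb).tendsto_at
        (polar_mem_closedAnnulus ha0 ht θ)).norm).pow 2
  have t4 := ((t3 b ⟨hab, le_rfl⟩).const_mul (ζ b)).sub ((t3 a ⟨le_rfl, hab⟩).const_mul (ζ a))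
  refine tendsto_nhds_unique (t1.add t2) (t4.congr fun n => ?_)
  have hf := contDiff_smoothApprox hh n
  have hfc := hf.continuous
  have hdc : Continuous (fderiv ℝ (smoothApprox r R h n)) := hf.continuous_fderiv (by simp)
  have key := setIntegral_normal_smooth ha0 hab (hf.of_le (by simp)) hζ hΦ
  have hΦc := hΦ.continuous
  rw [intervalIntegral.integral_sub (Continuous.intervalIntegrable (by fun_prop) _ _)
    (Continuous.intervalIntegrable (by fun_prop) _ _), intervalIntegral.integral_const_mul,
    intervalIntegral.integral_const_mul] at key
  rw [← key]
  have hGn : MemLp (fderiv ℝ (smoothApprox r R h n)) 2 (volume.restrict (closedAnnulus a b)) := by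
    obtain ⟨C, hC⟩ := (isCompact_closedAnnulus a b).exists_bound_of_continuousOn hdc.continuousOn
    exact MemLp.of_bound hdc.aestronglyMeasurable C
      (by filter_upwards [ae_restrict_mem (measurableSet_closedAnnulus a b)] with x hx using hC x hx)
  have hKae := ae_restrict_mem (μ := volume) (measurableSet_closedAnnulus a b)
  rw [← integral_add (integrable_coeff_mul (measurable_normalCoeff hζ.continuous hΦd)
      (continuousOn_normalCoeff hζ.continuous hΦd hS0) (isCompact_closedAnnulus a b) hT hKae
      hfc.aestronglyMeasurable (Eventually.of_forall (hmem n)) hGn continuous_id)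
    (integrable_coeff (measurable_normalCoeff' hζd hΦ.continuous)
      (continuousOn_normalCoeff' hζd hΦ.continuous hS0) (isCompact_closedAnnulus a b) hT hKae
      hfc.aestronglyMeasurable (Eventually.of_forall (hmem n)))]
  refine setIntegral_congr_fun (measurableSet_closedAnnulus a b) fun x hx => ?_
  have hx0 : ‖x‖ ≠ 0 := norm_ne_zero_iff.mpr (hS0 x hx)
  simp only [id, mul_assoc, Complex.re_ofReal_mul]
  field_simp

end Homeomorphisms

/-! ### The tangential identity, and exhaustion of the open annulus. -/

section Homeomorphisms

open scoped ComplexConjugate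

variable {r R r' R' m M a b p₀ P₀ : ℝ} {k : ℤ} {h : ℂ → ℂ} {G : ℂ → ℂ →L[ℝ] ℂ}

/-- Once the mollification is within `m / 2` of `h`, its quotient by `h` lies in the slit plane;
adding the periodic principal logarithm of the quotient to a logarithm of `h` shows that the
mollification has the same degree `k`. -/
theorem setIntegral_tangential_closedAnnulus (hr : 0 < r) (hc : ContinuousOn h (annulus r R))
    (hm : 0 < m) (hmM : ∀ x ∈ annulus r R, m ≤ ‖h x‖ ∧ ‖h x‖ ≤ M)
    (hw : HasWeakDeriv (annulus r R) h G) (hh : MemLp h 2 (volume.restrict (annulus r R)))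
    (hG : MemLp G 2 (volume.restrict (annulus r R))) (ha : r < a) (hab : a ≤ b) (hb : b < R)
    (hL : ∀ t ∈ Ioo r R, ∃ L : ℝ → ℂ, Continuous L ∧
      (∀ θ : ℝ, Complex.exp (L θ) = h (t * Complex.exp (θ * Complex.I))) ∧
      L Real.pi - L (-Real.pi) = 2 * Real.pi * Complex.I * k)
    {ζ : ℝ → ℝ} (hζ : Continuous ζ) :
    ∫ x in closedAnnulus a b, (((ζ ‖x‖ / ‖h x‖ ^ 2 / ‖x‖ ^ 2 : ℝ) : ℂ) *
      (-Complex.I * conj (h x)) * G x (Complex.I * x)).re =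
      2 * Real.pi * k * ∫ t in a..b, ζ t / t := by
  have ha0 := hr.trans ha
  have hS0 : ∀ x ∈ closedAnnulus a b, x ≠ 0 := fun x hx h0 => by
    have := hx.1; rw [h0, norm_zero] at this; linarith
  have hsub := closedAnnulus_subset (r := r) (R := R) ha hb
  have hMae : ∀ᵐ x ∂volume.restrict (annulus r R), ‖h x‖ ≤ M := by
    filter_upwards [ae_restrict_mem (measurableSet_annulus r R)] with x hx using (hmM x hx).2
  have hM0 : 0 ≤ M := by
    have hxA : (a : ℂ) * Complex.exp ((0 : ℝ) * Complex.I) ∈ annulus r R :=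
      hsub (polar_mem_closedAnnulus ha0 ⟨le_rfl, hab⟩ 0)
    exact hm.le.trans ((hmM _ hxA).1.trans (hmM _ hxA).2)
  have hT := isCompact_closedAnnulus (m / 2) M
  have hunif : ∀ᶠ n in atTop, ∀ x ∈ closedAnnulus a b, ‖h x - smoothApprox r R h n x‖ < m / 2 := by
    have := Metric.tendstoUniformlyOn_iff.mp (tendstoUniformlyOn_smoothApprox hc ha hb) (m / 2)
      (by positivity)
    simpa only [dist_eq_norm] using this
  have hmem : ∀ᶠ n in atTop, ∀ x ∈ closedAnnulus a b,
      smoothApprox r R h n x ∈ closedAnnulus (m / 2) M := by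
    filter_upwards [hunif] with n hn x hx
    refine ⟨?_, norm_smoothApprox_le hM0 hMae n x⟩
    have h1 := norm_sub_norm_le (h x) (smoothApprox r R h n x)
    have h2 := hn x hx
    have h3 := (hmM x (hsub hx)).1
    linarith
  have t1 := hw.tendsto_integral_coeff_mul_smoothApprox hc hh hG ha hb hT hmem
    (measurable_tangentialCoeff hζ) (continuousOn_tangentialCoeff hζ hS0 (fun y hy h0 => by
      have := hy.1; rw [h0, norm_zero] at this; linarith)) (d := fun x => Complex.I * x)
    (by fun_prop)
  refine tendsto_nhds_unique t1 (tendsto_const_nhds.congr' ?_)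
  filter_upwards [hunif, hmem] with n hn hn2
  have hf := contDiff_smoothApprox hh n
  rw [← setIntegral_angular_arg ha0 hab (hf.of_le (by simp)) hζ (k := k)]
  · refine setIntegral_congr_fun (measurableSet_closedAnnulus a b) fun x hx => ?_
    have hx0 : ‖x‖ ≠ 0 := norm_ne_zero_iff.mpr (hS0 x hx)
    have e : ∀ z w : ℂ, (-Complex.I * z * w).re = (z * w).im := fun z w => by
      rw [mul_assoc, neg_mul, Complex.neg_re, Complex.I_mul_re, neg_neg]
    rw [mul_assoc, Complex.re_ofReal_mul, e]
    ring
  · intro t ht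
    obtain ⟨L, hLc, hLe, hLk⟩ := hL t ⟨ha.trans_le ht.1, ht.2.trans_lt hb⟩
    set γ : ℝ → ℂ := fun θ => t * Complex.exp (θ * Complex.I)
    have hγ : ∀ θ, γ θ ∈ closedAnnulus a b := fun θ => polar_mem_closedAnnulus ha0 ht θ
    have hγc : Continuous γ := by fun_prop
    have hhc : Continuous fun θ => h (γ θ) := hc.comp_continuous hγc fun θ => hsub (hγ θ)
    have hne : ∀ θ, h (γ θ) ≠ 0 := fun θ h0 => by
      have := (hmM _ (hsub (hγ θ))).1; rw [h0, norm_zero] at this; linarith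
    set q : ℝ → ℂ := fun θ => smoothApprox r R h n (γ θ) / h (γ θ) with hq
    have hqs : ∀ θ, q θ ∈ Complex.slitPlane := fun θ => by
      have e : q θ = 1 + (smoothApprox r R h n (γ θ) - h (γ θ)) / h (γ θ) := by
        have := hne θ
        simp only [hq]; field_simp; ring
      rw [e]
      apply Complex.mem_slitPlane_of_norm_lt_one
      have h1 : 0 < ‖h (γ θ)‖ := norm_pos_iff.mpr (hne θ)
      rw [norm_div, div_lt_one h1, norm_sub_rev]
      have := hn _ (hγ θ)
      have := (hmM _ (hsub (hγ θ))).1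
      linarith
    have hqc : Continuous q := ((hf.continuous.comp hγc).div hhc hne)
    refine ⟨fun θ => L θ + Complex.log (q θ), hLc.add (hqc.clog hqs), fun θ => ?_, ?_⟩
    · rw [Complex.exp_add, hLe, Complex.exp_log (Complex.slitPlane_ne_zero (hqs θ))]
      exact mul_div_cancel₀ _ (hne θ)
    · have hγp : γ Real.pi = γ (-Real.pi) := by
        simp only [γ]
        push_cast
        rw [neg_mul, Complex.exp_neg, Complex.exp_pi_mul_I]; norm_num
      have hqp : q Real.pi = q (-Real.pi) := by simp only [hq, hγp]
      simp only [hqp]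
      rw [← hLk]; ring

theorem tendsto_norm_circle {ρ : ℝ} (hr : 0 < r)
    (hp : Tendsto (fun x => ‖h x‖) (comap norm (𝓝 ρ) ⊓ 𝓟 (annulus r R)) (𝓝 p₀)) {t : ℕ → ℝ}
    (ht : ∀ j, t j ∈ Ioo r R) (hlim : Tendsto t atTop (𝓝 ρ)) (θ : ℝ) :
    Tendsto (fun j => ‖h (t j * Complex.exp (θ * Complex.I))‖) atTop (𝓝 p₀) := by
  have hn : ∀ j, ‖(t j : ℂ) * Complex.exp (θ * Complex.I)‖ = t j := fun j =>
    norm_mul_exp_mul_I (hr.trans (ht j).1).le θ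
  refine hp.comp (tendsto_inf.mpr ⟨tendsto_comap_iff.mpr (hlim.congr fun j => (hn j).symm), ?_⟩)
  refine tendsto_principal.mpr (Eventually.of_forall fun j => ⟨?_, ?_⟩)
  · rw [hn]; exact (ht j).1
  · rw [hn]; exact (ht j).2

/-- Continuous `W^{1,2}` maps whose modulus has limits at the boundary circles satisfy the integral
identities of `IsAnnularMap`. -/
theorem isAnnularMap_of_continuousOn (hr : 0 < r) (hrR : r < R) (hc : ContinuousOn h (annulus r R))
    (hm : 0 < m) (hmM : ∀ x ∈ annulus r R, m ≤ ‖h x‖ ∧ ‖h x‖ ≤ M)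
    (hw : HasWeakDeriv (annulus r R) h G) (hh : MemLp h 2 (volume.restrict (annulus r R)))
    (hG : MemLp G 2 (volume.restrict (annulus r R)))
    (hp : Tendsto (fun x => ‖h x‖) (comap norm (𝓝 r) ⊓ 𝓟 (annulus r R)) (𝓝 p₀))
    (hP : Tendsto (fun x => ‖h x‖) (comap norm (𝓝 R) ⊓ 𝓟 (annulus r R)) (𝓝 P₀))
    (hL : ∀ t ∈ Ioo r R, ∃ L : ℝ → ℂ, Continuous L ∧
      (∀ θ : ℝ, Complex.exp (L θ) = h (t * Complex.exp (θ * Complex.I))) ∧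
      L Real.pi - L (-Real.pi) = 2 * Real.pi * Complex.I * k) :
    IsAnnularMap r R m M (p₀ ^ 2) (P₀ ^ 2) k h G := by
  have hA := measurableSet_annulus r R
  have hAae := ae_restrict_mem (μ := volume) hA
  have hS : IsCompact (closedAnnulus r R) := isCompact_closedAnnulus r R
  have hT := isCompact_closedAnnulus m M
  have hS0 : ∀ x ∈ closedAnnulus r R, x ≠ 0 := fun x hx h0 => by
    have := hx.1; rw [h0, norm_zero] at this; linarith
  have hT0 : ∀ x ∈ closedAnnulus m M, x ≠ 0 := fun x hx h0 => by
    have := hx.1; rw [h0, norm_zero] at this; linarith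
  have hμS : ∀ᵐ x ∂volume.restrict (annulus r R), x ∈ closedAnnulus r R := by
    filter_upwards [hAae] with x hx using annulus_subset_closedAnnulus r R hx
  have hbd : ∀ᵐ x ∂volume.restrict (annulus r R), h x ∈ closedAnnulus m M := by
    filter_upwards [hAae] with x hx using hmM x hx
  have hM0 : 0 ≤ M := by
    obtain ⟨t, ht⟩ := exists_between hrR
    have hn : ‖((t : ℝ) : ℂ)‖ = t := by
      rw [Complex.norm_real, Real.norm_of_nonneg (hr.trans ht.1).le]
    have := hmM (t : ℂ) ⟨by rw [hn]; exact ht.1, by rw [hn]; exact ht.2⟩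
    exact hm.le.trans (this.1.trans this.2)
  have hin : ∀ j, innerRadius r R j ∈ Ioo r R := fun j =>
    ⟨lt_innerRadius hrR j, (innerRadius_lt_outerRadius hrR j).trans (outerRadius_lt hrR j)⟩
  have hout : ∀ j, outerRadius r R j ∈ Ioo r R := fun j =>
    ⟨(lt_innerRadius hrR j).trans (innerRadius_lt_outerRadius hrR j), outerRadius_lt hrR j⟩
  refine ⟨hw, hh, hG, hbd, fun ζ Φ hζ hΦ => ?_, fun ζ hζ => ?_⟩
  · have hΦd : Continuous (deriv Φ) := hΦ.continuous_deriv (by simp)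
    have hζd : Continuous (deriv ζ) := hζ.continuous_deriv (by simp)
    have i1 := integrable_coeff_mul (measurable_normalCoeff hζ.continuous hΦd)
      (continuousOn_normalCoeff hζ.continuous hΦd hS0) hS hT hμS hh.1 hbd hG continuous_id
    have i2 := integrable_coeff (measurable_normalCoeff' hζd hΦ.continuous)
      (continuousOn_normalCoeff' hζd hΦ.continuous hS0) hS hT hμS hh.1 hbd
    have t1 := (tendsto_setIntegral_exhaustion hrR i1).add (tendsto_setIntegral_exhaustion hrR i2)
    -- Along circles shrinking to a boundary circle, `|h|` tends to a constant, so the circle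
    -- integrals tend to `2π` times a value of `Φ`; no boundary values of `h` itself are involved.
    have circ : ∀ (ρ q₀ : ℝ) (t : ℕ → ℝ), (∀ j, t j ∈ Ioo r R) → Tendsto t atTop (𝓝 ρ) →
        Tendsto (fun x => ‖h x‖) (comap norm (𝓝 ρ) ⊓ 𝓟 (annulus r R)) (𝓝 q₀) →
        Tendsto (fun j => ζ (t j) *
          ∫ θ in (-Real.pi)..Real.pi, Φ (‖h (t j * Complex.exp (θ * Complex.I))‖ ^ 2)) atTop
          (𝓝 (ζ ρ * (2 * Real.pi * Φ (q₀ ^ 2)))) := by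
      intro ρ q₀ t ht hlim hq
      have hmemA : ∀ j (θ : ℝ), (t j : ℂ) * Complex.exp (θ * Complex.I) ∈ annulus r R := fun j θ =>
        by
          have := norm_mul_exp_mul_I (hr.trans (ht j).1).le θ
          exact ⟨by rw [this]; exact (ht j).1, by rw [this]; exact (ht j).2⟩
      have := tendsto_circle_integral (F := fun j θ => ‖h (t j * Complex.exp (θ * Complex.I))‖ ^ 2)
        (f := fun _ => q₀ ^ 2) hΦ.continuous (fun j => ?_) (C := M ^ 2) (fun j θ => ?_)
        (fun θ => (tendsto_norm_circle hr hq ht hlim θ).pow 2)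
      · refine ((hζ.continuous.tendsto ρ).comp hlim).mul ?_
        convert this using 2
        rw [intervalIntegral.integral_const, smul_eq_mul]
        ring
      · exact (hc.comp_continuous (by fun_prop) (hmemA j)).norm.pow 2
      · rw [abs_of_nonneg (by positivity)]
        exact pow_le_pow_left₀ (norm_nonneg _) (hmM _ (hmemA j θ)).2 2
    have t2 := (circ R P₀ _ hout (tendsto_outerRadius r R) hP).sub
      (circ r p₀ _ hin (tendsto_innerRadius r R) hp)
    have e := tendsto_nhds_unique t1 (t2.congr fun j => (setIntegral_normal_closedAnnulus hr hc hM0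
      (fun x hx => (hmM x hx).2) hw hh hG (lt_innerRadius hrR j)
      (innerRadius_lt_outerRadius hrR j).le (outerRadius_lt hrR j) hζ hΦ).symm)
    simp only [id] at e
    rw [e]; ring
  · have i1 := integrable_coeff_mul (measurable_tangentialCoeff hζ)
      (continuousOn_tangentialCoeff hζ hS0 hT0) hS hT hμS hh.1 hbd hG (d := fun x => Complex.I * x)
      (by fun_prop)
    have t1 := tendsto_setIntegral_exhaustion hrR i1
    have hint : IntervalIntegrable (fun t => ζ t / t) volume r R := by
      apply ContinuousOn.intervalIntegrable
      rw [uIcc_of_le hrR.le]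
      exact ContinuousOn.div hζ.continuousOn continuousOn_id fun t ht => (hr.trans_le ht.1).ne'
    have hcont := (intervalIntegral.continuousOn_primitive_interval' hint left_mem_uIcc)
    rw [uIcc_of_le hrR.le] at hcont
    have lim : ∀ (t : ℕ → ℝ) (ρ : ℝ), (∀ j, t j ∈ Ioo r R) → ρ ∈ Icc r R → Tendsto t atTop (𝓝 ρ) →
        Tendsto (fun j => ∫ s in r..t j, ζ s / s) atTop (𝓝 (∫ s in r..ρ, ζ s / s)) := by
      intro t ρ ht hρ hlim
      exact (hcont ρ hρ).tendsto.comp (tendsto_nhdsWithin_iff.mpr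
        ⟨hlim, Eventually.of_forall fun j => Ioo_subset_Icc_self (ht j)⟩)
    have t2 := ((lim _ R hout (right_mem_Icc.mpr hrR.le) (tendsto_outerRadius r R)).sub
      (lim _ r hin (left_mem_Icc.mpr hrR.le) (tendsto_innerRadius r R))).const_mul
      (2 * Real.pi * (k : ℝ))
    rw [intervalIntegral.integral_same, sub_zero] at t2
    refine tendsto_nhds_unique t1 (t2.congr fun j => ?_)
    have hsubi : ∀ t ∈ Ioo r R, IntervalIntegrable (fun t => ζ t / t) volume r t := fun t ht =>
      hint.mono_set (by
        rw [uIcc_of_le hrR.le, uIcc_of_le ht.1.le]; exact Icc_subset_Icc_right ht.2.le)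
    rw [intervalIntegral.integral_interval_sub_left (hsubi _ (hout j)) (hsubi _ (hin j))]
    exact (setIntegral_tangential_closedAnnulus hr hc hm hmM hw hh hG (lt_innerRadius hrR j)
      (innerRadius_lt_outerRadius hrR j).le (outerRadius_lt hrR j) hL hζ).symm

/-- `W^{1,2}` homeomorphisms between annuli satisfy the integral identities of `IsAnnularMap`. -/
theorem isAnnularMap_of_mem_sobolevHomeos (hr : 0 < r) (hrR : r < R) (hr' : 0 < r') (hrR' : r' < R')
    (hh : h ∈ sobolevHomeos r R r' R') :
    ∃ k : ℤ, (k = 1 ∨ k = -1) ∧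
      (h ∈ orientedSobolevHomeos r R r' R' → k = 1) ∧
      ((PreservesBoundaryOrder r R r' R' h ∧
        IsAnnularMap r R r' R' (r' ^ 2) (R' ^ 2) k h (weakDeriv (annulus r R) h)) ∨
      (PreservesBoundaryOrder r R R' r' h ∧
        IsAnnularMap r R r' R' (R' ^ 2) (r' ^ 2) k h (weakDeriv (annulus r R) h))) := by
  obtain ⟨⟨e, he⟩, hW⟩ := hh
  have hΩ := isOpen_annulus r R
  have hc : ContinuousOn h (annulus r R) := by
    rw [continuousOn_iff_continuous_domRestrict]
    exact (continuous_subtype_val.comp e.continuous).congr fun x => he x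
  have hmem : ∀ x ∈ annulus r R, h x ∈ annulus r' R' := fun x hx => by
    rw [← he ⟨x, hx⟩]; exact (e _).2
  have hmM : ∀ x ∈ annulus r R, r' ≤ ‖h x‖ ∧ ‖h x‖ ≤ R' := fun x hx =>
    ⟨(hmem x hx).1.le, (hmem x hx).2.le⟩
  obtain ⟨L, k, hk, hLc, hinj, hLe, hLk⟩ := exists_log_lift_of_homeo hr hrR hr' hrR' e he
  have hL : ∀ t ∈ Ioo r R, ∃ L : ℝ → ℂ, Continuous L ∧
      (∀ θ : ℝ, Complex.exp (L θ) = h (t * Complex.exp (θ * Complex.I))) ∧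
      L Real.pi - L (-Real.pi) = 2 * Real.pi * Complex.I * k := by
    intro t ht
    have ht0 := hr.trans ht.1
    have hz : ∀ θ : ℝ, (Real.log t : ℂ) + θ * Complex.I ∈ logStrip r R := fun θ => by
      simp only [logStrip, mem_ofPred_eq, Complex.add_re, Complex.ofReal_re, Complex.re_ofReal_mul,
        Complex.I_re, mul_zero, add_zero]
      exact ⟨Real.log_lt_log hr ht.1, Real.log_lt_log ht0 ht.2⟩
    refine ⟨fun θ => L (Real.log t + θ * Complex.I), hLc.comp_continuous (by fun_prop) hz,
      fun θ => ?_, ?_⟩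
    · rw [hLe _ (hz θ), Complex.exp_add, ← Complex.ofReal_exp, Real.exp_log ht0]
    · have := hLk _ (hz (-Real.pi))
      have e : (Real.log t : ℂ) + ((-Real.pi : ℝ) : ℂ) * Complex.I +
          ((2 * Real.pi : ℝ) : ℂ) * Complex.I = Real.log t + (Real.pi : ℝ) * Complex.I := by
        push_cast; ring
      rw [e] at this
      simp only [this]
      ring
  refine ⟨k, hk, fun ho => ?_, ?_⟩
  · exact degree_eq_one hr hrR hk hc hmem hLc hinj hLe hLk ho.2.1 ho.2.2
  · have key := fun (p₀ P₀ : ℝ) (hb : PreservesBoundaryOrder r R p₀ P₀ h) =>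
      isAnnularMap_of_continuousOn (k := k) hr hrR hc hr' hmM hW.hasWeakDeriv hW.1
        (hW.memLp_weakDeriv hΩ) hb.1 hb.2 hL
    exact (preservesBoundaryOrder_or hr hrR hr' hrR' e he).imp (fun hb => ⟨hb, key _ _ hb⟩)
      (fun hb => ⟨hb, key _ _ hb⟩)

end Homeomorphisms

/-! ### The null Lagrangian identity for Sobolev maps. -/

section NullLagrangian

open scoped ComplexConjugate

variable {r R m M a b : ℝ} {h : ℂ → ℂ} {G : ℂ → ℂ →L[ℝ] ℂ}

theorem memLp_fderiv_smoothApprox (hh : MemLp h 2 (volume.restrict (annulus r R))) (n : ℕ) :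
    MemLp (fderiv ℝ (smoothApprox r R h n)) 2 (volume.restrict (closedAnnulus a b)) := by
  have hcd : Continuous (fderiv ℝ (smoothApprox r R h n)) :=
    (contDiff_smoothApprox hh n).continuous_fderiv (by simp)
  obtain ⟨C, hC⟩ := (isCompact_closedAnnulus a b).exists_bound_of_continuousOn hcd.continuousOn
  exact MemLp.of_bound hcd.aestronglyMeasurable C
    (by filter_upwards [ae_restrict_mem (measurableSet_closedAnnulus a b)] with x hx using hC x hx)

theorem re_neg_I_mul_ofReal_mul (s : ℝ) (z w : ℂ) :
    (-Complex.I * s * z * w).re = s * (z * w).im := by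
  simp only [Complex.mul_re, Complex.mul_im, Complex.neg_re, Complex.neg_im, Complex.I_re,
    Complex.I_im, Complex.ofReal_re, Complex.ofReal_im]
  ring

/-- The identity is quadratic in `Dh` but passes from mollifications to `h`, whose derivatives
converge strongly on compact annuli. Continuity of `h` is not needed, so weak limits are covered. -/
theorem setIntegral_null_lagrangian (hr : 0 < r) (hM0 : 0 ≤ M)
    (hM : ∀ᵐ x ∂volume.restrict (annulus r R), ‖h x‖ ≤ M)
    (hw : HasWeakDeriv (annulus r R) h G) (hh : MemLp h 2 (volume.restrict (annulus r R)))
    (hG : MemLp G 2 (volume.restrict (annulus r R))) (ha : r < a) (hab : a ≤ b) (hb : b < R)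
    {η P : ℝ → ℝ} (hη : ContDiff ℝ 1 η) (hP : ContDiff ℝ 1 P) (hηa : η a = 0) (hηb : η b = 0) :
    (∫ x in closedAnnulus a b, η ‖x‖ * (2 * (P (‖h x‖ ^ 2) + ‖h x‖ ^ 2 * deriv P (‖h x‖ ^ 2))) *
      (conj (G x x) * G x (Complex.I * x)).im / ‖x‖ ^ 2) +
    ∫ x in closedAnnulus a b, deriv η ‖x‖ * P (‖h x‖ ^ 2) *
      (conj (h x) * G x (Complex.I * x)).im / ‖x‖ = 0 := by
  have ha0 := hr.trans ha
  have hS0 : ∀ x ∈ closedAnnulus a b, x ≠ 0 := fun x hx h0 => by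
    have := hx.1; rw [h0, norm_zero] at this; linarith
  have hsub := closedAnnulus_subset (r := r) (R := R) ha hb
  have hKm := measurableSet_closedAnnulus a b
  have hKae := ae_restrict_mem (μ := volume) hKm
  have hS := isCompact_closedAnnulus a b
  have hT := isCompact_closedAnnulus 0 M
  have hmono := Measure.restrict_mono (μ := volume) hsub le_rfl
  have hPd : Continuous (deriv P) := hP.continuous_deriv (by simp)
  have hηd : Continuous (deriv η) := hη.continuous_deriv (by simp)
  have hPc := hP.continuous
  have hηc := hη.continuous
  have hmem : ∀ n x, smoothApprox r R h n x ∈ closedAnnulus 0 M := fun n x =>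
    ⟨norm_nonneg _, norm_smoothApprox_le hM0 hM n x⟩
  have hae : ∀ᵐ x ∂volume.restrict (closedAnnulus a b),
      Tendsto (fun n => smoothApprox r R h n x) atTop (𝓝 (h x)) :=
    ae_mono hmono (smoothApprox_ae_tendsto hh)
  have hGn := fun n => memLp_fderiv_smoothApprox (a := a) (b := b) hh n
  have hG0 : MemLp G 2 (volume.restrict (closedAnnulus a b)) := hG.mono_measure hmono
  have hs := tendsto_eLpNorm_fderiv_smoothApprox hw hh hG ha hb
  have hmeas : ∀ n, AEStronglyMeasurable (smoothApprox r R h n)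
      (volume.restrict (closedAnnulus a b)) := fun n =>
    (contDiff_smoothApprox hh n).continuous.aestronglyMeasurable
  set B₁ : ℂ × ℂ → ℂ := fun p => -Complex.I * ((η ‖p.1‖ * (2 * (P (‖p.2‖ ^ 2) + ‖p.2‖ ^ 2 *
    deriv P (‖p.2‖ ^ 2))) / ‖p.1‖ ^ 2 : ℝ) : ℂ) with hB₁
  set B₂ : ℂ × ℂ → ℂ := fun p => -Complex.I * ((deriv η ‖p.1‖ * P (‖p.2‖ ^ 2) / ‖p.1‖ : ℝ) : ℂ) *
    conj p.2 with hB₂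
  have hB₁m : Measurable B₁ := by
    have h1 : Measurable fun p : ℂ × ℂ => η ‖p.1‖ * (2 * (P (‖p.2‖ ^ 2) + ‖p.2‖ ^ 2 *
      deriv P (‖p.2‖ ^ 2))) := Continuous.measurable (by fun_prop)
    have h2 : Measurable fun p : ℂ × ℂ => ‖p.1‖ ^ 2 := Continuous.measurable (by fun_prop)
    exact (Complex.measurable_ofReal.comp (h1.div h2)).const_mul _
  have hB₂m : Measurable B₂ := by
    have h1 : Measurable fun p : ℂ × ℂ => deriv η ‖p.1‖ * P (‖p.2‖ ^ 2) :=
      Continuous.measurable (by fun_prop)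
    have h2 : Measurable fun p : ℂ × ℂ => ‖p.1‖ := Continuous.measurable (by fun_prop)
    exact ((Complex.measurable_ofReal.comp (h1.div h2)).const_mul _).mul
      (Complex.continuous_conj.comp continuous_snd).measurable
  have hB₁c : ContinuousOn B₁ (closedAnnulus a b ×ˢ closedAnnulus 0 M) := by
    apply ContinuousOn.mul continuousOn_const
    apply Complex.continuous_ofReal.comp_continuousOn
    apply ContinuousOn.div (by fun_prop) (by fun_prop)
    rintro ⟨x, y⟩ ⟨hx, -⟩
    have := hS0 x hx
    simpa using this
  have hB₂c : ContinuousOn B₂ (closedAnnulus a b ×ˢ closedAnnulus 0 M) := by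
    apply ContinuousOn.mul
    · apply ContinuousOn.mul continuousOn_const
      apply Complex.continuous_ofReal.comp_continuousOn
      apply ContinuousOn.div (by fun_prop) (by fun_prop)
      rintro ⟨x, y⟩ ⟨hx, -⟩
      have := hS0 x hx
      simpa using this
    · exact (Complex.continuous_conj.comp continuous_snd).continuousOn
  have t1 := tendsto_integral_coeff_mul_mul hB₁m hB₁c hS hT hKae hmeas
    (fun n => Eventually.of_forall (hmem n)) hae hGn hG0 hs continuous_id
    (d' := fun x => Complex.I * x) (by fun_prop)
  have t2 := tendsto_integral_coeff_mul hB₂m hB₂c hS hT hKae hmeas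
    (fun n => Eventually.of_forall (hmem n)) hae hGn hG0 (fun g hg v => weak_of_strong hGn hG0 hs g hg v)
    (d := fun x => Complex.I * x) (by fun_prop)
  have e₁ : ∀ (x y : ℂ) (L : ℂ →L[ℝ] ℂ), (B₁ (x, y) * conj (L (id x)) * L (Complex.I * x)).re =
      η ‖x‖ * (2 * (P (‖y‖ ^ 2) + ‖y‖ ^ 2 * deriv P (‖y‖ ^ 2))) *
      (conj (L x) * L (Complex.I * x)).im / ‖x‖ ^ 2 := fun x y L => by
    simp only [hB₁, id, re_neg_I_mul_ofReal_mul]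
    ring
  have e₂ : ∀ (x y : ℂ) (L : ℂ →L[ℝ] ℂ), (B₂ (x, y) * L (Complex.I * x)).re =
      deriv η ‖x‖ * P (‖y‖ ^ 2) * (conj y * L (Complex.I * x)).im / ‖x‖ := fun x y L => by
    simp only [hB₂, re_neg_I_mul_ofReal_mul]
    ring
  simp only [e₁, e₂] at t1 t2
  refine tendsto_nhds_unique (t1.add t2) (tendsto_const_nhds.congr fun n => ?_)
  have hf := contDiff_smoothApprox hh n
  have hfc := hf.continuous
  have hdc : Continuous (fderiv ℝ (smoothApprox r R h n)) := hf.continuous_fderiv (by simp)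
  have cont : ∀ F : ℂ → ℝ, Continuous F → ∀ j : ℕ, IntegrableOn (fun x => F x / ‖x‖ ^ j)
      (closedAnnulus a b) := fun F hF j => by
    refine ContinuousOn.integrableOn_compact hS (hF.continuousOn.div (by fun_prop) fun x hx => ?_)
    exact pow_ne_zero _ (norm_ne_zero_iff.mpr (hS0 x hx))
  have c1 : Continuous fun x => (conj (fderiv ℝ (smoothApprox r R h n) x x) *
      fderiv ℝ (smoothApprox r R h n) x (Complex.I * x)).im :=
    Complex.continuous_im.comp ((Complex.continuous_conj.comp (hdc.clm_apply continuous_id)).mul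
      (hdc.clm_apply (by fun_prop)))
  have c2 : Continuous fun x => (conj (smoothApprox r R h n x) *
      fderiv ℝ (smoothApprox r R h n) x (Complex.I * x)).im :=
    Complex.continuous_im.comp ((Complex.continuous_conj.comp hfc).mul
      (hdc.clm_apply (by fun_prop)))
  have i1 := cont (fun x => η ‖x‖ * (2 * (P (‖smoothApprox r R h n x‖ ^ 2) +
    ‖smoothApprox r R h n x‖ ^ 2 * deriv P (‖smoothApprox r R h n x‖ ^ 2))) *
      (conj (fderiv ℝ (smoothApprox r R h n) x x) *
      fderiv ℝ (smoothApprox r R h n) x (Complex.I * x)).im) (by fun_prop) 2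
  have i2 := cont (fun x => deriv η ‖x‖ * P (‖smoothApprox r R h n x‖ ^ 2) *
      (conj (smoothApprox r R h n x) *
      fderiv ℝ (smoothApprox r R h n) x (Complex.I * x)).im) (by fun_prop) 1
  simp only [pow_one] at i2
  rw [← integral_add i1 i2, ← setIntegral_null_lagrangian_smooth ha0 hab hf hη hP hηa hηb]
  refine setIntegral_congr_fun hKm fun x hx => ?_
  have hx0 : ‖x‖ ≠ 0 := norm_ne_zero_iff.mpr (hS0 x hx)
  field_simp

end NullLagrangian

/-! ### A Hardy type estimate at the boundary circles. -/

section Collar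

open scoped ComplexConjugate

theorem hasDerivAt_max_zero_sq (x : ℝ) : HasDerivAt (fun x : ℝ => max x 0 ^ 2) (2 * max x 0) x := by
  rcases lt_trichotomy x 0 with hx | rfl | hx
  · rw [max_eq_right hx.le, mul_zero]
    refine (hasDerivAt_const x (0 : ℝ)).congr_of_eventuallyEq ?_
    filter_upwards [eventually_lt_nhds hx] with y hy
    rw [max_eq_right hy.le]; norm_num
  · simp only [max_self, mul_zero]
    rw [hasDerivAt_iff_isLittleO]
    simp only [sub_zero, max_self, smul_zero, ne_eq, OfNat.ofNat_ne_zero, not_false_eq_true,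
      zero_pow]
    refine Asymptotics.IsBigO.trans_isLittleO (g := fun y : ℝ => y ^ 2) ?_ ?_
    · refine Asymptotics.IsBigO.of_bound 1 (Eventually.of_forall fun y => ?_)
      rw [one_mul, norm_pow, norm_pow]
      refine pow_le_pow_left₀ (norm_nonneg _) ?_ 2
      simp only [Real.norm_eq_abs]
      exact abs_max_le_max_abs_abs.trans (by simp)
    · exact (Asymptotics.isLittleO_pow_id one_lt_two)
  · rw [max_eq_left hx.le]
    have : HasDerivAt (fun x : ℝ => x ^ 2) (2 * x) x := by simpa using hasDerivAt_pow 2 x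
    refine this.congr_of_eventuallyEq ?_
    filter_upwards [eventually_gt_nhds hx] with y hy
    rw [max_eq_left hy.le]

/-- The square of a truncated linear weight is an admissible `C¹` function `ζ` in the normal
identity. -/
theorem contDiff_max_zero_sq : ContDiff ℝ 1 (fun x : ℝ => max x 0 ^ 2) := by
  rw [contDiff_one_iff_deriv]
  refine ⟨fun x => (hasDerivAt_max_zero_sq x).differentiableAt, ?_⟩
  rw [funext fun x => (hasDerivAt_max_zero_sq x).deriv]
  fun_prop

theorem deriv_smoothTransition_eq_zero {t : ℝ} (ht : t < 0 ∨ 1 < t) :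
    deriv Real.smoothTransition t = 0 := by
  rcases ht with ht | ht
  · have : Real.smoothTransition =ᶠ[𝓝 t] fun _ => 0 := by
      filter_upwards [eventually_lt_nhds ht] with y hy
      exact Real.smoothTransition.zero_of_nonpos hy.le
    rw [this.deriv_eq]; simp
  · have : Real.smoothTransition =ᶠ[𝓝 t] fun _ => 1 := by
      filter_upwards [eventually_gt_nhds ht] with y hy
      exact Real.smoothTransition.one_of_one_le hy.le
    rw [this.deriv_eq]; simp

theorem exists_bound_deriv_smoothTransition :
    ∃ D, 0 ≤ D ∧ ∀ t, |deriv Real.smoothTransition t| ≤ D := by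
  have hc : Continuous (deriv Real.smoothTransition) :=
    (Real.smoothTransition.contDiff (n := 1)).continuous_deriv le_rfl
  obtain ⟨D, hD⟩ := (isCompact_Icc (a := (0 : ℝ)) (b := 1)).exists_bound_of_continuousOn
    hc.continuousOn
  have hD0 : 0 ≤ D := (norm_nonneg _).trans (hD 0 (by simp))
  refine ⟨D, hD0, fun t => ?_⟩
  by_cases ht : t ∈ Icc (0 : ℝ) 1
  · exact hD t ht
  · rw [deriv_smoothTransition_eq_zero, abs_zero]
    · exact hD0
    · rw [mem_Icc, not_and_or, not_le, not_le] at ht; exact ht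

variable {r R m M p P : ℝ} {k : ℤ} {h : ℂ → ℂ} {G : ℂ → ℂ →L[ℝ] ℂ}

theorem ae_mem_closedAnnulus (r R : ℝ) :
    ∀ᵐ x ∂volume.restrict (annulus r R), x ∈ closedAnnulus r R := by
  filter_upwards [ae_restrict_mem (measurableSet_annulus r R)] with x hx using
    annulus_subset_closedAnnulus r R hx

theorem IsAnnularMap.memLp_clm_apply (H : IsAnnularMap r R m M p P k h G) {d : ℂ → ℂ}
    (hd : Continuous d) : MemLp (fun x => G x (d x)) 2 (volume.restrict (annulus r R)) :=
  MemLp.clm_apply_bounded H.memLp_deriv hd (isCompact_closedAnnulus r R) (ae_mem_closedAnnulus r R)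

theorem IsAnnularMap.integrable_norm_sq_apply (H : IsAnnularMap r R m M p P k h G) {d : ℂ → ℂ}
    (hd : Continuous d) : IntegrableOn (fun x => ‖G x (d x)‖ ^ 2) (annulus r R) :=
  (memLp_two_iff_integrable_sq_norm (H.memLp_clm_apply hd).1).mp (H.memLp_clm_apply hd)

/-- Multiplication by a bounded measurable function preserves integrability. -/
theorem integrable_mul_of_bound {μ : Measure ℂ} {f g : ℂ → ℝ} (hf : AEStronglyMeasurable f μ)
    {C : ℝ} (hC : ∀ᵐ x ∂μ, |f x| ≤ C) (hg : Integrable g μ) : Integrable (fun x => f x * g x) μ :=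
  hg.bdd_mul hf hC

theorem aestronglyMeasurable_norm_comp {μ : Measure ℂ} {f : ℝ → ℝ} (hf : Measurable f) :
    AEStronglyMeasurable (fun x : ℂ => f ‖x‖) μ :=
  (hf.comp measurable_norm).aestronglyMeasurable

/-- Weighted estimate for `|h|²` near a boundary circle. -/
theorem IsAnnularMap.weighted_collar (H : IsAnnularMap r R m M p P k h G) (hr : 0 < r)
    {ρ s q₀ δ : ℝ} (hρ : (ρ = r ∧ s = 1 ∧ q₀ = p) ∨ (ρ = R ∧ s = -1 ∧ q₀ = P))
    (hδ : δ ≤ R - r) :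
    ∫ x in annulus r R, max (δ - s * (‖x‖ - ρ)) 0 * (‖h x‖ ^ 2 - q₀) ^ 2 / ‖x‖ ≤
      4 * M ^ 2 * ∫ x in annulus r R, max (δ - s * (‖x‖ - ρ)) 0 ^ 3 / ‖x‖ ^ 3 * ‖G x x‖ ^ 2 := by
  have hA := measurableSet_annulus r R
  have hAae := ae_restrict_mem (μ := volume) hA
  have hS0 : ∀ x ∈ closedAnnulus r R, x ≠ 0 := fun x hx h0 => by
    have := hx.1; rw [h0, norm_zero] at this; linarith
  have hs : s = 1 ∨ s = -1 := hρ.imp (fun h => h.2.1) (fun h => h.2.1)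
  have hs2 : s * s = 1 := by rcases hs with rfl | rfl <;> norm_num
  -- With this choice no boundary term survives: at the circle `|x| = ρ` the function `Φ` vanishes
  -- at the boundary value of `|h|²`, and at the other circle `ζ` vanishes. The sign `s` points into
  -- the annulus.
  set ζ : ℝ → ℝ := fun t => max (δ - s * (t - ρ)) 0 ^ 2 with hζd
  set Φ : ℝ → ℝ := fun q => (q - q₀) ^ 2 with hΦd
  have hζ : ContDiff ℝ 1 ζ := contDiff_max_zero_sq.comp (by fun_prop)
  have hΦ : ContDiff ℝ 1 Φ := by fun_prop
  have hζ' : ∀ t, deriv ζ t = -2 * s * max (δ - s * (t - ρ)) 0 := fun t => by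
    have h1 : HasDerivAt (fun t => δ - s * (t - ρ)) (-s) t := by
      simpa using (((hasDerivAt_id t).sub_const ρ).const_mul s).const_sub δ
    have := (hasDerivAt_max_zero_sq (δ - s * (t - ρ))).comp t h1
    rw [show ζ = (fun x : ℝ => max x 0 ^ 2) ∘ fun t => δ - s * (t - ρ) from rfl, this.deriv]
    ring
  have hΦ' : ∀ q, deriv Φ q = 2 * (q - q₀) := fun q => by
    have : HasDerivAt Φ (2 * (q - q₀)) q := by
      simpa using ((hasDerivAt_id q).sub_const q₀).fun_pow 2
    exact this.deriv
  have key := H.normal ζ Φ hζ hΦ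
  have hrhs : ζ R * Φ P - ζ r * Φ p = 0 := by
    rcases hρ with ⟨rfl, rfl, rfl⟩ | ⟨rfl, rfl, rfl⟩
    · have : ζ R = 0 := by simp only [hζd]; rw [max_eq_right (by linarith)]; norm_num
      rw [this]; simp [hΦd]
    · have : ζ r = 0 := by simp only [hζd]; rw [max_eq_right (by linarith)]; norm_num
      rw [this]; simp [hΦd]
  rw [hrhs, mul_zero] at key
  have hζc : Continuous fun t => max (δ - s * (t - ρ)) 0 := by fun_prop
  have i2 := integrable_coeff (measurable_normalCoeff' hζc hΦ.continuous)
      (continuousOn_normalCoeff' hζc hΦ.continuous hS0) (isCompact_closedAnnulus r R)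
      (isCompact_closedAnnulus m M) (ae_mem_closedAnnulus r R) H.memLp.1 H.bound
  have e2 : ∫ x in annulus r R, deriv ζ ‖x‖ * Φ (‖h x‖ ^ 2) / ‖x‖ = -2 * s *
      ∫ x in annulus r R, max (δ - s * (‖x‖ - ρ)) 0 * (‖h x‖ ^ 2 - q₀) ^ 2 / ‖x‖ := by
    rw [← integral_const_mul]
    congr 1; ext x
    rw [hζ']; ring
  rw [e2] at key
  have hΦdc : Continuous (deriv Φ) := hΦ.continuous_deriv (by simp)
  have i1 := integrable_coeff_mul (measurable_normalCoeff hζ.continuous hΦdc)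
      (continuousOn_normalCoeff hζ.continuous hΦdc hS0) (isCompact_closedAnnulus r R)
      (isCompact_closedAnnulus m M) (ae_mem_closedAnnulus r R) H.memLp.1 H.bound H.memLp_deriv
      continuous_id
  simp only [id] at i1
  have i3 : IntegrableOn (fun x => max (δ - s * (‖x‖ - ρ)) 0 ^ 3 / ‖x‖ ^ 3 * ‖G x x‖ ^ 2)
      (annulus r R) := by
    have hcont : ContinuousOn (fun x : ℂ => max (δ - s * (‖x‖ - ρ)) 0 ^ 3 / ‖x‖ ^ 3)
        (closedAnnulus r R) := ContinuousOn.div (by fun_prop) (by fun_prop)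
          (fun x hx => pow_ne_zero _ (norm_ne_zero_iff.mpr (hS0 x hx)))
    obtain ⟨C, hC⟩ := (isCompact_closedAnnulus r R).exists_bound_of_continuousOn hcont
    refine integrable_mul_of_bound ?_ (C := C) ?_ (H.integrable_norm_sq_apply continuous_id)
    · exact aestronglyMeasurable_norm_comp (f := fun t => max (δ - s * (t - ρ)) 0 ^ 3 / t ^ 3)
        (by fun_prop)
    · filter_upwards [ae_mem_closedAnnulus r R] with x hx using hC x hx
  have hle : ∫ x in annulus r R, s * (((ζ ‖x‖ * deriv Φ (‖h x‖ ^ 2) * 2 / ‖x‖ ^ 2 : ℝ) : ℂ) *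
      conj (h x) * G x x).re ≤ ∫ x in annulus r R,
      (max (δ - s * (‖x‖ - ρ)) 0 * (‖h x‖ ^ 2 - q₀) ^ 2 / ‖x‖ + 4 * M ^ 2 *
        (max (δ - s * (‖x‖ - ρ)) 0 ^ 3 / ‖x‖ ^ 3 * ‖G x x‖ ^ 2)) := by
    refine integral_mono_ae (i1.const_mul s) (i2.add (i3.const_mul _)) ?_
    filter_upwards [hAae, H.bound] with x hx hxM
    have hx0 : 0 < ‖x‖ := hr.trans hx.1
    rw [hΦ', mul_assoc, Complex.re_ofReal_mul]
    simp only [hζd]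
    set τ := max (δ - s * (‖x‖ - ρ)) 0
    set w := ‖h x‖ ^ 2 - q₀
    have hτ : 0 ≤ τ := le_max_right _ _
    have h1 : |s * w * (conj (h x) * G x x).re| ≤ |w| * (M * ‖G x x‖) := by
      rw [abs_mul, abs_mul]
      have : |s| = 1 := by rcases hs with rfl | rfl <;> norm_num
      rw [this, one_mul]
      gcongr
      refine (Complex.abs_re_le_norm _).trans ?_
      rw [norm_mul, RCLike.norm_conj]
      gcongr
      exact hxM.2
    have h2 : s * (τ ^ 2 * (2 * w) * 2 / ‖x‖ ^ 2 * (conj (h x) * G x x).re) =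
        4 * τ ^ 2 / ‖x‖ ^ 2 * (s * w * (conj (h x) * G x x).re) := by ring
    rw [h2]
    have h3 : 4 * τ ^ 2 / ‖x‖ ^ 2 * (s * w * (conj (h x) * G x x).re) ≤
        4 * τ ^ 2 / ‖x‖ ^ 2 * (|w| * (M * ‖G x x‖)) :=
      mul_le_mul_of_nonneg_left ((le_abs_self _).trans h1) (by positivity)
    refine h3.trans ?_
    -- Completing the square leaves the left side of the estimate once on the right; since it occurs
    -- twice on the left, it can be absorbed.
    have h4 : 0 ≤ τ / ‖x‖ * (|w| - 2 * M * τ * ‖G x x‖ / ‖x‖) ^ 2 := by positivity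
    have h5 : τ / ‖x‖ * (|w| - 2 * M * τ * ‖G x x‖ / ‖x‖) ^ 2 = τ * |w| ^ 2 / ‖x‖ +
        4 * M ^ 2 * (τ ^ 3 / ‖x‖ ^ 3 * ‖G x x‖ ^ 2) -
        4 * τ ^ 2 / ‖x‖ ^ 2 * (|w| * (M * ‖G x x‖)) := by
      field_simp
      ring
    rw [sq_abs] at h5
    linarith
  rw [integral_const_mul, integral_add i2 (i3.const_mul _), integral_const_mul] at hle
  have e3 := eq_neg_of_add_eq_zero_left key
  rw [e3] at hle
  set I := ∫ x in annulus r R, max (δ - s * (‖x‖ - ρ)) 0 * (‖h x‖ ^ 2 - q₀) ^ 2 / ‖x‖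
  have e4 : s * -(-2 * s * I) = 2 * I := by linear_combination 2 * I * hs2
  rw [e4] at hle
  have e5 : ∫ x in annulus r R, max (δ - s * (‖x‖ - ρ)) 0 * Φ (‖h x‖ ^ 2) / ‖x‖ = I := rfl
  linarith

end Collar

/-! ### Fluxes through thin collars. -/

section Jacobian

open scoped ComplexConjugate

variable {r R m M p P : ℝ} {k : ℤ} {h : ℂ → ℂ} {G : ℂ → ℂ →L[ℝ] ℂ}

theorem IsAnnularMap.integrable_sq_sub (H : IsAnnularMap r R m M p P k h G) (q₀ : ℝ) :
    IntegrableOn (fun x => (‖h x‖ ^ 2 - q₀) ^ 2) (annulus r R) :=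
  integrable_coeff (B := fun p => (‖p.2‖ ^ 2 - q₀) ^ 2)
    (Continuous.measurable (by fun_prop)) (Continuous.continuousOn (by fun_prop))
    (isCompact_closedAnnulus r R) (isCompact_closedAnnulus m M) (ae_mem_closedAnnulus r R)
    H.memLp.1 H.bound

/-- `|h|²` is close to its boundary value near a boundary circle. -/
theorem IsAnnularMap.collar (H : IsAnnularMap r R m M p P k h G) (hr : 0 < r) (hrR : r < R)
    {ρ s q₀ ε : ℝ} (hρ : (ρ = r ∧ s = 1 ∧ q₀ = p) ∨ (ρ = R ∧ s = -1 ∧ q₀ = P))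
    (hε : 0 < ε) (hεR : 3 * ε ≤ R - r) :
    ∫ x in annulus r R, {x : ℂ | s * (‖x‖ - ρ) ≤ 2 * ε}.indicator
      (fun x => (‖h x‖ ^ 2 - q₀) ^ 2) x ≤ ε ^ 2 * (108 * M ^ 2 * R / r ^ 3 *
        ∫ x in annulus r R, {x : ℂ | s * (‖x‖ - ρ) ≤ 3 * ε}.indicator (fun x => ‖G x x‖ ^ 2) x) := by
  have hAae := ae_restrict_mem (μ := volume) (measurableSet_annulus r R)
  have hS0 : ∀ x ∈ closedAnnulus r R, x ≠ 0 := fun x hx h0 => by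
    have := hx.1; rw [h0, norm_zero] at this; linarith
  have hR := hr.trans hrR
  have hw := H.weighted_collar hr hρ hεR
  have hm1 : MeasurableSet {x : ℂ | s * (‖x‖ - ρ) ≤ 2 * ε} :=
    measurableSet_le (by fun_prop) (by fun_prop)
  have hm2 : MeasurableSet {x : ℂ | s * (‖x‖ - ρ) ≤ 3 * ε} :=
    measurableSet_le (by fun_prop) (by fun_prop)
  have i1 := (H.integrable_sq_sub q₀).indicator hm1
  have i2 := (H.integrable_norm_sq_apply continuous_id).indicator hm2
  have hpos : ∀ x ∈ annulus r R, 0 ≤ s * (‖x‖ - ρ) := by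
    intro x hx
    rcases hρ with ⟨rfl, rfl, -⟩ | ⟨rfl, rfl, -⟩
    · linarith [hx.1]
    · linarith [hx.2]
  -- The weight `3ε - distance` is at least `ε` up to distance `2ε` and never exceeds `3ε`. Dividing
  -- the cubed weight by the lower bound leaves `ε²`, with constant `4 · 27 = 108`.
  have step1 : ε / R * ∫ x in annulus r R, {x : ℂ | s * (‖x‖ - ρ) ≤ 2 * ε}.indicator
      (fun x => (‖h x‖ ^ 2 - q₀) ^ 2) x ≤
      ∫ x in annulus r R, max (3 * ε - s * (‖x‖ - ρ)) 0 * (‖h x‖ ^ 2 - q₀) ^ 2 / ‖x‖ := by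
    rw [← integral_const_mul]
    have i3 : IntegrableOn (fun x => max (3 * ε - s * (‖x‖ - ρ)) 0 * (‖h x‖ ^ 2 - q₀) ^ 2 / ‖x‖)
        (annulus r R) := by
      have hcont : ContinuousOn (fun x : ℂ => max (3 * ε - s * (‖x‖ - ρ)) 0 / ‖x‖)
          (closedAnnulus r R) := ContinuousOn.div (by fun_prop) (by fun_prop)
            (fun x hx => norm_ne_zero_iff.mpr (hS0 x hx))
      obtain ⟨C, hC⟩ := (isCompact_closedAnnulus r R).exists_bound_of_continuousOn hcont
      refine (integrable_mul_of_bound (f := fun x => max (3 * ε - s * (‖x‖ - ρ)) 0 / ‖x‖)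
        (aestronglyMeasurable_norm_comp (f := fun t => max (3 * ε - s * (t - ρ)) 0 / t)
          (by fun_prop)) (C := C) ?_ (H.integrable_sq_sub q₀)).congr ?_
      · filter_upwards [ae_mem_closedAnnulus r R] with x hx using hC x hx
      · exact Eventually.of_forall fun x => by ring
    refine integral_mono_ae (i1.const_mul _) i3 ?_
    filter_upwards [hAae] with x hx
    have hx0 := hr.trans hx.1
    by_cases hxS : x ∈ {x : ℂ | s * (‖x‖ - ρ) ≤ 2 * ε}
    · rw [indicator_of_mem hxS, mul_div_right_comm]
      have h1 : ε ≤ max (3 * ε - s * (‖x‖ - ρ)) 0 := le_max_of_le_left (by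
        have : s * (‖x‖ - ρ) ≤ 2 * ε := hxS
        linarith)
      have h2 := hx.2.le
      gcongr
    · rw [indicator_of_notMem hxS, mul_zero]
      positivity
  have step2 : ∫ x in annulus r R, max (3 * ε - s * (‖x‖ - ρ)) 0 ^ 3 / ‖x‖ ^ 3 * ‖G x x‖ ^ 2 ≤
      27 * ε ^ 3 / r ^ 3 * ∫ x in annulus r R,
        {x : ℂ | s * (‖x‖ - ρ) ≤ 3 * ε}.indicator (fun x => ‖G x x‖ ^ 2) x := by
    rw [← integral_const_mul]
    refine integral_mono_of_nonneg (Eventually.of_forall fun x => ?_) (i2.const_mul _) ?_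
    · have : 0 ≤ max (3 * ε - s * (‖x‖ - ρ)) 0 := le_max_right _ _
      simp only [Pi.zero_apply]
      positivity
    filter_upwards [hAae] with x hx
    have hx0 := hr.trans hx.1
    by_cases hxS : x ∈ {x : ℂ | s * (‖x‖ - ρ) ≤ 3 * ε}
    · rw [indicator_of_mem hxS]
      have h1 : max (3 * ε - s * (‖x‖ - ρ)) 0 ≤ 3 * ε :=
        max_le (by linarith [hpos x hx]) (by linarith)
      have h3 : max (3 * ε - s * (‖x‖ - ρ)) 0 ^ 3 ≤ 27 * ε ^ 3 := by
        calc _ ≤ (3 * ε) ^ 3 := pow_le_pow_left₀ (le_max_right _ _) h1 3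
          _ = _ := by ring
      have h2 := hx.1.le
      gcongr
    · rw [indicator_of_notMem hxS, mul_zero]
      have : max (3 * ε - s * (‖x‖ - ρ)) 0 = 0 := max_eq_right (by
        have : 3 * ε < s * (‖x‖ - ρ) := not_le.mp hxS
        linarith)
      rw [this]; simp
  have h5 := step1.trans (hw.trans (mul_le_mul_of_nonneg_left step2 (by positivity)))
  rw [div_mul_eq_mul_div, div_le_iff₀ hR] at h5
  refine le_of_mul_le_mul_left (h5.trans_eq ?_) hε
  ring

theorem tendsto_integral_indicator_collar {ρ s : ℝ} (hρ : (ρ = r ∧ s = 1) ∨ (ρ = R ∧ s = -1))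
    {ε : ℕ → ℝ} (hε : Tendsto ε atTop (𝓝 0)) {F : ℂ → ℝ} (hF : IntegrableOn F (annulus r R)) :
    Tendsto (fun j => ∫ x in annulus r R, {x : ℂ | s * (‖x‖ - ρ) ≤ 3 * ε j}.indicator F x) atTop
      (𝓝 0) := by
  have hm : ∀ c : ℝ, MeasurableSet {x : ℂ | s * (‖x‖ - ρ) ≤ c} := fun c =>
    measurableSet_le (by fun_prop) (by fun_prop)
  rw [show (0 : ℝ) = ∫ x in annulus r R, (0 : ℝ) by simp]
  refine tendsto_integral_of_dominated_convergence (fun x => ‖F x‖)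
    (fun j => (hF.indicator (hm _)).1) hF.norm (fun j => Eventually.of_forall fun x => ?_) ?_
  · exact norm_indicator_le_norm_self _ _
  · filter_upwards [ae_restrict_mem (measurableSet_annulus r R)] with x hx
    have hpos : 0 < s * (‖x‖ - ρ) := by
      rcases hρ with ⟨rfl, rfl⟩ | ⟨rfl, rfl⟩
      · linarith [hx.1]
      · linarith [hx.2]
    have h3 : Tendsto (fun j => 3 * ε j) atTop (𝓝 0) := by simpa using hε.const_mul 3
    refine tendsto_const_nhds.congr' ?_
    filter_upwards [h3.eventually_lt_const hpos] with j hj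
    rw [indicator_of_notMem]
    exact not_le.mpr hj

theorem IsAnnularMap.integrable_flux (H : IsAnnularMap r R m M p P k h G) (hr : 0 < r) (hm : 0 < m)
    {β F : ℝ → ℝ} (hβ : Continuous β) (hF : Continuous F) :
    IntegrableOn (fun x => β ‖x‖ * (F (‖h x‖ ^ 2) / ‖h x‖ ^ 2) *
      (conj (h x) * G x (Complex.I * x)).im / ‖x‖) (annulus r R) := by
  have hIx : Continuous fun x : ℂ => Complex.I * x := by fun_prop
  have hB1 : Measurable fun p : ℂ × ℂ => -Complex.I * ((β ‖p.1‖ * (F (‖p.2‖ ^ 2) / ‖p.2‖ ^ 2) /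
      ‖p.1‖ : ℝ) : ℂ) * conj p.2 := by
    have h1 : Measurable fun p : ℂ × ℂ => F (‖p.2‖ ^ 2) := Continuous.measurable (by fun_prop)
    have h2 : Measurable fun p : ℂ × ℂ => β ‖p.1‖ := Continuous.measurable (by fun_prop)
    exact ((Complex.measurable_ofReal.comp ((h2.mul (h1.div (by fun_prop))).div
      (by fun_prop))).const_mul _).mul (Complex.continuous_conj.comp continuous_snd).measurable
  have hB2 : ContinuousOn (fun p : ℂ × ℂ => -Complex.I * ((β ‖p.1‖ *
      (F (‖p.2‖ ^ 2) / ‖p.2‖ ^ 2) / ‖p.1‖ : ℝ) : ℂ) * conj p.2)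
      (closedAnnulus r R ×ˢ closedAnnulus m M) := by
    apply ContinuousOn.mul
    · apply ContinuousOn.mul continuousOn_const
      apply Complex.continuous_ofReal.comp_continuousOn
      refine ContinuousOn.div (ContinuousOn.mul (by fun_prop)
        (ContinuousOn.div (by fun_prop) (by fun_prop) ?_)) (by fun_prop) ?_
      · rintro ⟨x, y⟩ ⟨-, hy⟩
        exact norm_sq_ne_zero_of_mem_closedAnnulus hm hy
      · rintro ⟨x, y⟩ ⟨hx, -⟩
        exact (hr.trans_le hx.1).ne'
    · exact (Complex.continuous_conj.comp continuous_snd).continuousOn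
  have := integrable_coeff_mul hB1 hB2 (isCompact_closedAnnulus r R)
    (isCompact_closedAnnulus m M) (ae_mem_closedAnnulus r R) H.memLp.1 H.bound H.memLp_deriv hIx
  refine Integrable.congr this (Eventually.of_forall fun x => ?_)
  simp only [re_neg_I_mul_ofReal_mul]
  ring

/-- The functions `β j` have mass one near a boundary circle. With `Q q₀` in place of `Q (|h|²)` the
integral is exactly a tangential identity. The error is at most a constant times `ε⁻¹ |q - q₀|`
times the angular derivative; after splitting this product into squares, the collar estimate and
absolute continuity of the integral send it to zero. -/
theorem IsAnnularMap.tendsto_collar_flux (H : IsAnnularMap r R m M p P k h G) (hr : 0 < r)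
    (hrR : r < R) (hm : 0 < m) (hM0 : 0 ≤ M) {ρ s q₀ : ℝ}
    (hρ : (ρ = r ∧ s = 1 ∧ q₀ = p) ∨ (ρ = R ∧ s = -1 ∧ q₀ = P))
    {Q : ℝ → ℝ} (hQc : Continuous Q) {Λ : ℝ} (hΛ : 0 ≤ Λ)
    (hQ : ∀ q ∈ Icc (m ^ 2) (M ^ 2), |Q q - Q q₀| ≤ Λ * |q - q₀|)
    {ε : ℕ → ℝ} (hε : ∀ j, 0 < ε j) (hεR : ∀ j, 3 * ε j ≤ R - r) (hε0 : Tendsto ε atTop (𝓝 0))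
    {β : ℕ → ℝ → ℝ} {D : ℝ} (hD : 0 ≤ D) (hβ : ∀ j, Continuous (β j))
    (hβD : ∀ j t, |β j t| ≤ D / ε j) (hβ0 : ∀ j t, 2 * ε j < s * (t - ρ) → β j t = 0)
    (hβ1 : ∀ j, ∫ t in r..R, β j t = 1) :
    Tendsto (fun j => ∫ x in annulus r R, β j ‖x‖ * (Q (‖h x‖ ^ 2) / ‖h x‖ ^ 2) *
      (conj (h x) * G x (Complex.I * x)).im / ‖x‖) atTop (𝓝 (2 * Real.pi * k * Q q₀)) := by
  have hAae := ae_restrict_mem (μ := volume) (measurableSet_annulus r R)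
  have hIx : Continuous fun x : ℂ => Complex.I * x := by fun_prop
  have hint := fun (j : ℕ) (F : ℝ → ℝ) (hF : Continuous F) => H.integrable_flux hr hm (hβ j) hF
  have hconst : ∀ j, ∫ x in annulus r R, β j ‖x‖ * (Q q₀ / ‖h x‖ ^ 2) *
      (conj (h x) * G x (Complex.I * x)).im / ‖x‖ = 2 * Real.pi * k * Q q₀ := by
    intro j
    have h1 := H.tangential (fun t => Q q₀ * β j t * t) (by have := hβ j; fun_prop)
    have e1 : ∫ t in r..R, Q q₀ * β j t * t / t = Q q₀ := by
      rw [intervalIntegral.integral_congr (g := fun t => Q q₀ * β j t)]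
      · rw [intervalIntegral.integral_const_mul, hβ1, mul_one]
      · intro t ht
        rw [uIcc_of_le hrR.le] at ht
        exact mul_div_cancel_right₀ _ (hr.trans_le ht.1).ne'
    rw [e1] at h1
    rw [← h1]
    refine integral_congr_ae ?_
    filter_upwards [hAae] with x hx
    have hx0 : ‖x‖ ≠ 0 := (hr.trans hx.1).ne'
    have e2 := re_neg_I_mul_ofReal_mul (Q q₀ * β j ‖x‖ * ‖x‖ / ‖h x‖ ^ 2 / ‖x‖ ^ 2) (conj (h x))
      (G x (Complex.I * x))
    rw [show ((Q q₀ * β j ‖x‖ * ‖x‖ / ‖h x‖ ^ 2 / ‖x‖ ^ 2 : ℝ) : ℂ) * (-Complex.I * conj (h x)) *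
      G x (Complex.I * x) = -Complex.I * ((Q q₀ * β j ‖x‖ * ‖x‖ / ‖h x‖ ^ 2 / ‖x‖ ^ 2 : ℝ) : ℂ) *
      conj (h x) * G x (Complex.I * x) by ring, e2]
    field_simp
  set K : ℝ := D * Λ * M / (m ^ 2 * r) with hK
  have hK0 : 0 ≤ K := by positivity
  set C : ℝ := 108 * M ^ 2 * R / r ^ 3
  set A₁ : ℕ → ℝ := fun j => ∫ x in annulus r R,
    {x : ℂ | s * (‖x‖ - ρ) ≤ 3 * ε j}.indicator (fun x => ‖G x x‖ ^ 2) x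
  set A₂ : ℕ → ℝ := fun j => ∫ x in annulus r R,
    {x : ℂ | s * (‖x‖ - ρ) ≤ 3 * ε j}.indicator (fun x => ‖G x (Complex.I * x)‖ ^ 2) x
  have hρ' : (ρ = r ∧ s = 1) ∨ (ρ = R ∧ s = -1) :=
    hρ.imp (fun h => ⟨h.1, h.2.1⟩) (fun h => ⟨h.1, h.2.1⟩)
  have i1 := H.integrable_norm_sq_apply continuous_id
  have i2 := H.integrable_norm_sq_apply hIx
  have t1 : Tendsto A₁ atTop (𝓝 0) := tendsto_integral_indicator_collar hρ' hε0 i1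
  have t2 : Tendsto A₂ atTop (𝓝 0) := tendsto_integral_indicator_collar hρ' hε0 i2
  have t3 : Tendsto (fun j => K * (C * A₁ j + A₂ j)) atTop (𝓝 0) := by
    simpa using ((t1.const_mul C).add t2).const_mul K
  rw [tendsto_iff_norm_sub_tendsto_zero]
  refine squeeze_zero (fun _ => norm_nonneg _) (fun j => ?_) t3
  have hm2 : ∀ c : ℝ, MeasurableSet {x : ℂ | s * (‖x‖ - ρ) ≤ c} := fun c =>
    measurableSet_le (by fun_prop) (by fun_prop)
  rw [← hconst j, ← integral_sub (hint j Q hQc) (hint j (fun _ => Q q₀) continuous_const)]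
  have j1 := (H.integrable_sq_sub q₀).indicator (hm2 (2 * ε j))
  have j2 := i2.indicator (hm2 (3 * ε j))
  refine (norm_integral_le_integral_norm _).trans ?_
  have hle : ∫ x in annulus r R, ‖β j ‖x‖ * (Q (‖h x‖ ^ 2) / ‖h x‖ ^ 2) *
      (conj (h x) * G x (Complex.I * x)).im / ‖x‖ - β j ‖x‖ * (Q q₀ / ‖h x‖ ^ 2) *
      (conj (h x) * G x (Complex.I * x)).im / ‖x‖‖ ≤ ∫ x in annulus r R, K * ((ε j ^ 2)⁻¹ *
      {x : ℂ | s * (‖x‖ - ρ) ≤ 2 * ε j}.indicator (fun x => (‖h x‖ ^ 2 - q₀) ^ 2) x +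
      {x : ℂ | s * (‖x‖ - ρ) ≤ 3 * ε j}.indicator (fun x => ‖G x (Complex.I * x)‖ ^ 2) x) := by
    refine integral_mono_ae ((hint j Q hQc).sub (hint j (fun _ => Q q₀) continuous_const)).norm
      (((j1.const_mul _).add j2).const_mul K) ?_
    filter_upwards [hAae, H.bound] with x hx hxM
    have hx0 := hr.trans hx.1
    have hεj := hε j
    by_cases hxS : s * (‖x‖ - ρ) ≤ 2 * ε j
    · rw [indicator_of_mem (show x ∈ {x : ℂ | s * (‖x‖ - ρ) ≤ 2 * ε j} from hxS),
        indicator_of_mem (show x ∈ {x : ℂ | s * (‖x‖ - ρ) ≤ 3 * ε j} from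
          (show s * (‖x‖ - ρ) ≤ 3 * ε j by linarith))]
      set q := ‖h x‖ ^ 2
      set B := G x (Complex.I * x)
      have hqm : m ^ 2 ≤ q := pow_le_pow_left₀ hm.le hxM.1 2
      have hqM : q ≤ M ^ 2 := pow_le_pow_left₀ (norm_nonneg _) hxM.2 2
      have hq0 : 0 < q := (by positivity : 0 < m ^ 2).trans_le hqm
      have e : β j ‖x‖ * (Q q / q) * (conj (h x) * B).im / ‖x‖ -
          β j ‖x‖ * (Q q₀ / q) * (conj (h x) * B).im / ‖x‖ =
          β j ‖x‖ * ((Q q - Q q₀) / q) * (conj (h x) * B).im / ‖x‖ := by ring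
      rw [e, Real.norm_eq_abs, abs_div, abs_mul, abs_mul, abs_div, abs_of_pos hq0, abs_norm]
      have hb : |(conj (h x) * B).im| ≤ M * ‖B‖ := by
        refine (Complex.abs_im_le_norm _).trans ?_
        rw [norm_mul, RCLike.norm_conj]
        gcongr
        exact hxM.2
      have hbound : |β j ‖x‖| * (|Q q - Q q₀| / q) * |(conj (h x) * B).im| / ‖x‖ ≤
          D / ε j * (Λ * |q - q₀| / m ^ 2) * (M * ‖B‖) / r := by
        have h1 := hβD j ‖x‖
        have h2 := hQ q ⟨hqm, hqM⟩
        have h3 := hx.1.le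
        gcongr
      refine hbound.trans ?_
      have e2 : D / ε j * (Λ * |q - q₀| / m ^ 2) * (M * ‖B‖) / r =
          K * ((ε j)⁻¹ * |q - q₀| * ‖B‖) := by
        rw [hK]; field_simp
      rw [e2]
      refine mul_le_mul_of_nonneg_left ?_ hK0
      have h4 : ((ε j) ^ 2)⁻¹ * (q - q₀) ^ 2 = ((ε j)⁻¹ * |q - q₀|) ^ 2 := by
        rw [mul_pow, sq_abs, inv_pow]
      rw [h4]
      nlinarith [sq_nonneg ((ε j)⁻¹ * |q - q₀| - ‖B‖), sq_nonneg ((ε j)⁻¹ * |q - q₀|),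
        sq_nonneg ‖B‖]
    · rw [hβ0 j _ (not_le.mp hxS)]
      simp only [zero_mul, zero_div, sub_zero, norm_zero]
      refine mul_nonneg hK0 (add_nonneg (mul_nonneg (by positivity) ?_) ?_)
      · exact indicator_nonneg (fun x _ => sq_nonneg _) _
      · exact indicator_nonneg (fun x _ => sq_nonneg _) _
  refine hle.trans ?_
  rw [integral_const_mul, integral_add (j1.const_mul _) j2, integral_const_mul]
  refine mul_le_mul_of_nonneg_left ?_ hK0
  have hcol := H.collar hr hrR hρ (hε j) (hεR j)
  have hεj := hε j
  have : ((ε j) ^ 2)⁻¹ * ∫ x in annulus r R, {x : ℂ | s * (‖x‖ - ρ) ≤ 2 * ε j}.indicator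
      (fun x => (‖h x‖ ^ 2 - q₀) ^ 2) x ≤ C * A₁ j := by
    rw [inv_mul_le_iff₀ (by positivity)]
    exact hcol
  linarith

end Jacobian

/-! ### The change of variables formula with radial densities. -/

section Jacobian

open scoped ComplexConjugate

/-- The null Lagrangian has density `2(F + qF') = 2(qF)'`, so `F = Q/q` with `Q' = σ/2` produces the
density `σ`. Cutting `σ` off below `m` makes `Q` vanish near the origin, and `F` is `C¹` on the
whole line. -/
theorem exists_primitive_quotient {m : ℝ} (hm : 0 < m) {σ : ℝ → ℝ} (hσ : Continuous σ) :
    ∃ F Q : ℝ → ℝ, ContDiff ℝ 1 F ∧ Continuous Q ∧ (∀ q, m ≤ q → F q = Q q / q) ∧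
      (∀ q, m ≤ q → 2 * (F q + q * deriv F q) = σ q) ∧
      ∀ q q', m ≤ q → m ≤ q' → Q q - Q q' = (∫ x in q'..q, σ x) / 2 := by
  set τ : ℝ → ℝ := fun q => σ q * min 1 (max 0 (2 * q / m - 1)) with hτd
  have hτ : Continuous τ := by fun_prop
  have hτ1 : ∀ q, m ≤ q → τ q = σ q := fun q hq => by
    have : 1 ≤ max 0 (2 * q / m - 1) := le_max_of_le_right (by
      rw [le_sub_iff_add_le, le_div_iff₀ hm]; linarith)
    simp only [hτd]; rw [min_eq_left this, mul_one]
  have hτ0 : ∀ q, q ≤ m / 2 → τ q = 0 := fun q hq => by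
    have : max 0 (2 * q / m - 1) = 0 := max_eq_left (by
      rw [sub_nonpos, div_le_one hm]; linarith)
    simp only [hτd]; rw [this, min_eq_right zero_le_one, mul_zero]
  set Q : ℝ → ℝ := fun q => (∫ x in (m / 4)..q, τ x) / 2 with hQd
  have hQ' : ∀ q, HasDerivAt Q (τ q / 2) q := fun q =>
    (intervalIntegral.integral_hasDerivAt_right (hτ.intervalIntegrable _ _)
      (hτ.stronglyMeasurableAtFilter _ _) hτ.continuousAt).div_const 2
  have hQc1 : ContDiff ℝ 1 Q := by
    rw [contDiff_one_iff_deriv]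
    refine ⟨fun q => (hQ' q).differentiableAt, ?_⟩
    rw [funext fun q => (hQ' q).deriv]
    fun_prop
  have hQ0 : ∀ q, q < m / 2 → Q q = 0 := fun q hq => by
    simp only [hQd]
    rw [intervalIntegral.integral_congr (g := fun _ => 0)]
    · simp
    · intro x hx
      refine hτ0 x ?_
      rcases mem_uIcc.mp hx with h | h
      · exact h.2.trans hq.le
      · linarith [h.2]
  refine ⟨fun q => Q q / q, Q, ?_, hQc1.continuous, fun q _ => rfl, fun q hq => ?_,
    fun q q' hq hq' => ?_⟩
  · rw [contDiff_iff_contDiffAt]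
    intro q
    rcases lt_or_ge q (m / 2) with hq | hq
    · refine (contDiffAt_const (c := (0 : ℝ))).congr_of_eventuallyEq ?_
      filter_upwards [eventually_lt_nhds hq] with x hx
      rw [hQ0 x hx, zero_div]
    · exact hQc1.contDiffAt.div contDiffAt_id (by linarith)
  · have hq0 : q ≠ 0 := by linarith
    have h1 : HasDerivAt (fun q => Q q / q) ((τ q / 2 * q - Q q * 1) / q ^ 2) q :=
      (hQ' q).fun_div (hasDerivAt_id q) hq0
    rw [h1.deriv, hτ1 q hq]
    field_simp
    ring
  · simp only [hQd]
    rw [← sub_div, intervalIntegral.integral_interval_sub_left (hτ.intervalIntegrable _ _)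
      (hτ.intervalIntegrable _ _)]
    congr 1
    refine intervalIntegral.integral_congr fun x hx => hτ1 x ?_
    rcases mem_uIcc.mp hx with h | h
    · exact hq'.trans h.1
    · exact hq.trans h.1

/-- The transition function from `0` to `1` on the interval `[x, x + ε]`. -/
noncomputable def ramp (x ε t : ℝ) : ℝ := Real.smoothTransition ((t - x) / ε)

theorem contDiff_ramp (x ε : ℝ) : ContDiff ℝ 1 (ramp x ε) :=
  Real.smoothTransition.contDiff.comp (by fun_prop)

theorem deriv_ramp (x ε t : ℝ) :
    deriv (ramp x ε) t = deriv Real.smoothTransition ((t - x) / ε) / ε := by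
  have h1 : HasDerivAt (fun t => (t - x) / ε) (1 / ε) t :=
    ((hasDerivAt_id t).sub_const x).div_const ε
  have h2 : HasDerivAt Real.smoothTransition (deriv Real.smoothTransition ((t - x) / ε))
      ((t - x) / ε) :=
    ((Real.smoothTransition.contDiff (n := 1)).differentiable one_ne_zero _).hasDerivAt
  have := HasDerivAt.comp (h := fun t => (t - x) / ε) t h2 h1
  rw [show ramp x ε = Real.smoothTransition ∘ fun t => (t - x) / ε from rfl, this.deriv]
  ring

theorem ramp_eq_zero {x ε t : ℝ} (hε : 0 < ε) (ht : t ≤ x) : ramp x ε t = 0 :=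
  Real.smoothTransition.zero_of_nonpos (div_nonpos_of_nonpos_of_nonneg (by linarith) hε.le)

theorem ramp_eq_one {x ε t : ℝ} (hε : 0 < ε) (ht : x + ε ≤ t) : ramp x ε t = 1 :=
  Real.smoothTransition.one_of_one_le (by rw [one_le_div hε]; linarith)

theorem deriv_ramp_eq_zero {x ε t : ℝ} (hε : 0 < ε) (ht : t < x ∨ x + ε < t) :
    deriv (ramp x ε) t = 0 := by
  rw [deriv_ramp, deriv_smoothTransition_eq_zero, zero_div]
  refine ht.imp (fun h => div_neg_of_neg_of_pos (by linarith) hε) (fun h => ?_)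
  rw [one_lt_div hε]; linarith

theorem integral_deriv_ramp {x ε a b : ℝ} (hε : 0 < ε) (ha : a ≤ x) (hb : x + ε ≤ b) :
    ∫ t in a..b, deriv (ramp x ε) t = 1 := by
  have hd := contDiff_ramp x ε
  rw [intervalIntegral.integral_deriv_eq_sub (fun t _ => hd.differentiable one_ne_zero t)
    ((hd.continuous_deriv le_rfl).intervalIntegrable _ _), ramp_eq_zero hε ha, ramp_eq_one hε hb,
    sub_zero]

variable {r R m M p P : ℝ} {k : ℤ} {h : ℂ → ℂ} {G : ℂ → ℂ →L[ℝ] ℂ}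

theorem IsAnnularMap.integrable_jacobian (H : IsAnnularMap r R m M p P k h G) (hr : 0 < r)
    {σ : ℝ → ℝ} (hσ : Continuous σ) :
    IntegrableOn (fun x => σ (‖h x‖ ^ 2) * (conj (G x x) * G x (Complex.I * x)).im / ‖x‖ ^ 2)
      (annulus r R) := by
  have hIx : Continuous fun x : ℂ => Complex.I * x := by fun_prop
  have h1 : IntegrableOn (fun x => (conj (G x x) * G x (Complex.I * x)).im) (annulus r R) := by
    have h2 := H.memLp_clm_apply continuous_id
    have h3 : MemLp (fun x => conj (G x x)) 2 (volume.restrict (annulus r R)) :=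
      h2.of_le (Complex.continuous_conj.comp_aestronglyMeasurable h2.1)
        (Eventually.of_forall fun x => by rw [RCLike.norm_conj]; rfl)
    exact (MemLp.integrable_mul_two h3 (H.memLp_clm_apply hIx)).im
  have hcont : ContinuousOn (fun p : ℂ × ℂ => ((σ (‖p.2‖ ^ 2) / ‖p.1‖ ^ 2 : ℝ) : ℂ))
      (closedAnnulus r R ×ˢ closedAnnulus m M) := by
    apply Complex.continuous_ofReal.comp_continuousOn
    apply ContinuousOn.div (by fun_prop) (by fun_prop)
    rintro ⟨x, y⟩ ⟨hx, -⟩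
    have := norm_sq_ne_zero_of_mem_closedAnnulus hr hx
    simpa using this
  have hmeas : Measurable (fun p : ℂ × ℂ => ((σ (‖p.2‖ ^ 2) / ‖p.1‖ ^ 2 : ℝ) : ℂ)) := by
    have h1 : Measurable fun p : ℂ × ℂ => σ (‖p.2‖ ^ 2) := Continuous.measurable (by fun_prop)
    exact Complex.measurable_ofReal.comp (h1.div (by fun_prop))
  obtain ⟨C, b1, b2, -⟩ := coeff_aux (h := fun _ => h) (h₀ := h) hmeas hcont
    (isCompact_closedAnnulus r R) (isCompact_closedAnnulus m M) (ae_mem_closedAnnulus r R)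
    (fun _ => H.memLp.1) (fun _ => H.bound) (Eventually.of_forall fun _ => tendsto_const_nhds)
  refine (integrable_mul_of_bound (f := fun x => σ (‖h x‖ ^ 2) / ‖x‖ ^ 2)
    (by simpa only [Complex.ofReal_re] using Complex.continuous_re.comp_aestronglyMeasurable (b1 0)) (C := C) ?_ h1).congr
    (Eventually.of_forall fun x => by ring)
  filter_upwards [b2 0] with x hx
  rwa [Complex.norm_real] at hx

/-- The change of variables formula for radial densities. -/
theorem IsAnnularMap.integral_jacobian (H : IsAnnularMap r R m M p P k h G) (hr : 0 < r)
    (hrR : r < R) (hm : 0 < m) (hM0 : 0 ≤ M) (hp : p ∈ Icc (m ^ 2) (M ^ 2))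
    (hP : P ∈ Icc (m ^ 2) (M ^ 2)) {σ : ℝ → ℝ} (hσ : Continuous σ) :
    ∫ x in annulus r R, σ (‖h x‖ ^ 2) * (conj (G x x) * G x (Complex.I * x)).im / ‖x‖ ^ 2 =
      k * Real.pi * ∫ q in p..P, σ q := by
  have hA := measurableSet_annulus r R
  have hAae := ae_restrict_mem (μ := volume) hA
  obtain ⟨F, Q, hF, hQ, hFQ, hFσ, hQσ⟩ := exists_primitive_quotient (pow_pos hm 2) hσ
  obtain ⟨Λ, hΛ⟩ := (isCompact_Icc (a := m ^ 2) (b := M ^ 2)).exists_bound_of_continuousOn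
    hσ.continuousOn
  have hΛ0 : 0 ≤ Λ := (norm_nonneg _).trans (hΛ p hp)
  have hQL : ∀ q₀ ∈ Icc (m ^ 2) (M ^ 2), ∀ q ∈ Icc (m ^ 2) (M ^ 2), |Q q - Q q₀| ≤ Λ * |q - q₀| := by
    intro q₀ h0 q h1
    rw [hQσ q q₀ h1.1 h0.1, abs_div, abs_two]
    have := intervalIntegral.norm_integral_le_of_norm_le_const (f := σ) (a := q₀) (b := q) (C := Λ)
      (fun x hx => hΛ x ⟨?_, ?_⟩)
    · rw [Real.norm_eq_abs] at this
      have h3 : 0 ≤ Λ * |q - q₀| := by positivity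
      linarith
    · rcases mem_uIoc.mp hx with h | h
      · exact h0.1.trans h.1.le
      · exact h1.1.trans h.1.le
    · rcases mem_uIoc.mp hx with h | h
      · exact h.2.trans h1.2
      · exact h.2.trans h0.2
  set ε : ℕ → ℝ := fun j => (R - r) / 3 * (1 / ((j : ℝ) + 1)) with hεd
  have hRr : 0 < R - r := by linarith
  have hε : ∀ j, 0 < ε j := fun j => by simp only [hεd]; positivity
  have hεR : ∀ j, 3 * ε j ≤ R - r := fun j => by
    have : 1 / ((j : ℝ) + 1) ≤ 1 := by
      rw [div_le_one (by positivity)]; linarith [Nat.cast_nonneg (α := ℝ) j]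
    simp only [hεd]
    nlinarith
  have hε0 : Tendsto ε atTop (𝓝 0) := by
    simpa only [mul_zero] using
      (tendsto_one_div_add_atTop_nhds_zero_nat (𝕜 := ℝ)).const_mul ((R - r) / 3)
  obtain ⟨D, hD0, hD⟩ := exists_bound_deriv_smoothTransition
  have hβD : ∀ x j t, |deriv (ramp x (ε j)) t| ≤ D / ε j := fun x j t => by
    rw [deriv_ramp, abs_div, abs_of_pos (hε j)]
    have := hε j
    gcongr
    exact hD _
  have t1 := H.tendsto_collar_flux hr hrR hm hM0 (Or.inl ⟨rfl, rfl, rfl⟩) hQ hΛ0 (hQL p hp) hε hεR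
    hε0 (β := fun j => deriv (ramp (r + ε j) (ε j))) hD0
    (fun j => (contDiff_ramp _ _).continuous_deriv le_rfl) (fun j t => hβD _ j t)
    (fun j t ht => deriv_ramp_eq_zero (hε j) (Or.inr (by linarith)))
    (fun j => integral_deriv_ramp (hε j) (by linarith [hε j]) (by linarith [hε j, hεR j]))
  have t2 := H.tendsto_collar_flux hr hrR hm hM0 (Or.inr ⟨rfl, rfl, rfl⟩) hQ hΛ0 (hQL P hP) hε hεR
    hε0 (β := fun j => deriv (ramp (R - 2 * ε j) (ε j))) hD0
    (fun j => (contDiff_ramp _ _).continuous_deriv le_rfl) (fun j t => hβD _ j t)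
    (fun j t ht => deriv_ramp_eq_zero (hε j) (Or.inl (by linarith)))
    (fun j => integral_deriv_ramp (hε j) (by linarith [hε j, hεR j]) (by linarith [hε j]))
  -- A cut-off that vanishes within `ε j` of both circles and equals one beyond `2 ε j` from them.
  -- Its derivative is a bump of mass one in the inner collar minus one in the outer collar.
  set η : ℕ → ℝ → ℝ := fun j t => ramp (r + ε j) (ε j) t - ramp (R - 2 * ε j) (ε j) t with hηd
  have hη : ∀ j, ContDiff ℝ 1 (η j) := fun j => (contDiff_ramp _ _).sub (contDiff_ramp _ _)
  have hη' : ∀ j t, deriv (η j) t =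
      deriv (ramp (r + ε j) (ε j)) t - deriv (ramp (R - 2 * ε j) (ε j)) t := fun j t =>
    deriv_fun_sub ((contDiff_ramp _ _).differentiable one_ne_zero t)
      ((contDiff_ramp _ _).differentiable one_ne_zero t)
  have hη0 : ∀ j t, (t ≤ r + ε j ∨ R - ε j ≤ t) → η j t = 0 := by
    intro j t ht
    simp only [hηd]
    rcases ht with ht | ht
    · rw [ramp_eq_zero (hε j) ht, ramp_eq_zero (hε j) (by linarith [hε j, hεR j]), sub_zero]
    · rw [ramp_eq_one (hε j) (by linarith [hε j, hεR j]), ramp_eq_one (hε j) (by linarith), sub_self]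
  have hη'0 : ∀ j t, (t < r + ε j ∨ R - ε j < t) → deriv (η j) t = 0 := by
    intro j t ht
    rw [hη']
    rcases ht with ht | ht
    · rw [deriv_ramp_eq_zero (hε j) (Or.inl ht),
        deriv_ramp_eq_zero (hε j) (Or.inl (by linarith [hε j, hεR j])), sub_zero]
    · rw [deriv_ramp_eq_zero (hε j) (Or.inr (by linarith [hε j, hεR j])),
        deriv_ramp_eq_zero (hε j) (Or.inr (by linarith)), sub_self]
  have hMae : ∀ᵐ x ∂volume.restrict (annulus r R), ‖h x‖ ≤ M := H.bound.mono fun x hx => hx.2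
  set J : ℂ → ℝ := fun x => σ (‖h x‖ ^ 2) * (conj (G x x) * G x (Complex.I * x)).im / ‖x‖ ^ 2
  have hJ : IntegrableOn J (annulus r R) := H.integrable_jacobian hr hσ
  set fl : (ℝ → ℝ) → ℂ → ℝ := fun β x => β ‖x‖ * (Q (‖h x‖ ^ 2) / ‖h x‖ ^ 2) *
      (conj (h x) * G x (Complex.I * x)).im / ‖x‖ with hfl
  have hflint : ∀ β, Continuous β → IntegrableOn (fl β) (annulus r R) := fun β hβ =>
    H.integrable_flux hr hm hβ hQ
  -- the null Lagrangian identity on the whole annulus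
  have hN : ∀ j, (∫ x in annulus r R, η j ‖x‖ * J x) +
      (∫ x in annulus r R, fl (deriv (ramp (r + ε j) (ε j))) x) -
      ∫ x in annulus r R, fl (deriv (ramp (R - 2 * ε j) (ε j))) x = 0 := by
    intro j
    have hsub : closedAnnulus (r + ε j) (R - ε j) ⊆ annulus r R :=
      closedAnnulus_subset (by linarith [hε j]) (by linarith [hε j])
    have key := setIntegral_null_lagrangian hr hM0 hMae H.hasWeakDeriv H.memLp H.memLp_deriv
      (a := r + ε j) (b := R - ε j) (by linarith [hε j]) (by linarith [hε j, hεR j])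
      (by linarith [hε j]) (hη j) hF (hη0 j _ (Or.inl le_rfl)) (hη0 j _ (Or.inr le_rfl))
    rw [add_sub_assoc, ← integral_sub (hflint _ ((contDiff_ramp _ _).continuous_deriv le_rfl))
      (hflint _ ((contDiff_ramp _ _).continuous_deriv le_rfl)), ← key]
    have hout : ∀ x ∈ annulus r R \ closedAnnulus (r + ε j) (R - ε j),
        ‖x‖ < r + ε j ∨ R - ε j < ‖x‖ := by
      rintro x ⟨-, hx⟩
      by_contra! hcon
      exact hx ⟨hcon.1, hcon.2⟩
    have hKm := measurableSet_closedAnnulus (r + ε j) (R - ε j)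
    have hbK : ∀ᵐ x ∂volume.restrict (closedAnnulus (r + ε j) (R - ε j)), m ≤ ‖h x‖ ∧ ‖h x‖ ≤ M :=
      ae_mono (Measure.restrict_mono hsub le_rfl) H.bound
    congr 1
    · rw [setIntegral_eq_of_subset_of_forall_sdiff_eq_zero hA hsub (f := fun x => η j ‖x‖ * J x)]
      · refine integral_congr_ae ?_
        filter_upwards [hbK] with x hx
        rw [hFσ _ (pow_le_pow_left₀ hm.le hx.1 2)]
        simp only [J]
        ring
      · intro x hx
        rw [hη0 j _ ((hout x hx).imp le_of_lt le_of_lt), zero_mul]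
    · rw [setIntegral_eq_of_subset_of_forall_sdiff_eq_zero hA hsub (f := fun x =>
        fl (deriv (ramp (r + ε j) (ε j))) x - fl (deriv (ramp (R - 2 * ε j) (ε j))) x)]
      · refine integral_congr_ae ?_
        filter_upwards [hbK] with x hx
        rw [hFQ _ (pow_le_pow_left₀ hm.le hx.1 2), hη']
        simp only [hfl]
        ring
      · intro x hx
        have h0 := hη'0 j _ (hout x hx)
        rw [hη'] at h0
        simp only [hfl]
        rw [sub_eq_zero.mp h0, sub_self]
  have t3 : Tendsto (fun j => ∫ x in annulus r R, η j ‖x‖ * J x) atTop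
      (𝓝 (∫ x in annulus r R, J x)) := by
    refine tendsto_integral_of_dominated_convergence (fun x => ‖J x‖) (fun j => ?_) hJ.norm
      (fun j => Eventually.of_forall fun x => ?_) ?_
    · exact (aestronglyMeasurable_norm_comp (hη j).continuous.measurable).mul hJ.1
    · rw [norm_mul]
      refine mul_le_of_le_one_left (norm_nonneg _) ?_
      rw [Real.norm_eq_abs, abs_le]
      have a1 := Real.smoothTransition.nonneg ((‖x‖ - (r + ε j)) / ε j)
      have a2 := Real.smoothTransition.le_one ((‖x‖ - (r + ε j)) / ε j)
      have a3 := Real.smoothTransition.nonneg ((‖x‖ - (R - 2 * ε j)) / ε j)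
      have a4 := Real.smoothTransition.le_one ((‖x‖ - (R - 2 * ε j)) / ε j)
      simp only [hηd, ramp]
      constructor <;> linarith
    · filter_upwards [hAae] with x hx
      have h3 : Tendsto (fun j => 2 * ε j) atTop (𝓝 0) := by simpa using hε0.const_mul 2
      refine tendsto_const_nhds.congr' ?_
      filter_upwards [h3.eventually_lt_const (sub_pos.mpr hx.1),
        h3.eventually_lt_const (sub_pos.mpr hx.2)] with j h1 h2
      simp only [hηd]
      rw [ramp_eq_one (hε j) (by linarith), ramp_eq_zero (hε j) (by linarith), sub_zero, one_mul]
  -- In the limit the Jacobian integral equals the outer flux `2πk Q(P)` minus the inner flux `2πk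
  -- Q(p)`, and `Q(P) - Q(p)` is half the integral of `σ`.
  have t4 := (t3.add t1).sub t2
  have e := tendsto_nhds_unique t4 (tendsto_const_nhds.congr fun j => (hN j).symm)
  have e2 := hQσ P p hP.1 hp.1
  linear_combination e + 2 * Real.pi * k * e2

end Jacobian

/-! ### The energy in polar form and the values of the free Lagrangians. -/

section EnergyIntegrals

open scoped ComplexConjugate

variable {r R m M p P : ℝ} {k : ℤ} {h : ℂ → ℂ} {G : ℂ → ℂ →L[ℝ] ℂ}

/-- `x` and `I * x` are orthogonal and of the same length, and the Hilbert–Schmidt norm does not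
depend on the orthonormal basis. -/
theorem clm_polar_norm_sq (L : ℂ →L[ℝ] ℂ) (x : ℂ) :
    ‖L x‖ ^ 2 + ‖L (Complex.I * x)‖ ^ 2 = ‖x‖ ^ 2 * (‖L 1‖ ^ 2 + ‖L Complex.I‖ ^ 2) := by
  rw [clm_apply_eq L x, clm_apply_eq L (Complex.I * x)]
  simp only [← Complex.normSq_eq_norm_sq, Complex.normSq_apply, Complex.mul_re, Complex.mul_im,
    Complex.add_re, Complex.add_im, Complex.ofReal_re, Complex.ofReal_im, Complex.I_re,
    Complex.I_im]
  ring

theorem IsAnnularMap.integrable_energy (H : IsAnnularMap r R m M p P k h G) (hr : 0 < r) :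
    IntegrableOn (fun x => (‖G x x‖ ^ 2 + ‖G x (Complex.I * x)‖ ^ 2) / ‖x‖ ^ 2) (annulus r R) := by
  have h1 : ∀ v, IntegrableOn (fun x => ‖G x v‖ ^ 2) (annulus r R) := fun v =>
    H.integrable_norm_sq_apply (d := fun _ => v) continuous_const
  refine ((h1 1).add (h1 Complex.I)).congr ?_
  filter_upwards [ae_restrict_mem (measurableSet_annulus r R)] with x hx
  have : ‖x‖ ^ 2 ≠ 0 := pow_ne_zero _ (hr.trans hx.1).ne'
  rw [clm_polar_norm_sq, mul_div_cancel_left₀ _ this]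
  rfl

theorem IsAnnularMap.dirichletEnergy_eq (H : IsAnnularMap r R m M p P k h G) (hr : 0 < r) :
    dirichletEnergy (annulus r R) h = ENNReal.ofReal (∫ x in annulus r R,
      (‖G x x‖ ^ 2 + ‖G x (Complex.I * x)‖ ^ 2) / ‖x‖ ^ 2) := by
  rw [ofReal_integral_eq_lintegral_ofReal (H.integrable_energy hr)
    (Eventually.of_forall fun x => by positivity),
    H.hasWeakDeriv.dirichletEnergy_eq (isOpen_annulus r R)]
  refine lintegral_congr_ae ?_
  filter_upwards [ae_restrict_mem (measurableSet_annulus r R)] with x hx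
  have : ‖x‖ ^ 2 ≠ 0 := pow_ne_zero _ (hr.trans hx.1).ne'
  rw [clm_polar_norm_sq, mul_div_cancel_left₀ _ this]

/-- The normal identity with `ζ = 1` and `Φ` a primitive of `ψ / 2`. -/
theorem IsAnnularMap.integral_radial (H : IsAnnularMap r R m M p P k h G) (hr : 0 < r)
    {ψ : ℝ → ℝ} (hψ : Continuous ψ) :
    IntegrableOn (fun x => ψ (‖h x‖ ^ 2) * (conj (h x) * G x x).re / ‖x‖ ^ 2) (annulus r R) ∧
    ∫ x in annulus r R, ψ (‖h x‖ ^ 2) * (conj (h x) * G x x).re / ‖x‖ ^ 2 =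
      Real.pi * ∫ q in p..P, ψ q := by
  have hS0 : ∀ x ∈ closedAnnulus r R, x ≠ 0 := fun x hx h0 => by
    have := hx.1; rw [h0, norm_zero] at this; linarith
  set Φ : ℝ → ℝ := fun q => (∫ x in p..q, ψ x) / 2 with hΦd
  have hΦ' : ∀ q, HasDerivAt Φ (ψ q / 2) q := fun q =>
    (intervalIntegral.integral_hasDerivAt_right (hψ.intervalIntegrable _ _)
      (hψ.stronglyMeasurableAtFilter _ _) hψ.continuousAt).div_const 2
  have hΦ : ContDiff ℝ 1 Φ := by
    rw [contDiff_one_iff_deriv]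
    refine ⟨fun q => (hΦ' q).differentiableAt, ?_⟩
    rw [funext fun q => (hΦ' q).deriv]
    fun_prop
  have hΦd' : Continuous (deriv Φ) := hΦ.continuous_deriv le_rfl
  have i1 := integrable_coeff_mul (measurable_normalCoeff (ζ := fun _ => 1) continuous_const hΦd')
    (continuousOn_normalCoeff continuous_const hΦd' hS0) (isCompact_closedAnnulus r R)
    (isCompact_closedAnnulus m M) (ae_mem_closedAnnulus r R) H.memLp.1 H.bound H.memLp_deriv
    continuous_id
  have key := H.normal (fun _ => 1) Φ contDiff_const hΦ
  have e : ∀ x, (((1 * deriv Φ (‖h x‖ ^ 2) * 2 / ‖x‖ ^ 2 : ℝ) : ℂ) * conj (h x) * G x x).re =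
      ψ (‖h x‖ ^ 2) * (conj (h x) * G x x).re / ‖x‖ ^ 2 := fun x => by
    rw [mul_assoc, Complex.re_ofReal_mul, (hΦ' _).deriv]; ring
  simp only [id, e, deriv_const, zero_mul, zero_div, integral_zero, add_zero] at i1 key
  refine ⟨i1, key.trans ?_⟩
  simp only [hΦd, intervalIntegral.integral_same]
  ring

theorem IsAnnularMap.integral_angular (H : IsAnnularMap r R m M p P k h G) (hr : 0 < r)
    (hrR : r < R) (hm : 0 < m) :
    IntegrableOn (fun x => (conj (h x) * G x (Complex.I * x)).im / ‖h x‖ ^ 2 / ‖x‖ ^ 2)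
      (annulus r R) ∧
    ∫ x in annulus r R, (conj (h x) * G x (Complex.I * x)).im / ‖h x‖ ^ 2 / ‖x‖ ^ 2 =
      2 * Real.pi * k * Real.log (R / r) := by
  have hS0 : ∀ x ∈ closedAnnulus r R, x ≠ 0 := fun x hx h0 => by
    have := hx.1; rw [h0, norm_zero] at this; linarith
  have hT0 : ∀ x ∈ closedAnnulus m M, x ≠ 0 := fun x hx h0 => by
    have := hx.1; rw [h0, norm_zero] at this; linarith
  have i1 := integrable_coeff_mul (measurable_tangentialCoeff (ζ := fun _ => 1) continuous_const)
    (continuousOn_tangentialCoeff continuous_const hS0 hT0) (isCompact_closedAnnulus r R)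
    (isCompact_closedAnnulus m M) (ae_mem_closedAnnulus r R) H.memLp.1 H.bound H.memLp_deriv
    (d := fun x => Complex.I * x) (by fun_prop)
  have key := H.tangential (fun _ => 1) continuous_const
  have e : ∀ x, (((1 / ‖h x‖ ^ 2 / ‖x‖ ^ 2 : ℝ) : ℂ) * (-Complex.I * conj (h x)) *
      G x (Complex.I * x)).re = (conj (h x) * G x (Complex.I * x)).im / ‖h x‖ ^ 2 / ‖x‖ ^ 2 :=
    fun x => by
      have := re_neg_I_mul_ofReal_mul (1 / ‖h x‖ ^ 2 / ‖x‖ ^ 2) (conj (h x)) (G x (Complex.I * x))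
      rw [show ((1 / ‖h x‖ ^ 2 / ‖x‖ ^ 2 : ℝ) : ℂ) * (-Complex.I * conj (h x)) *
        G x (Complex.I * x) = -Complex.I * ((1 / ‖h x‖ ^ 2 / ‖x‖ ^ 2 : ℝ) : ℂ) * conj (h x) *
        G x (Complex.I * x) by ring, this]
      ring
  simp only [e] at i1 key
  rw [integral_one_div_of_pos hr (hr.trans hrR)] at key
  exact ⟨i1, key⟩

/-- With constant `Φ` the map drops out of the normal identity, which then merely computes radial
integrals. -/
theorem IsAnnularMap.integral_deriv_radius (H : IsAnnularMap r R m M p P k h G) {ζ : ℝ → ℝ}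
    (hζ : ContDiff ℝ 1 ζ) :
    ∫ x in annulus r R, deriv ζ ‖x‖ / ‖x‖ = 2 * Real.pi * (ζ R - ζ r) := by
  have key := H.normal ζ (fun _ => 1) hζ contDiff_const
  simpa using key

theorem IsAnnularMap.integral_inv_sq (H : IsAnnularMap r R m M p P k h G) (hr : 0 < r)
    (hrR : r < R) : IntegrableOn (fun x : ℂ => 1 / ‖x‖ ^ 2) (annulus r R) ∧
    ∫ x in annulus r R, 1 / ‖x‖ ^ 2 = 2 * Real.pi * Real.log (R / r) := by
  constructor
  · refine (ContinuousOn.integrableOn_compact (isCompact_closedAnnulus r R) ?_).mono_set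
      (annulus_subset_closedAnnulus r R)
    exact continuousOn_const.div (by fun_prop) fun x hx => norm_sq_ne_zero_of_mem_closedAnnulus hr hx
  · set f : ℝ → ℝ := fun t => 1 / max t r with hf
    have hfc : Continuous f := continuous_const.div (by fun_prop) fun t =>
      (lt_max_of_lt_right hr).ne'
    set ζ : ℝ → ℝ := fun t => ∫ s in r..t, f s
    have hζ' : ∀ t, HasDerivAt ζ (f t) t := fun t =>
      intervalIntegral.integral_hasDerivAt_right (hfc.intervalIntegrable _ _)
        (hfc.stronglyMeasurableAtFilter _ _) hfc.continuousAt
    have hζ : ContDiff ℝ 1 ζ := by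
      rw [contDiff_one_iff_deriv]
      refine ⟨fun q => (hζ' q).differentiableAt, ?_⟩
      rwa [funext fun q => (hζ' q).deriv]
    have key := H.integral_deriv_radius hζ
    have e1 : ζ R = Real.log (R / r) := by
      rw [← integral_one_div_of_pos hr (hr.trans hrR)]
      refine intervalIntegral.integral_congr fun t ht => ?_
      rw [uIcc_of_le hrR.le] at ht
      simp only [hf]; rw [max_eq_left ht.1]
    have e2 : ζ r = 0 := intervalIntegral.integral_same
    rw [e1, e2, sub_zero] at key
    rw [← key]
    refine setIntegral_congr_fun (measurableSet_annulus r R) fun x hx => ?_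
    simp only [(hζ' _).deriv, hf, max_eq_left hx.1.le]
    field_simp

end EnergyIntegrals

/-! ### The energy bound and its equality case. -/

section LowerBound

open scoped ComplexConjugate

variable {r R m M p P c : ℝ} {k : ℤ} {h : ℂ → ℂ} {G : ℂ → ℂ →L[ℝ] ℂ}

theorem norm_sq_mul_eq (z w : ℂ) :
    ‖z‖ ^ 2 * ‖w‖ ^ 2 = (conj z * w).re ^ 2 + (conj z * w).im ^ 2 := by
  simp only [← Complex.normSq_eq_norm_sq, Complex.normSq_apply, Complex.mul_re, Complex.mul_im,
    Complex.conj_re, Complex.conj_im]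
  ring

/-- Multiplication by `z̄` resolves a variation of `z` into its effect on the modulus (real part)
and on the argument (imaginary part); the Jacobian becomes a determinant in these components. -/
theorem norm_sq_mul_im_conj_mul (z a b : ℂ) : ‖z‖ ^ 2 * (conj a * b).im =
    (conj z * a).re * (conj z * b).im - (conj z * a).im * (conj z * b).re := by
  simp only [← Complex.normSq_eq_norm_sq, Complex.normSq_apply, Complex.mul_re, Complex.mul_im,
    Complex.conj_re, Complex.conj_im]
  ring

theorem eq_mul_of_conj_mul {z a w : ℂ} (hz : z ≠ 0) (h : conj z * a = ‖z‖ ^ 2 * w) : a = w * z := by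
  have hc : conj z ≠ 0 := by simpa using hz
  apply mul_left_cancel₀ hc
  rw [h, ← Complex.ofReal_pow, ← Complex.normSq_eq_norm_sq, ← Complex.mul_conj]
  ring

theorem quadratic_nonneg {s x y : ℝ} (hs : |s| ≤ 1) : 0 ≤ x ^ 2 + y ^ 2 + 2 * s * x * y := by
  obtain ⟨h1, h2⟩ := abs_le.mp hs
  nlinarith [mul_nonneg (by linarith : 0 ≤ 1 + s) (sq_nonneg (x + y)),
    mul_nonneg (by linarith : 0 ≤ 1 - s) (sq_nonneg (x - y))]

theorem eq_zero_of_quadratic {s x y : ℝ} (hs : |s| < 1) (h : x ^ 2 + y ^ 2 + 2 * s * x * y = 0) :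
    x = 0 ∧ y = 0 := by
  obtain ⟨h1, h2⟩ := abs_lt.mp hs
  have h3 := mul_nonneg (by linarith : 0 ≤ 1 + s) (sq_nonneg (x + y))
  have h4 := mul_nonneg (by linarith : 0 ≤ 1 - s) (sq_nonneg (x - y))
  have h5 : (1 + s) * (x + y) ^ 2 = 0 := by nlinarith
  have h6 : (1 - s) * (x - y) ^ 2 = 0 := by nlinarith
  have h7 : x + y = 0 := by
    rcases mul_eq_zero.mp h5 with h | h
    · linarith
    · exact pow_eq_zero_iff two_ne_zero |>.mp h
  have h8 : x - y = 0 := by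
    rcases mul_eq_zero.mp h6 with h | h
    · linarith
    · exact pow_eq_zero_iff two_ne_zero |>.mp h
  constructor <;> linarith

/-- The slope `√(1 - c / q)` of extremal maps, as a function of `q = |h|²`, made constant for
`q ≤ m²`. -/
noncomputable def extremalSlope (c m q : ℝ) : ℝ := Real.sqrt (1 - c / max q (m ^ 2))

theorem continuous_extremalSlope (c : ℝ) (hm : 0 < m) : Continuous (extremalSlope c m) := by
  unfold extremalSlope
  exact (continuous_const.sub (continuous_const.div (by fun_prop) fun q =>
    (lt_max_of_lt_right (pow_pos hm 2)).ne')).sqrt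

theorem extremalSlope_sq (hm : 0 < m) (hc : c ≤ m ^ 2) {q : ℝ} (hq : m ^ 2 ≤ q) :
    extremalSlope c m q ^ 2 = 1 - c / q := by
  have hq0 : 0 < q := (pow_pos hm 2).trans_le hq
  rw [extremalSlope, max_eq_left hq, Real.sq_sqrt]
  rw [sub_nonneg, div_le_one hq0]
  exact hc.trans hq

/-- Here `q = |h|²`, and `A`, `B` are `h̄ · G x x` and `h̄ · G x (I x)`. The weight of `B₂²` is
split as `1 = σ² + c/q`: the first share completes a square with `A₁`, the second with the constant.
The signs `ε`, `κ` stand for orientation and degree. -/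
theorem defect_identity {q σ ε κ A₁ A₂ B₁ B₂ : ℝ} (hq : q ≠ 0) (hσ : σ ^ 2 = 1 - c / q)
    (hε : ε ^ 2 = 1) (hκ : κ ^ 2 = 1) :
    (A₁ ^ 2 + A₂ ^ 2) / q + (B₁ ^ 2 + B₂ ^ 2) / q - 2 * ε * (σ * ((A₁ * B₂ - A₂ * B₁) / q)) -
      c * (2 * κ * (B₂ / q) - 1) =
    ((A₁ - ε * σ * B₂) ^ 2 + c / q * (B₂ - κ * q) ^ 2 +
      (A₂ ^ 2 + B₁ ^ 2 + 2 * (σ * ε) * A₂ * B₁)) / q := by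
  have h1 : c = q * (1 - σ ^ 2) := by rw [hσ]; field_simp; ring
  subst h1
  field_simp
  linear_combination (-(σ ^ 2 * B₂ ^ 2)) * hε - (1 - σ ^ 2) * q ^ 2 * hκ

/-- For `c < 0` the square with coefficient `c/q` would have the wrong sign. Now `σ` is the
reciprocal slope, `e = -c`, and it is the weight of `A₁²` that is split, as `σ² + σ² e/q`. -/
theorem defect_identity' {q σ ε o e A₁ A₂ B₁ B₂ : ℝ} (hq : q ≠ 0) (hσ : σ ^ 2 * (1 + e / q) = 1)
    (hε : ε ^ 2 = 1) (ho : o ^ 2 = 1) :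
    (A₁ ^ 2 + A₂ ^ 2) / q + (B₁ ^ 2 + B₂ ^ 2) / q - 2 * ε * (σ * ((A₁ * B₂ - A₂ * B₁) / q)) -
      e * (2 * o * (σ / q * A₁) - 1) =
    ((B₂ - ε * σ * A₁) ^ 2 + e / q * (σ * A₁ - o * q) ^ 2 +
      (A₂ ^ 2 + B₁ ^ 2 + 2 * (σ * ε) * A₂ * B₁)) / q := by
  have h1 : σ ^ 2 * (q + e) = q := by field_simp at hσ; linarith
  field_simp
  linear_combination (-(σ ^ 2 * q * A₁ ^ 2)) * hε - e * q ^ 2 * ho - A₁ ^ 2 * h1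

/-- Two energy integrands that agree up to a nonnegative defect. -/
theorem integral_eq_of_defect {F D : ℂ → ℝ} {μ : Measure ℂ} (hF : Integrable F μ)
    (hD : Integrable D μ) (h0 : ∀ᵐ x ∂μ, 0 ≤ F x - D x) :
    ∫ x, D x ∂μ ≤ ∫ x, F x ∂μ ∧ (∫ x, F x ∂μ = ∫ x, D x ∂μ ↔ ∀ᵐ x ∂μ, F x - D x = 0) := by
  have h1 := integral_sub hF hD
  have h2 := integral_nonneg_of_ae h0
  refine ⟨by linarith, ?_⟩
  rw [← sub_eq_zero, ← h1, integral_eq_zero_iff_of_nonneg_ae h0 (hF.sub hD)]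
  rfl

/-- The data of the orientation and of the order of the boundary components. -/
theorem exists_sign (hk : k = 1 ∨ k = -1)
    (ho : (p = m ^ 2 ∧ P = M ^ 2) ∨ (p = M ^ 2 ∧ P = m ^ 2)) :
    ∃ o : ℝ, o ^ 2 = 1 ∧ (o * k) ^ 2 = 1 ∧ (k : ℝ) ^ 2 = 1 ∧
      (∀ σ : ℝ → ℝ, o * ∫ q in p..P, σ q = ∫ q in (m ^ 2)..(M ^ 2), σ q) ∧
      (p = m ^ 2 → P = M ^ 2 → p < P → o = 1) := by
  have hk2 : (k : ℝ) ^ 2 = 1 := by rcases hk with rfl | rfl <;> norm_num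
  rcases ho with ⟨rfl, rfl⟩ | ⟨rfl, rfl⟩
  · exact ⟨1, by norm_num, by rw [one_mul, hk2], hk2, fun σ => one_mul _, fun _ _ _ => rfl⟩
  · refine ⟨-1, by norm_num, by rw [mul_pow, hk2]; norm_num, hk2, fun σ => ?_, fun h1 _ h3 => ?_⟩
    · rw [intervalIntegral.integral_symm]; ring
    · exact absurd h3 (by rw [h1]; linarith)

/-- `h` satisfies the first order equations of extremal maps. -/
def IsExtremal (r R m c : ℝ) (h : ℂ → ℂ) (G : ℂ → ℂ →L[ℝ] ℂ) : Prop :=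
  ∀ᵐ x ∂volume.restrict (annulus r R), G x x = extremalSlope c m (‖h x‖ ^ 2) * h x ∧
    G x (Complex.I * x) = Complex.I * h x

theorem IsAnnularMap.ae_pos (H : IsAnnularMap r R m M p P k h G) (hr : 0 < r) (hm : 0 < m) :
    ∀ᵐ x ∂volume.restrict (annulus r R), 0 < ‖x‖ ∧ h x ≠ 0 ∧ m ^ 2 ≤ ‖h x‖ ^ 2 ∧ 0 < ‖h x‖ ^ 2 := by
  filter_upwards [ae_restrict_mem (measurableSet_annulus r R), H.bound] with x hx hb
  have h0 : 0 < ‖h x‖ := hm.trans_le hb.1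
  exact ⟨hr.trans hx.1, norm_pos_iff.mp h0, pow_le_pow_left₀ hm.le hb.1 2, by positivity⟩

theorem extremal_re_im {s : ℝ} {z a b : ℂ} (ha : a = s * z) (hb : b = Complex.I * z) :
    (conj z * a).re = s * ‖z‖ ^ 2 ∧ (conj z * a).im = 0 ∧ (conj z * b).re = 0 ∧
      (conj z * b).im = ‖z‖ ^ 2 := by
  have h1 : conj z * a = (s * ‖z‖ ^ 2 : ℝ) := by
    rw [ha, mul_left_comm, ← Complex.normSq_eq_conj_mul_self, Complex.normSq_eq_norm_sq]
    push_cast; ring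
  have h2 : conj z * b = Complex.I * (‖z‖ ^ 2 : ℝ) := by
    rw [hb, mul_left_comm, ← Complex.normSq_eq_conj_mul_self, Complex.normSq_eq_norm_sq]
  rw [h1, h2]
  exact ⟨Complex.ofReal_re _, Complex.ofReal_im _, by rw [Complex.I_mul_re, Complex.ofReal_im,
    neg_zero], by rw [Complex.I_mul_im, Complex.ofReal_re]⟩

theorem extremal_of_re_im {s : ℝ} {z a b : ℂ} (hz : z ≠ 0) (h1 : (conj z * a).re = s * ‖z‖ ^ 2)
    (h2 : (conj z * a).im = 0) (h3 : (conj z * b).re = 0) (h4 : (conj z * b).im = ‖z‖ ^ 2) :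
    a = s * z ∧ b = Complex.I * z := by
  constructor
  · apply eq_mul_of_conj_mul hz
    apply Complex.ext <;> simp [h1, h2, ← Complex.ofReal_pow]; ring
  · apply eq_mul_of_conj_mul hz
    apply Complex.ext <;> simp [h3, h4, ← Complex.ofReal_pow]

theorem eq_zero_of_sq_add_sq {x y : ℝ} (h : x ^ 2 + y ^ 2 = 0) : x = 0 ∧ y = 0 := by
  obtain ⟨h1, h2⟩ := (add_eq_zero_iff_of_nonneg (sq_nonneg x) (sq_nonneg y)).mp h
  exact ⟨pow_eq_zero_iff two_ne_zero |>.mp h1, pow_eq_zero_iff two_ne_zero |>.mp h2⟩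

theorem extremalSlope_zero (m q : ℝ) : extremalSlope 0 m q = 1 := by simp [extremalSlope]

/-- A conformal map of degree one satisfies the equations of extremal maps. -/
theorem IsAnnularMap.isExtremal_of_conformal (H : IsAnnularMap r R m M p P 1 h G) (hr : 0 < r)
    (hrR : r < R) (hm : 0 < m) (hM0 : 0 ≤ M) (hp : p ∈ Icc (m ^ 2) (M ^ 2))
    (hP : P ∈ Icc (m ^ 2) (M ^ 2)) (hconf : ∀ᵐ x ∂volume.restrict (annulus r R),
      (conj (h x) * G x x).re = (conj (h x) * G x (Complex.I * x)).im ∧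
      (conj (h x) * G x x).im = -(conj (h x) * G x (Complex.I * x)).re) :
    IsExtremal r R m 0 h G := by
  obtain ⟨hIi, hI⟩ := H.integral_inv_sq hr hrR
  obtain ⟨hBi, hB⟩ := H.integral_angular hr hrR hm
  set ψ : ℝ → ℝ := fun q => 1 / max q (m ^ 2)
  have hψ : Continuous ψ := continuous_const.div (by fun_prop) fun q =>
    (lt_max_of_lt_right (pow_pos hm 2)).ne'
  obtain ⟨hAi, hA⟩ := H.integral_radial hr hψ
  have hKi := H.integrable_jacobian hr hψ
  have hK := H.integral_jacobian hr hrR hm hM0 hp hP hψ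
  set I := ∫ q in p..P, ψ q
  have hAB : ∫ x in annulus r R, ψ (‖h x‖ ^ 2) * (conj (h x) * G x x).re / ‖x‖ ^ 2 =
      ∫ x in annulus r R, (conj (h x) * G x (Complex.I * x)).im / ‖h x‖ ^ 2 / ‖x‖ ^ 2 := by
    refine integral_congr_ae ?_
    filter_upwards [H.ae_pos hr hm, hconf] with x ⟨hx, hh0, hqm, hq⟩ hcf
    simp only [ψ, max_eq_left hqm, hcf.1]
    ring
  rw [hA, hB, Int.cast_one] at hAB
  rw [Int.cast_one] at hK
  -- The integral of `|h̄ · G x x / |h|² - 1|² / |x|²`, expanded. With `ψ = 1/q` the Jacobian term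
  -- gives `πI`; conformality equates the radial and angular integrals, so `πI = 2π log(R/r)`, and
  -- the three terms cancel.
  have hz : ∫ x in annulus r R, (ψ (‖h x‖ ^ 2) *
      (conj (G x x) * G x (Complex.I * x)).im / ‖x‖ ^ 2 - 2 *
      (ψ (‖h x‖ ^ 2) * (conj (h x) * G x x).re / ‖x‖ ^ 2) + 1 / ‖x‖ ^ 2) = 0 := by
    have i1 : IntegrableOn (fun x => ψ (‖h x‖ ^ 2) *
      (conj (G x x) * G x (Complex.I * x)).im / ‖x‖ ^ 2 - 2 *
      (ψ (‖h x‖ ^ 2) * (conj (h x) * G x x).re / ‖x‖ ^ 2)) (annulus r R) :=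
      hKi.sub (hAi.const_mul 2)
    rw [integral_add i1 hIi, integral_sub hKi (hAi.const_mul 2), integral_const_mul, hK, hA, hI]
    linear_combination -hAB
  have hform : ∀ᵐ x ∂volume.restrict (annulus r R), ψ (‖h x‖ ^ 2) *
      (conj (G x x) * G x (Complex.I * x)).im / ‖x‖ ^ 2 - 2 *
      (ψ (‖h x‖ ^ 2) * (conj (h x) * G x x).re / ‖x‖ ^ 2) + 1 / ‖x‖ ^ 2 =
      (((conj (h x) * G x x).re - ‖h x‖ ^ 2) ^ 2 + (conj (h x) * G x x).im ^ 2) /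
      (‖h x‖ ^ 2) ^ 2 / ‖x‖ ^ 2 := by
    filter_upwards [H.ae_pos hr hm, hconf] with x ⟨hx, hh0, hqm, hq⟩ hcf
    have h1 := norm_sq_mul_im_conj_mul (h x) (G x x) (G x (Complex.I * x))
    rw [← hcf.1, show (conj (h x) * G x (Complex.I * x)).re = -(conj (h x) * G x x).im by
      rw [hcf.2, neg_neg]] at h1
    have h2 : (conj (G x x) * G x (Complex.I * x)).im =
        ((conj (h x) * G x x).re ^ 2 + (conj (h x) * G x x).im ^ 2) / ‖h x‖ ^ 2 := by
      rw [eq_div_iff hq.ne']; linarith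
    rw [h2]
    simp only [ψ, max_eq_left hqm]
    field_simp
    ring
  rw [integral_eq_zero_iff_of_nonneg_ae] at hz
  · filter_upwards [H.ae_pos hr hm, hconf, hform, hz] with x ⟨hx, hh0, hqm, hq⟩ hcf hfm hz0
    rw [hfm, Pi.zero_apply, div_eq_zero_iff, div_eq_zero_iff] at hz0
    have h1 := (hz0.resolve_right (by positivity)).resolve_right (by positivity)
    obtain ⟨h2, h3⟩ := eq_zero_of_sq_add_sq h1
    rw [sub_eq_zero] at h2
    have hσx := extremalSlope_zero m (‖h x‖ ^ 2)
    exact extremal_of_re_im hh0 (by rw [hσx, one_mul, h2]) h3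
      (by rw [← neg_eq_zero, ← hcf.2, h3]) (by rw [← hcf.1, h2])
  · filter_upwards [hform] with x hx
    rw [hx, Pi.zero_apply]
    positivity
  · exact (hKi.sub (hAi.const_mul 2)).add hIi

theorem extremalSlope_pos (hm : 0 < m) (hc : c < 0) (q : ℝ) : 0 < extremalSlope c m q := by
  apply Real.sqrt_pos.mpr
  have : c / max q (m ^ 2) ≤ 0 :=
    div_nonpos_of_nonpos_of_nonneg hc.le (lt_max_of_lt_right (pow_pos hm 2)).le
  linarith

/-- The lower bound for the energy, with its equality case, for `0 ≤ c`. -/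
theorem IsAnnularMap.energy_bound_of_nonneg (H : IsAnnularMap r R m M p P k h G) (hr : 0 < r)
    (hrR : r < R) (hm : 0 < m) (hmM : m < M) (hk : k = 1 ∨ k = -1)
    (ho : (p = m ^ 2 ∧ P = M ^ 2) ∨ (p = M ^ 2 ∧ P = m ^ 2)) (hc0 : 0 ≤ c) (hc : c ≤ m ^ 2) :
    2 * Real.pi * (∫ q in (m ^ 2)..(M ^ 2), extremalSlope c m q) +
        c * (2 * Real.pi * Real.log (R / r)) ≤
      ∫ x in annulus r R, (‖G x x‖ ^ 2 + ‖G x (Complex.I * x)‖ ^ 2) / ‖x‖ ^ 2 ∧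
    (k = 1 → p = m ^ 2 → P = M ^ 2 →
      (∫ x in annulus r R, (‖G x x‖ ^ 2 + ‖G x (Complex.I * x)‖ ^ 2) / ‖x‖ ^ 2 =
        2 * Real.pi * (∫ q in (m ^ 2)..(M ^ 2), extremalSlope c m q) +
        c * (2 * Real.pi * Real.log (R / r)) ↔ IsExtremal r R m c h G)) := by
  have hmM2 : m ^ 2 < M ^ 2 := pow_lt_pow_left₀ hmM hm.le two_ne_zero
  have hM0 : 0 ≤ M := hm.le.trans hmM.le
  have hp : p ∈ Icc (m ^ 2) (M ^ 2) := by
    rcases ho with ⟨rfl, -⟩ | ⟨rfl, -⟩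
    exacts [⟨le_rfl, hmM2.le⟩, ⟨hmM2.le, le_rfl⟩]
  have hP : P ∈ Icc (m ^ 2) (M ^ 2) := by
    rcases ho with ⟨-, rfl⟩ | ⟨-, rfl⟩
    exacts [⟨hmM2.le, le_rfl⟩, ⟨le_rfl, hmM2.le⟩]
  obtain ⟨o, ho2, hε, hk2, hoI, ho1⟩ := exists_sign hk ho
  set ε : ℝ := o * k with hεd
  have hσc := continuous_extremalSlope c hm
  set σ := extremalSlope c m
  have hJ := H.integral_jacobian hr hrR hm hM0 hp hP hσc
  have hJi := H.integrable_jacobian hr hσc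
  obtain ⟨hBi, hB⟩ := H.integral_angular hr hrR hm
  obtain ⟨hIi, hI⟩ := H.integral_inv_sq hr hrR
  -- The calibrating free Lagrangian. The signs `ε` and `k` compensate orientation and boundary
  -- order, so its integral is the same for all admissible classes.
  set D : ℂ → ℝ := fun x => 2 * ε *
    (σ (‖h x‖ ^ 2) * (conj (G x x) * G x (Complex.I * x)).im / ‖x‖ ^ 2) +
    c * (2 * k * ((conj (h x) * G x (Complex.I * x)).im / ‖h x‖ ^ 2 / ‖x‖ ^ 2) - 1 / ‖x‖ ^ 2)
    with hDd
  have hDi2 : IntegrableOn (fun x => 2 * (k : ℝ) * ((conj (h x) * G x (Complex.I * x)).im /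
      ‖h x‖ ^ 2 / ‖x‖ ^ 2) - 1 / ‖x‖ ^ 2) (annulus r R) := (hBi.const_mul _).sub hIi
  have hDi : IntegrableOn D (annulus r R) := (hJi.const_mul _).add (hDi2.const_mul _)
  have hDval : ∫ x in annulus r R, D x = 2 * Real.pi * (∫ q in (m ^ 2)..(M ^ 2), σ q) +
      c * (2 * Real.pi * Real.log (R / r)) := by
    simp only [hDd]
    rw [integral_add (hJi.const_mul _) (hDi2.const_mul _), integral_const_mul, integral_const_mul,
      integral_sub (hBi.const_mul _) hIi, integral_const_mul, hJ, hB, hI, ← hoI σ]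
    linear_combination (2 * Real.pi * o * ∫ q in p..P, σ q) * hk2 +
      (4 * c * Real.pi * Real.log (R / r)) * hk2
  have hdef : ∀ᵐ x ∂volume.restrict (annulus r R),
      (‖G x x‖ ^ 2 + ‖G x (Complex.I * x)‖ ^ 2) / ‖x‖ ^ 2 - D x =
      (((conj (h x) * G x x).re - ε * σ (‖h x‖ ^ 2) * (conj (h x) * G x (Complex.I * x)).im) ^ 2 +
        c / ‖h x‖ ^ 2 * ((conj (h x) * G x (Complex.I * x)).im - k * ‖h x‖ ^ 2) ^ 2 +
        ((conj (h x) * G x x).im ^ 2 + (conj (h x) * G x (Complex.I * x)).re ^ 2 +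
        2 * (σ (‖h x‖ ^ 2) * ε) * (conj (h x) * G x x).im *
        (conj (h x) * G x (Complex.I * x)).re)) / ‖h x‖ ^ 2 / ‖x‖ ^ 2 := by
    filter_upwards [H.ae_pos hr hm] with x ⟨hx, hh0, hqm, hq⟩
    rw [← defect_identity hq.ne' (extremalSlope_sq hm hc hqm) hε hk2, ← norm_sq_mul_eq,
      ← norm_sq_mul_eq, ← norm_sq_mul_im_conj_mul]
    simp only [hDd]
    field_simp
    ring
  -- `c ≥ 0` gives slope at most one, which makes the form in the off-diagonal components `A₂`, `B₁`
  -- semidefinite. It is definite only if `c > 0`.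
  have hσ1 : ∀ q, m ^ 2 ≤ q → |σ q * ε| ≤ 1 := fun q hq => by
    have h1 := extremalSlope_sq hm hc hq
    rw [← abs_one (α := ℝ), ← sq_le_sq, mul_pow, hε, mul_one, h1]
    have : 0 ≤ c / q := div_nonneg hc0 ((pow_pos hm 2).le.trans hq)
    linarith
  have hnn : ∀ᵐ x ∂volume.restrict (annulus r R),
      0 ≤ (‖G x x‖ ^ 2 + ‖G x (Complex.I * x)‖ ^ 2) / ‖x‖ ^ 2 - D x := by
    filter_upwards [H.ae_pos hr hm, hdef] with x ⟨hx, hh0, hqm, hq⟩ hd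
    rw [hd]
    have := quadratic_nonneg (x := (conj (h x) * G x x).im)
      (y := (conj (h x) * G x (Complex.I * x)).re) (hσ1 _ hqm)
    positivity
  obtain ⟨hle, hiff⟩ := integral_eq_of_defect (H.integrable_energy hr) hDi hnn
  rw [hDval] at hle hiff
  refine ⟨hle, fun hk1 hpm hPM => ?_⟩
  have hkr : (k : ℝ) = 1 := by rw [hk1]; norm_num
  have hε1 : ε = 1 := by rw [hεd, ho1 hpm hPM (by rw [hpm, hPM]; exact hmM2), hkr, one_mul]
  rw [hiff]
  constructor
  · intro hD0
    -- For `c = 0` the middle square disappears and the form degenerates: zero defect yields only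
    -- the Cauchy–Riemann equations.
    rcases hc0.eq_or_lt with hc00 | hcpos
    · subst hc00
      subst hk1
      refine H.isExtremal_of_conformal hr hrR hm hM0 hp hP ?_
      filter_upwards [H.ae_pos hr hm, hdef, hD0] with x ⟨hx, hh0, hqm, hq⟩ hd hd0
      have hσx : σ (‖h x‖ ^ 2) = 1 := extremalSlope_zero _ _
      rw [hd, hε1, hσx, hkr, zero_div, zero_mul, div_eq_zero_iff, div_eq_zero_iff] at hd0
      have h1 := (hd0.resolve_right (by positivity)).resolve_right hq.ne'
      obtain ⟨h2, h3⟩ := eq_zero_of_sq_add_sq (by linear_combination h1 :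
        ((conj (h x) * G x x).re - (conj (h x) * G x (Complex.I * x)).im) ^ 2 +
        ((conj (h x) * G x x).im + (conj (h x) * G x (Complex.I * x)).re) ^ 2 = 0)
      exact ⟨sub_eq_zero.mp h2, eq_neg_of_add_eq_zero_left h3⟩
    · filter_upwards [H.ae_pos hr hm, hdef, hD0] with x ⟨hx, hh0, hqm, hq⟩ hd hd0
      have hcq : 0 < c / ‖h x‖ ^ 2 := div_pos hcpos hq
      have hσs : |σ (‖h x‖ ^ 2) * ε| < 1 := by
        rw [← abs_one (α := ℝ), ← sq_lt_sq, mul_pow, hε, mul_one, extremalSlope_sq hm hc hqm]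
        linarith
      have hquad := quadratic_nonneg (x := (conj (h x) * G x x).im)
        (y := (conj (h x) * G x (Complex.I * x)).re) hσs.le
      rw [hd, div_eq_zero_iff, div_eq_zero_iff] at hd0
      have h1 := (hd0.resolve_right (by positivity)).resolve_right hq.ne'
      have n1 := sq_nonneg ((conj (h x) * G x x).re -
        ε * σ (‖h x‖ ^ 2) * (conj (h x) * G x (Complex.I * x)).im)
      have n2 := mul_nonneg hcq.le
        (sq_nonneg ((conj (h x) * G x (Complex.I * x)).im - k * ‖h x‖ ^ 2))
      have e1 := pow_eq_zero_iff two_ne_zero |>.mp (by linarith : ((conj (h x) * G x x).re -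
        ε * σ (‖h x‖ ^ 2) * (conj (h x) * G x (Complex.I * x)).im) ^ 2 = 0)
      have e2 := pow_eq_zero_iff two_ne_zero |>.mp ((mul_eq_zero.mp (by linarith :
        c / ‖h x‖ ^ 2 * ((conj (h x) * G x (Complex.I * x)).im - k * ‖h x‖ ^ 2) ^ 2 = 0)).resolve_left
        hcq.ne')
      obtain ⟨e3, e4⟩ := eq_zero_of_quadratic (x := (conj (h x) * G x x).im)
        (y := (conj (h x) * G x (Complex.I * x)).re) hσs (by linarith)
      rw [hkr, one_mul, sub_eq_zero] at e2
      rw [hε1, one_mul, e2, sub_eq_zero] at e1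
      exact extremal_of_re_im hh0 e1 e3 e4 e2
  · intro hex
    filter_upwards [hex, hdef, H.ae_pos hr hm] with x ⟨ha, hb⟩ hd ⟨hx, hh0, hqm, hq⟩
    obtain ⟨h1, h2, h3, h4⟩ := extremal_re_im ha hb
    rw [hd, h1, h2, h3, h4, hkr, hε1]
    simp [σ]

/-- The lower bound for the energy, with its equality case, for `c < 0`. -/
theorem IsAnnularMap.energy_bound_of_neg (H : IsAnnularMap r R m M p P k h G) (hr : 0 < r)
    (hrR : r < R) (hm : 0 < m) (hmM : m < M) (hk : k = 1 ∨ k = -1)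
    (ho : (p = m ^ 2 ∧ P = M ^ 2) ∨ (p = M ^ 2 ∧ P = m ^ 2)) (hc0 : c < 0) :
    2 * Real.pi * (∫ q in (m ^ 2)..(M ^ 2), (extremalSlope c m q)⁻¹) +
        -c * (2 * Real.pi * (∫ q in (m ^ 2)..(M ^ 2), (extremalSlope c m q)⁻¹ / max q (m ^ 2)) -
          2 * Real.pi * Real.log (R / r)) ≤
      ∫ x in annulus r R, (‖G x x‖ ^ 2 + ‖G x (Complex.I * x)‖ ^ 2) / ‖x‖ ^ 2 ∧
    (k = 1 → p = m ^ 2 → P = M ^ 2 →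
      (∫ x in annulus r R, (‖G x x‖ ^ 2 + ‖G x (Complex.I * x)‖ ^ 2) / ‖x‖ ^ 2 =
        2 * Real.pi * (∫ q in (m ^ 2)..(M ^ 2), (extremalSlope c m q)⁻¹) +
        -c * (2 * Real.pi * (∫ q in (m ^ 2)..(M ^ 2), (extremalSlope c m q)⁻¹ / max q (m ^ 2)) -
          2 * Real.pi * Real.log (R / r)) ↔ IsExtremal r R m c h G)) := by
  have hmM2 : m ^ 2 < M ^ 2 := pow_lt_pow_left₀ hmM hm.le two_ne_zero
  have hM0 : 0 ≤ M := hm.le.trans hmM.le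
  have hc : c ≤ m ^ 2 := hc0.le.trans (by positivity)
  have hp : p ∈ Icc (m ^ 2) (M ^ 2) := by
    rcases ho with ⟨rfl, -⟩ | ⟨rfl, -⟩
    exacts [⟨le_rfl, hmM2.le⟩, ⟨hmM2.le, le_rfl⟩]
  have hP : P ∈ Icc (m ^ 2) (M ^ 2) := by
    rcases ho with ⟨-, rfl⟩ | ⟨-, rfl⟩
    exacts [⟨hmM2.le, le_rfl⟩, ⟨le_rfl, hmM2.le⟩]
  obtain ⟨o, ho2, hε, hk2, hoI, ho1⟩ := exists_sign hk ho
  set ε : ℝ := o * k with hεd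
  have hs0 := extremalSlope_pos hm hc0
  have hσc : Continuous fun q => (extremalSlope c m q)⁻¹ :=
    (continuous_extremalSlope c hm).inv₀ fun q => (hs0 q).ne'
  set σ : ℝ → ℝ := fun q => (extremalSlope c m q)⁻¹ with hσd
  set ψ : ℝ → ℝ := fun q => σ q / max q (m ^ 2) with hψd
  have hψ : Continuous ψ := hσc.div (by fun_prop) fun q =>
    (lt_max_of_lt_right (pow_pos hm 2)).ne'
  have hσ2 : ∀ q, m ^ 2 ≤ q → σ q ^ 2 * (1 + -c / q) = 1 := fun q hq => by
    have h1 := extremalSlope_sq hm hc hq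
    rw [show 1 + -c / q = extremalSlope c m q ^ 2 by rw [h1]; ring, hσd, ← mul_pow,
      inv_mul_cancel₀ (hs0 q).ne', one_pow]
  have hJ := H.integral_jacobian hr hrR hm hM0 hp hP hσc
  have hJi := H.integrable_jacobian hr hσc
  obtain ⟨hAi, hA⟩ := H.integral_radial hr hψ
  obtain ⟨hIi, hI⟩ := H.integral_inv_sq hr hrR
  -- The radial logarithmic derivative replaces the angular one, so the boundary order sign `o`
  -- takes the place of the degree.
  set D : ℂ → ℝ := fun x => 2 * ε *
    (σ (‖h x‖ ^ 2) * (conj (G x x) * G x (Complex.I * x)).im / ‖x‖ ^ 2) +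
    -c * (2 * o * (ψ (‖h x‖ ^ 2) * (conj (h x) * G x x).re / ‖x‖ ^ 2) - 1 / ‖x‖ ^ 2)
    with hDd
  have hDi2 : IntegrableOn (fun x => 2 * o * (ψ (‖h x‖ ^ 2) * (conj (h x) * G x x).re / ‖x‖ ^ 2) -
      1 / ‖x‖ ^ 2) (annulus r R) := (hAi.const_mul _).sub hIi
  have hDi : IntegrableOn D (annulus r R) := (hJi.const_mul _).add (hDi2.const_mul _)
  have hDval : ∫ x in annulus r R, D x = 2 * Real.pi * (∫ q in (m ^ 2)..(M ^ 2), σ q) +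
      -c * (2 * Real.pi * (∫ q in (m ^ 2)..(M ^ 2), ψ q) - 2 * Real.pi * Real.log (R / r)) := by
    simp only [hDd]
    rw [integral_add (hJi.const_mul _) (hDi2.const_mul _), integral_const_mul, integral_const_mul,
      integral_sub (hAi.const_mul _) hIi, integral_const_mul, hJ, hA, hI, ← hoI σ, ← hoI ψ]
    linear_combination (2 * Real.pi * o * ∫ q in p..P, σ q) * hk2
  have hdef : ∀ᵐ x ∂volume.restrict (annulus r R),
      (‖G x x‖ ^ 2 + ‖G x (Complex.I * x)‖ ^ 2) / ‖x‖ ^ 2 - D x =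
      (((conj (h x) * G x (Complex.I * x)).im - ε * σ (‖h x‖ ^ 2) * (conj (h x) * G x x).re) ^ 2 +
        -c / ‖h x‖ ^ 2 * (σ (‖h x‖ ^ 2) * (conj (h x) * G x x).re - o * ‖h x‖ ^ 2) ^ 2 +
        ((conj (h x) * G x x).im ^ 2 + (conj (h x) * G x (Complex.I * x)).re ^ 2 +
        2 * (σ (‖h x‖ ^ 2) * ε) * (conj (h x) * G x x).im *
        (conj (h x) * G x (Complex.I * x)).re)) / ‖h x‖ ^ 2 / ‖x‖ ^ 2 := by
    filter_upwards [H.ae_pos hr hm] with x ⟨hx, hh0, hqm, hq⟩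
    rw [← defect_identity' hq.ne' (hσ2 _ hqm) hε ho2, ← norm_sq_mul_eq,
      ← norm_sq_mul_eq, ← norm_sq_mul_im_conj_mul]
    simp only [hDd, hψd, max_eq_left hqm]
    field_simp
    ring
  -- For `c < 0` the reciprocal slope is strictly below one, so there is no degenerate case.
  have hσ1 : ∀ q, m ^ 2 ≤ q → |σ q * ε| < 1 := fun q hq => by
    have hq0 : 0 < q := (pow_pos hm 2).trans_le hq
    have h1 := hσ2 q hq
    have h2 : 0 < σ q ^ 2 := pow_pos (inv_pos.mpr (hs0 q)) 2
    have h3 : 0 < -c / q := div_pos (by linarith) hq0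
    rw [← abs_one (α := ℝ), ← sq_lt_sq, mul_pow, hε, mul_one]
    nlinarith
  have hnn : ∀ᵐ x ∂volume.restrict (annulus r R),
      0 ≤ (‖G x x‖ ^ 2 + ‖G x (Complex.I * x)‖ ^ 2) / ‖x‖ ^ 2 - D x := by
    filter_upwards [H.ae_pos hr hm, hdef] with x ⟨hx, hh0, hqm, hq⟩ hd
    rw [hd]
    have h1 := quadratic_nonneg (x := (conj (h x) * G x x).im)
      (y := (conj (h x) * G x (Complex.I * x)).re) (hσ1 _ hqm).le
    have h2 : 0 ≤ -c / ‖h x‖ ^ 2 := div_nonneg (by linarith) hq.le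
    positivity
  obtain ⟨hle, hiff⟩ := integral_eq_of_defect (H.integrable_energy hr) hDi hnn
  rw [hDval] at hle hiff
  refine ⟨hle, fun hk1 hpm hPM => ?_⟩
  have hkr : (k : ℝ) = 1 := by rw [hk1]; norm_num
  have ho1' : o = 1 := ho1 hpm hPM (by rw [hpm, hPM]; exact hmM2)
  have hε1 : ε = 1 := by rw [hεd, ho1', hkr, one_mul]
  rw [hiff]
  constructor
  · intro hD0
    filter_upwards [H.ae_pos hr hm, hdef, hD0] with x ⟨hx, hh0, hqm, hq⟩ hd hd0
    have hcq : 0 < -c / ‖h x‖ ^ 2 := div_pos (by linarith) hq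
    have hquad := quadratic_nonneg (x := (conj (h x) * G x x).im)
      (y := (conj (h x) * G x (Complex.I * x)).re) (hσ1 _ hqm).le
    rw [hd, div_eq_zero_iff, div_eq_zero_iff] at hd0
    have h1 := (hd0.resolve_right (by positivity)).resolve_right hq.ne'
    have n1 := sq_nonneg ((conj (h x) * G x (Complex.I * x)).im -
      ε * σ (‖h x‖ ^ 2) * (conj (h x) * G x x).re)
    have n2 := mul_nonneg hcq.le
      (sq_nonneg (σ (‖h x‖ ^ 2) * (conj (h x) * G x x).re - o * ‖h x‖ ^ 2))
    have e1 := pow_eq_zero_iff two_ne_zero |>.mp (by linarith :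
      ((conj (h x) * G x (Complex.I * x)).im -
      ε * σ (‖h x‖ ^ 2) * (conj (h x) * G x x).re) ^ 2 = 0)
    have e2 := pow_eq_zero_iff two_ne_zero |>.mp ((mul_eq_zero.mp (by linarith :
      -c / ‖h x‖ ^ 2 * (σ (‖h x‖ ^ 2) * (conj (h x) * G x x).re - o * ‖h x‖ ^ 2) ^ 2 =
      0)).resolve_left hcq.ne')
    obtain ⟨e3, e4⟩ := eq_zero_of_quadratic (x := (conj (h x) * G x x).im)
        (y := (conj (h x) * G x (Complex.I * x)).re) (hσ1 _ hqm) (by linarith)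
    rw [ho1', one_mul, sub_eq_zero] at e2
    rw [hε1, one_mul, e2, sub_eq_zero] at e1
    refine extremal_of_re_im hh0 ?_ e3 e4 e1
    exact (inv_mul_eq_iff_eq_mul₀ (hs0 _).ne').mp e2
  · intro hex
    filter_upwards [hex, hdef, H.ae_pos hr hm] with x ⟨ha, hb⟩ hd ⟨hx, hh0, hqm, hq⟩
    obtain ⟨h1, h2, h3, h4⟩ := extremal_re_im ha hb
    have h5 : σ (‖h x‖ ^ 2) * (extremalSlope c m (‖h x‖ ^ 2) * ‖h x‖ ^ 2) = ‖h x‖ ^ 2 := by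
      rw [← mul_assoc, inv_mul_cancel₀ (hs0 _).ne', one_mul]
    rw [hd, h1, h2, h3, h4, ho1', hε1, one_mul, h5]
    simp

/-- An extremal oriented annular map minimises the energy among all annular maps, and the
minimisers among the oriented ones are the extremal maps. -/
theorem IsAnnularMap.energy_le_of_isExtremal {h₀ : ℂ → ℂ} {G₀ : ℂ → ℂ →L[ℝ] ℂ}
    (H₀ : IsAnnularMap r R m M (m ^ 2) (M ^ 2) 1 h₀ G₀) (hex : IsExtremal r R m c h₀ G₀)
    (hr : 0 < r) (hrR : r < R) (hm : 0 < m) (hmM : m < M) (hc : c ≤ m ^ 2) :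
    (∀ (p P : ℝ) (k : ℤ) (h : ℂ → ℂ) (G : ℂ → ℂ →L[ℝ] ℂ), IsAnnularMap r R m M p P k h G →
      (k = 1 ∨ k = -1) → ((p = m ^ 2 ∧ P = M ^ 2) ∨ (p = M ^ 2 ∧ P = m ^ 2)) →
      dirichletEnergy (annulus r R) h₀ ≤ dirichletEnergy (annulus r R) h) ∧
    ∀ (h : ℂ → ℂ) (G : ℂ → ℂ →L[ℝ] ℂ), IsAnnularMap r R m M (m ^ 2) (M ^ 2) 1 h G →
      dirichletEnergy (annulus r R) h = dirichletEnergy (annulus r R) h₀ →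
      IsExtremal r R m c h G := by
  -- Only the existence of one common bound matters; its two expressions for `c ≥ 0` and `c < 0` are
  -- hidden, and the extremal map `h₀` shows that it is attained.
  obtain ⟨L, hL⟩ : ∃ L : ℝ, ∀ (p P : ℝ) (k : ℤ) (h : ℂ → ℂ) (G : ℂ → ℂ →L[ℝ] ℂ),
      IsAnnularMap r R m M p P k h G →
      (k = 1 ∨ k = -1) → ((p = m ^ 2 ∧ P = M ^ 2) ∨ (p = M ^ 2 ∧ P = m ^ 2)) →
      L ≤ ∫ x in annulus r R, (‖G x x‖ ^ 2 + ‖G x (Complex.I * x)‖ ^ 2) / ‖x‖ ^ 2 ∧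
      (k = 1 → p = m ^ 2 → P = M ^ 2 →
        (∫ x in annulus r R, (‖G x x‖ ^ 2 + ‖G x (Complex.I * x)‖ ^ 2) / ‖x‖ ^ 2 = L ↔
          IsExtremal r R m c h G)) := by
    rcases le_or_gt 0 c with hc0 | hc0
    · exact ⟨_, fun p P k h G H hk ho => H.energy_bound_of_nonneg hr hrR hm hmM hk ho hc0 hc⟩
    · exact ⟨_, fun p P k h G H hk ho => H.energy_bound_of_neg hr hrR hm hmM hk ho hc0⟩
  have hL₀ := ((hL _ _ _ h₀ G₀ H₀ (Or.inl rfl) (Or.inl ⟨rfl, rfl⟩)).2 rfl rfl rfl).mpr hex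
  refine ⟨fun p P k h G H hk ho => ?_, fun h G H he => ?_⟩
  · rw [H₀.dirichletEnergy_eq hr, H.dirichletEnergy_eq hr, hL₀]
    exact ENNReal.ofReal_le_ofReal (hL p P k h G H hk ho).1
  · rw [← (hL _ _ _ h G H (Or.inl rfl) (Or.inl ⟨rfl, rfl⟩)).2 rfl rfl rfl, ← hL₀]
    rw [H₀.dirichletEnergy_eq hr, H.dirichletEnergy_eq hr] at he
    exact (ENNReal.ofReal_eq_ofReal_iff (integral_nonneg fun x => by positivity)
      (integral_nonneg fun x => by positivity)).mp he

end LowerBound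

/-! ### Uniqueness of extremal maps up to rotation. -/

section Rigidity

open scoped ComplexConjugate

variable {r R m M p P c : ℝ} {k : ℤ} {h : ℂ → ℂ} {G : ℂ → ℂ →L[ℝ] ℂ}

/-- The product of a `W^{1,2}` map with a `C¹` function has a weak derivative. -/
theorem HasWeakDeriv.mul_contDiffOn (hw : HasWeakDeriv (annulus r R) h G)
    (hh : MemLp h 2 (volume.restrict (annulus r R)))
    (hG : MemLp G 2 (volume.restrict (annulus r R))) {f : ℂ → ℂ}
    (hf : ContDiffOn ℝ 1 f (annulus r R)) :
    HasWeakDeriv (annulus r R) (fun x => f x * h x)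
      (fun x => f x • G x + h x • fderiv ℝ f x) := by
  have hA := isOpen_annulus r R
  have hAm := measurableSet_annulus r R
  have hDf : ContinuousOn (fderiv ℝ f) (annulus r R) := hf.continuousOn_fderiv_of_isOpen hA le_rfl
  refine ⟨?_, ?_, fun φ hφ hc hs v => ?_⟩
  · exact hw.1.continuousOn_smul hA.isLocallyClosed hf.continuousOn
  · exact (hw.2.1.continuousOn_smul hA.isLocallyClosed hf.continuousOn).add
      (hw.1.smul_continuousOn hA.isLocallyClosed hDf)
  obtain ⟨a, b, ha, hb, hab⟩ : ∃ a b, r < a ∧ b < R ∧ tsupport φ ⊆ closedAnnulus a b := by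
    rcases (tsupport φ).eq_empty_or_nonempty with he | hne
    · exact ⟨r + 1, R - 1, by linarith, by linarith, by rw [he]; exact empty_subset _⟩
    obtain ⟨x, hx, hxm⟩ := hc.isCompact.exists_isMinOn hne continuous_norm.continuousOn
    obtain ⟨y, hy, hym⟩ := hc.isCompact.exists_isMaxOn hne continuous_norm.continuousOn
    exact ⟨‖x‖, ‖y‖, (hs hx).1, (hs hy).2, fun z hz => ⟨hxm hz, hym hz⟩⟩
  set K := closedAnnulus a b
  have hKm : MeasurableSet K := measurableSet_closedAnnulus a b
  have hKA : K ⊆ annulus r R := closedAnnulus_subset ha hb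
  have z1 : ∀ x, x ∉ K → φ x = 0 := fun x hx => by
    by_contra h0
    exact hx (hab (subset_tsupport φ h0))
  have z2 : ∀ x, x ∉ K → fderiv ℝ φ x v = 0 := fun x hx => by
    by_contra h0
    exact hx (hab (tsupport_fderiv_apply_subset ℝ v (subset_tsupport _ h0)))
  have red : ∀ F : ℂ → ℂ, (∀ x, x ∉ K → F x = 0) → ∫ x in annulus r R, F x = ∫ x in K, F x :=
    fun F hF => by
      rw [setIntegral_eq_integral_of_forall_compl_eq_zero (fun x hx => hF x fun hxK => hx (hKA hxK)),
        setIntegral_eq_integral_of_forall_compl_eq_zero hF]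
  have bdd : ∀ F : ℂ → ℂ, ContinuousOn F K → MemLp F 2 (volume.restrict K) := fun F hF => by
    obtain ⟨C, hC⟩ := (isCompact_closedAnnulus a b).exists_bound_of_continuousOn hF
    exact MemLp.of_bound (hF.aestronglyMeasurable hKm) C
      (by filter_upwards [ae_restrict_mem hKm] with x hx using hC x hx)
  have cφ : Continuous φ := hφ.continuous
  have cφ' : Continuous fun x => fderiv ℝ φ x v :=
    (hφ.continuous_fderiv (by simp)).clm_apply continuous_const
  have cf : ContinuousOn f K := hf.continuousOn.mono hKA
  have cf' : ContinuousOn (fun x => fderiv ℝ f x v) K :=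
    (hDf.mono hKA).clm_apply continuousOn_const
  -- Expanding the product rule for smooth `u n` gives `∫ g₁ u = -∫ g₂ ∂u` with fixed `L²`
  -- coefficients, a relation that passes to the limit of the mollifications.
  set g₁ : ℂ → ℂ := fun x => (fderiv ℝ φ x v : ℂ) * f x + φ x * fderiv ℝ f x v with hg₁
  set g₂ : ℂ → ℂ := fun x => φ x * f x with hg₂
  have m1 : MemLp g₁ 2 (volume.restrict K) := bdd _
    (((Complex.continuous_ofReal.comp cφ').continuousOn.mul cf).add
      ((Complex.continuous_ofReal.comp cφ).continuousOn.mul cf'))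
  have m2 : MemLp g₂ 2 (volume.restrict K) := bdd _
    ((Complex.continuous_ofReal.comp cφ).continuousOn.mul cf)
  have hhK : MemLp h 2 (volume.restrict K) := hh.mono_measure (Measure.restrict_mono hKA le_rfl)
  have hGK : MemLp G 2 (volume.restrict K) := hG.mono_measure (Measure.restrict_mono hKA le_rfl)
  have hGv : MemLp (fun x => G x v) 2 (volume.restrict K) :=
    (ContinuousLinearMap.apply ℝ ℂ v).comp_memLp' hGK
  set u := smoothApprox r R h
  have hu : ∀ n, ContDiff ℝ ∞ (u n) := contDiff_smoothApprox hh
  have mu : ∀ n, MemLp (u n) 2 (volume.restrict K) := fun n => bdd _ (hu n).continuous.continuousOn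
  have cu' : ∀ n, Continuous (fderiv ℝ (u n)) := fun n => (hu n).continuous_fderiv (by simp)
  have mu' : ∀ n, MemLp (fun x => fderiv ℝ (u n) x v) 2 (volume.restrict K) := fun n =>
    bdd _ ((cu' n).clm_apply continuous_const).continuousOn
  have t1 : Tendsto (fun n => ∫ x in K, g₁ x * u n x) atTop (𝓝 (∫ x in K, g₁ x * h x)) := by
    refine tendsto_integral_mul_of_strong m1 mu hhK ?_
    refine tendsto_of_tendsto_of_tendsto_of_le_of_le tendsto_const_nhds
      (tendsto_eLpNorm_smoothApprox hh) (fun _ => zero_le) fun n => ?_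
    exact eLpNorm_mono_measure _ (Measure.restrict_mono hKA le_rfl)
  have t2 : Tendsto (fun n => ∫ x in K, g₂ x * fderiv ℝ (u n) x v) atTop
      (𝓝 (∫ x in K, g₂ x * G x v)) := by
    refine weak_of_strong (fun n => ?_) hGK (tendsto_eLpNorm_fderiv_smoothApprox hw hh hG ha hb)
      g₂ m2 v
    obtain ⟨C, hC⟩ := (isCompact_closedAnnulus a b).exists_bound_of_continuousOn (cu' n).continuousOn
    exact MemLp.of_bound (cu' n).aestronglyMeasurable C
      (by filter_upwards [ae_restrict_mem hKm] with x hx using hC x hx)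
  have e : ∀ n, ∫ x in K, g₁ x * u n x = -∫ x in K, g₂ x * fderiv ℝ (u n) x v := fun n => by
    have hd : ContDiffOn ℝ 1 (fun x => f x * u n x) (annulus r R) :=
      hf.mul ((hu n).of_le (by simp)).contDiffOn
    have e1 := (hd.hasWeakDeriv hA).2.2 φ hφ hc hs v
    rw [red _ fun x hx => by rw [z2 x hx, zero_smul], red _ fun x hx => by rw [z1 x hx, zero_smul]]
      at e1
    have e2 : ∫ x in K, φ x • fderiv ℝ (fun x => f x * u n x) x v =
        ∫ x in K, (φ x * fderiv ℝ f x v * u n x + g₂ x * fderiv ℝ (u n) x v) := by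
      refine setIntegral_congr_fun hKm fun x hx => ?_
      have hfx : DifferentiableAt ℝ f x :=
        (hf.contDiffAt (hA.mem_nhds (hKA hx))).differentiableAt (by simp)
      have hux : DifferentiableAt ℝ (u n) x := (hu n).differentiable (by simp) x
      simp only [fderiv_fun_mul hfx hux, add_apply, smul_apply, smul_eq_mul, Complex.real_smul, hg₂]
      ring
    have i1 : IntegrableOn (fun x => φ x * fderiv ℝ f x v * u n x) K :=
      MemLp.integrable_mul_two (bdd _ ((Complex.continuous_ofReal.comp cφ).continuousOn.mul cf'))
        (mu n)
    have i2 : IntegrableOn (fun x => g₂ x * fderiv ℝ (u n) x v) K :=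
      MemLp.integrable_mul_two m2 (mu' n)
    have i3 : IntegrableOn (fun x => (fderiv ℝ φ x v : ℂ) * f x * u n x) K :=
      MemLp.integrable_mul_two (bdd _ ((Complex.continuous_ofReal.comp cφ').continuousOn.mul cf))
        (mu n)
    rw [e2, integral_add i1 i2] at e1
    have e3 : ∫ x in K, g₁ x * u n x = (∫ x in K, (fderiv ℝ φ x v : ℂ) * f x * u n x) +
        ∫ x in K, φ x * fderiv ℝ f x v * u n x := by
      rw [← integral_add i3 i1]
      congr 1; ext x; simp only [hg₁]; ring
    have e4 : ∫ x in K, (fderiv ℝ φ x v) • (f x * u n x) =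
        ∫ x in K, (fderiv ℝ φ x v : ℂ) * f x * u n x := by
      congr 1; ext x; rw [Complex.real_smul]; ring
    rw [e3, ← e4, e1]; ring
  have lim := tendsto_nhds_unique t1 (by simp_rw [e]; exact t2.neg)
  rw [red _ fun x hx => by rw [z2 x hx, zero_smul], red _ fun x hx => by rw [z1 x hx, zero_smul]]
  have i1 : IntegrableOn (fun x => φ x * fderiv ℝ f x v * h x) K :=
    MemLp.integrable_mul_two (bdd _ ((Complex.continuous_ofReal.comp cφ).continuousOn.mul cf')) hhK
  have i2 : IntegrableOn (fun x => g₂ x * G x v) K := MemLp.integrable_mul_two m2 hGv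
  have i3 : IntegrableOn (fun x => (fderiv ℝ φ x v : ℂ) * f x * h x) K :=
    MemLp.integrable_mul_two (bdd _ ((Complex.continuous_ofReal.comp cφ').continuousOn.mul cf)) hhK
  have e3 : ∫ x in K, g₁ x * h x = (∫ x in K, (fderiv ℝ φ x v : ℂ) * f x * h x) +
      ∫ x in K, φ x * fderiv ℝ f x v * h x := by
    rw [← integral_add i3 i1]
    congr 1; ext x; simp only [hg₁]; ring
  have e4 : ∫ x in K, (fderiv ℝ φ x v) • (f x * h x) =
      ∫ x in K, (fderiv ℝ φ x v : ℂ) * f x * h x := by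
    congr 1; ext x; rw [Complex.real_smul]; ring
  have e5 : ∫ x in K, φ x • (f x • G x + h x • fderiv ℝ f x) v =
      (∫ x in K, φ x * fderiv ℝ f x v * h x) + ∫ x in K, g₂ x * G x v := by
    rw [← integral_add i1 i2]
    congr 1; ext x
    simp only [add_apply, smul_apply, smul_eq_mul, Complex.real_smul, hg₂]; ring
  rw [e4, e5]
  linear_combination lim - e3

/-- A map with zero weak derivative is constant. -/
theorem HasWeakDeriv.ae_eq_const (hr : 0 < r) (hrR : r < R)
    (hw : HasWeakDeriv (annulus r R) h fun _ => 0) (hh : MemLp h 2 (volume.restrict (annulus r R))) :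
    ∃ C : ℂ, ∀ᵐ x ∂volume.restrict (annulus r R), h x = C := by
  have hA := measurableSet_annulus r R
  have hS := (smoothApprox_ae_tendsto hh).and (ae_restrict_mem hA)
  have hne : (volume.restrict (annulus r R)) ≠ 0 := by
    rw [Ne, Measure.restrict_eq_zero]
    have hmem : (((r + R) / 2 : ℝ) : ℂ) ∈ annulus r R := by
      have : ‖(((r + R) / 2 : ℝ) : ℂ)‖ = (r + R) / 2 := by
        rw [Complex.norm_real, Real.norm_eq_abs, abs_of_pos (by linarith)]
      constructor <;> rw [this] <;> linarith
    exact ((isOpen_annulus r R).measure_pos volume ⟨_, hmem⟩).ne'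
  have : NeBot (ae (volume.restrict (annulus r R))) := ae_neBot.mpr hne
  obtain ⟨y, hy, hyA⟩ := hS.exists
  refine ⟨h y, ?_⟩
  filter_upwards [hS] with x ⟨hx, hxA⟩
  -- A smaller annulus containing both points, on which mollifications at small scales have zero
  -- derivative and hence equal values at the two points.
  obtain ⟨a, ha, ha'⟩ := exists_between (lt_min hxA.1 hyA.1)
  obtain ⟨b, hb', hb⟩ := exists_between (max_lt hxA.2 hyA.2)
  have hxa : x ∈ annulus a b := ⟨(lt_min_iff.mp ha').1, (max_lt_iff.mp hb').1⟩
  have hya : y ∈ annulus a b := ⟨(lt_min_iff.mp ha').2, (max_lt_iff.mp hb').2⟩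
  refine tendsto_nhds_unique hx (hy.congr' ?_)
  have h0 : MemLp (fun _ : ℂ => (0 : ℂ →L[ℝ] ℂ)) 2 (volume.restrict (annulus r R)) :=
    MemLp.zero (ε := ℂ →L[ℝ] ℂ)
  filter_upwards [eventually_fderiv_smoothApprox hw hh h0 ha hb] with n hn
  refine (isOpen_annulus a b).is_const_of_fderiv_eq_zero
    (isPreconnected_annulus (hr.trans ha) b)
    ((contDiff_smoothApprox hh n).differentiable (by simp)).differentiableOn (fun z hz => ?_) hya hxa
  rw [hn z (annulus_subset_closedAnnulus a b hz)]
  simp [mollify_apply]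

/-- The modulus of an extremal map is radial. -/
theorem IsAnnularMap.norm_eq_of_isExtremal (Hh : IsAnnularMap r R m M (m ^ 2) (M ^ 2) 1 h G)
    (hex : IsExtremal r R m c h G) (hr : 0 < r) (hm : 0 < m) (hmM : m < M)
    {H : ℝ → ℝ} (hH : ContDiff ℝ 1 H) (hHr : H r = m) (hHR : H R = M)
    (hHm : ∀ t ∈ Icc r R, m ≤ H t) (hH' : ∀ t ∈ Icc r R, 0 ≤ deriv H t)
    (hHc : ∀ t ∈ Icc r R, H t ^ 2 - t ^ 2 * deriv H t ^ 2 = c) :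
    ∀ᵐ x ∂volume.restrict (annulus r R), ‖h x‖ = H ‖x‖ := by
  have hM := hm.trans hmM
  have cH := hH.continuous
  have cH' : Continuous (deriv H) := hH.continuous_deriv le_rfl
  -- Both `|h|` and `H` solve `t ∂ₜ v = S(v)`, with `S` increasing. Hence `t (|h| - H)²` has radial
  -- derivative `(|h| - H)² + 2(|h| - H)(S(|h|) - S(H))`, a sum of nonnegative terms, and equal
  -- boundary values make its integral vanish.
  set S : ℝ → ℝ := fun ρ => Real.sqrt (ρ ^ 2 - c) with hS
  have cS : Continuous S := by fun_prop
  -- The normal identity accepts `C¹` functions of `|h|²`; this is the derivative of one that equals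
  -- the square root for `q ≥ m²`.
  set ψ : ℝ → ℝ := fun q => 1 / (2 * Real.sqrt (max q (m ^ 2))) with hψ
  have cψ : Continuous ψ := continuous_const.div (by fun_prop) fun q =>
    (mul_pos two_pos (Real.sqrt_pos.mpr (lt_max_of_lt_right (pow_pos hm 2)))).ne'
  obtain ⟨Φ, hΦ, hΦ', hΦv⟩ : ∃ Φ : ℝ → ℝ, ContDiff ℝ 1 Φ ∧ (∀ q, deriv Φ q = ψ q) ∧
      ∀ ρ, m ≤ ρ → Φ (ρ ^ 2) = ρ := by
    have hd : ∀ q, HasDerivAt (fun q => m + ∫ s in (m ^ 2)..q, ψ s) (ψ q) q := fun q =>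
      (intervalIntegral.integral_hasDerivAt_right (cψ.intervalIntegrable _ _)
        (cψ.stronglyMeasurableAtFilter _ _) cψ.continuousAt).const_add m
    refine ⟨_, contDiff_one_iff_deriv.mpr ⟨fun q => (hd q).differentiableAt, ?_⟩,
      fun q => (hd q).deriv, fun ρ hρ => ?_⟩
    · rw [funext fun q => (hd q).deriv]; exact cψ
    · have h1 : ∫ s in (m ^ 2)..(ρ ^ 2), ψ s = Real.sqrt (ρ ^ 2) - Real.sqrt (m ^ 2) := by
        refine intervalIntegral.integral_eq_sub_of_hasDerivAt (fun q hq => ?_)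
          (cψ.intervalIntegrable _ _)
        rw [uIcc_of_le (pow_le_pow_left₀ hm.le hρ 2)] at hq
        simp only [hψ, max_eq_left hq.1]
        exact Real.hasDerivAt_sqrt ((pow_pos hm 2).trans_le hq.1).ne'
      simp only [h1, Real.sqrt_sq hm.le, Real.sqrt_sq (hm.le.trans hρ)]
      ring
  have int : ∀ B : ℝ → ℝ → ℝ, Continuous (fun p : ℝ × ℝ => B p.1 p.2) →
      IntegrableOn (fun x => B ‖x‖ ‖h x‖ / ‖x‖) (annulus r R) := fun B hB => by
    refine integrable_coeff (B := fun p => B ‖p.1‖ ‖p.2‖ / ‖p.1‖) ?_ ?_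
      (isCompact_closedAnnulus r R) (isCompact_closedAnnulus m M) (ae_mem_closedAnnulus r R)
      Hh.memLp.1 Hh.bound
    · have h1 : Measurable fun p : ℂ × ℂ => B ‖p.1‖ ‖p.2‖ :=
        (hB.comp (by fun_prop : Continuous fun p : ℂ × ℂ => (‖p.1‖, ‖p.2‖))).measurable
      exact h1.div (measurable_norm.comp measurable_fst)
    · refine ContinuousOn.div (hB.comp (by fun_prop :
        Continuous fun p : ℂ × ℂ => (‖p.1‖, ‖p.2‖))).continuousOn (by fun_prop) fun p hp => ?_
      exact (hr.trans_le hp.1.1).ne'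
  -- The normal identity rewritten by the extremal equation. It is used for the three terms `|h|²`,
  -- `H |h|` and `H²` of the expanded square.
  have nrm : ∀ (Z Ψ T W : ℝ → ℝ), ContDiff ℝ 1 Z → ContDiff ℝ 1 Ψ → Continuous T → Continuous W →
      (∀ ρ, m ≤ ρ → deriv Ψ (ρ ^ 2) * 2 * ρ = T ρ) → (∀ ρ, m ≤ ρ → Ψ (ρ ^ 2) = W ρ) →
      IntegrableOn (fun x => (Z ‖x‖ * T ‖h x‖ * S ‖h x‖ +
        (Z ‖x‖ + ‖x‖ * deriv Z ‖x‖) * W ‖h x‖) / ‖x‖) (annulus r R) ∧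
      ∫ x in annulus r R, (Z ‖x‖ * T ‖h x‖ * S ‖h x‖ +
        (Z ‖x‖ + ‖x‖ * deriv Z ‖x‖) * W ‖h x‖) / ‖x‖ =
        2 * Real.pi * (R * Z R * W M - r * Z r * W m) := by
    intro Z Ψ T W hZ hΨ hT hW hT' hW'
    have cZ := hZ.continuous
    have cZ' : Continuous (deriv Z) := hZ.continuous_deriv le_rfl
    have hd : ∀ t, deriv (fun t => t * Z t) t = Z t + t * deriv Z t := fun t => by
      rw [deriv_fun_mul differentiableAt_fun_id (hZ.differentiable one_ne_zero t)]
      simp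
    have key := Hh.normal (fun t => t * Z t) Ψ (contDiff_id.mul hZ) hΨ
    rw [hW' M hmM.le, hW' m le_rfl] at key
    have i1 := int (fun t ρ => Z t * T ρ * S ρ) (by fun_prop)
    have i2 := int (fun t ρ => (Z t + t * deriv Z t) * W ρ) (by fun_prop)
    have i3 : IntegrableOn (fun x => (Z ‖x‖ * T ‖h x‖ * S ‖h x‖ +
        (Z ‖x‖ + ‖x‖ * deriv Z ‖x‖) * W ‖h x‖) / ‖x‖) (annulus r R) := by
      refine (i1.add i2).congr (Eventually.of_forall fun x => ?_)
      simp only [Pi.add_apply]; ring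
    refine ⟨i3, ?_⟩
    rw [← key]
    have e1 : ∫ x in annulus r R, (((‖x‖ * Z ‖x‖ * deriv Ψ (‖h x‖ ^ 2) * 2 / ‖x‖ ^ 2 : ℝ) : ℂ) *
        conj (h x) * G x x).re = ∫ x in annulus r R, Z ‖x‖ * T ‖h x‖ * S ‖h x‖ / ‖x‖ := by
      refine integral_congr_ae ?_
      filter_upwards [Hh.ae_pos hr hm, Hh.bound, hex] with x ⟨hx, hh0, hqm, hq⟩ hb ⟨ha, hb'⟩
      have h1 := (extremal_re_im ha hb').1
      have h2 : extremalSlope c m (‖h x‖ ^ 2) * ‖h x‖ = S ‖h x‖ := by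
        rw [extremalSlope, max_eq_left hqm, hS]
        simp only
        rw [show ‖h x‖ ^ 2 - c = ‖h x‖ ^ 2 * (1 - c / ‖h x‖ ^ 2) by field_simp,
          Real.sqrt_mul hq.le, Real.sqrt_sq (norm_nonneg _), mul_comm]
      rw [mul_assoc, Complex.re_ofReal_mul, h1, ← hT' _ hb.1, ← h2]
      field_simp
    rw [e1, ← integral_add i1 ?_]
    · refine integral_congr_ae ?_
      filter_upwards [Hh.bound] with x hb
      rw [hd, hW' _ hb.1]; ring
    · refine i2.congr ?_
      filter_upwards [Hh.bound] with x hb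
      rw [hd, hW' _ hb.1]
  obtain ⟨i1, n1⟩ := nrm (fun _ => 1) (fun q => q) (fun ρ => 2 * ρ) (fun ρ => ρ ^ 2) contDiff_const
    contDiff_id (by fun_prop) (by fun_prop) (fun ρ _ => by simp) (fun ρ _ => rfl)
  obtain ⟨i2, n2⟩ := nrm H Φ (fun _ => 1) (fun ρ => ρ) hH hΦ (by fun_prop) (by fun_prop)
    (fun ρ hρ => by
      have h1 : 0 < ρ := hm.trans_le hρ
      rw [hΦ', hψ]
      simp only
      rw [max_eq_left (pow_le_pow_left₀ hm.le hρ 2), Real.sqrt_sq h1.le]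
      field_simp) hΦv
  obtain ⟨i3, n3⟩ := nrm (fun t => H t ^ 2) (fun _ => 1) (fun _ => 0) (fun _ => 1) (hH.pow 2)
    contDiff_const (by fun_prop) (by fun_prop) (fun ρ _ => by simp) (fun ρ _ => rfl)
  have hsum := ((i1.sub (i2.const_mul 2)).add i3)
  have hval := integral_add (i1.sub (i2.const_mul 2)) i3
  rw [integral_sub' i1 (i2.const_mul 2), integral_const_mul, n1, n2, n3, hHr, hHR] at hval
  have hpt : ∀ᵐ x ∂volume.restrict (annulus r R),
      (((1 * (2 * ‖h x‖) * S ‖h x‖ + (1 + ‖x‖ * deriv (fun _ => 1) ‖x‖) * ‖h x‖ ^ 2) / ‖x‖ -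
        2 * ((H ‖x‖ * 1 * S ‖h x‖ + (H ‖x‖ + ‖x‖ * deriv H ‖x‖) * ‖h x‖) / ‖x‖)) +
        (H ‖x‖ ^ 2 * 0 * S ‖h x‖ + (H ‖x‖ ^ 2 + ‖x‖ * deriv (fun t => H t ^ 2) ‖x‖) * 1) / ‖x‖) =
      ((‖h x‖ - H ‖x‖) ^ 2 + 2 * ((‖h x‖ - H ‖x‖) * (S ‖h x‖ - S (H ‖x‖)))) / ‖x‖ := by
    filter_upwards [Hh.ae_pos hr hm, ae_mem_closedAnnulus r R] with x hx hxA
    have h1 : S (H ‖x‖) = ‖x‖ * deriv H ‖x‖ := by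
      rw [hS]
      simp only
      rw [← hHc _ hxA, show H ‖x‖ ^ 2 - (H ‖x‖ ^ 2 - ‖x‖ ^ 2 * deriv H ‖x‖ ^ 2) =
        (‖x‖ * deriv H ‖x‖) ^ 2 by ring, Real.sqrt_sq (mul_nonneg hx.1.le (hH' _ hxA))]
    rw [h1, deriv_const, (((hH.differentiable one_ne_zero ‖x‖).hasDerivAt).fun_pow 2).deriv]
    field_simp
    push_cast
    ring
  have hmono : ∀ x ∈ closedAnnulus r R, m ≤ ‖h x‖ →
      0 ≤ (‖h x‖ - H ‖x‖) * (S ‖h x‖ - S (H ‖x‖)) := by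
    intro x hx hb
    have h0 := hHm _ hx
    rcases le_total ‖h x‖ (H ‖x‖) with h1 | h1
    · refine mul_nonneg_of_nonpos_of_nonpos (by linarith) (sub_nonpos.mpr (Real.sqrt_le_sqrt ?_))
      have := pow_le_pow_left₀ (norm_nonneg (h x)) h1 2
      linarith
    · refine mul_nonneg (by linarith) (sub_nonneg.mpr (Real.sqrt_le_sqrt ?_))
      have := pow_le_pow_left₀ (hm.le.trans h0) h1 2
      linarith
  have hzero : ∫ x in annulus r R, ((‖h x‖ - H ‖x‖) ^ 2 +
      2 * ((‖h x‖ - H ‖x‖) * (S ‖h x‖ - S (H ‖x‖)))) / ‖x‖ = 0 := by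
    rw [← integral_congr_ae hpt]
    exact hval.trans (by ring)
  rw [integral_eq_zero_iff_of_nonneg_ae] at hzero
  · filter_upwards [hzero, Hh.ae_pos hr hm, ae_mem_closedAnnulus r R, Hh.bound] with x h0 hx hxA hb
    have h1 := hmono x hxA hb.1
    rw [Pi.zero_apply, div_eq_zero_iff] at h0
    have h2 := h0.resolve_right hx.1.ne'
    have h3 : (‖h x‖ - H ‖x‖) ^ 2 = 0 := le_antisymm (by linarith) (sq_nonneg _)
    exact sub_eq_zero.mp (pow_eq_zero_iff two_ne_zero |>.mp h3)
  · filter_upwards [Hh.ae_pos hr hm, ae_mem_closedAnnulus r R, Hh.bound] with x hx hxA hb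
    have h1 := hmono x hxA hb.1
    exact div_nonneg (by positivity) hx.1.le
  · exact hsum.congr hpt

/-- The derivative of the norm on `ℂ`, away from the origin. -/
theorem hasFDerivAt_norm_complex {x : ℂ} (hx : x ≠ 0) :
    HasFDerivAt (fun y : ℂ => ‖y‖) (‖x‖⁻¹ • innerSL ℝ x) x := by
  have h0 : ‖x‖ ≠ 0 := norm_ne_zero_iff.mpr hx
  have h1 := (hasStrictFDerivAt_norm_sq x).hasFDerivAt.sqrt (pow_ne_zero 2 h0)
  have h2 : (fun y : ℂ => Real.sqrt (‖y‖ ^ 2)) = fun y => ‖y‖ :=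
    funext fun y => Real.sqrt_sq (norm_nonneg y)
  rw [h2] at h1
  refine h1.congr_fderiv ?_
  rw [Real.sqrt_sq (norm_nonneg x)]
  ext v
  simp
  field_simp

/-- The derivative of `x ↦ K(|x|) L x` in the radial and the angular direction. -/
theorem fderiv_radial_mul {K : ℝ → ℝ} {K' : ℝ} (L : ℂ →L[ℝ] ℂ) {x : ℂ} (hx : x ≠ 0)
    (hK : HasDerivAt K K' ‖x‖) :
    fderiv ℝ (fun y => (K ‖y‖ : ℂ) * L y) x x = ((‖x‖ * K' + K ‖x‖ : ℝ) : ℂ) * L x ∧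
    fderiv ℝ (fun y => (K ‖y‖ : ℂ) * L y) x (Complex.I * x) = K ‖x‖ * L (Complex.I * x) := by
  have h0 : ‖x‖ ≠ 0 := norm_ne_zero_iff.mpr hx
  have h1 : HasFDerivAt (fun y : ℂ => K ‖y‖) (K' • (‖x‖⁻¹ • innerSL ℝ x)) x :=
    hK.comp_hasFDerivAt x (hasFDerivAt_norm_complex hx)
  have h2 : (fun y => (K ‖y‖ : ℂ) * L y) = fun y => K ‖y‖ • L y :=
    funext fun y => (Complex.real_smul).symm
  rw [h2, (h1.fun_smul L.hasFDerivAt).fderiv]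
  have h3 : inner ℝ x (Complex.I * x) = 0 := by
    simp [Complex.inner]; ring
  constructor
  · simp only [add_apply, smul_apply, ContinuousLinearMap.smulRight_apply, innerSL_apply_apply,
      real_inner_self_eq_norm_sq, smul_eq_mul, Complex.real_smul]
    push_cast
    field_simp
    ring
  · simp only [add_apply, smul_apply, ContinuousLinearMap.smulRight_apply, innerSL_apply_apply,
      h3, smul_eq_mul, Complex.real_smul]
    simp

theorem contDiffOn_radial_mul {K : ℝ → ℝ} (L : ℂ →L[ℝ] ℂ) (hr : 0 ≤ r)
    (hK : ∀ t ∈ Ioo r R, ContDiffAt ℝ 1 K t) :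
    ContDiffOn ℝ 1 (fun y => (K ‖y‖ : ℂ) * L y) (annulus r R) := by
  intro x hx
  have h0 : x ≠ 0 := norm_pos_iff.mp (hr.trans_lt hx.1)
  have h1 : ContDiffAt ℝ 1 (fun y : ℂ => K ‖y‖) x :=
    (hK ‖x‖ hx).comp x (contDiffAt_norm ℝ h0)
  exact ((Complex.ofRealCLM.contDiff.contDiffAt.comp x h1).mul L.contDiff.contDiffAt).contDiffWithinAt

theorem clm_eq_zero_of_polar {L : ℂ →L[ℝ] ℂ} {x : ℂ} (hx : x ≠ 0) (h1 : L x = 0)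
    (h2 : L (Complex.I * x) = 0) : L = 0 := by
  have h := clm_polar_norm_sq L x
  rw [h1, h2] at h
  have h3 : ‖L 1‖ ^ 2 + ‖L Complex.I‖ ^ 2 = 0 := by
    have : 0 < ‖x‖ ^ 2 := by positivity
    have h4 : ‖x‖ ^ 2 * (‖L 1‖ ^ 2 + ‖L Complex.I‖ ^ 2) = 0 := by rw [← h]; simp
    exact (mul_eq_zero.mp h4).resolve_left this.ne'
  obtain ⟨h4, h5⟩ := eq_zero_of_sq_add_sq h3
  ext z
  rw [show z = z.re • (1 : ℂ) + z.im • Complex.I by simp [Complex.re_add_im]]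
  simp only [map_add, map_smul, norm_eq_zero.mp h4, norm_eq_zero.mp h5]
  simp

/-- Extremal oriented maps are rotations of the radial extremal map. -/
theorem IsAnnularMap.eq_rotation_of_isExtremal (Hh : IsAnnularMap r R m M (m ^ 2) (M ^ 2) 1 h G)
    (hex : IsExtremal r R m c h G) (hr : 0 < r) (hrR : r < R) (hm : 0 < m) (hmM : m < M)
    {H : ℝ → ℝ} (hH : ContDiff ℝ 1 H) (hHr : H r = m) (hHR : H R = M)
    (hHm : ∀ t ∈ Icc r R, m ≤ H t) (hH' : ∀ t ∈ Icc r R, 0 ≤ deriv H t)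
    (hHc : ∀ t ∈ Icc r R, H t ^ 2 - t ^ 2 * deriv H t ^ 2 = c) :
    ∃ α : ℝ, ∀ᵐ x ∂volume.restrict (annulus r R),
      h x = Complex.exp (α * Complex.I) * radialMap H x := by
  have hnorm := Hh.norm_eq_of_isExtremal hex hr hm hmM hH hHr hHR hHm hH' hHc
  have hA := isOpen_annulus r R
  have hne : ∀ t ∈ Icc r R, t * H t ≠ 0 := fun t ht =>
    (mul_pos (hr.trans_le ht.1) (hm.trans_le (hHm t ht))).ne'
  set K : ℝ → ℝ := fun t => (t * H t)⁻¹ with hK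
  -- On the annulus `f` is the reciprocal of `radialMap H`. The extremal equations say that `f · h`
  -- has vanishing radial and angular derivatives, and the equality of moduli gives it modulus one.
  set f : ℂ → ℂ := fun x => (K ‖x‖ : ℂ) * Complex.conjCLE x with hf
  have hK' : ∀ t ∈ Icc r R, HasDerivAt K (-(H t + t * deriv H t) / (t * H t) ^ 2) t := fun t ht => by
    have := ((hasDerivAt_id t).fun_mul (hH.differentiable one_ne_zero t).hasDerivAt).fun_inv (hne t ht)
    exact this.congr_deriv (by simp)
  have hfc : ContDiffOn ℝ 1 f (annulus r R) :=
    contDiffOn_radial_mul (Complex.conjCLE : ℂ →L[ℝ] ℂ) hr.le fun t ht =>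
      ((contDiff_id.mul hH).contDiffAt).inv (hne t ⟨ht.1.le, ht.2.le⟩)
  have hw := Hh.hasWeakDeriv.mul_contDiffOn Hh.memLp Hh.memLp_deriv hfc
  have hz : (fun x => f x • G x + h x • fderiv ℝ f x) =ᵐ[volume.restrict (annulus r R)]
      fun _ => 0 := by
    filter_upwards [hex, hnorm, Hh.ae_pos hr hm, ae_mem_closedAnnulus r R] with x ⟨h1, h2⟩ h3
      ⟨hx, hh0, hqm, hq⟩ hxA
    have hx0 : x ≠ 0 := norm_pos_iff.mp hx
    obtain ⟨d1, d2⟩ := fderiv_radial_mul (Complex.conjCLE : ℂ →L[ℝ] ℂ) hx0 (hK' _ hxA)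
    have hH0 : 0 < H ‖x‖ := hm.trans_le (hHm _ hxA)
    have hs : extremalSlope c m (‖h x‖ ^ 2) = ‖x‖ * deriv H ‖x‖ / H ‖x‖ := by
      rw [extremalSlope, max_eq_left hqm, h3, ← hHc _ hxA,
        show 1 - (H ‖x‖ ^ 2 - ‖x‖ ^ 2 * deriv H ‖x‖ ^ 2) / H ‖x‖ ^ 2 =
          (‖x‖ * deriv H ‖x‖ / H ‖x‖) ^ 2 by field_simp; ring,
        Real.sqrt_sq (div_nonneg (mul_nonneg hx.le (hH' _ hxA)) hH0.le)]
    have hr1 : ‖x‖ * (-(H ‖x‖ + ‖x‖ * deriv H ‖x‖) / (‖x‖ * H ‖x‖) ^ 2) + K ‖x‖ =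
        -(K ‖x‖ * (‖x‖ * deriv H ‖x‖ / H ‖x‖)) := by
      simp only [hK]; field_simp; ring
    refine clm_eq_zero_of_polar hx0 ?_ ?_
    · simp only [add_apply, smul_apply, smul_eq_mul]
      rw [h1, hs]
      erw [d1]
      rw [hr1]
      simp only [hf, ContinuousLinearEquiv.coe_coe]
      push_cast
      ring
    · simp only [add_apply, smul_apply, smul_eq_mul]
      rw [h2]
      erw [d2]
      simp only [hf, ContinuousLinearEquiv.coe_coe, Complex.conjCLE_apply, map_mul, Complex.conj_I]
      ring
  have hw0 := hw.congr_deriv hz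
  have hbd : ∀ᵐ x ∂volume.restrict (annulus r R), ‖f x * h x‖ = 1 := by
    filter_upwards [hnorm, Hh.ae_pos hr hm, ae_mem_closedAnnulus r R] with x h3 ⟨hx, hh0, hqm, hq⟩ hxA
    have hH0 : 0 < H ‖x‖ := hm.trans_le (hHm _ hxA)
    simp only [hf, hK, norm_mul, Complex.norm_real, Real.norm_eq_abs, h3, Complex.conjCLE_apply,
      Complex.norm_conj, abs_of_pos (inv_pos.mpr (mul_pos hx hH0))]
    field_simp
  have hmem : MemLp (fun x => f x * h x) 2 (volume.restrict (annulus r R)) := by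
    have : IsFiniteMeasure (volume.restrict (annulus r R)) :=
      ⟨by simpa using volume_annulus_lt_top r R⟩
    refine MemLp.of_bound ?_ 1 (by filter_upwards [hbd] with x hx using hx.le)
    exact (hfc.continuousOn.aestronglyMeasurable hA.measurableSet).mul Hh.memLp.1
  obtain ⟨C, hC⟩ := hw0.ae_eq_const hr hrR hmem
  have hC1 : ∀ᵐ x ∂volume.restrict (annulus r R), ‖C‖ = 1 := by
    filter_upwards [hC, hbd] with x h1 h2
    rw [← h1, h2]
  refine ⟨C.arg, ?_⟩
  filter_upwards [hC, hC1, Hh.ae_pos hr hm, ae_mem_closedAnnulus r R] with x h1 h2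
    ⟨hx, hh0, hqm, hq⟩ hxA
  have hH0 : 0 < H ‖x‖ := hm.trans_le (hHm _ hxA)
  have h3 : Complex.exp (C.arg * Complex.I) = C := by
    have := Complex.norm_mul_exp_arg_mul_I C
    rwa [h2, Complex.ofReal_one, one_mul] at this
  have h4 : x * conj x = (‖x‖ : ℂ) ^ 2 := by
    rw [Complex.mul_conj, Complex.normSq_eq_norm_sq]; push_cast; ring
  have hx1 : (‖x‖ : ℂ) ≠ 0 := Complex.ofReal_ne_zero.mpr hx.ne'
  have hx2 : (H ‖x‖ : ℂ) ≠ 0 := Complex.ofReal_ne_zero.mpr hH0.ne'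
  rw [h3, ← h1, radialMap]
  simp only [hf, hK, Complex.conjCLE_apply]
  push_cast
  field_simp
  linear_combination -h4

end Rigidity

/-! ### Radial maps as admissible homeomorphisms. -/

section RadialMaps

open scoped ComplexConjugate

variable {r R m M c : ℝ} {H : ℝ → ℝ}

theorem radialMap_eq (H : ℝ → ℝ) :
    radialMap H = fun x => ((H ‖x‖ / ‖x‖ : ℝ) : ℂ) * ContinuousLinearMap.id ℝ ℂ x := by
  ext x
  simp only [radialMap, ContinuousLinearMap.id_apply]
  push_cast
  ring

theorem norm_radialMap {x : ℂ} (hx : x ≠ 0) (hH : 0 ≤ H ‖x‖) : ‖radialMap H x‖ = H ‖x‖ := by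
  have h0 : ‖x‖ ≠ 0 := norm_ne_zero_iff.mpr hx
  rw [radialMap, norm_mul, norm_div, Complex.norm_real, Complex.norm_real, norm_norm, div_self h0,
    mul_one, Real.norm_eq_abs, abs_of_nonneg hH]

theorem radialMap_congr {H₁ H₂ : ℝ → ℝ} (h : EqOn H₁ H₂ (Icc r R)) {x : ℂ}
    (hx : x ∈ annulus r R) : radialMap H₁ x = radialMap H₂ x := by
  rw [radialMap, radialMap, h ⟨hx.1.le, hx.2.le⟩]

theorem contDiffOn_radialMap (hH : ContDiff ℝ 1 H) (hr : 0 ≤ r) :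
    ContDiffOn ℝ 1 (radialMap H) (annulus r R) := by
  rw [radialMap_eq]
  exact contDiffOn_radial_mul _ hr fun t ht =>
    hH.contDiffAt.div contDiffAt_id (hr.trans_lt ht.1).ne'

/-- The radial map of a profile that is `C¹` on the line is `C¹` on the punctured plane, so it and
its derivative are bounded up to the boundary of the annulus. -/
theorem closedAnnulus_subset_annulus_zero (hr : 0 < r) (R : ℝ) :
    closedAnnulus r R ⊆ annulus 0 (R + 1) :=
  closedAnnulus_subset hr (by linarith)

theorem memLp_of_continuousOn_closedAnnulus {E : Type*} [NormedAddCommGroup E]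
    [SecondCountableTopologyEither ℂ E] {F : ℂ → E}
    (hF : ContinuousOn F (closedAnnulus r R)) : MemLp F 2 (volume.restrict (annulus r R)) := by
  obtain ⟨C, hC⟩ := (isCompact_closedAnnulus r R).exists_bound_of_continuousOn hF
  refine (MemLp.of_bound (hF.aestronglyMeasurable (measurableSet_closedAnnulus r R)) C ?_).mono_measure
    (Measure.restrict_mono (annulus_subset_closedAnnulus r R) le_rfl)
  filter_upwards [ae_restrict_mem (measurableSet_closedAnnulus r R)] with x hx using hC x hx

theorem memLp_radialMap (hH : ContDiff ℝ 1 H) (hr : 0 < r) :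
    MemLp (radialMap H) 2 (volume.restrict (annulus r R)) :=
  memLp_of_continuousOn_closedAnnulus ((contDiffOn_radialMap hH le_rfl).continuousOn.mono
    (closedAnnulus_subset_annulus_zero hr R))

theorem memLp_fderiv_radialMap (hH : ContDiff ℝ 1 H) (hr : 0 < r) :
    MemLp (fderiv ℝ (radialMap H)) 2 (volume.restrict (annulus r R)) :=
  memLp_of_continuousOn_closedAnnulus (((contDiffOn_radialMap hH le_rfl).continuousOn_fderiv_of_isOpen
    (isOpen_annulus 0 (R + 1)) le_rfl).mono (closedAnnulus_subset_annulus_zero hr R))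

theorem hasWeakDeriv_radialMap (hH : ContDiff ℝ 1 H) (hr : 0 ≤ r) :
    HasWeakDeriv (annulus r R) (radialMap H) (fderiv ℝ (radialMap H)) :=
  (contDiffOn_radialMap hH hr).hasWeakDeriv (isOpen_annulus r R)

theorem memW12_radialMap (hH : ContDiff ℝ 1 H) (hr : 0 < r) :
    MemW12 (annulus r R) (radialMap H) :=
  ⟨memLp_radialMap hH hr, _, hasWeakDeriv_radialMap hH hr.le, memLp_fderiv_radialMap hH hr⟩

theorem fderiv_radialMap (hH : ContDiff ℝ 1 H) {x : ℂ} (hx : x ≠ 0) :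
    fderiv ℝ (radialMap H) x x = deriv H ‖x‖ * x ∧
    fderiv ℝ (radialMap H) x (Complex.I * x) = Complex.I * radialMap H x := by
  have h0 : ‖x‖ ≠ 0 := norm_ne_zero_iff.mpr hx
  have h1 : HasDerivAt (fun t => H t / t) ((deriv H ‖x‖ * ‖x‖ - H ‖x‖ * 1) / ‖x‖ ^ 2) ‖x‖ :=
    (hH.differentiable one_ne_zero ‖x‖).hasDerivAt.fun_div (hasDerivAt_id ‖x‖) h0
  obtain ⟨d1, d2⟩ := fderiv_radial_mul (ContinuousLinearMap.id ℝ ℂ) hx h1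
  rw [← radialMap_eq] at d1 d2
  constructor
  · rw [d1]
    simp only [ContinuousLinearMap.id_apply]
    congr 2
    field_simp
    ring
  · rw [d2, radialMap_eq]
    simp only [ContinuousLinearMap.id_apply]
    ring

/-- Radial maps are monotone. -/
theorem re_radialMap_sub_pos (hr : 0 < r) (hH : StrictMonoOn H (Icc r R))
    (hpos : ∀ t ∈ Icc r R, 0 < H t) {x y : ℂ} (hx : x ∈ annulus r R) (hy : y ∈ annulus r R)
    (hxy : x ≠ y) : 0 < (conj (x - y) * (radialMap H x - radialMap H y)).re := by
  have tx := hr.trans hx.1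
  have ty := hr.trans hy.1
  have ix : ‖x‖ ∈ Icc r R := ⟨hx.1.le, hx.2.le⟩
  have iy : ‖y‖ ∈ Icc r R := ⟨hy.1.le, hy.2.le⟩
  have px := hpos _ ix
  have py := hpos _ iy
  set s := (conj x * y).re
  have hs : s ≤ ‖x‖ * ‖y‖ := by
    have := Complex.re_le_norm (conj x * y)
    rwa [norm_mul, Complex.norm_conj] at this
  have nx : x.re ^ 2 + x.im ^ 2 = ‖x‖ ^ 2 := by
    rw [← Complex.normSq_eq_norm_sq, Complex.normSq_apply]; ring
  have ny : y.re ^ 2 + y.im ^ 2 = ‖y‖ ^ 2 := by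
    rw [← Complex.normSq_eq_norm_sq, Complex.normSq_apply]; ring
  have hsd : s = x.re * y.re + x.im * y.im := by
    simp only [s, Complex.mul_re, Complex.conj_re, Complex.conj_im]; ring
  -- The first term is positive when the moduli differ, the second when the directions differ, and
  -- neither is ever negative.
  have key : (conj (x - y) * (radialMap H x - radialMap H y)).re =
      (‖x‖ - ‖y‖) * (H ‖x‖ - H ‖y‖) +
      (‖x‖ * ‖y‖ - s) * (H ‖x‖ / ‖x‖ + H ‖y‖ / ‖y‖) := by
    have e : ∀ z : ℂ, (radialMap H z).re = H ‖z‖ / ‖z‖ * z.re ∧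
        (radialMap H z).im = H ‖z‖ / ‖z‖ * z.im := fun z => by
      rw [radialMap_eq]
      exact ⟨Complex.re_ofReal_mul _ _, Complex.im_ofReal_mul _ _⟩
    simp only [Complex.mul_re, Complex.conj_re, Complex.conj_im, Complex.sub_re, Complex.sub_im,
      (e x).1, (e x).2, (e y).1, (e y).2, hsd]
    field_simp
    linear_combination (H ‖x‖ * ‖y‖) * nx + (H ‖y‖ * ‖x‖) * ny
  rw [key]
  have hm1 : 0 ≤ (‖x‖ - ‖y‖) * (H ‖x‖ - H ‖y‖) ∧
      (‖x‖ ≠ ‖y‖ → 0 < (‖x‖ - ‖y‖) * (H ‖x‖ - H ‖y‖)) := by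
    rcases lt_trichotomy ‖x‖ ‖y‖ with h | h | h
    · have := mul_pos_of_neg_of_neg (sub_neg.mpr h) (sub_neg.mpr (hH ix iy h))
      exact ⟨this.le, fun _ => this⟩
    · rw [h]; simp
    · have := mul_pos (sub_pos.mpr h) (sub_pos.mpr (hH iy ix h))
      exact ⟨this.le, fun _ => this⟩
  have hw : 0 < H ‖x‖ / ‖x‖ + H ‖y‖ / ‖y‖ := by positivity
  have hm2 := mul_nonneg (sub_nonneg.mpr hs) hw.le
  by_cases hn : ‖x‖ = ‖y‖
  · have h1 : s < ‖x‖ * ‖y‖ := by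
      refine lt_of_le_of_ne hs fun h => hxy ?_
      rw [hn] at nx h
      have h2 : (x.re - y.re) ^ 2 + (x.im - y.im) ^ 2 = 0 := by
        rw [hsd] at h
        linear_combination nx + ny - 2 * h
      obtain ⟨h3, h4⟩ := eq_zero_of_sq_add_sq h2
      exact Complex.ext (sub_eq_zero.mp h3) (sub_eq_zero.mp h4)
    have := mul_pos (sub_pos.mpr h1) hw
    linarith [hm1.1]
  · linarith [hm1.2 hn]

/-- Monotonicity says that `e^{-it} (h(a + s e^{it}) - h(a))` has positive real part. Its principal
argument is then continuous and periodic, and `t` plus this argument is the required angle. -/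
theorem orientationPreservingOn_of_monotone {h : ℂ → ℂ} {Ω : Set ℂ} (hΩ : IsOpen Ω)
    (hc : ContinuousOn h Ω)
    (hm : ∀ x ∈ Ω, ∀ y ∈ Ω, x ≠ y → 0 < (conj (x - y) * (h x - h y)).re) :
    OrientationPreservingOn h Ω := by
  intro a ha
  obtain ⟨δ, hδ, hball⟩ := Metric.isOpen_iff.mp hΩ a ha
  filter_upwards [Ioo_mem_nhdsGT hδ] with s ⟨hs0, hsδ⟩
  have hmem : ∀ t : ℝ, a + s * Complex.exp (t * Complex.I) ∈ Ω := fun t => hball (by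
    rw [Metric.mem_ball, dist_eq_norm, add_sub_cancel_left, norm_mul, Complex.norm_real,
      Complex.norm_exp_ofReal_mul_I, Real.norm_eq_abs, abs_of_pos hs0, mul_one]
    exact hsδ)
  set γ : ℝ → ℂ := fun t => h (a + s * Complex.exp (t * Complex.I)) - h a with hγ
  have cγ : Continuous γ :=
    (hc.comp_continuous (by fun_prop) hmem).sub continuous_const
  set w : ℝ → ℂ := fun t => Complex.exp (-(t * Complex.I)) * γ t with hw
  have cw : Continuous w := by fun_prop
  have hwre : ∀ t, 0 < (w t).re := fun t => by
    have h1 := hm _ (hmem t) a ha (by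
      rw [Ne, add_eq_left]
      exact mul_ne_zero (Complex.ofReal_ne_zero.mpr hs0.ne') (Complex.exp_ne_zero _))
    rw [add_sub_cancel_left, map_mul, Complex.conj_ofReal, mul_assoc, Complex.re_ofReal_mul,
      ← Complex.exp_conj, map_mul, Complex.conj_ofReal, Complex.conj_I, mul_neg] at h1
    exact (mul_pos_iff_of_pos_left hs0).mp h1
  have hγw : ∀ t, γ t = Complex.exp (t * Complex.I) * w t := fun t => by
    rw [hw]
    simp only
    rw [← mul_assoc, ← Complex.exp_add, add_neg_cancel, Complex.exp_zero, one_mul]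
  refine ⟨fun t => t + (w t).arg, ?_, fun t => ⟨fun h0 => ?_, ?_⟩, ?_⟩
  · exact continuous_id.add (continuous_iff_continuousAt.mpr fun t =>
      (Complex.continuousAt_arg (Or.inl (hwre t))).comp cw.continuousAt)
  · have : γ t = 0 := sub_eq_zero.mpr h0
    have h1 := hwre t
    rw [hw] at h1
    simp [this] at h1
  · change γ t = ‖γ t‖ * _
    rw [hγw t, norm_mul, Complex.norm_exp_ofReal_mul_I, one_mul]
    push_cast
    rw [add_mul, Complex.exp_add]
    nth_rewrite 1 [← Complex.norm_mul_exp_arg_mul_I (w t)]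
    ring
  · have h2 : w (2 * Real.pi) = w 0 := by
      simp only [hw, hγ]
      push_cast
      rw [Complex.exp_neg, Complex.exp_two_pi_mul_I]
      simp
    simp only [h2]
    ring

theorem image_Ioo_of_strictMonoOn (hrR : r < R) (hH : StrictMonoOn H (Icc r R))
    (hc : ContinuousOn H (Icc r R)) : H '' Ioo r R = Ioo (H r) (H R) := by
  apply Subset.antisymm
  · rintro _ ⟨t, ht, rfl⟩
    exact ⟨hH (left_mem_Icc.mpr hrR.le) ⟨ht.1.le, ht.2.le⟩ ht.1,
      hH ⟨ht.1.le, ht.2.le⟩ (right_mem_Icc.mpr hrR.le) ht.2⟩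
  · exact intermediate_value_Ioo hrR.le hc

theorem exists_homeomorph_radialMap (hr : 0 < r) (hrR : r < R) (hm : 0 < m)
    (hHc : Continuous H) (hH : StrictMonoOn H (Icc r R)) (hHr : H r = m) (hHR : H R = M) :
    ∃ e : annulus r R ≃ₜ annulus m M, ∀ x, (e x : ℂ) = radialMap H x := by
  have himg := image_Ioo_of_strictMonoOn hrR hH hHc.continuousOn
  rw [hHr, hHR] at himg
  set O : Ioo r R ≃o H '' Ioo r R := StrictMonoOn.orderIso H _ (hH.mono Ioo_subset_Icc_self)
  have hO : ∀ t, (O t : ℝ) = H t := fun t => rfl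
  have : OrdConnected (H '' Ioo r R) := by rw [himg]; exact ordConnected_Ioo
  have cO : Continuous O.symm := O.symm.continuous
  have memI : ∀ y : annulus m M, ‖(y : ℂ)‖ ∈ H '' Ioo r R := fun y => by rw [himg]; exact y.2
  set K : annulus m M → ℝ := fun y => O.symm ⟨‖(y : ℂ)‖, memI y⟩ with hK
  have cK : Continuous K := continuous_subtype_val.comp (cO.comp (by fun_prop))
  have hHK : ∀ y, H (K y) = ‖(y : ℂ)‖ := fun y => by
    rw [hK]; simp only; rw [← hO, O.apply_symm_apply]
  have hKm : ∀ y, K y ∈ Ioo r R := fun y => (O.symm _).2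
  have hpos : ∀ t ∈ Ioo r R, 0 < H t := fun t ht => by
    have : H t ∈ Ioo m M := by rw [← himg]; exact mem_image_of_mem H ht
    exact hm.trans this.1
  have hnx : ∀ x : annulus r R, ‖radialMap H x‖ = H ‖(x : ℂ)‖ := fun x =>
    norm_radialMap (norm_pos_iff.mp (hr.trans x.2.1)) (hpos _ x.2).le
  have fwd : ∀ x : annulus r R, radialMap H x ∈ annulus m M := fun x => by
    have h1 : H ‖(x : ℂ)‖ ∈ Ioo m M := by rw [← himg]; exact mem_image_of_mem H x.2
    rw [← hnx x] at h1
    exact h1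
  set inv : annulus m M → ℂ := fun y => (K y : ℂ) * (y / (‖(y : ℂ)‖ : ℂ)) with hinv
  have hy0 : ∀ y : annulus m M, (‖(y : ℂ)‖ : ℂ) ≠ 0 := fun y =>
    Complex.ofReal_ne_zero.mpr (hm.trans y.2.1).ne'
  have hx0 : ∀ x : annulus r R, (‖(x : ℂ)‖ : ℂ) ≠ 0 := fun x =>
    Complex.ofReal_ne_zero.mpr (hr.trans x.2.1).ne'
  have hninv : ∀ y, ‖inv y‖ = K y := fun y => by
    rw [hinv]
    simp only
    rw [norm_mul, norm_div, Complex.norm_real, Complex.norm_real, norm_norm,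
      div_self (hm.trans y.2.1).ne', mul_one, Real.norm_eq_abs, abs_of_pos (hr.trans (hKm y).1)]
  refine ⟨{ toFun := fun x => ⟨radialMap H x, fwd x⟩
            invFun := fun y => ⟨inv y, by
              change r < ‖inv y‖ ∧ ‖inv y‖ < R
              rw [hninv y]; exact hKm y⟩
            left_inv := fun x => ?_
            right_inv := fun y => ?_
            continuous_toFun := ?_
            continuous_invFun := ?_ }, fun x => rfl⟩
  · apply Subtype.ext
    have h1 : K ⟨radialMap H x, fwd x⟩ = ‖(x : ℂ)‖ :=
      (hH.mono Ioo_subset_Icc_self).injOn (hKm _) x.2 (by rw [hHK]; exact hnx x)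
    have h2 : (H ‖(x : ℂ)‖ : ℂ) ≠ 0 := Complex.ofReal_ne_zero.mpr (hpos _ x.2).ne'
    have h3 := hx0 x
    simp only [hinv, h1, hnx x]
    rw [radialMap]
    field_simp
  · apply Subtype.ext
    have h1 := hy0 y
    have h2 : (K y : ℂ) ≠ 0 := Complex.ofReal_ne_zero.mpr (hr.trans (hKm y).1).ne'
    change radialMap H (inv y) = y
    rw [radialMap, hninv, hHK, hinv]
    field_simp
  · refine Continuous.subtype_mk ?_ _
    simp only [radialMap]
    exact (Complex.continuous_ofReal.comp (by fun_prop)).mul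
      (continuous_subtype_val.div (by fun_prop) hx0)
  · refine Continuous.subtype_mk ?_ _
    exact (Complex.continuous_ofReal.comp cK).mul (continuous_subtype_val.div (by fun_prop) hy0)

/-- Strictly increasing radial maps are admissible homeomorphisms. -/
theorem radialMap_mem_orientedSobolevHomeos (hr : 0 < r) (hrR : r < R) (hm : 0 < m)
    (hH : ContDiff ℝ 1 H) (hHs : StrictMonoOn H (Icc r R)) (hHr : H r = m) (hHR : H R = M) :
    radialMap H ∈ orientedSobolevHomeos r R m M := by
  have hpos : ∀ t ∈ Icc r R, 0 < H t := fun t ht =>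
    hm.trans_le (hHr ▸ hHs.monotoneOn (left_mem_Icc.mpr hrR.le) ht ht.1)
  refine ⟨⟨exists_homeomorph_radialMap hr hrR hm hH.continuous hHs hHr hHR, memW12_radialMap hH hr⟩,
    orientationPreservingOn_of_monotone (isOpen_annulus r R)
      (contDiffOn_radialMap hH hr.le).continuousOn
      fun x hx y hy hxy => re_radialMap_sub_pos hr hHs hpos hx hy hxy, ?_⟩
  have key : ∀ ρ, Tendsto (fun x => ‖radialMap H x‖) (comap norm (𝓝 ρ) ⊓ 𝓟 (annulus r R))
      (𝓝 (H ρ)) := fun ρ => by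
    have h1 : Tendsto (fun x : ℂ => H ‖x‖) (comap norm (𝓝 ρ) ⊓ 𝓟 (annulus r R)) (𝓝 (H ρ)) :=
      ((hH.continuous.tendsto ρ).comp tendsto_comap).mono_left inf_le_left
    refine h1.congr' ?_
    filter_upwards [mem_inf_of_right (mem_principal_self (annulus r R))] with x hx
    exact (norm_radialMap (norm_pos_iff.mp (hr.trans hx.1)) (hpos _ ⟨hx.1.le, hx.2.le⟩).le).symm
  exact ⟨hHr ▸ key r, hHR ▸ key R⟩

end RadialMaps

/-! ### Deformations are annular maps; approximation of monotone radial maps. -/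

section Deformations

variable {r R m M c : ℝ} {H : ℝ → ℝ} {h : ℂ → ℂ}

/-- Needed for uniqueness of the limit of `|h|` at the inner circle, which excludes the reversed
boundary order for oriented maps. -/
theorem comap_norm_inf_annulus_neBot (hr : 0 ≤ r) (hrR : r < R) :
    (comap norm (𝓝 r) ⊓ 𝓟 (annulus r R)).NeBot := by
  rw [neBot_iff]
  intro h
  have h1 : ∀ᶠ _ in comap norm (𝓝 r) ⊓ 𝓟 (annulus r R), False := by rw [h]; exact eventually_bot
  obtain ⟨ε, hε, h2⟩ := eventually_comap_norm_iff.mp h1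
  obtain ⟨t, ht, ht'⟩ := exists_between (lt_min hrR (by linarith : r < r + ε))
  obtain ⟨h3, h4⟩ := lt_min_iff.mp ht'
  have hn : ‖(t : ℂ)‖ = t := by
    rw [Complex.norm_real, Real.norm_eq_abs, abs_of_pos (hr.trans_lt ht)]
  exact h2 (t : ℂ) (by constructor <;> rw [hn] <;> assumption)
    (by rw [hn, abs_of_pos (by linarith)]; linarith)

theorem WeaklyTendstoW12.comp {Ω : Set ℂ} {u : ℕ → ℂ → ℂ} (hw : WeaklyTendstoW12 Ω u h)
    {φ : ℕ → ℕ} (hφ : Tendsto φ atTop atTop) : WeaklyTendstoW12 Ω (fun n => u (φ n)) h :=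
  ⟨fun _ => hw.1 _, hw.2.1, fun g hg => ⟨(hw.2.2 g hg).1.comp hφ,
    fun v => ((hw.2.2 g hg).2 v).comp hφ⟩⟩

theorem norm_mem_of_mem_sobolevHomeos (hh : h ∈ sobolevHomeos r R m M) :
    ∀ x ∈ annulus r R, m ≤ ‖h x‖ ∧ ‖h x‖ ≤ M := fun x hx => by
  obtain ⟨⟨e, he⟩, -⟩ := hh
  have h1 := (e ⟨x, hx⟩).2
  rw [he ⟨x, hx⟩] at h1
  exact ⟨h1.1.le, h1.2.le⟩

theorem isAnnularMap_of_mem_orientedSobolevHomeos (hr : 0 < r) (hrR : r < R) (hm : 0 < m)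
    (hmM : m < M) (hh : h ∈ orientedSobolevHomeos r R m M) :
    IsAnnularMap r R m M (m ^ 2) (M ^ 2) 1 h (weakDeriv (annulus r R) h) := by
  obtain ⟨k, -, hk, ⟨-, h2⟩ | ⟨h1, -⟩⟩ := isAnnularMap_of_mem_sobolevHomeos hr hrR hm hmM hh.1
  · rwa [hk hh] at h2
  · have := comap_norm_inf_annulus_neBot hr.le hrR
    exact absurd (tendsto_nhds_unique hh.2.2.1 h1.1) hmM.ne

/-- Deformations generated by oriented homeomorphisms. -/
theorem isAnnularMap_of_mem_weakLimits_oriented (hr : 0 < r) (hrR : r < R) (hm : 0 < m)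
    (hmM : m < M) (hh : h ∈ weakLimits (annulus r R) (orientedSobolevHomeos r R m M)) :
    IsAnnularMap r R m M (m ^ 2) (M ^ 2) 1 h (weakDeriv (annulus r R) h) := by
  obtain ⟨u, hu, hw⟩ := hh
  exact IsAnnularMap.of_weaklyTendsto hr hrR hm hmM.le
    (fun n => isAnnularMap_of_mem_orientedSobolevHomeos hr hrR hm hmM (hu n))
    (fun n => norm_mem_of_mem_sobolevHomeos (hu n).1) hw

/-- Deformations generated by all homeomorphisms. -/
theorem isAnnularMap_of_mem_weakLimits (hr : 0 < r) (hrR : r < R) (hm : 0 < m)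
    (hmM : m < M) (hh : h ∈ weakLimits (annulus r R) (sobolevHomeos r R m M)) :
    ∃ (p P : ℝ) (k : ℤ), (k = 1 ∨ k = -1) ∧
      ((p = m ^ 2 ∧ P = M ^ 2) ∨ (p = M ^ 2 ∧ P = m ^ 2)) ∧
      IsAnnularMap r R m M p P k h (weakDeriv (annulus r R) h) := by
  obtain ⟨u, hu, hw⟩ := hh
  -- There are four combinations of degree and boundary order. One of them occurs for infinitely
  -- many terms, and the weak limit inherits it along that subsequence.
  set D : Finset (ℤ × ℝ × ℝ) := {(1, m ^ 2, M ^ 2), (-1, m ^ 2, M ^ 2), (1, M ^ 2, m ^ 2),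
    (-1, M ^ 2, m ^ 2)} with hD
  have hn : ∀ n, ∃ d ∈ D, IsAnnularMap r R m M d.2.1 d.2.2 d.1 (u n)
      (weakDeriv (annulus r R) (u n)) := fun n => by
    obtain ⟨k, hk, -, ⟨-, h2⟩ | ⟨-, h2⟩⟩ := isAnnularMap_of_mem_sobolevHomeos hr hrR hm hmM (hu n)
    · exact ⟨(k, m ^ 2, M ^ 2), by rcases hk with rfl | rfl <;> simp [hD], h2⟩
    · exact ⟨(k, M ^ 2, m ^ 2), by rcases hk with rfl | rfl <;> simp [hD], h2⟩
  obtain ⟨d, hdD, hd⟩ : ∃ d ∈ D, ∃ᶠ n in atTop, IsAnnularMap r R m M d.2.1 d.2.2 d.1 (u n)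
      (weakDeriv (annulus r R) (u n)) := by
    by_contra! hcon
    have h1 := (eventually_all_finset D).mpr hcon
    obtain ⟨n, h2⟩ := h1.exists
    obtain ⟨d, hd, h3⟩ := hn n
    exact h2 d hd h3
  obtain ⟨φ, hφ, hφd⟩ := extraction_of_frequently_atTop hd
  refine ⟨d.2.1, d.2.2, d.1, ?_, ?_, IsAnnularMap.of_weaklyTendsto hr hrR hm hmM.le hφd
    (fun n => norm_mem_of_mem_sobolevHomeos (hu _)) (hw.comp hφ.tendsto_atTop)⟩
  · simp only [hD, Finset.mem_insert, Finset.mem_singleton] at hdD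
    rcases hdD with rfl | rfl | rfl | rfl <;> simp
  · simp only [hD, Finset.mem_insert, Finset.mem_singleton] at hdD
    rcases hdD with rfl | rfl | rfl | rfl <;> simp

theorem self_mem_weakLimits {Ω : Set ℂ} {S : Set (ℂ → ℂ)} (hh : h ∈ S) (hW : MemW12 Ω h) :
    h ∈ weakLimits Ω S :=
  ⟨fun _ => h, fun _ => hh, fun _ => hW, hW, fun _ _ => ⟨tendsto_const_nhds,
    fun _ => tendsto_const_nhds⟩⟩

/-- The affine increasing function of `[r, R]` onto `[m, M]`. -/
noncomputable def affineProfile (r R m M t : ℝ) : ℝ := m + (M - m) / (R - r) * (t - r)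

/-- Strictly increasing approximations of a monotone profile. -/
noncomputable def strictProfile (r R m M : ℝ) (H : ℝ → ℝ) (n : ℕ) (t : ℝ) : ℝ :=
  (1 - 1 / (n + 1 : ℝ)) * H t + 1 / (n + 1 : ℝ) * affineProfile r R m M t

theorem one_div_succ_mem (n : ℕ) : 0 < 1 / (n + 1 : ℝ) ∧ 0 ≤ 1 - 1 / (n + 1 : ℝ) := by
  have h : (0 : ℝ) < n + 1 := by positivity
  refine ⟨by positivity, ?_⟩
  rw [sub_nonneg, div_le_one h]
  linarith [Nat.cast_nonneg (α := ℝ) n]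

theorem contDiff_affineProfile : ContDiff ℝ 1 (affineProfile r R m M) := by
  unfold affineProfile
  fun_prop

theorem contDiff_strictProfile (hH : ContDiff ℝ 1 H) (n : ℕ) :
    ContDiff ℝ 1 (strictProfile r R m M H n) :=
  (contDiff_const.mul hH).add (contDiff_const.mul contDiff_affineProfile)

theorem radialMap_strictProfile_mem (hr : 0 < r) (hrR : r < R) (hm : 0 < m) (hmM : m < M)
    (hH : ContDiff ℝ 1 H) (hHm : MonotoneOn H (Icc r R)) (hHr : H r = m) (hHR : H R = M) (n : ℕ) :
    radialMap (strictProfile r R m M H n) ∈ orientedSobolevHomeos r R m M := by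
  obtain ⟨h1, h2⟩ := one_div_succ_mem n
  have h3 : 0 < (M - m) / (R - r) := div_pos (by linarith) (by linarith)
  refine radialMap_mem_orientedSobolevHomeos hr hrR hm (contDiff_strictProfile hH n)
    (fun s hs t ht hst => ?_) ?_ ?_
  · have h4 := mul_le_mul_of_nonneg_left (hHm hs ht hst.le) h2
    have h5 : affineProfile r R m M s < affineProfile r R m M t := by
      have := mul_lt_mul_of_pos_left (by linarith : s - r < t - r) h3
      simp only [affineProfile]; linarith
    have h6 := mul_lt_mul_of_pos_left h5 h1
    simp only [strictProfile]
    linarith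
  · simp only [strictProfile, affineProfile, hHr]; ring
  · have : R - r ≠ 0 := by linarith
    simp only [strictProfile, affineProfile, hHR]; field_simp; ring

theorem radialMap_strictProfile (n : ℕ) (x : ℂ) :
    radialMap (strictProfile r R m M H n) x = ((1 - 1 / (n + 1 : ℝ) : ℝ) : ℂ) * radialMap H x +
      ((1 / (n + 1 : ℝ) : ℝ) : ℂ) * radialMap (affineProfile r R m M) x := by
  simp only [radialMap, strictProfile]
  push_cast
  ring

theorem fderiv_radialMap_strictProfile (hr : 0 ≤ r) (hH : ContDiff ℝ 1 H) (n : ℕ) {x : ℂ}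
    (hx : x ∈ annulus r R) (v : ℂ) : fderiv ℝ (radialMap (strictProfile r R m M H n)) x v =
      ((1 - 1 / (n + 1 : ℝ) : ℝ) : ℂ) * fderiv ℝ (radialMap H) x v +
      ((1 / (n + 1 : ℝ) : ℝ) : ℂ) * fderiv ℝ (radialMap (affineProfile r R m M)) x v := by
  have hA := (isOpen_annulus r R).mem_nhds hx
  have d1 : DifferentiableAt ℝ (radialMap H) x :=
    ((contDiffOn_radialMap hH hr).contDiffAt hA).differentiableAt one_ne_zero
  have d2 : DifferentiableAt ℝ (radialMap (affineProfile r R m M)) x :=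
    ((contDiffOn_radialMap contDiff_affineProfile hr).contDiffAt hA).differentiableAt one_ne_zero
  rw [funext (radialMap_strictProfile (r := r) (R := R) (m := m) (M := M) (H := H) n),
    ((d1.hasFDerivAt.const_mul _).fun_add (d2.hasFDerivAt.const_mul _)).fderiv]
  simp

/-- The radial map is linear in its profile, so each pairing with the strict profiles is a convex
combination of two fixed numbers, with the weight of the second tending to zero. -/
theorem radialMap_mem_weakLimits (hr : 0 < r) (hrR : r < R) (hm : 0 < m) (hmM : m < M)
    (hH : ContDiff ℝ 1 H) (hHm : MonotoneOn H (Icc r R)) (hHr : H r = m) (hHR : H R = M) :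
    radialMap H ∈ weakLimits (annulus r R) (orientedSobolevHomeos r R m M) := by
  have hA := isOpen_annulus r R
  have hAm := measurableSet_annulus r R
  refine ⟨fun n => radialMap (strictProfile r R m M H n),
    radialMap_strictProfile_mem hr hrR hm hmM hH hHm hHr hHR,
    fun n => memW12_radialMap (contDiff_strictProfile hH n) hr, memW12_radialMap hH hr,
    fun g hg => ?_⟩
  have lim : ∀ I J : ℂ, Tendsto (fun n : ℕ => ((1 - 1 / (n + 1 : ℝ) : ℝ) : ℂ) * I +
      ((1 / (n + 1 : ℝ) : ℝ) : ℂ) * J) atTop (𝓝 I) := fun I J => by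
    have h1 := tendsto_one_div_add_atTop_nhds_zero_nat (𝕜 := ℝ)
    have h2 := (((Complex.continuous_ofReal.tendsto _).comp (h1.const_sub 1)).mul_const I).add
      (((Complex.continuous_ofReal.tendsto _).comp h1).mul_const J)
    simpa using h2
  have gen : ∀ (F₁ F₂ : ℂ → ℂ) (F : ℕ → ℂ → ℂ), MemLp F₁ 2 (volume.restrict (annulus r R)) →
      MemLp F₂ 2 (volume.restrict (annulus r R)) →
      (∀ n, ∀ᵐ x ∂volume.restrict (annulus r R), F n x = ((1 - 1 / (n + 1 : ℝ) : ℝ) : ℂ) * F₁ x +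
        ((1 / (n + 1 : ℝ) : ℝ) : ℂ) * F₂ x) →
      Tendsto (fun n => ∫ x in annulus r R, g x * F n x) atTop
        (𝓝 (∫ x in annulus r R, g x * F₁ x)) := by
    intro F₁ F₂ F h1 h2 h3
    have i1 := MemLp.integrable_mul_two hg h1
    have i2 := MemLp.integrable_mul_two hg h2
    refine (lim _ (∫ x in annulus r R, g x * F₂ x)).congr fun n => ?_
    rw [← integral_const_mul, ← integral_const_mul, ← integral_add (i1.const_mul _) (i2.const_mul _)]
    refine integral_congr_ae ?_
    filter_upwards [h3 n] with x hx
    rw [hx]; ring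
  refine ⟨gen _ (radialMap (affineProfile r R m M)) _ (memLp_radialMap hH hr)
    (memLp_radialMap contDiff_affineProfile hr) fun n => Eventually.of_forall fun x =>
      radialMap_strictProfile n x, fun v => ?_⟩
  have e1 := (hasWeakDeriv_radialMap (R := R) hH hr.le).weakDeriv_ae_eq hA
  have e2 : ∫ x in annulus r R, g x * weakDeriv (annulus r R) (radialMap H) x v =
      ∫ x in annulus r R, g x * fderiv ℝ (radialMap H) x v := by
    refine integral_congr_ae ?_
    filter_upwards [e1] with x hx
    rw [hx]
  rw [e2]
  refine gen _ (fun x => fderiv ℝ (radialMap (affineProfile r R m M)) x v) _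
    ((ContinuousLinearMap.apply ℝ ℂ v).comp_memLp' (memLp_fderiv_radialMap hH hr))
    ((ContinuousLinearMap.apply ℝ ℂ v).comp_memLp' (memLp_fderiv_radialMap contDiff_affineProfile hr))
    fun n => ?_
  filter_upwards [(hasWeakDeriv_radialMap (R := R) (contDiff_strictProfile (r := r) (R := R)
    (m := m) (M := M) hH n) hr.le).weakDeriv_ae_eq hA, ae_restrict_mem hAm] with x h1 h2
  rw [h1, fderiv_radialMap_strictProfile hr.le hH n h2]

theorem norm_sq_convex {s : ℝ} (h0 : 0 ≤ s) (h1 : 0 ≤ 1 - s) (z w : ℂ) :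
    ‖((1 - s : ℝ) : ℂ) * z + (s : ℂ) * w‖ ^ 2 ≤ (1 - s) * ‖z‖ ^ 2 + s * ‖w‖ ^ 2 := by
  have := mul_nonneg (mul_nonneg h0 h1) (sq_nonneg ‖z - w‖)
  simp only [← Complex.normSq_eq_norm_sq, Complex.normSq_apply, Complex.mul_re, Complex.mul_im,
    Complex.add_re, Complex.add_im, Complex.sub_re, Complex.sub_im, Complex.ofReal_re,
    Complex.ofReal_im] at this ⊢
  linarith

/-- Convexity of the energy. Weak convergence would bound the limit energy from above by those of
the homeomorphisms; this is the opposite inequality, needed for the infimum. -/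
theorem dirichletEnergy_strictProfile_le (hr : 0 ≤ r) (hH : ContDiff ℝ 1 H) (n : ℕ) :
    dirichletEnergy (annulus r R) (radialMap (strictProfile r R m M H n)) ≤
      ENNReal.ofReal (1 - 1 / (n + 1 : ℝ)) * dirichletEnergy (annulus r R) (radialMap H) +
      ENNReal.ofReal (1 / (n + 1 : ℝ)) *
        dirichletEnergy (annulus r R) (radialMap (affineProfile r R m M)) := by
  have hA := isOpen_annulus r R
  obtain ⟨h1, h2⟩ := one_div_succ_mem n
  rw [(hasWeakDeriv_radialMap (contDiff_strictProfile hH n) hr).dirichletEnergy_eq hA,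
    (hasWeakDeriv_radialMap hH hr).dirichletEnergy_eq hA,
    (hasWeakDeriv_radialMap contDiff_affineProfile hr).dirichletEnergy_eq hA,
    ← lintegral_const_mul' _ _ ENNReal.ofReal_ne_top,
    ← lintegral_const_mul' _ _ ENNReal.ofReal_ne_top]
  have hmeas : AEMeasurable (fun x => ENNReal.ofReal (1 - 1 / (n + 1 : ℝ)) *
      ENNReal.ofReal (‖fderiv ℝ (radialMap H) x 1‖ ^ 2 +
        ‖fderiv ℝ (radialMap H) x Complex.I‖ ^ 2)) (volume.restrict (annulus r R)) :=
    ((((measurable_fderiv_apply_const ℝ _ _).norm.pow_const 2).add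
      ((measurable_fderiv_apply_const ℝ _ _).norm.pow_const 2)).ennreal_ofReal.const_mul
      _).aemeasurable
  rw [← lintegral_add_left' hmeas]
  refine lintegral_mono_ae ?_
  filter_upwards [ae_restrict_mem hA.measurableSet] with x hx
  rw [← ENNReal.ofReal_mul h2, ← ENNReal.ofReal_mul h1.le, ← ENNReal.ofReal_add
    (mul_nonneg h2 (by positivity)) (mul_nonneg h1.le (by positivity))]
  refine ENNReal.ofReal_le_ofReal ?_
  rw [fderiv_radialMap_strictProfile hr hH n hx, fderiv_radialMap_strictProfile hr hH n hx]
  have := norm_sq_convex h1.le h2 (fderiv ℝ (radialMap H) x 1)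
    (fderiv ℝ (radialMap (affineProfile r R m M)) x 1)
  have := norm_sq_convex h1.le h2 (fderiv ℝ (radialMap H) x Complex.I)
    (fderiv ℝ (radialMap (affineProfile r R m M)) x Complex.I)
  linarith

theorem dirichletEnergy_radialMap_lt_top (hr : 0 < r) (hrR : r < R) (hm : 0 < m) (hmM : m < M)
    (hH : ContDiff ℝ 1 H) (hHm : MonotoneOn H (Icc r R)) (hHr : H r = m) (hHR : H R = M) :
    dirichletEnergy (annulus r R) (radialMap H) < ⊤ := by
  rw [(isAnnularMap_of_mem_weakLimits_oriented hr hrR hm hmM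
    (radialMap_mem_weakLimits hr hrR hm hmM hH hHm hHr hHR)).dirichletEnergy_eq hr]
  exact ENNReal.ofReal_lt_top

/-- The energy of a monotone radial map is approximated from above by homeomorphisms. -/
theorem le_dirichletEnergy_radialMap (hr : 0 < r) (hrR : r < R) (hm : 0 < m) (hmM : m < M)
    (hH : ContDiff ℝ 1 H) (hHm : MonotoneOn H (Icc r R)) (hHr : H r = m) (hHR : H R = M) {b : ℝ≥0∞}
    (hb : ∀ h ∈ orientedSobolevHomeos r R m M, b ≤ dirichletEnergy (annulus r R) h) :
    b ≤ dirichletEnergy (annulus r R) (radialMap H) := by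
  have t0 := tendsto_one_div_add_atTop_nhds_zero_nat (𝕜 := ℝ)
  have hE := (dirichletEnergy_radialMap_lt_top hr hrR hm hmM hH hHm hHr hHR).ne
  have hR : R - r ≠ 0 := by linarith
  have hE' := (dirichletEnergy_radialMap_lt_top hr hrR hm hmM
    (contDiff_affineProfile (r := r) (R := R) (m := m) (M := M)) (fun s _ t _ hst => by
      have := mul_le_mul_of_nonneg_left (by linarith : s - r ≤ t - r)
        (div_nonneg (by linarith) (by linarith) : 0 ≤ (M - m) / (R - r))
      simp only [affineProfile]; linarith) (by simp [affineProfile])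
      (by simp only [affineProfile]; field_simp; ring)).ne
  have t1 : Tendsto (fun n : ℕ => ENNReal.ofReal (1 - 1 / (n + 1 : ℝ)) *
      dirichletEnergy (annulus r R) (radialMap H) + ENNReal.ofReal (1 / (n + 1 : ℝ)) *
        dirichletEnergy (annulus r R) (radialMap (affineProfile r R m M))) atTop
      (𝓝 (ENNReal.ofReal (1 - 0) * dirichletEnergy (annulus r R) (radialMap H) +
        ENNReal.ofReal 0 *
        dirichletEnergy (annulus r R) (radialMap (affineProfile r R m M)))) :=
    (ENNReal.Tendsto.mul_const (ENNReal.tendsto_ofReal (t0.const_sub 1)) (Or.inr hE)).add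
      (ENNReal.Tendsto.mul_const (ENNReal.tendsto_ofReal t0) (Or.inr hE'))
  simp only [sub_zero, ENNReal.ofReal_one, one_mul, ENNReal.ofReal_zero, zero_mul, add_zero] at t1
  exact ge_of_tendsto' t1 fun n => (hb _ (radialMap_strictProfile_mem hr hrR hm hmM hH hHm hHr hHR
    n)).trans (dirichletEnergy_strictProfile_le hr.le hH n)

/-- The radial map of a solution of the characteristic equation is extremal. -/
theorem isExtremal_radialMap (hr : 0 < r) (hm : 0 < m) (hH : ContDiff ℝ 1 H)
    (hHm : ∀ t ∈ Icc r R, m ≤ H t) (hH' : ∀ t ∈ Icc r R, 0 ≤ deriv H t)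
    (hHc : ∀ t ∈ Icc r R, H t ^ 2 - t ^ 2 * deriv H t ^ 2 = c) :
    IsExtremal r R m c (radialMap H) (weakDeriv (annulus r R) (radialMap H)) := by
  filter_upwards [(hasWeakDeriv_radialMap (R := R) hH hr.le).weakDeriv_ae_eq (isOpen_annulus r R),
    ae_restrict_mem (measurableSet_annulus r R)] with x h1 hx
  have hxA : ‖x‖ ∈ Icc r R := ⟨hx.1.le, hx.2.le⟩
  have hx0 : 0 < ‖x‖ := hr.trans hx.1
  have hH0 : 0 < H ‖x‖ := hm.trans_le (hHm _ hxA)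
  obtain ⟨d1, d2⟩ := fderiv_radialMap hH (norm_pos_iff.mp hx0)
  rw [h1, d1, d2, norm_radialMap (norm_pos_iff.mp hx0) hH0.le]
  refine ⟨?_, rfl⟩
  have hs : extremalSlope c m (H ‖x‖ ^ 2) = ‖x‖ * deriv H ‖x‖ / H ‖x‖ := by
    rw [extremalSlope, max_eq_left (pow_le_pow_left₀ hm.le (hHm _ hxA) 2), ← hHc _ hxA,
      show 1 - (H ‖x‖ ^ 2 - ‖x‖ ^ 2 * deriv H ‖x‖ ^ 2) / H ‖x‖ ^ 2 =
        (‖x‖ * deriv H ‖x‖ / H ‖x‖) ^ 2 by field_simp; ring,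
      Real.sqrt_sq (div_nonneg (mul_nonneg hx0.le (hH' _ hxA)) hH0.le)]
  have e1 : (‖x‖ : ℂ) ≠ 0 := Complex.ofReal_ne_zero.mpr hx0.ne'
  have e2 : (H ‖x‖ : ℂ) ≠ 0 := Complex.ofReal_ne_zero.mpr hH0.ne'
  rw [hs, radialMap]
  push_cast
  field_simp

end Deformations

/-! ### Solutions of the characteristic equation. -/

section CharacteristicEquation

variable {r R m M c a b ρ : ℝ} {H : ℝ → ℝ}

/-- A `C¹` function on a closed interval extends to a `C¹` function on the line. -/
theorem exists_contDiff_extension (hrR : r < R) (hH : ContDiffOn ℝ 1 H (Icc r R)) :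
    ∃ F : ℝ → ℝ, ContDiff ℝ 1 F ∧ EqOn F H (Icc r R) ∧
      ∀ t ∈ Icc r R, deriv F t = derivWithin H (Icc r R) t := by
  -- The derivative is continued by its end values, and the extension is the primitive.
  set D : ℝ → ℝ := fun t => derivWithin H (Icc r R) (projIcc r R hrR.le t) with hD
  have cD : Continuous D :=
    (hH.continuousOn_derivWithin (uniqueDiffOn_Icc hrR) le_rfl).comp_continuous
      (continuous_subtype_val.comp continuous_projIcc) fun t => (projIcc r R hrR.le t).2
  have hDt : ∀ t ∈ Icc r R, D t = derivWithin H (Icc r R) t := fun t ht => by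
    simp only [hD, projIcc_of_mem hrR.le ht]
  have hd : ∀ t, HasDerivAt (fun t => H r + ∫ s in r..t, D s) (D t) t := fun t =>
    (intervalIntegral.integral_hasDerivAt_right (cD.intervalIntegrable _ _)
      (cD.stronglyMeasurableAtFilter _ _) cD.continuousAt).const_add _
  have hderiv : deriv (fun t => H r + ∫ s in r..t, D s) = D := funext fun t => (hd t).deriv
  have cF : ContDiff ℝ 1 (fun t => H r + ∫ s in r..t, D s) :=
    contDiff_one_iff_deriv.mpr ⟨fun t => (hd t).differentiableAt, by rw [hderiv]; exact cD⟩
  refine ⟨_, cF, fun t ht => ?_, fun t ht => by rw [hderiv, hDt t ht]⟩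
  have hHd : ∀ s ∈ Ioo r t, HasDerivAt H (D s) s := fun s hs => by
    have hsI : s ∈ Icc r R := ⟨hs.1.le, hs.2.le.trans ht.2⟩
    rw [hDt s hsI]
    exact ((hH.differentiableOn one_ne_zero s hsI).hasDerivWithinAt).hasDerivAt
      (Icc_mem_nhds hs.1 (hs.2.trans_le ht.2))
  have := intervalIntegral.integral_eq_sub_of_hasDerivAt_of_le ht.1
    (hH.continuousOn.mono (Icc_subset_Icc_right ht.2)) hHd (cD.intervalIntegrable _ _)
  simp only [this]
  ring

/-- A characteristic solution, extended to the line. -/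
structure IsSmoothProfile (r R m M c : ℝ) (H : ℝ → ℝ) : Prop where
  contDiff : ContDiff ℝ 1 H
  monotoneOn : MonotoneOn H (Icc r R)
  left : H r = m
  right : H R = M
  char : ∀ t ∈ Icc r R, H t ^ 2 - t ^ 2 * deriv H t ^ 2 = c

theorem IsCharacteristicSolution.exists_smoothProfile (hrR : r < R) (hmM : m < M)
    (hH : IsCharacteristicSolution r R m M H c) :
    ∃ F, IsSmoothProfile r R m M c F ∧ EqOn F H (Icc r R) := by
  obtain ⟨h1, h2, h3, h4⟩ := hH
  obtain ⟨F, cF, eF, dF⟩ := exists_contDiff_extension hrR h1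
  have hl := left_mem_Icc.mpr hrR.le
  have hR := right_mem_Icc.mpr hrR.le
  refine ⟨F, ⟨cF, h2.congr eF.symm, ?_, ?_, fun t ht => by rw [eF ht, dF t ht, h4 t ht]⟩, eF⟩
  · rw [eF hl]
    obtain ⟨t, ht, e⟩ : m ∈ H '' Icc r R := by rw [h3]; exact left_mem_Icc.mpr hmM.le
    have h5 : H r ∈ Icc m M := by rw [← h3]; exact mem_image_of_mem H hl
    exact le_antisymm (e ▸ h2 hl ht ht.1) h5.1
  · rw [eF hR]
    obtain ⟨t, ht, e⟩ : M ∈ H '' Icc r R := by rw [h3]; exact right_mem_Icc.mpr hmM.le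
    have h5 : H R ∈ Icc m M := by rw [← h3]; exact mem_image_of_mem H hR
    exact le_antisymm h5.2 (e ▸ h2 ht hR ht.2)

namespace IsSmoothProfile

theorem deriv_nonneg (hH : IsSmoothProfile r R m M c H) (hrR : r < R) :
    ∀ t ∈ Icc r R, 0 ≤ deriv H t := fun t ht => by
  have h1 := ((hH.contDiff.differentiable one_ne_zero t).hasDerivAt.hasDerivWithinAt
    (s := Icc r R)).derivWithin (uniqueDiffOn_Icc hrR t ht)
  rw [← h1]
  exact hH.monotoneOn.derivWithin_nonneg

theorem le_of_mem (hH : IsSmoothProfile r R m M c H) (hrR : r < R) : ∀ t ∈ Icc r R, m ≤ H t :=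
  fun _ ht => hH.left ▸ hH.monotoneOn (left_mem_Icc.mpr hrR.le) ht ht.1

theorem const_le (hH : IsSmoothProfile r R m M c H) (hrR : r < R) : c ≤ m ^ 2 := by
  have h1 := hH.char r (left_mem_Icc.mpr hrR.le)
  rw [hH.left] at h1
  nlinarith [mul_nonneg (sq_nonneg r) (sq_nonneg (deriv H r))]

/-- The structure of the solutions of the characteristic equation. -/
theorem exists_structure (hH : IsSmoothProfile r R m M c H) (hr : 0 < r) (hrR : r < R) (hm : 0 < m)
    (hmM : m < M) : ∃ ρ ∈ Ico r R, (∀ t ∈ Icc r ρ, H t = m) ∧ (∀ t ∈ Ioc ρ R, 0 < deriv H t) ∧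
      (r < ρ → deriv H ρ = 0) ∧
      ∃ a b, ∀ t ∈ Icc ρ R, H t = a * t + b / t ∧ t * deriv H t = a * t - b / t := by
  have cH := hH.contDiff.continuous
  have cH' : Continuous (deriv H) := hH.contDiff.continuous_deriv le_rfl
  have hcm := hH.const_le hrR
  have hnn := hH.deriv_nonneg hrR
  -- `ρ` is the last radius where `H` takes its minimum; by monotonicity `H` is constant before it.
  set Z : Set ℝ := Icc r R ∩ {t | H t = m} with hZ
  have hZc : IsCompact Z := isCompact_Icc.inter_right (isClosed_eq cH continuous_const)
  have hrZ : r ∈ Z := ⟨left_mem_Icc.mpr hrR.le, hH.left⟩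
  set ρ := sSup Z with hρ
  have hρZ : ρ ∈ Z := hZc.sSup_mem ⟨r, hrZ⟩
  have hrρ : r ≤ ρ := hρZ.1.1
  have hρR : ρ < R := lt_of_le_of_ne hρZ.1.2 fun h => by
    have := hρZ.2
    rw [mem_ofPred_eq, h, hH.right] at this
    exact hmM.ne' this
  have hgt : ∀ t ∈ Ioc ρ R, m < H t := fun t ht => by
    have htI : t ∈ Icc r R := ⟨hrρ.trans ht.1.le, ht.2⟩
    refine lt_of_le_of_ne (hH.le_of_mem hrR t htI) fun h => ?_
    have : t ≤ ρ := le_csSup hZc.bddAbove ⟨htI, h.symm⟩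
    exact this.not_gt ht.1
  have hconst : ∀ t ∈ Icc r ρ, H t = m := fun t ht => by
    have htI : t ∈ Icc r R := ⟨ht.1, ht.2.trans hρR.le⟩
    have h1 := hH.monotoneOn htI hρZ.1 ht.2
    rw [hρZ.2] at h1
    exact le_antisymm h1 (hH.le_of_mem hrR t htI)
  -- A critical point would give `H² = c ≤ m²`, impossible where `H > m`.
  have hpos : ∀ t ∈ Ioc ρ R, 0 < deriv H t := fun t ht => by
    have htI : t ∈ Icc r R := ⟨hrρ.trans ht.1.le, ht.2⟩
    refine lt_of_le_of_ne (hnn t htI) fun h => ?_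
    have h1 := hH.char t htI
    rw [← h] at h1
    have h2 := pow_lt_pow_left₀ (hgt t ht) hm.le two_ne_zero
    linarith
  refine ⟨ρ, ⟨hrρ, hρR⟩, hconst, hpos, fun hlt => ?_, ?_⟩
  · have h1 : deriv H ((r + ρ) / 2) = 0 := by
      have h2 : H =ᶠ[𝓝 ((r + ρ) / 2)] fun _ => m := by
        filter_upwards [Ioo_mem_nhds (by linarith : r < (r + ρ) / 2)
          (by linarith : (r + ρ) / 2 < ρ)] with t ht using hconst t ⟨ht.1.le, ht.2.le⟩
      rw [h2.deriv_eq, deriv_const]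
    have h2 := hH.char ((r + ρ) / 2) ⟨by linarith, by linarith⟩
    rw [h1, hconst _ ⟨by linarith, by linarith⟩] at h2
    have h3 := hH.char ρ hρZ.1
    rw [hconst ρ ⟨hrρ, le_rfl⟩] at h3
    have h4 : ρ ^ 2 * deriv H ρ ^ 2 = 0 := by linarith
    have h5 : 0 < ρ := hr.trans hlt
    exact pow_eq_zero_iff two_ne_zero |>.mp ((mul_eq_zero.mp h4).resolve_left (by positivity))
  · have hρ0 : 0 < ρ := hr.trans_le hrρ
    -- `W = t Ḣ` is differentiable on `(ρ, R)`, with `Ẇ = H / t`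
    have hW : ∀ t ∈ Ioo ρ R, HasDerivAt (fun t => t * deriv H t) (H t / t) t := fun t ht => by
      have ht0 : 0 < t := hρ0.trans ht.1
      have h1 : (fun t => t * deriv H t) =ᶠ[𝓝 t] fun t => Real.sqrt (H t ^ 2 - c) := by
        filter_upwards [Ioo_mem_nhds ht.1 ht.2] with s hs
        have hsI : s ∈ Icc r R := ⟨hrρ.trans hs.1.le, hs.2.le⟩
        rw [← hH.char s hsI, show H s ^ 2 - (H s ^ 2 - s ^ 2 * deriv H s ^ 2) =
          (s * deriv H s) ^ 2 by ring, Real.sqrt_sq (mul_nonneg (hρ0.trans hs.1).le (hnn s hsI))]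
      have hHd := (hH.contDiff.differentiable one_ne_zero t).hasDerivAt
      have h2 := hpos t ⟨ht.1, ht.2.le⟩
      have h3 : t * deriv H t = Real.sqrt (H t ^ 2 - c) := h1.self_of_nhds
      have h4 : 0 < t * deriv H t := mul_pos ht0 h2
      have h5 : H t ^ 2 - c ≠ 0 := (Real.sqrt_pos.mp (by rw [← h3]; exact h4)).ne'
      refine (((hHd.fun_pow 2).sub_const c).sqrt h5).congr_of_eventuallyEq h1 |>.congr_deriv ?_
      rw [← h3]
      field_simp
      push_cast
      ring
    have const : ∀ f f' : ℝ → ℝ, ContinuousOn f (Icc ρ R) →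
        (∀ t ∈ Ioo ρ R, HasDerivAt f (f' t) t) → (∀ t ∈ Ioo ρ R, f' t = 0) →
        ∀ t ∈ Icc ρ R, f t = f R := by
      intro f f' hf hd h0 t ht
      rcases ht.2.eq_or_lt with rfl | hlt
      · rfl
      obtain ⟨s, hs, hsl⟩ := exists_hasDerivAt_eq_slope f f' hlt
        (hf.mono (Icc_subset_Icc_left ht.1)) fun s hs => hd s ⟨ht.1.trans_lt hs.1, hs.2⟩
      rw [h0 s ⟨ht.1.trans_lt hs.1, hs.2⟩, eq_comm, div_eq_zero_iff] at hsl
      have := hsl.resolve_right (by linarith)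
      linarith
    -- Since `t Ẇ = H` for `W = t Ḣ`, both `(H + W)/t` and `(H - W)t` are constant; half of each
    -- gives the coefficients of `t` and `1/t`.
    have hu := const (fun t => (H t + t * deriv H t) / t)
      (fun t => ((deriv H t + H t / t) * t - (H t + t * deriv H t) * 1) / t ^ 2)
      (ContinuousOn.div (by fun_prop) (by fun_prop) fun t ht => (hρ0.trans_le ht.1).ne')
      (fun t ht => ((hH.contDiff.differentiable one_ne_zero t).hasDerivAt.fun_add (hW t ht)).fun_div
        (hasDerivAt_id t) (hρ0.trans ht.1).ne')
      (fun t ht => by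
        have : t ≠ 0 := (hρ0.trans ht.1).ne'
        field_simp
        ring)
    have hv := const (fun t => (H t - t * deriv H t) * t)
      (fun t => (deriv H t - H t / t) * t + (H t - t * deriv H t) * 1)
      (by fun_prop)
      (fun t ht => ((hH.contDiff.differentiable one_ne_zero t).hasDerivAt.fun_sub (hW t ht)).fun_mul
        (hasDerivAt_id t))
      (fun t ht => by
        have : t ≠ 0 := (hρ0.trans ht.1).ne'
        field_simp
        ring)
    refine ⟨(H R + R * deriv H R) / R / 2, (H R - R * deriv H R) * R / 2, fun t ht => ?_⟩
    have ht0 : t ≠ 0 := (hρ0.trans_le ht.1).ne'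
    have hR0 : R ≠ 0 := (hρ0.trans hρR).ne'
    rw [← hu t ht, ← hv t ht]
    constructor <;> field_simp <;> ring

end IsSmoothProfile

theorem coeff_of_boundary_values (hr : 0 < r) (hrR : r < R) (h1 : m = a * r + b / r)
    (h2 : M = a * R + b / R) : a = (R * M - r * m) / (R ^ 2 - r ^ 2) ∧
      b = (R ^ 2 * r * m - r ^ 2 * R * M) / (R ^ 2 - r ^ 2) := by
  have hR : 0 < R := hr.trans hrR
  have hd : R ^ 2 - r ^ 2 ≠ 0 := by nlinarith
  rw [eq_div_iff hd, eq_div_iff hd, h1, h2]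
  constructor <;> field_simp <;> ring

/-- The difference of the two sums factors with `R² - rρ > 0`. Strict monotonicity in the inner
radius is what separates the two regimes. -/
theorem half_add_inv_lt (hr : 0 < r) (hρ : r < ρ) (hρR : ρ < R) :
    (R / ρ + ρ / R) / 2 < (R / r + r / R) / 2 := by
  have hρ0 : 0 < ρ := hr.trans hρ
  have hR : 0 < R := hρ0.trans hρR
  have e : (R / r + r / R) - (R / ρ + ρ / R) = (ρ - r) * (R ^ 2 - r * ρ) / (r * ρ * R) := by
    field_simp; ring
  have h1 : 0 < R ^ 2 - r * ρ := by nlinarith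
  have : 0 < (ρ - r) * (R ^ 2 - r * ρ) / (r * ρ * R) :=
    div_pos (mul_pos (by linarith) h1) (by positivity)
  linarith

/-- The coefficients of a squeezing profile. -/
theorem coeff_of_critical (hρ : 0 < ρ) (h1 : m = a * ρ + b / ρ) (h2 : a * ρ - b / ρ = 0) :
    a = m / 2 / ρ ∧ b = m / 2 * ρ := by
  have h3 : a * ρ = m / 2 := by linarith
  have h4 : b / ρ = m / 2 := by linarith
  exact ⟨by rw [eq_div_iff hρ.ne']; exact h3, by rw [div_eq_iff hρ.ne'] at h4; exact h4⟩

/-- Within the Nitsche range. -/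
theorem IsSmoothProfile.of_le (hH : IsSmoothProfile r R m M c H) (hr : 0 < r) (hrR : r < R)
    (hm : 0 < m) (hmM : m < M) (hN : (R / r + r / R) / 2 ≤ M / m) :
    (∀ t ∈ Icc r R, H t = (R * M - r * m) / (R ^ 2 - r ^ 2) * t +
      (R ^ 2 * r * m - r ^ 2 * R * M) / (R ^ 2 - r ^ 2) / t) ∧ StrictMonoOn H (Icc r R) := by
  have hR : 0 < R := hr.trans hrR
  obtain ⟨ρ, ⟨hρ, hρR⟩, h1, h2, h3, a, b, h4⟩ := hH.exists_structure hr hrR hm hmM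
  have hρr : ρ = r := by
    -- A constant piece would force `R'/r'` to equal the Nitsche quotient at `ρ > r`, which is
    -- strictly smaller than the one at `r`.
    by_contra hne
    have hlt : r < ρ := lt_of_le_of_ne hρ (Ne.symm hne)
    have hρ0 := hr.trans hlt
    obtain ⟨e1, e2⟩ := h4 ρ ⟨le_rfl, hρR.le⟩
    rw [h3 hlt, mul_zero] at e2
    rw [h1 ρ ⟨hρ, le_rfl⟩] at e1
    obtain ⟨ea, eb⟩ := coeff_of_critical hρ0 e1 e2.symm
    have e3 := (h4 R ⟨hρR.le, le_rfl⟩).1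
    rw [hH.right, ea, eb] at e3
    have e4 : M / m = (R / ρ + ρ / R) / 2 := by
      rw [e3]; field_simp
    have := half_add_inv_lt hr hlt hρR
    linarith
  subst hρr
  obtain ⟨ea, eb⟩ := coeff_of_boundary_values hr hrR
    (hH.left ▸ (h4 ρ (left_mem_Icc.mpr hrR.le)).1) (hH.right ▸ (h4 R (right_mem_Icc.mpr hrR.le)).1)
  refine ⟨fun t ht => by rw [← ea, ← eb]; exact (h4 t ht).1, ?_⟩
  refine strictMonoOn_of_deriv_pos (convex_Icc _ _) hH.contDiff.continuous.continuousOn fun t ht => ?_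
  rw [interior_Icc] at ht
  exact h2 t ⟨ht.1, ht.2.le⟩

/-- Beyond the Nitsche bound. -/
theorem IsSmoothProfile.of_lt (hH : IsSmoothProfile r R m M c H) (hr : 0 < r) (hrR : r < R)
    (hm : 0 < m) (hmM : m < M) (hN : M / m < (R / r + r / R) / 2) :
    ∃ ρ ∈ Ioo r R, (R / ρ + ρ / R) / 2 = M / m ∧ (∀ t ∈ Icc r ρ, H t = m) ∧
      (∀ t ∈ Icc ρ R, H t = m / 2 * (t / ρ + ρ / t)) := by
  have hR : 0 < R := hr.trans hrR
  obtain ⟨ρ, ⟨hρ, hρR⟩, h1, h2, h3, a, b, h4⟩ := hH.exists_structure hr hrR hm hmM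
  have hlt : r < ρ := by
    refine lt_of_le_of_ne hρ fun hne => ?_
    subst hne
    obtain ⟨e1, e2⟩ := h4 r (left_mem_Icc.mpr hrR.le)
    obtain ⟨ea, eb⟩ := coeff_of_boundary_values hr hrR (hH.left ▸ e1)
      (hH.right ▸ (h4 R (right_mem_Icc.mpr hrR.le)).1)
    -- Without a constant piece, `Ḣ(r) ≥ 0` with the explicit coefficients is exactly the Nitsche
    -- inequality.
    have e3 : 0 ≤ a * r - b / r := by
      rw [← e2]; exact mul_nonneg hr.le (hH.deriv_nonneg hrR r (left_mem_Icc.mpr hrR.le))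
    have hd : 0 < R ^ 2 - r ^ 2 := by nlinarith
    have e4 : a * r - b / r = (2 * r * R * M - m * (R ^ 2 + r ^ 2)) / (R ^ 2 - r ^ 2) := by
      rw [ea, eb]; field_simp; ring
    rw [e4, le_div_iff₀ hd, zero_mul] at e3
    have e5 : (R / r + r / R) / 2 ≤ M / m := by
      rw [le_div_iff₀ hm, show (R / r + r / R) / 2 * m = m * (R ^ 2 + r ^ 2) / (2 * r * R) by
        field_simp, div_le_iff₀ (by positivity)]
      linarith
    linarith
  have hρ0 := hr.trans hlt
  obtain ⟨e1, e2⟩ := h4 ρ ⟨le_rfl, hρR.le⟩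
  rw [h3 hlt, mul_zero] at e2
  rw [h1 ρ ⟨hρ, le_rfl⟩] at e1
  obtain ⟨ea, eb⟩ := coeff_of_critical hρ0 e1 e2.symm
  have hform : ∀ t ∈ Icc ρ R, H t = m / 2 * (t / ρ + ρ / t) := fun t ht => by
    have ht0 : t ≠ 0 := (hρ0.trans_le ht.1).ne'
    rw [(h4 t ht).1, ea, eb]; field_simp
  refine ⟨ρ, ⟨hlt, hρR⟩, ?_, h1, hform⟩
  rw [← hH.right, hform R ⟨hρR.le, le_rfl⟩]
  field_simp

end CharacteristicEquation

/-! ### Construction of characteristic solutions. -/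

section Existence

variable {r R m M c a b ρ : ℝ} {H : ℝ → ℝ}

theorem isCharacteristicSolution_of_hasDerivAt (hrR : r < R) {H' : ℝ → ℝ}
    (hd : ∀ t ∈ Icc r R, HasDerivAt H (H' t) t) (hc : ContinuousOn H' (Icc r R))
    (hnn : ∀ t ∈ Icc r R, 0 ≤ H' t) (hl : H r = m) (hR : H R = M)
    (hH : ∀ t ∈ Icc r R, H t ^ 2 - t ^ 2 * H' t ^ 2 = c) :
    IsCharacteristicSolution r R m M H c := by
  have hw : ∀ t ∈ Icc r R, derivWithin H (Icc r R) t = H' t := fun t ht =>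
    (hd t ht).hasDerivWithinAt.derivWithin (uniqueDiffOn_Icc hrR t ht)
  have hcont : ContinuousOn H (Icc r R) := fun t ht => (hd t ht).continuousAt.continuousWithinAt
  have hmono : MonotoneOn H (Icc r R) := by
    refine monotoneOn_of_deriv_nonneg (convex_Icc r R) hcont (fun t ht => ?_) fun t ht => ?_
    · exact (hd t (interior_subset ht)).differentiableAt.differentiableWithinAt
    · rw [(hd t (interior_subset ht)).deriv]; exact hnn t (interior_subset ht)
  refine ⟨?_, hmono, ?_, fun t ht => by rw [hw t ht, hH t ht]⟩
  · rw [contDiffOn_one_iff_derivWithin (uniqueDiffOn_Icc hrR)]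
    exact ⟨fun t ht => (hd t ht).differentiableAt.differentiableWithinAt, hc.congr hw⟩
  · apply Subset.antisymm
    · rintro _ ⟨t, ht, rfl⟩
      rw [← hl, ← hR]
      exact ⟨hmono (left_mem_Icc.mpr hrR.le) ht ht.1, hmono ht (right_mem_Icc.mpr hrR.le) ht.2⟩
    · rw [← hl, ← hR]
      exact intermediate_value_Icc hrR.le hcont

theorem hasDerivAt_harmonic (a b : ℝ) {t : ℝ} (ht : t ≠ 0) :
    HasDerivAt (fun t => a * t + b / t) (a - b / t ^ 2) t := by
  have h1 := ((hasDerivAt_id t).const_mul a).fun_add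
    ((hasDerivAt_const t b).fun_div (hasDerivAt_id t) ht)
  exact h1.congr_deriv (by simp; ring)

/-- Freezing a function to the left of a critical point. -/
theorem hasDerivAt_comp_max {F F' : ℝ → ℝ} (hF : ∀ t, ρ ≤ t → HasDerivAt F (F' t) t)
    (h0 : F' ρ = 0) (t : ℝ) : HasDerivAt (fun t => F (max t ρ)) (F' (max t ρ)) t := by
  rcases lt_trichotomy t ρ with h | rfl | h
  · rw [max_eq_right h.le, h0]
    refine (hasDerivAt_const t (F ρ)).congr_of_eventuallyEq ?_
    filter_upwards [eventually_lt_nhds h] with s hs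
    rw [max_eq_right hs.le]
  · rw [max_self, h0]
    have h1 := (hF t le_rfl)
    rw [h0, hasDerivAt_iff_isLittleO] at h1
    rw [hasDerivAt_iff_isLittleO]
    have h2 : Tendsto (fun s : ℝ => max s t) (𝓝 t) (𝓝 t) := by
      have : Continuous fun s : ℝ => max s t := by fun_prop
      simpa using this.tendsto t
    have h3 := h1.comp_tendsto h2
    simp only [smul_zero, sub_zero, max_self] at h3 ⊢
    refine h3.trans_le fun s => ?_
    rw [Real.norm_eq_abs, Real.norm_eq_abs, Function.comp_apply]
    rcases le_total s t with hs | hs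
    · rw [max_eq_right hs, sub_self, abs_zero]; exact abs_nonneg _
    · rw [max_eq_left hs]
  · rw [max_eq_left h.le]
    refine (hF t h.le).congr_of_eventuallyEq ?_
    filter_upwards [eventually_gt_nhds h] with s hs
    rw [max_eq_left hs.le]

theorem exists_isCharacteristicSolution (hr : 0 < r) (hrR : r < R) (hm : 0 < m) (hmM : m < M) :
    ∃ (H : ℝ → ℝ) (c : ℝ), IsCharacteristicSolution r R m M H c := by
  have hR : 0 < R := hr.trans hrR
  have hM : 0 < M := hm.trans hmM
  rcases le_or_gt ((R / r + r / R) / 2) (M / m) with hN | hN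
  · set a := (R * M - r * m) / (R ^ 2 - r ^ 2) with ha
    set b := (R ^ 2 * r * m - r ^ 2 * R * M) / (R ^ 2 - r ^ 2) with hb
    have hd : 0 < R ^ 2 - r ^ 2 := by nlinarith
    have ha0 : 0 ≤ a := div_nonneg (by nlinarith) hd.le
    -- The Nitsche inequality in the form `Ḣ(r) ≥ 0`; as `a ≥ 0`, it propagates to every `t ≥ r`.
    -- The constant of the solution is `(at + b/t)² - (at - b/t)² = 4ab`.
    have hab : b ≤ a * r ^ 2 := by
      rw [le_div_iff₀ hm, show (R / r + r / R) / 2 * m = m * (R ^ 2 + r ^ 2) / (2 * r * R) by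
        field_simp, div_le_iff₀ (by positivity)] at hN
      rw [ha, hb, div_mul_eq_mul_div, div_le_div_iff_of_pos_right hd]
      nlinarith
    refine ⟨fun t => a * t + b / t, 4 * a * b, isCharacteristicSolution_of_hasDerivAt hrR
      (H' := fun t => a - b / t ^ 2)
      (fun t ht => hasDerivAt_harmonic a b (hr.trans_le ht.1).ne') ?_ (fun t ht => ?_) ?_ ?_
      fun t ht => ?_⟩
    · exact continuousOn_const.sub (continuousOn_const.div (by fun_prop) fun t ht =>
        pow_ne_zero 2 (hr.trans_le ht.1).ne')
    · have ht0 := hr.trans_le ht.1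
      rw [sub_nonneg, div_le_iff₀ (by positivity)]
      exact hab.trans (mul_le_mul_of_nonneg_left (pow_le_pow_left₀ hr.le ht.1 2) ha0)
    · simp only [ha, hb]
      field_simp
      ring
    · simp only [ha, hb]
      field_simp
      ring
    · have ht0 : t ≠ 0 := (hr.trans_le ht.1).ne'
      field_simp
      ring
  · have hg : ContinuousOn (fun s => (R / s + s / R) / 2) (Icc r R) :=
      ((continuousOn_const.div continuousOn_id fun t ht => (hr.trans_le ht.1).ne').add
        (by fun_prop)).div_const 2
    have hgR : (R / R + R / R) / 2 < M / m := by
      rw [div_self hR.ne', lt_div_iff₀ hm]; linarith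
    -- The Nitsche quotient of `R` and `s` falls from above `R'/r'` at `s = r` to `1`, which is
    -- below it, at `s = R`.
    obtain ⟨ρ, hρ, hρM⟩ := intermediate_value_Ioo' hrR.le hg ⟨hgR, hN⟩
    simp only at hρM
    have hρ0 : 0 < ρ := hr.trans hρ.1
    have hmax : ∀ t, 0 < max t ρ := fun t => lt_max_of_lt_right hρ0
    have hF' : ∀ t, m / 2 / ρ - m / 2 * ρ / max t ρ ^ 2 =
        m / 2 * (max t ρ ^ 2 - ρ ^ 2) / (ρ * max t ρ ^ 2) := fun t => by
      have := (hmax t).ne'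
      field_simp
    -- The harmonic profile has its critical point at `ρ`, so freezing it to the left of `ρ` keeps
    -- it `C¹`. Its constant `4ab` equals `m²`, the value on the constant piece.
    have hder := hasDerivAt_comp_max (F := fun t => m / 2 / ρ * t + m / 2 * ρ / t)
      (F' := fun t => m / 2 / ρ - m / 2 * ρ / t ^ 2) (ρ := ρ)
      (fun t ht => hasDerivAt_harmonic _ _ (hρ0.trans_le ht).ne') (by field_simp; ring)
    refine ⟨_, m ^ 2, isCharacteristicSolution_of_hasDerivAt hrR (fun t _ => hder t) ?_
      (fun t ht => ?_) ?_ ?_ fun t ht => ?_⟩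
    · refine Continuous.continuousOn ?_
      exact continuous_const.sub (continuous_const.div (by fun_prop) fun t =>
        pow_ne_zero 2 (hmax t).ne')
    · rw [hF']
      have := pow_le_pow_left₀ hρ0.le (le_max_right t ρ) 2
      have := hmax t
      exact div_nonneg (mul_nonneg (by positivity) (by linarith)) (by positivity)
    · simp only [max_eq_right hρ.1.le]
      field_simp
      ring
    · simp only [max_eq_left hρ.2.le]
      have : M = (R / ρ + ρ / R) / 2 * m := by rw [hρM]; field_simp
      rw [this]
      field_simp
    · rcases le_total t ρ with h | h
      · rw [max_eq_right h]
        field_simp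
        ring
      · have ht0 : 0 < t := hρ0.trans_le h
        rw [max_eq_left h]
        field_simp
        ring

end Existence

/-! ### Invariance under changes off the annulus or on null sets. -/

section Congruence

variable {r R m M : ℝ} {h h' : ℂ → ℂ} {Ω : Set ℂ}

theorem MemW12.congr_ae (hh : MemW12 Ω h) (e : h =ᵐ[volume.restrict Ω] h') :
    MemW12 Ω h' := by
  obtain ⟨h1, G, h2, h3⟩ := hh
  exact ⟨(memLp_congr_ae e).mp h1, G, h2.congr_ae e, h3⟩

theorem OrientationPreservingOn.congr (hΩ : IsOpen Ω) (hh : OrientationPreservingOn h Ω)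
    (e : EqOn h h' Ω) : OrientationPreservingOn h' Ω := by
  intro a ha
  obtain ⟨δ, hδ, hball⟩ := Metric.isOpen_iff.mp hΩ a ha
  filter_upwards [hh a ha, Ioo_mem_nhdsGT hδ] with s ⟨θ, h1, h2, h3⟩ ⟨hs0, hsδ⟩
  have hmem : ∀ t : ℝ, a + s * Complex.exp (t * Complex.I) ∈ Ω := fun t => hball (by
    rw [Metric.mem_ball, dist_eq_norm, add_sub_cancel_left, norm_mul, Complex.norm_real,
      Complex.norm_exp_ofReal_mul_I, Real.norm_eq_abs, abs_of_pos hs0, mul_one]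
    exact hsδ)
  exact ⟨θ, h1, fun t => by rw [← e (hmem t), ← e ha]; exact h2 t, h3⟩

theorem PreservesBoundaryOrder.congr (hh : PreservesBoundaryOrder r R m M h)
    (e : EqOn h h' (annulus r R)) : PreservesBoundaryOrder r R m M h' := by
  have key : ∀ ρ : ℝ, (fun x => ‖h x‖) =ᶠ[comap norm (𝓝 ρ) ⊓ 𝓟 (annulus r R)] fun x => ‖h' x‖ :=
    fun ρ => by
      filter_upwards [mem_inf_of_right (mem_principal_self (annulus r R))] with x hx
      rw [e hx]
  exact ⟨hh.1.congr' (key r), hh.2.congr' (key R)⟩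

theorem EqOn.ae_eq_annulus (e : EqOn h h' (annulus r R)) :
    h =ᵐ[volume.restrict (annulus r R)] h' := by
  filter_upwards [ae_restrict_mem (measurableSet_annulus r R)] with x hx using e hx

theorem mem_orientedSobolevHomeos_congr (hh : h ∈ orientedSobolevHomeos r R m M)
    (e : EqOn h h' (annulus r R)) : h' ∈ orientedSobolevHomeos r R m M := by
  obtain ⟨⟨⟨E, hE⟩, hW⟩, h2, h3⟩ := hh
  exact ⟨⟨⟨E, fun x => by rw [hE, e x.2]⟩, hW.congr_ae (EqOn.ae_eq_annulus e)⟩,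
    h2.congr (isOpen_annulus r R) e, h3.congr e⟩

theorem mem_weakLimits_congr {S : Set (ℂ → ℂ)} (hΩ : IsOpen Ω) (hh : h ∈ weakLimits Ω S)
    (e : h =ᵐ[volume.restrict Ω] h') : h' ∈ weakLimits Ω S := by
  obtain ⟨u, hu, h1, h2, h3⟩ := hh
  have e' := (h2.hasWeakDeriv.congr_ae e).weakDeriv_ae_eq hΩ
  refine ⟨u, hu, h1, h2.congr_ae e, fun g hg => ⟨?_, fun v => ?_⟩⟩
  · have : ∫ x in Ω, g x * h' x = ∫ x in Ω, g x * h x :=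
      integral_congr_ae (by filter_upwards [e] with x hx; rw [hx])
    rw [this]
    exact (h3 g hg).1
  · have : ∫ x in Ω, g x * weakDeriv Ω h' x v = ∫ x in Ω, g x * weakDeriv Ω h x v :=
      integral_congr_ae (by filter_upwards [e'] with x hx; rw [hx])
    rw [this]
    exact (h3 g hg).2 v

end Congruence

/-! ### Assembly of the theorem. -/

theorem mainTheorem5 (r R r' R' : ℝ) (hr : 0 < r) (hrR : r < R) (hr' : 0 < r') (hrR' : r' < R') :
    (∃ (H : ℝ → ℝ) (c : ℝ), IsCharacteristicSolution r R r' R' H c) ∧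
    ∀ (H : ℝ → ℝ) (c : ℝ), IsCharacteristicSolution r R r' R' H c →
      -- within the Nitsche range: `H` is explicit and the radial map is a homeomorphism
      ((R / r + r / R) / 2 ≤ R' / r' →
        (∀ t ∈ Icc r R, H t = (R * R' - r * r') / (R ^ 2 - r ^ 2) * t +
          (R ^ 2 * r * r' - r ^ 2 * R * R') / (R ^ 2 - r ^ 2) / t) ∧
        radialMap H ∈ orientedSobolevHomeos r R r' R') ∧
      -- beyond the Nitsche bound: `H` is the squeezing map
      (R' / r' < (R / r + r / R) / 2 →
        ∃ ρ ∈ Ioo r R, (R / ρ + ρ / R) / 2 = R' / r' ∧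
          (∀ t ∈ Icc r ρ, H t = r') ∧
          (∀ t ∈ Icc ρ R, H t = r' / 2 * (t / ρ + ρ / t))) ∧
      -- the energy of the radial map is the infimum over homeomorphisms
      IsGLB (dirichletEnergy (annulus r R) '' sobolevHomeos r R r' R')
        (dirichletEnergy (annulus r R) (radialMap H)) ∧
      IsGLB (dirichletEnergy (annulus r R) '' orientedSobolevHomeos r R r' R')
        (dirichletEnergy (annulus r R) (radialMap H)) ∧
      -- the radial map is a deformation, of minimal energy among all deformations
      radialMap H ∈ weakLimits (annulus r R) (orientedSobolevHomeos r R r' R') ∧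
      (∀ h ∈ weakLimits (annulus r R) (sobolevHomeos r R r' R'),
        dirichletEnergy (annulus r R) (radialMap H) ≤ dirichletEnergy (annulus r R) h) ∧
      -- the minimiser is unique up to rotation
      (∀ h ∈ weakLimits (annulus r R) (orientedSobolevHomeos r R r' R'),
        (dirichletEnergy (annulus r R) h = dirichletEnergy (annulus r R) (radialMap H) ↔
          ∃ α : ℝ, ∀ᵐ x ∂(volume.restrict (annulus r R)),
            h x = Complex.exp (α * Complex.I) * radialMap H x)) := by
  refine ⟨exists_isCharacteristicSolution hr hrR hr' hrR', fun H c hHc => ?_⟩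
  have hA := isOpen_annulus r R
  -- `H` is controlled on `[r, R]` only, with one-sided derivatives at the ends; all estimates are
  -- made for a `C¹` extension `F`, whose radial map agrees with that of `H` on the annulus.
  obtain ⟨F, hF, eF⟩ := hHc.exists_smoothProfile hrR hrR'
  have eFH : EqOn (radialMap F) (radialMap H) (annulus r R) := fun x hx => radialMap_congr eF hx
  have eae : radialMap F =ᵐ[volume.restrict (annulus r R)] radialMap H := EqOn.ae_eq_annulus eFH
  have hFW : MemW12 (annulus r R) (radialMap F) := memW12_radialMap hF.contDiff hr
  have hE : dirichletEnergy (annulus r R) (radialMap H) =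
      dirichletEnergy (annulus r R) (radialMap F) := dirichletEnergy_congr_ae hA hFW eae
  have hlim : radialMap F ∈ weakLimits (annulus r R) (orientedSobolevHomeos r R r' R') :=
    radialMap_mem_weakLimits hr hrR hr' hrR' hF.contDiff hF.monotoneOn hF.left hF.right
  have hmem := hF.le_of_mem hrR
  have hnn := hF.deriv_nonneg hrR
  have hann := isAnnularMap_of_mem_weakLimits_oriented hr hrR hr' hrR' hlim
  have hex := isExtremal_radialMap hr hr' hF.contDiff hmem hnn hF.char
  obtain ⟨hmin, huniq⟩ := hann.energy_le_of_isExtremal hex hr hrR hr' hrR' (hF.const_le hrR)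
  have hdef : ∀ h ∈ weakLimits (annulus r R) (sobolevHomeos r R r' R'),
      dirichletEnergy (annulus r R) (radialMap H) ≤ dirichletEnergy (annulus r R) h :=
    fun h hh => by
      obtain ⟨p, P, k, hk, ho, hm⟩ := isAnnularMap_of_mem_weakLimits hr hrR hr' hrR' hh
      rw [hE]
      exact hmin p P k h _ hm hk ho
  have hlow : ∀ h ∈ sobolevHomeos r R r' R',
      dirichletEnergy (annulus r R) (radialMap H) ≤ dirichletEnergy (annulus r R) h :=
    fun h hh => hdef h (self_mem_weakLimits hh hh.2)
  have hgl : ∀ b : ℝ≥0∞, (∀ h ∈ orientedSobolevHomeos r R r' R',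
      b ≤ dirichletEnergy (annulus r R) h) → b ≤ dirichletEnergy (annulus r R) (radialMap H) :=
    fun b hb => by
      rw [hE]
      exact le_dirichletEnergy_radialMap hr hrR hr' hrR' hF.contDiff hF.monotoneOn hF.left
        hF.right hb
  refine ⟨fun hN => ?_, fun hN => ?_, ⟨?_, ?_⟩, ⟨?_, ?_⟩, mem_weakLimits_congr hA hlim eae, hdef,
    fun h hh => ⟨fun he => ?_, ?_⟩⟩
  · obtain ⟨h1, h2⟩ := hF.of_le hr hrR hr' hrR' hN
    exact ⟨fun t ht => by rw [← eF ht, h1 t ht], mem_orientedSobolevHomeos_congr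
      (radialMap_mem_orientedSobolevHomeos hr hrR hr' hF.contDiff h2 hF.left hF.right) eFH⟩
  · obtain ⟨ρ, hρ, h1, h2, h3⟩ := hF.of_lt hr hrR hr' hrR' hN
    exact ⟨ρ, hρ, h1, fun t ht => by rw [← eF ⟨ht.1, ht.2.trans hρ.2.le⟩, h2 t ht],
      fun t ht => by rw [← eF ⟨hρ.1.le.trans ht.1, ht.2⟩, h3 t ht]⟩
  · rintro _ ⟨h, hh, rfl⟩
    exact hlow h hh
  -- A lower bound over all homeomorphisms is one over the oriented ones, so the same approximating
  -- sequence identifies both infima.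
  · exact fun b hb => hgl b fun h hh => hb (mem_image_of_mem _ hh.1)
  · rintro _ ⟨h, hh, rfl⟩
    exact hlow h hh.1
  · exact fun b hb => hgl b fun h hh => hb (mem_image_of_mem _ hh)
  · have hm := isAnnularMap_of_mem_weakLimits_oriented hr hrR hr' hrR' hh
    obtain ⟨α, hα⟩ := hm.eq_rotation_of_isExtremal (huniq h _ hm (he.trans hE)) hr hrR hr' hrR'
      hF.contDiff hF.left hF.right hmem hnn hF.char
    refine ⟨α, ?_⟩
    filter_upwards [hα, eae] with x h1 h2
    rw [h1, h2]
  · rintro ⟨α, hα⟩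
    rw [hE, ← dirichletEnergy_const_mul hA hFW (Complex.norm_exp_ofReal_mul_I α)]
    have hrot : MemW12 (annulus r R) (fun x => Complex.exp (α * Complex.I) * radialMap F x) :=
      ⟨hFW.1.const_mul _, _, hFW.hasWeakDeriv.const_mul _,
        (hFW.memLp_weakDeriv hA).const_smul (Complex.exp (α * Complex.I))⟩
    refine dirichletEnergy_congr_ae hA hrot ?_
    filter_upwards [hα, eae] with x h1 h2
    rw [h1, h2]
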